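/- **Definitions.** A smooth $3$-polytope is a full-dimensional convex lattice polytope $P\subset\mathbb R^3$ such that through every vertex there pass exactly three edges, whose primitive directions form a basis of $\mathbb Z^3$. Two lattice polytopes in $\mathbb{R}^3$ are isomorphic if an affine isomorphism of $\mathbb R^3$ preserving $\mathbb Z^3$ maps one onto the other. The label of a smooth $3$-polytope is $\prod_m m^{v_m}$, where $v_m$ is the number of vertices of degree $m$ in the triangulation of $S^2$ cut out by its inner-normal fan (equivalently, the number of facets with $m$ edges). Let $F$ be a vertex or an edge of a smooth $3$-polytope $P$, let $x_1,\dots,x_r$ be the primitive generators of the inner-normal cone $\sigma_F$ of $P$ at $F$, let $p=x_1+\dots+x_r$, and let $k\ge 1$ be an integer. The blow-up of $P$ along $F$ at level $k$ is $$\mathrm{Bl}^k_F(P)=\{y\in P:\ \langle p,y\rangle\ge \langle p,z\rangle+k \text{ for all } z\in F\},$$ and it is defined only when this is a smooth polytope whose inner-normal fan is the stellar subdivision in direction $p$ of the inner-normal fan of $P$. "The blow-up of $P$ at $n$ vertices" means a polytope obtained by $n$ consecutive blow-ups whose centers are vertices of $P$ (each also a vertex of the polytope being blown up). For $s\ge 1$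 and polytopes $P_0,\dots,P_k\subset\mathbb R^n$ with the same inner-normal fan, $\mathrm{Cay}^s(P_0,\dots,P_k)=\mathrm{conv}\big((P_0,se_0),\dots,(P_k,se_k)\big)\subset\mathbb R^{n+k}$, where $e_0=0$ and $e_1,\dots,e_k$ is the standard basis. Write $\Delta_d=\mathrm{conv}(0,e_1,\dots,e_d)$. **Lemma.** Consider the smooth $3$-polytopes $Q$ with $|Q\cap\mathbb Z^3|\le 16$ that can be obtained by a sequence of one or more blow-ups from a smooth $3$-polytope with label $3^4$ or $3^24^3$, and that * are not isomorphic to any $k\Delta_3$ with $k\ge 1$, * are not isomorphic to any $\mathrm{Cay}^s([0,i],[0,j],[0,k])$ with $s,i,j,k\ge1$, * are not isomorphic to any $\mathrm{Cay}^s(P_0,P_1)$ with $s\ge 1$ and $P_0,P_1$ lattice polygons with the same inner-normal fan, and * do not have the label $3^24^36^2$. Up to isomorphism there are exactly three such polytopes: the blow-up of $\mathrm{Cay}^2(3\Delta_1,\Delta_1,\Delta_1)$ at a vertex, the blow-up of $3\Delta_3$ at four vertices, and the blow-up of $\mathrm{Cay}^2(2\Delta_1,2\Delta_1,2\Delta_1)$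 at two vertices. Each of these three blow-ups exists and is unique up to isomorphism, and the three are pairwise non-isomorphic. -/

import Mathlib

open scoped Pointwise

namespace SmoothPolytope

/-- The lattice point of `ℝ^d` with the given integer coordinates. -/
def toReal {d : ℕ} (z : Fin d → ℤ) : Fin d → ℝ := fun i => (z i : ℝ)

/-- The lattice `ℤ^d` inside `ℝ^d`. -/
def latticePoints (d : ℕ) : Set (Fin d → ℝ) := Set.range toReal

/-- A convex lattice polytope in `ℝ^d` of dimension `d`. -/
def IsLatticePolytope {d : ℕ} (P : Set (Fin d → ℝ)) : Prop :=
  (∃ V : Finset (Fin d → ℤ), P = convexHull ℝ (toReal '' (V : Set (Fin d → ℤ)))) ∧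
    affineSpan ℝ P = ⊤

/-- The nonempty faces of `P`: the subsets of `P` on which some linear functional
(identified with a vector `u` through the dot product) attains its minimum over `P`.
`P` itself is a face (`u = 0`). -/
def IsFace {d : ℕ} (P F : Set (Fin d → ℝ)) : Prop :=
  F.Nonempty ∧ ∃ u : Fin d → ℝ, F = {x ∈ P | ∀ y ∈ P, u ⬝ᵥ x ≤ u ⬝ᵥ y}

/-- `v` is a vertex of `P`. -/
def IsVertex {d : ℕ} (P : Set (Fin d → ℝ)) (v : Fin d → ℝ) : Prop := IsFace P {v}

/-- `F` is an edge of `P`: a face of dimension one. -/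
def IsEdge {d : ℕ} (P F : Set (Fin d → ℝ)) : Prop :=
  IsFace P F ∧ Module.finrank ℝ (vectorSpan ℝ F) = 1

/-- A smooth `d`-polytope in `ℝ^d`: a `d`-dimensional convex lattice polytope such that at every
vertex `v` there are exactly `d` edges and their directions form a basis of the lattice `ℤ^d`. -/
def IsSmooth {d : ℕ} (P : Set (Fin d → ℝ)) : Prop :=
  IsLatticePolytope P ∧
    ∀ v, IsVertex P v →
      ∃ (b : Module.Basis (Fin d) ℤ (Fin d → ℤ)) (l : Fin d → ℝ), (∀ i, 0 < l i) ∧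
        {F | IsEdge P F ∧ v ∈ F} = Set.range fun i => segment ℝ v (v + l i • toReal (b i))

/-- Two polytopes are isomorphic if they differ by a lattice preserving affine isomorphism. -/
def Iso {d : ℕ} (P Q : Set (Fin d → ℝ)) : Prop :=
  ∃ φ : (Fin d → ℝ) ≃ᵃ[ℝ] (Fin d → ℝ), φ '' latticePoints d = latticePoints d ∧ φ '' P = Q

/-- The inner normal cone of `P` at the face `F`: the vectors `u` whose minimum over `P` is
attained on all of `F`. -/
def normalCone {d : ℕ} (P F : Set (Fin d → ℝ)) : PointedCone ℝ (Fin d → ℝ) where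
  carrier := {u | ∀ x ∈ F, ∀ y ∈ P, u ⬝ᵥ x ≤ u ⬝ᵥ y}
  add_mem' := by
    intro u w hu hw x hx y hy
    rw [add_dotProduct, add_dotProduct]
    exact add_le_add (hu x hx y hy) (hw x hx y hy)
  zero_mem' := by
    intro x _ y _
    simp
  smul_mem' := by
    intro c u hu x hx y hy
    have h : ∀ z : Fin d → ℝ, (c • u) ⬝ᵥ z = (c : ℝ) * (u ⬝ᵥ z) := fun z => smul_dotProduct (c : ℝ) u z
    rw [h, h]
    exact mul_le_mul_of_nonneg_left (hu x hx y hy) c.2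

/-- The inner-normal fan of `P`. -/
def normalFan {d : ℕ} (P : Set (Fin d → ℝ)) : Set (PointedCone ℝ (Fin d → ℝ)) :=
  {σ | ∃ F, IsFace P F ∧ σ = normalCone P F}

/-- The dimension of a cone. -/
noncomputable def coneDim {d : ℕ} (σ : PointedCone ℝ (Fin d → ℝ)) : ℕ :=
  Module.finrank ℝ (Submodule.span ℝ (σ : Set (Fin d → ℝ)))

/-- The star of `σ` in the fan `S`. -/
def star {d : ℕ} (S : Set (PointedCone ℝ (Fin d → ℝ))) (σ : PointedCone ℝ (Fin d → ℝ)) :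
    Set (PointedCone ℝ (Fin d → ℝ)) :=
  {τ ∈ S | σ.IsFaceOf τ}

/-- The closed star of `σ` in the fan `S`. -/
def closedStar {d : ℕ} (S : Set (PointedCone ℝ (Fin d → ℝ)))
    (σ : PointedCone ℝ (Fin d → ℝ)) : Set (PointedCone ℝ (Fin d → ℝ)) :=
  {τ ∈ S | ∃ τ' ∈ star S σ, τ.IsFaceOf τ'}

/-- The stellar subdivision of the fan `S` in direction `p`, a point of the relative interior of
`σ ∈ S`. Here `ρ ⊔ τ` is the cone spanned by the union of `ρ = ℝ≥0 p` and `τ`. -/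
def stellarSubdivision {d : ℕ} (S : Set (PointedCone ℝ (Fin d → ℝ)))
    (σ : PointedCone ℝ (Fin d → ℝ)) (p : Fin d → ℝ) : Set (PointedCone ℝ (Fin d → ℝ)) :=
  (S \ star S σ) ∪ (fun τ => PointedCone.hull ℝ {p} ⊔ τ) '' (closedStar S σ \ star S σ)

/-- The linearly independent lattice vectors `x` span the cone `σ` and generate the monoid of its
lattice points. -/
def IsUnimodularGenerators {d r : ℕ} (σ : PointedCone ℝ (Fin d → ℝ))
    (x : Fin r → Fin d → ℤ) : Prop :=
  LinearIndependent ℤ x ∧ σ = PointedCone.hull ℝ (Set.range fun i => toReal (x i)) ∧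
    (AddSubmonoid.closure (Set.range x) : Set (Fin d → ℤ)) = {z | toReal z ∈ σ}

/-- `Q` is the blow-up `Bl_F^k(P)` of the smooth polytope `P` along its face `F` at level `k ≥ 1`.
Let `x_1, …, x_r` be the generators of the normal cone of `F`, with `r ≥ 2` (so that `F` is not a
facet of `P` or `P` itself), and `p = x_1 + ⋯ + x_r`. Then `Q` arises from `P` by cutting off `F`
at lattice distance `k` in direction `p`, and `Q` is the smooth polytope of an ample line bundle on
the blow-up, i.e. its normal fan is the unimodular stellar subdivision of that of `P` in
direction `p`. -/
def IsBlowUp {d : ℕ} (P F : Set (Fin d → ℝ)) (k : ℕ) (Q : Set (Fin d → ℝ)) : Prop :=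
  IsSmooth P ∧ IsFace P F ∧ 1 ≤ k ∧ IsSmooth Q ∧
    ∃ (r : ℕ) (x : Fin r → Fin d → ℤ), 2 ≤ r ∧ IsUnimodularGenerators (normalCone P F) x ∧
      Q = {y ∈ P | ∀ z ∈ F, toReal (∑ i, x i) ⬝ᵥ z + k ≤ toReal (∑ i, x i) ⬝ᵥ y} ∧
      normalFan Q = stellarSubdivision (normalFan P) (normalCone P F) (toReal (∑ i, x i))

/-- `Q` is obtained from `P` by a sequence of one or more consecutive blow-ups along faces. -/
def IsIteratedBlowUp {d : ℕ} (P Q : Set (Fin d → ℝ)) : Prop :=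
  Relation.TransGen (fun A B : Set (Fin d → ℝ) => ∃ F k, IsBlowUp A F k B) P Q

/-- `IsBlowUpAtVertices P n Q`: `Q` is a blow-up of `P` at `n` of its vertices, i.e. it arises by
consecutively blowing up `n` vertices of `P`. (These are automatically distinct, since a vertex that
has been blown up is no longer a vertex.) -/
inductive IsBlowUpAtVertices {d : ℕ} (P : Set (Fin d → ℝ)) : ℕ → Set (Fin d → ℝ) → Prop
  | zero : IsBlowUpAtVertices P 0 P
  | succ {n : ℕ} {A B : Set (Fin d → ℝ)} {v : Fin d → ℝ} {k : ℕ} :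
      IsBlowUpAtVertices P n A → IsVertex P v → IsBlowUp A {v} k B →
      IsBlowUpAtVertices P (n + 1) B

/-- The label of the triangulation of the sphere `S^2` cut out by the normal fan of a smooth
3-polytope: `label P m` is the number of vertices of degree `m` of the triangulation. Vertices of
the triangulation are rays of the fan and edges of the triangulation are two-dimensional cones. The
label `∏ m ^ (v_m)` is encoded as the exponent function `m ↦ v_m`. -/
noncomputable def label (P : Set (Fin 3 → ℝ)) (m : ℕ) : ℕ :=
  {ρ ∈ normalFan P | coneDim ρ = 1 ∧
    {τ ∈ normalFan P | coneDim τ = 2 ∧ ρ.IsFaceOf τ}.ncard = m}.ncard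

/-- The standard simplex `Δ_d = conv(0, e_1, …, e_d)` in `ℝ^d`. -/
def simplex (d : ℕ) : Set (Fin d → ℝ) :=
  convexHull ℝ (insert 0 (Set.range fun i : Fin d => (Pi.single i 1 : Fin d → ℝ)))

/-- The Cayley polytope `Cay^s(P_0, …, P_k) = conv((P_0, s e_0), …, (P_k, s e_k))` in `ℝ^(n+k)`,
where `e_0 = 0` and `e_1, …, e_k` is the standard basis. -/
def cayley {n k : ℕ} (s : ℕ) (P : Fin (k + 1) → Set (Fin n → ℝ)) : Set (Fin (n + k) → ℝ) :=
  convexHull ℝ (⋃ i, (fun p : Fin n → ℝ => Fin.append p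
    ((s : ℝ) • (Fin.cons 0 (fun j => Pi.single j 1) : Fin (k + 1) → Fin k → ℝ) i)) '' P i)

/-- `P` is isomorphic to a dilated simplex `k Δ_3`. -/
def IsSimplexType (P : Set (Fin 3 → ℝ)) : Prop :=
  ∃ k : ℕ, 1 ≤ k ∧ Iso P ((k : ℝ) • simplex 3)

/-- `P` is isomorphic to `Cay^s(P_0, P_1, P_2)` for line segments `P_0 = [0,i]`, `P_1 = [0,j]`,
`P_2 = [0,k]`. -/
def IsCayleyOfSegments (P : Set (Fin 3 → ℝ)) : Prop :=
  ∃ s i j k : ℕ, 1 ≤ s ∧ 1 ≤ i ∧ 1 ≤ j ∧ 1 ≤ k ∧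
    Iso P (cayley (n := 1) (k := 2) s
      ![(i : ℝ) • simplex 1, (j : ℝ) • simplex 1, (k : ℝ) • simplex 1])

/-- `P` is isomorphic to `Cay^s(P_0, P_1)` for strictly isomorphic 2-polytopes `P_0` and `P_1`,
i.e. two lattice polygons with the same normal fan. -/
def IsCayleyOfPolygons (P : Set (Fin 3 → ℝ)) : Prop :=
  ∃ (s : ℕ) (P₀ P₁ : Set (Fin 2 → ℝ)), 1 ≤ s ∧ IsLatticePolytope P₀ ∧ IsLatticePolytope P₁ ∧
    normalFan P₀ = normalFan P₁ ∧ Iso P (cayley (n := 2) (k := 1) s ![P₀, P₁])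

/-- The 3-polytopes that the lemma classifies: smooth 3-polytopes with at most 16 lattice points
which can be obtained by a sequence of blow-ups of a smooth 3-polytope with label `3^4` or
`3^2 4^3`, and which are further ones: neither of the three types of strict Cayley 3-polytopes nor
of label `3^2 4^3 6^2`. -/
def IsFurther (Q : Set (Fin 3 → ℝ)) : Prop :=
  IsSmooth Q ∧ (Q ∩ latticePoints 3).encard ≤ 16 ∧
    (∃ P, IsSmooth P ∧ (label P = Pi.single 3 4 ∨ label P = Pi.single 3 2 + Pi.single 4 3) ∧
      IsIteratedBlowUp P Q) ∧
    ¬ IsSimplexType Q ∧ ¬ IsCayleyOfSegments Q ∧ ¬ IsCayleyOfPolygons Q ∧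
    label Q ≠ Pi.single 3 2 + Pi.single 4 3 + Pi.single 6 2

end SmoothPolytope

/-! A smooth 3-polytope is the same thing as a finite complex `T` of unimodular triples of facet
normals together with a strictly convex integral support function `h`, recorded in `IsData`; the two
directions are `IsData.isSmooth` and `IsSmooth.exists_isData`. In these terms a blow-up is a stellar
subdivision of `T` with one new height (`exists_of_isBlowUp`, `isBlowUp`). It adds one facet and at
least two vertices. A chain of blow-ups starting from a tetrahedron or a triangular prism therefore
runs through few combinatorial types while the number of facets is small: the prism with five
facets, two types with six, five types with seven (`Reach.step`).

The bound of 16 lattice points limits everything else. Vertices use up many of the points. Besides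
them, a facet with at least five corners has a lattice point in its relative interior
(`tight_inner`), a pentagon has two adjacent edges with interior lattice points (`pentagon`), and a
facet with at least seven corners contains four lattice points that are not vertices
(`four_le_card_facetPts`, by parity of coordinates). Points in the relative interiors of different
faces are different, so these contributions add up. Nine or more facets are impossible by double
counting vertex-facet incidences (`card_rays_le`).

With eight facets there are twelve vertices, so only four further points. The truncated tetrahedron
needs exactly four and is rigid: all edges have length one, and its hexagons can be rebuilt corner
by corner (`iso_of_ltrunc`). The hexagonal prism is a Cayley polytope, and every other type needs
too many points. With seven facets there are ten vertices and six further points: two types are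
impossible, one is a Cayley polytope, one has the excluded label, and the last is rigid
(`iso_of_l7C`). With six facets the polytope is a prism with an edge or corner cut off; normal form
coordinates and an explicit count leave one polytope outside the Cayley class (`Six.classify`).
Prisms themselves are Cayley polytopes (`cayley_of_prism`).

For the converse, all blow-ups of the three starting polytopes at the required number of vertices
are enumerated: a surviving vertex bounds the levels, so the list is finite (`exists_mem_reach`).
The Cayley polytopes and the simplices are hulls of points on two parallel planes, in lattice
coordinates with one coordinate taking two values; the vertices of the three models contain steps of
lengths one and two in every coordinate direction, which forbids this (`not_layered`). The numbers
of hexagons, 0, 4 and 1, separate the models from each other and from the excluded label. -/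

namespace SmoothPolytope
-- Lattice vectors and dual bases
/-- Lattice vectors. -/
abbrev Lat := Fin 3 → ℤ

/-- Vectors of the ambient space. -/
abbrev Spc := Fin 3 → ℝ

lemma toReal_dot (u v : Lat) : toReal u ⬝ᵥ toReal v = ((u ⬝ᵥ v : ℤ) : ℝ) := by
  simp [toReal, dotProduct]

lemma toReal_add {d : ℕ} (u v : Fin d → ℤ) : toReal (u + v) = toReal u + toReal v := by
  ext i; simp [toReal]

lemma toReal_sub {d : ℕ} (u v : Fin d → ℤ) : toReal (u - v) = toReal u - toReal v := by
  ext i; simp [toReal]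

lemma toReal_zero {d : ℕ} : toReal (0 : Fin d → ℤ) = 0 := by
  ext i; simp [toReal]

lemma toReal_zsmul {d : ℕ} (c : ℤ) (u : Fin d → ℤ) : toReal (c • u) = (c : ℝ) • toReal u := by
  ext i; simp [toReal]

lemma toReal_sum {d : ℕ} {ι : Type*} (s : Finset ι) (f : ι → Fin d → ℤ) :
    toReal (∑ i ∈ s, f i) = ∑ i ∈ s, toReal (f i) := by
  ext j; simp [toReal]

lemma toReal_injective {d : ℕ} : Function.Injective (toReal : (Fin d → ℤ) → Fin d → ℝ) := by
  intro u v h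
  ext i
  have := congrFun h i
  simpa [toReal] using this

/-- The vectors `e u`, `u ∈ t`, form the basis dual to the three vectors of `t`. -/
structure IsDual (t : Finset Lat) (e : Lat → Lat) : Prop where
  card : t.card = 3
  dot : ∀ u ∈ t, ∀ w ∈ t, u ⬝ᵥ e w = if u = w then 1 else 0

/-- The vectors of `t` form a basis of the lattice. -/
def Unimodular (t : Finset Lat) : Prop := ∃ e, IsDual t e

namespace IsDual
variable {t : Finset Lat} {e : Lat → Lat}

lemma dot_self (hd : IsDual t e) {u : Lat} (hu : u ∈ t) : u ⬝ᵥ e u = 1 := by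
  simp [hd.dot u hu u hu]

lemma dot_ne (hd : IsDual t e) {u w : Lat} (hu : u ∈ t) (hw : w ∈ t) (h : u ≠ w) :
    u ⬝ᵥ e w = 0 := by
  simp [hd.dot u hu w hw, h]

/-- Duality says that the matrix with rows `t` times the transposed matrix of the dual vectors is
the identity. The matrices are square, so the product in the other order is the identity too; these
are its entries, and both expansion formulas follow from them. -/
lemma entry_sum (hd : IsDual t e) (i j : Fin 3) :
    ∑ u ∈ t, e u i * u j = if i = j then 1 else 0 := by
  obtain ⟨a, b, c, hab, hac, hbc, rfl⟩ := Finset.card_eq_three.mp hd.card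
  have h1 : Matrix.of ![a, b, c] * (Matrix.of ![e a, e b, e c]).transpose = 1 := by
    ext i j
    have := hd.dot
    simp only [Finset.mem_insert, Finset.mem_singleton, forall_eq_or_imp, forall_eq, hab, hac, hbc,
      hab.symm, hac.symm, hbc.symm, if_true, if_false] at this
    fin_cases i <;> fin_cases j <;>
      simp [Matrix.mul_apply] <;>
      simpa [dotProduct] using (by tauto)
  have h2 := mul_eq_one_comm.mp h1
  have h3 := congrFun (congrFun h2 i) j
  rw [Finset.sum_insert (by simp [hab, hac]), Finset.sum_insert (by simp [hbc]),
    Finset.sum_singleton]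
  simp only [Matrix.mul_apply, Matrix.transpose_apply, Fin.sum_univ_three, Matrix.one_apply] at h3
  rw [← h3]
  simp [Matrix.of_apply, add_assoc]

lemma entry_sum_real (hd : IsDual t e) (i j : Fin 3) :
    ∑ u ∈ t, (e u i : ℝ) * (u j : ℝ) = if i = j then 1 else 0 := by
  have := hd.entry_sum i j
  have h := congrArg (fun z : ℤ => (z : ℝ)) this
  push_cast at h
  simpa using h

lemma expand_primal (hd : IsDual t e) (y : Spc) :
    y = ∑ u ∈ t, (toReal u ⬝ᵥ y) • toReal (e u) := by
  ext i
  simp only [dotProduct, toReal, Finset.sum_apply, Pi.smul_apply, smul_eq_mul, Finset.sum_mul]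
  rw [Finset.sum_comm]
  have : ∀ j, ∑ u ∈ t, (u j : ℝ) * y j * (e u i : ℝ) = (if i = j then 1 else 0) * y j := by
    intro j
    rw [← hd.entry_sum_real i j, Finset.sum_mul]
    exact Finset.sum_congr rfl fun u _ => by ring
  simp [this]

lemma expand_dual (hd : IsDual t e) (w : Spc) :
    w = ∑ u ∈ t, (w ⬝ᵥ toReal (e u)) • toReal u := by
  ext i
  simp only [dotProduct, toReal, Finset.sum_apply, Pi.smul_apply, smul_eq_mul, Finset.sum_mul]
  rw [Finset.sum_comm]
  have : ∀ j, ∑ u ∈ t, w j * (e u j : ℝ) * (u i : ℝ) = (if j = i then 1 else 0) * w j := by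
    intro j
    rw [← hd.entry_sum_real j i, Finset.sum_mul]
    exact Finset.sum_congr rfl fun u _ => by ring
  simp [this]

lemma expand_primal_int (hd : IsDual t e) (y : Lat) : y = ∑ u ∈ t, (u ⬝ᵥ y) • e u := by
  apply toReal_injective
  rw [toReal_sum]
  simp only [toReal_zsmul, ← toReal_dot]
  exact hd.expand_primal _

lemma expand_dual_int (hd : IsDual t e) (w : Lat) : w = ∑ u ∈ t, (w ⬝ᵥ e u) • u := by
  apply toReal_injective
  rw [toReal_sum]
  simp only [toReal_zsmul, ← toReal_dot]
  exact hd.expand_dual _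

lemma ext_primal (hd : IsDual t e) {y z : Spc} (h : ∀ u ∈ t, toReal u ⬝ᵥ y = toReal u ⬝ᵥ z) :
    y = z := by
  rw [hd.expand_primal y, hd.expand_primal z]
  exact Finset.sum_congr rfl fun u hu => by rw [h u hu]

lemma ext_primal_int (hd : IsDual t e) {y z : Lat} (h : ∀ u ∈ t, u ⬝ᵥ y = u ⬝ᵥ z) : y = z := by
  rw [hd.expand_primal_int y, hd.expand_primal_int z]
  exact Finset.sum_congr rfl fun u hu => by rw [h u hu]

lemma ext_dual_int (hd : IsDual t e) {y z : Lat} (h : ∀ u ∈ t, y ⬝ᵥ e u = z ⬝ᵥ e u) : y = z := by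
  rw [hd.expand_dual_int y, hd.expand_dual_int z]
  exact Finset.sum_congr rfl fun u hu => by rw [h u hu]

lemma sum_smul_dot (hd : IsDual t e) {s : Finset Lat} (hs : s ⊆ t) (c : Lat → ℝ) {w : Lat}
    (hw : w ∈ t) :
    (∑ u ∈ s, c u • toReal u) ⬝ᵥ toReal (e w) = if w ∈ s then c w else 0 := by
  rw [sum_dotProduct]
  simp only [smul_dotProduct, toReal_dot, smul_eq_mul]
  have : ∀ u ∈ s, c u * ((u ⬝ᵥ e w : ℤ) : ℝ) = if u = w then c u else 0 := by
    intro u hu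
    rw [hd.dot u (hs hu) w hw]
    split_ifs <;> simp
  rw [Finset.sum_congr rfl this, Finset.sum_ite_eq' s w]

end IsDual

/-! ### Unimodular cones, their faces and their generators -/

/-- The cone generated by finitely many lattice vectors. -/
noncomputable def cone (s : Finset Lat) : PointedCone ℝ Spc :=
  PointedCone.hull ℝ (toReal '' (s : Set Lat))

lemma toReal_mem_cone {s : Finset Lat} {u : Lat} (hu : u ∈ s) : toReal u ∈ cone s :=
  PointedCone.subset_hull ⟨u, hu, rfl⟩

lemma sum_mem_cone {s : Finset Lat} {c : Lat → ℝ} (hc : ∀ u ∈ s, 0 ≤ c u) :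
    ∑ u ∈ s, c u • toReal u ∈ cone s :=
  Submodule.sum_mem _ fun u hu => PointedCone.smul_mem _ (hc u hu) (toReal_mem_cone hu)

lemma mem_cone {s : Finset Lat} {w : Spc} :
    w ∈ cone s ↔ ∃ c : Lat → ℝ, (∀ u, 0 ≤ c u) ∧ w = ∑ u ∈ s, c u • toReal u := by
  constructor
  · intro h
    refine Submodule.span_induction (p := fun w _ => ∃ c : Lat → ℝ, (∀ u, 0 ≤ c u) ∧
      w = ∑ u ∈ s, c u • toReal u) ?_ ?_ ?_ ?_ h
    · rintro _ ⟨u, hu, rfl⟩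
      refine ⟨fun v => if v = u then 1 else 0, fun v => by dsimp only; split_ifs <;> simp, ?_⟩
      have hu : u ∈ s := hu
      simp [hu]
    · exact ⟨0, by simp, by simp⟩
    · rintro _ _ - - ⟨c, hc, rfl⟩ ⟨d, hd, rfl⟩
      exact ⟨c + d, fun u => add_nonneg (hc u) (hd u), by simp [add_smul, Finset.sum_add_distrib]⟩
    · rintro a _ - ⟨c, hc, rfl⟩
      refine ⟨fun u => a * c u, fun u => mul_nonneg a.2 (hc u), ?_⟩
      rw [Finset.smul_sum]
      exact Finset.sum_congr rfl fun u _ => by rw [mul_smul]; rfl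
  · rintro ⟨c, hc, rfl⟩
    exact sum_mem_cone fun u _ => hc u

lemma cone_mono {s t : Finset Lat} (h : s ⊆ t) : cone s ≤ cone t :=
  Submodule.span_mono (Set.image_mono (by exact_mod_cast h))

lemma IsDual.mem_cone_iff {t s : Finset Lat} {e : Lat → Lat} (hd : IsDual t e) (hs : s ⊆ t)
    {w : Spc} : w ∈ cone s ↔ (∀ u ∈ t, 0 ≤ w ⬝ᵥ toReal (e u)) ∧
      ∀ u ∈ t, u ∉ s → w ⬝ᵥ toReal (e u) = 0 := by
  constructor
  · rw [mem_cone]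
    rintro ⟨c, hc, rfl⟩
    refine ⟨fun u hu => ?_, fun u hu hus => ?_⟩
    · rw [hd.sum_smul_dot hs c hu]; split_ifs <;> simp [hc]
    · rw [hd.sum_smul_dot hs c hu, if_neg hus]
  · rintro ⟨h1, h2⟩
    rw [hd.expand_dual w, ← Finset.sum_subset hs fun u hu hus => by rw [h2 u hu hus, zero_smul]]
    exact sum_mem_cone fun u hu => h1 u (hs hu)

/-- A set of lattice vectors that extends to a basis of the lattice. -/
def Primitive (s : Finset Lat) : Prop := ∃ t, Unimodular t ∧ s ⊆ t

/-- A basis vector that is a nonnegative integral combination of vectors of the cone of the basis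
occurs among these vectors. -/
lemma IsDual.mem_of_eq_sum {t : Finset Lat} {e : Lat → Lat} (hd : IsDual t e) {u : Lat}
    (hu : u ∈ t) {X : Finset Lat} (hX : ∀ x ∈ X, ∀ w ∈ t, 0 ≤ x ⬝ᵥ e w) (c : Lat → ℤ)
    (hc : ∀ x ∈ X, 0 ≤ c x) (h : u = ∑ x ∈ X, c x • x) : u ∈ X := by
  have key : ∀ w, u ⬝ᵥ e w = ∑ x ∈ X, c x * (x ⬝ᵥ e w) := by
    intro w
    conv_lhs => rw [h, sum_dotProduct]
    simp only [smul_dotProduct, smul_eq_mul]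
  have h1 := key u
  rw [hd.dot_self hu] at h1
  -- The nonnegative integers `c x * (x ⬝ᵥ e u)` sum to 1, so some `x` has both factors equal to 1
  -- or at least positive and bounded by 1. The other coordinates of the sum vanish term by term,
  -- which leaves `x = u`.
  have hex : ∃ x ∈ X, 0 < c x * (x ⬝ᵥ e u) := by
    by_contra! hcon
    have := Finset.sum_nonpos hcon
    omega
  obtain ⟨x, hx, hpos⟩ := hex
  have hle : c x * (x ⬝ᵥ e u) ≤ 1 := by
    rw [h1]
    exact Finset.single_le_sum (f := fun x => c x * (x ⬝ᵥ e u))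
      (fun y hy => mul_nonneg (hc y hy) (hX y hy u hu)) hx
  have hcx : 0 < c x := by
    rcases (hc x hx).lt_or_eq with h | h
    · exact h
    · rw [← h] at hpos; simp at hpos
  have hxe : x ⬝ᵥ e u = 1 := by
    have := hX x hx u hu
    nlinarith
  have hux : u = x := by
    apply hd.ext_dual_int
    intro w hw
    by_cases huw : u = w
    · subst huw; rw [hd.dot_self hu, hxe]
    · rw [hd.dot_ne hu hw huw]
      have h0 := key w
      rw [hd.dot_ne hu hw huw] at h0
      have := (Finset.sum_eq_zero_iff_of_nonneg
        (fun y hy => mul_nonneg (hc y hy) (hX y hy w hw))).mp h0.symm x hx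
      rcases mul_eq_zero.mp this with h | h
      · omega
      · exact h.symm
  rw [hux]; exact hx

lemma IsDual.int_coeff {t s : Finset Lat} {e : Lat → Lat} (hd : IsDual t e) (hs : s ⊆ t) {x : Lat}
    (hx : toReal x ∈ cone s) :
    (∀ w ∈ t, 0 ≤ x ⬝ᵥ e w) ∧ x = ∑ u ∈ s, (x ⬝ᵥ e u) • u := by
  obtain ⟨h1, h2⟩ := (hd.mem_cone_iff hs).mp hx
  simp only [toReal_dot] at h1 h2
  refine ⟨fun w hw => by exact_mod_cast h1 w hw, ?_⟩
  rw [Finset.sum_subset hs fun u hu hus => ?_]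
  · exact hd.expand_dual_int x
  · have : x ⬝ᵥ e u = 0 := by exact_mod_cast h2 u hu hus
    rw [this, zero_smul]

/-- A generator `u` of a face is a nonnegative integral combination of `s'`. The face property puts
every element of `s'` that really occurs into `cone s`, and a basis vector cannot be such a
combination unless it is one of the summands (`IsDual.mem_of_eq_sum`). -/
lemma cone_isFaceOf_iff {s s' : Finset Lat} (hs : Primitive s) (hs' : Primitive s') :
    (cone s).IsFaceOf (cone s') ↔ s ⊆ s' := by
  obtain ⟨t, ⟨e, hd⟩, hst⟩ := hs
  obtain ⟨t', ⟨e', hd'⟩, hst'⟩ := hs'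
  constructor
  · intro hF u hu
    have hu' : toReal u ∈ cone s' := hF.le (toReal_mem_cone hu)
    obtain ⟨hc, hexp⟩ := hd'.int_coeff hst' hu'
    set c : Lat → ℤ := fun x => u ⬝ᵥ e' x with hcdef
    have hmem : u ∈ s'.filter fun x => 0 < c x := by
      refine hd.mem_of_eq_sum (hst hu) ?_ c (fun x hx => (Finset.mem_filter.mp hx).2.le) ?_
      · intro x hx
        obtain ⟨hx1, hx2⟩ := Finset.mem_filter.mp hx
        refine (hd.int_coeff hst (x := x) ?_).1
        refine hF.mem_of_smul_add_mem (toReal_mem_cone hx1)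
          (y := ∑ y ∈ s'.erase x, (c y : ℝ) • toReal y) (a := (c x : ℝ)) ?_ (by exact_mod_cast hx2) ?_
        · refine cone_mono (Finset.erase_subset x s') (sum_mem_cone fun y hy => ?_)
          exact_mod_cast hc y (hst' (Finset.mem_of_mem_erase hy))
        · rw [Finset.add_sum_erase s' (fun y => (c y : ℝ) • toReal y) hx1]
          have : toReal u = ∑ y ∈ s', (c y : ℝ) • toReal y := by
            conv_lhs => rw [hexp]
            rw [toReal_sum]
            simp only [toReal_zsmul, hcdef]
          rw [← this]
          exact toReal_mem_cone hu
      · rw [Finset.sum_filter_of_ne fun x hx hne => ?_]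
        · exact hexp
        · rcases (hc x (hst' hx)).lt_or_eq with h | h
          · exact h
          · exact absurd (by rw [hcdef]; simp only; rw [← h, zero_smul]) hne
    exact (Finset.mem_filter.mp hmem).1
  · intro h
    refine ⟨cone_mono h, ?_⟩
    intro x y a hx hy ha hxy
    rw [hd'.mem_cone_iff (h.trans hst')] at hxy ⊢
    rw [hd'.mem_cone_iff hst'] at hx hy
    refine ⟨hx.1, fun u hu hus => ?_⟩
    have h0 := hxy.2 u hu hus
    rw [add_dotProduct, smul_dotProduct, smul_eq_mul] at h0
    have h1 := hx.1 u hu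
    have h2 := hy.1 u hu
    have h3 : 0 ≤ a * (x ⬝ᵥ toReal (e' u)) := mul_nonneg ha.le h1
    have h4 : a * (x ⬝ᵥ toReal (e' u)) = 0 := by linarith
    exact (mul_eq_zero.mp h4).resolve_left ha.ne'

lemma cone_injective {s s' : Finset Lat} (hs : Primitive s) (hs' : Primitive s')
    (h : cone s = cone s') : s = s' := by
  apply Finset.Subset.antisymm
  · rw [← cone_isFaceOf_iff hs hs', h]
  · rw [← cone_isFaceOf_iff hs' hs, h]

lemma IsDual.linearIndependent {t : Finset Lat} {e : Lat → Lat} (hd : IsDual t e) :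
    LinearIndependent ℝ fun u : t => toReal (u : Lat) := by
  rw [Fintype.linearIndependent_iff]
  intro g hg i
  have h := congrArg (fun w => w ⬝ᵥ toReal (e i)) hg
  simp only [sum_dotProduct, smul_dotProduct, toReal_dot, zero_dotProduct, smul_eq_mul] at h
  rw [Finset.sum_eq_single i] at h
  · rw [hd.dot_self i.2] at h; simpa using h
  · intro j _ hj
    rw [hd.dot_ne j.2 i.2 fun h => hj (Subtype.ext h)]; simp
  · simp

lemma IsDual.linearIndependent_int {t : Finset Lat} {e : Lat → Lat} (hd : IsDual t e) :
    LinearIndependent ℤ fun u : t => (u : Lat) := by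
  rw [Fintype.linearIndependent_iff]
  intro g hg i
  have h := congrArg (fun w => w ⬝ᵥ e i) hg
  simp only [sum_dotProduct, smul_dotProduct, zero_dotProduct, smul_eq_mul] at h
  rw [Finset.sum_eq_single i] at h
  · rw [hd.dot_self i.2] at h; simpa using h
  · intro j _ hj
    rw [hd.dot_ne j.2 i.2 fun h => hj (Subtype.ext h)]; simp
  · simp

lemma coneDim_cone {s : Finset Lat} (hs : Primitive s) : coneDim (cone s) = s.card := by
  classical
  obtain ⟨t, ⟨e, hd⟩, hst⟩ := hs
  have hli : LinearIndependent ℝ fun u : s => toReal (u : Lat) :=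
    hd.linearIndependent.comp (fun u : s => (⟨u, hst u.2⟩ : t))
      fun a b h => Subtype.ext (by simpa using h)
  have hspan : Submodule.span ℝ (cone s : Set Spc) =
      Submodule.span ℝ (Set.range fun u : s => toReal (u : Lat)) := by
    apply le_antisymm
    · rw [Submodule.span_le]
      intro w hw
      obtain ⟨c, -, rfl⟩ := mem_cone.mp hw
      exact Submodule.sum_mem _ fun u hu =>
        Submodule.smul_mem _ _ (Submodule.subset_span ⟨⟨u, hu⟩, rfl⟩)
    · rw [Submodule.span_le]
      rintro _ ⟨u, rfl⟩
      exact Submodule.subset_span (toReal_mem_cone u.2)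
  rw [coneDim, hspan, finrank_span_eq_card hli, Fintype.card_coe]

/-- Elements of `s` are indecomposable in the monoid, so all of them occur among the `x i`; a
further `x i` would depend linearly on them. Thus the centre `p` of a blow-up does not depend on the
chosen generators. -/
lemma IsUnimodularGenerators.sum_eq {s : Finset Lat} (hs : Primitive s) {r : ℕ}
    {x : Fin r → Lat} (hx : IsUnimodularGenerators (cone s) x) :
    ∑ i, x i = ∑ u ∈ s, u ∧ r = s.card := by
  classical
  obtain ⟨t, ⟨e, hd⟩, hst⟩ := hs
  obtain ⟨hli, hhull, hcl⟩ := hx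
  have hinj : Function.Injective x := hli.injective
  set X : Finset Lat := Finset.univ.image x with hX
  have hXcone : ∀ y ∈ X, toReal y ∈ cone s := by
    intro y hy
    obtain ⟨i, -, rfl⟩ := Finset.mem_image.mp hy
    rw [hhull]
    exact PointedCone.subset_hull ⟨i, rfl⟩
  have hsX : s ⊆ X := by
    intro u hu
    have hmem : u ∈ AddSubmonoid.closure (Set.range x) := by
      have : u ∈ {z : Lat | toReal z ∈ cone s} := toReal_mem_cone hu
      rw [← hcl] at this
      exact this
    rw [AddSubmonoid.mem_closure_range_iff] at hmem
    obtain ⟨a, ha⟩ := hmem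
    refine hd.mem_of_eq_sum (hst hu) (fun y hy => (hd.int_coeff hst (hXcone y hy)).1)
      (fun y => ∑ i, if x i = y then (a i : ℤ) else 0)
      (fun y _ => Finset.sum_nonneg fun i _ => by split_ifs <;> simp) ?_
    rw [hX, Finset.sum_image fun i _ j _ h => hinj h, ha, Finsupp.sum_fintype _ _ (by simp)]
    refine Finset.sum_congr rfl fun i _ => ?_
    rw [Finset.sum_eq_single i (fun j _ hj => by simp [hinj.ne hj]) (by simp)]
    simp
  have hXs : X ⊆ s := by
    intro y hy
    by_contra hys
    obtain ⟨i, -, rfl⟩ := Finset.mem_image.mp hy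
    obtain ⟨-, hexp⟩ := hd.int_coeff hst (hXcone _ hy)
    rw [Fintype.linearIndependent_iff] at hli
    have := hli (fun j => (if j = i then 1 else 0) - if x j ∈ s then x i ⬝ᵥ e (x j) else 0) ?_ i
    · simp [hys] at this
    · simp only [sub_smul, Finset.sum_sub_distrib, ite_smul, one_smul, zero_smul,
        Finset.sum_ite_eq', Finset.mem_univ, if_true]
      rw [sub_eq_zero]
      conv_lhs => rw [hexp]
      rw [← Finset.sum_image (f := fun y => if y ∈ s then (x i ⬝ᵥ e y) • y else 0)
        (g := x) fun i _ j _ h => hinj h, ← hX, ← Finset.sum_filter]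
      refine Finset.sum_congr ?_ fun _ _ => rfl
      ext u; simp only [Finset.mem_filter]
      exact ⟨fun h => ⟨hsX h, h⟩, fun h => h.2⟩
  have hXeq : X = s := Finset.Subset.antisymm hXs hsX
  constructor
  · rw [← hXeq, hX, Finset.sum_image fun i _ j _ h => hinj h]
  · rw [← hXeq, hX, Finset.card_image_of_injective _ hinj]; simp

lemma exists_isUnimodularGenerators {s : Finset Lat} (hs : Primitive s) :
    ∃ x : Fin s.card → Lat, IsUnimodularGenerators (cone s) x ∧ ∑ i, x i = ∑ u ∈ s, u := by
  classical
  obtain ⟨t, ⟨e, hd⟩, hst⟩ := hs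
  set f := s.equivFin.symm
  have hr : Set.range (fun i => ((f i : s) : Lat)) = s := by
    ext u
    constructor
    · rintro ⟨i, rfl⟩; exact (f i).2
    · intro hu; exact ⟨f.symm ⟨u, hu⟩, by simp⟩
  refine ⟨fun i => f i, ⟨?_, ?_, ?_⟩, ?_⟩
  · exact hd.linearIndependent_int.comp (fun i => (⟨f i, hst (f i).2⟩ : t))
      fun a b h => f.injective (Subtype.ext (by simpa using h))
  · rw [cone]
    congr 1
    rw [← hr, ← Set.range_comp]; rfl
  · rw [hr]
    apply Set.Subset.antisymm
    · intro z hz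
      refine AddSubmonoid.closure_induction (motive := fun z _ => toReal z ∈ cone s)
        (fun u hu => toReal_mem_cone hu) ?_ ?_ hz
      · rw [toReal_zero]; exact Submodule.zero_mem _
      · intro a b _ _ ha hb; rw [toReal_add]; exact Submodule.add_mem _ ha hb
    · intro z hz
      obtain ⟨h1, h2⟩ := hd.int_coeff hst hz
      rw [h2]
      refine AddSubmonoid.sum_mem _ fun u hu => ?_
      obtain ⟨n, hn⟩ := Int.eq_ofNat_of_zero_le (h1 u (hst hu))
      rw [hn, natCast_zsmul]
      exact AddSubmonoid.nsmul_mem _ (AddSubmonoid.subset_closure hu) n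
  · rw [← Finset.sum_coe_sort s]
    exact Equiv.sum_comp f fun u : s => (u : Lat)

/-! ### Fans with a support function and the polytopes they define -/

open Classical in
/-- The basis dual to a unimodular triple. -/
noncomputable def dualv (t : Finset Lat) : Lat → Lat :=
  if h : Unimodular t then h.choose else 0

lemma Unimodular.isDual {t : Finset Lat} (h : Unimodular t) : IsDual t (dualv t) := by
  rw [dualv, dif_pos h]; exact h.choose_spec

open Classical in
/-- The point at which the functionals in `t` take the values prescribed by `h`. -/
noncomputable def vert (h : Lat → ℤ) (t : Finset Lat) : Lat := ∑ u ∈ t, h u • dualv t u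

lemma dot_vert {h : Lat → ℤ} {t : Finset Lat} (ht : Unimodular t) {u : Lat} (hu : u ∈ t) :
    u ⬝ᵥ vert h t = h u := by
  rw [vert, dotProduct_sum, Finset.sum_eq_single u]
  · rw [dotProduct_smul, ht.isDual.dot_self hu]; simp
  · intro w hw hne; rw [dotProduct_smul, ht.isDual.dot_ne hu hw hne.symm]; simp
  · exact fun h => absurd hu h

lemma eq_vert {h : Lat → ℤ} {t : Finset Lat} (ht : Unimodular t) {v : Lat}
    (hv : ∀ u ∈ t, u ⬝ᵥ v = h u) : v = vert h t :=
  ht.isDual.ext_primal_int fun u hu => by rw [hv u hu, dot_vert ht hu]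

/-- The rays of a collection of cones. -/
def rays {α : Type*} [DecidableEq α] (T : Finset (Finset α)) : Finset α := T.biUnion id

lemma mem_rays {α : Type*} [DecidableEq α] {T : Finset (Finset α)} {u : α} : u ∈ rays T ↔ ∃ t ∈ T, u ∈ t := by
  simp [rays]

/-- The sets of generators of the cones of the fan with maximal cones `T`. -/
def cplx {α : Type*} [DecidableEq α] (T : Finset (Finset α)) : Finset (Finset α) := T.biUnion Finset.powerset

lemma mem_cplx {α : Type*} [DecidableEq α] {T : Finset (Finset α)} {s : Finset α} : s ∈ cplx T ↔ ∃ t ∈ T, s ⊆ t := by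
  simp [cplx]

/-- `T` is the set of maximal cones (given by their generators) of the inner-normal fan of a smooth
polytope with support function `h`. -/
structure IsData (T : Finset (Finset Lat)) (h : Lat → ℤ) : Prop where
  nonempty : T.Nonempty
  uni : ∀ t ∈ T, Unimodular t
  lt : ∀ t ∈ T, ∀ u ∈ rays T, u ∉ t → h u < u ⬝ᵥ vert h t
  closed : ∀ t ∈ T, ∀ u ∈ t, ∃ t' ∈ T, t' ≠ t ∧ t.erase u ⊆ t'

/-- The polytope with facet normals `rays T` and support function `h`. -/
def poly (T : Finset (Finset Lat)) (h : Lat → ℤ) : Set Spc :=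
  {y | ∀ u ∈ rays T, (h u : ℝ) ≤ toReal u ⬝ᵥ y}

/-- The face of `poly T h` where the inequalities in `s` are tight. -/
def faceOf (T : Finset (Finset Lat)) (h : Lat → ℤ) (s : Finset Lat) : Set Spc :=
  {y ∈ poly T h | ∀ u ∈ s, toReal u ⬝ᵥ y = h u}

namespace IsData
variable {T : Finset (Finset Lat)} {h : Lat → ℤ}

lemma isDual (hD : IsData T h) {t : Finset Lat} (ht : t ∈ T) : IsDual t (dualv t) :=
  (hD.uni t ht).isDual

lemma card (hD : IsData T h) {t : Finset Lat} (ht : t ∈ T) : t.card = 3 := (hD.isDual ht).card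

lemma dot (hD : IsData T h) {t : Finset Lat} (ht : t ∈ T) {u : Lat} (hu : u ∈ t) :
    u ⬝ᵥ vert h t = h u := dot_vert (hD.uni t ht) hu

lemma le (hD : IsData T h) {t : Finset Lat} (ht : t ∈ T) {u : Lat} (hu : u ∈ rays T) :
    h u ≤ u ⬝ᵥ vert h t := by
  by_cases hut : u ∈ t
  · exact (hD.dot ht hut).ge
  · exact (hD.lt t ht u hu hut).le

lemma mem_of_eq (hD : IsData T h) {t : Finset Lat} (ht : t ∈ T) {u : Lat} (hu : u ∈ rays T)
    (he : u ⬝ᵥ vert h t = h u) : u ∈ t := by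
  by_contra hut
  exact absurd he (hD.lt t ht u hu hut).ne'

lemma vert_mem (hD : IsData T h) {t : Finset Lat} (ht : t ∈ T) :
    toReal (vert h t) ∈ poly T h := by
  intro u hu
  rw [toReal_dot]
  exact_mod_cast hD.le ht hu

lemma vert_injOn (hD : IsData T h) {t t' : Finset Lat} (ht : t ∈ T) (ht' : t' ∈ T)
    (he : vert h t = vert h t') : t = t' := by
  apply Finset.Subset.antisymm
  · intro u hu
    exact hD.mem_of_eq ht' (mem_rays.mpr ⟨t, ht, hu⟩) (by rw [← he, hD.dot ht hu])
  · intro u hu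
    exact hD.mem_of_eq ht (mem_rays.mpr ⟨t', ht', hu⟩) (by rw [he, hD.dot ht' hu])

/-- The edge joining the vertices of two adjacent maximal cones. -/
lemma wall (hD : IsData T h) {t : Finset Lat} (ht : t ∈ T) {u u' : Lat} (hu : u ∈ t)
    (hu' : u' ∉ t) (ht' : insert u' (t.erase u) ∈ T) :
    u' ⬝ᵥ dualv t u = -1 ∧ 0 < u' ⬝ᵥ vert h t - h u' ∧
      vert h (insert u' (t.erase u)) = vert h t + (u' ⬝ᵥ vert h t - h u') • dualv t u := by
  set t' := insert u' (t.erase u) with ht'def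
  have hd := hD.isDual ht
  have hd' := hD.isDual ht'
  have hu't' : u' ∈ t' := Finset.mem_insert_self _ _
  have hut' : u ∉ t' := by
    rw [ht'def]; simp only [Finset.mem_insert, Finset.mem_erase, not_or]
    exact ⟨fun h => hu' (h ▸ hu), fun h => h.1 rfl⟩
  have hsub : ∀ w ∈ t, w ≠ u → w ∈ t' := fun w hw hne =>
    Finset.mem_insert_of_mem (Finset.mem_erase.mpr ⟨hne, hw⟩)
  have hne' : ∀ w ∈ t, w ≠ u' := fun w hw h => hu' (h ▸ hw)
  -- the edge vector
  have hvec : vert h t' = vert h t + (u ⬝ᵥ vert h t' - h u) • dualv t u := by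
    apply hd.ext_primal_int
    intro w hw
    rw [dotProduct_add, dotProduct_smul, hD.dot ht hw]
    by_cases hwu : w = u
    · subst hwu; rw [hd.dot_self hw]; simp
    · rw [hd.dot_ne hw hu hwu, hD.dot ht' (hsub w hw hwu)]; simp
  have hdual : dualv t' u' = (u ⬝ᵥ dualv t' u') • dualv t u := by
    apply hd.ext_primal_int
    intro w hw
    rw [dotProduct_smul]
    by_cases hwu : w = u
    · subst hwu; rw [hd.dot_self hw]; simp
    · rw [hd.dot_ne hw hu hwu, hd'.dot_ne (hsub w hw hwu) hu't' (hne' w hw)]; simp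
  -- The two triples share a pair, so the dual vectors transverse to it are integral multiples of
  -- each other, by a factor `1` or `-1`. The strict inequalities `h2` and `h3` rule out `1`.
  have h1 : u ⬝ᵥ dualv t' u' * (u' ⬝ᵥ dualv t u) = 1 := by
    have h := hd'.dot_self hu't'
    rw [hdual, dotProduct_smul] at h
    simpa using h
  have h2 := hD.lt t' ht' u (mem_rays.mpr ⟨t, ht, hu⟩) hut'
  have h3 := hD.lt t ht u' (mem_rays.mpr ⟨t', ht', hu't'⟩) hu'
  have h4 : h u' = u' ⬝ᵥ vert h t + (u ⬝ᵥ vert h t' - h u) * (u' ⬝ᵥ dualv t u) := by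
    rw [← hD.dot ht' hu't', hvec, dotProduct_add, dotProduct_smul, dotProduct_add, dotProduct_smul,
      hd.dot_self hu, hD.dot ht hu]
    simp
  have h5 : u' ⬝ᵥ dualv t u = -1 := by
    rcases Int.eq_one_or_neg_one_of_mul_eq_one (by rw [mul_comm] at h1; exact h1) with h | h
    · rw [h] at h4; linarith
    · exact h
  rw [h5] at h4
  refine ⟨h5, by linarith, ?_⟩
  rw [hvec]
  congr 2
  linarith

lemma exists_nbr (hD : IsData T h) {t : Finset Lat} (ht : t ∈ T) {u : Lat} (hu : u ∈ t) :
    ∃ u', u' ∉ t ∧ insert u' (t.erase u) ∈ T := by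
  obtain ⟨t', ht', hne, hsub⟩ := hD.closed t ht u hu
  have hc : (t' \ t.erase u).card = 1 := by
    rw [Finset.card_sdiff_of_subset hsub, hD.card ht', Finset.card_erase_of_mem hu, hD.card ht]
  obtain ⟨u', hu'⟩ := Finset.card_eq_one.mp hc
  have hins : t' = insert u' (t.erase u) := by
    rw [Finset.insert_eq, ← hu', Finset.sdiff_union_of_subset hsub]
  have hmem : u' ∈ t' \ t.erase u := by rw [hu']; simp
  refine ⟨u', fun hut => ?_, hins ▸ ht'⟩
  have : u' = u := by
    by_contra hne
    exact (Finset.mem_sdiff.mp hmem).2 (Finset.mem_erase.mpr ⟨hne, hut⟩)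
  rw [this, Finset.insert_erase hu] at hins
  exact hne hins

/-- Both neighbouring vertices lie on the same ray from `vert h t`, and each satisfies the
inequality that stops the other. Hence the lengths agree and `u'` is tight at the second vertex. -/
lemma nbr_unique (hD : IsData T h) {t : Finset Lat} (ht : t ∈ T) {u u' u'' : Lat} (hu : u ∈ t)
    (hu' : u' ∉ t) (ht' : insert u' (t.erase u) ∈ T) (hu'' : u'' ∉ t)
    (ht'' : insert u'' (t.erase u) ∈ T) : u' = u'' := by
  obtain ⟨a1, a2, a3⟩ := hD.wall ht hu hu' ht'
  obtain ⟨b1, b2, b3⟩ := hD.wall ht hu hu'' ht''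
  have r' : u' ∈ rays T := mem_rays.mpr ⟨_, ht', Finset.mem_insert_self _ _⟩
  have r'' : u'' ∈ rays T := mem_rays.mpr ⟨_, ht'', Finset.mem_insert_self _ _⟩
  have c1 := hD.le ht'' r'
  have c2 := hD.le ht' r''
  rw [b3, dotProduct_add, dotProduct_smul, a1] at c1
  rw [a3, dotProduct_add, dotProduct_smul, b1] at c2
  simp only [smul_eq_mul] at c1 c2
  have hmem : u' ∈ insert u'' (t.erase u) := by
    apply hD.mem_of_eq ht'' r'
    rw [b3, dotProduct_add, dotProduct_smul, a1, smul_eq_mul]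
    linarith
  rcases Finset.mem_insert.mp hmem with h | h
  · exact h
  · exact absurd (Finset.mem_of_mem_erase h) hu'

lemma min_of_dual (hD : IsData T h) {t : Finset Lat} (ht : t ∈ T) {w : Spc}
    (hw : ∀ u ∈ t, 0 ≤ w ⬝ᵥ toReal (dualv t u)) {y : Spc} (hy : y ∈ poly T h) :
    w ⬝ᵥ toReal (vert h t) ≤ w ⬝ᵥ y := by
  rw [(hD.isDual ht).expand_dual w, sum_dotProduct, sum_dotProduct]
  refine Finset.sum_le_sum fun u hu => ?_
  rw [smul_dotProduct, smul_dotProduct, toReal_dot, hD.dot ht hu]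
  exact mul_le_mul_of_nonneg_left (hy u (mem_rays.mpr ⟨t, ht, hu⟩)) (hw u hu)

lemma dual_nonneg_of_min (hD : IsData T h) {t : Finset Lat} (ht : t ∈ T) {w : Spc}
    (hw : ∀ t' ∈ T, w ⬝ᵥ toReal (vert h t) ≤ w ⬝ᵥ toReal (vert h t')) :
    ∀ u ∈ t, 0 ≤ w ⬝ᵥ toReal (dualv t u) := by
  intro u hu
  obtain ⟨u', hu', ht'⟩ := hD.exists_nbr ht hu
  obtain ⟨-, h2, h3⟩ := hD.wall ht hu hu' ht'
  have := hw _ ht'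
  rw [h3, toReal_add, toReal_zsmul, dotProduct_add, dotProduct_smul, smul_eq_mul] at this
  have h2' : (0 : ℝ) < ((u' ⬝ᵥ vert h t - h u' : ℤ) : ℝ) := by exact_mod_cast h2
  exact (mul_nonneg_iff_of_pos_left h2').mp (by linarith)

/-- This is the completeness of the fan, which is not among the axioms of `IsData`: choose a vertex
where `w` is minimal among the finitely many vertices and compare it with its neighbours along the
edges. -/
lemma exists_min (hD : IsData T h) (w : Spc) :
    ∃ t ∈ T, ∀ u ∈ t, 0 ≤ w ⬝ᵥ toReal (dualv t u) := by
  obtain ⟨t, ht, hmin⟩ := T.exists_min_image (fun t => w ⬝ᵥ toReal (vert h t)) hD.nonempty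
  exact ⟨t, ht, hD.dual_nonneg_of_min ht hmin⟩

lemma vert_mem_faceOf (hD : IsData T h) {t s : Finset Lat} (ht : t ∈ T) (hs : s ⊆ t) :
    toReal (vert h t) ∈ faceOf T h s :=
  ⟨hD.vert_mem ht, fun u hu => by rw [toReal_dot, hD.dot ht (hs hu)]⟩

/-- In the coordinates dual to `t`, minimality at the vertex means nonnegative coordinates. For `u ∉
s` the edge in direction `dualv t u` ends inside the face, so constancy on the face kills that
coordinate. -/
lemma normalCone_faceOf (hD : IsData T h) {t s : Finset Lat} (ht : t ∈ T) (hs : s ⊆ t) :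
    normalCone (poly T h) (faceOf T h s) = cone s := by
  ext w
  change (∀ x ∈ faceOf T h s, ∀ y ∈ poly T h, w ⬝ᵥ x ≤ w ⬝ᵥ y) ↔ _
  rw [(hD.isDual ht).mem_cone_iff hs]
  constructor
  · intro hw
    have hnn := hD.dual_nonneg_of_min ht
      fun t' ht' => hw _ (hD.vert_mem_faceOf ht hs) _ (hD.vert_mem ht')
    refine ⟨hnn, fun u hu hus => ?_⟩
    obtain ⟨u', hu', ht'⟩ := hD.exists_nbr ht hu
    obtain ⟨-, h2, h3⟩ := hD.wall ht hu hu' ht'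
    have hs' : s ⊆ insert u' (t.erase u) := fun x hx => Finset.mem_insert_of_mem
      (Finset.mem_erase.mpr ⟨fun h => hus (h ▸ hx), hs hx⟩)
    have := hw _ (hD.vert_mem_faceOf ht' hs') _ (hD.vert_mem ht)
    rw [h3, toReal_add, toReal_zsmul, dotProduct_add, dotProduct_smul, smul_eq_mul] at this
    have h2' : (0 : ℝ) < ((u' ⬝ᵥ vert h t - h u' : ℤ) : ℝ) := by exact_mod_cast h2
    have h0 := hnn u hu
    by_contra hne
    have := mul_pos h2' (lt_of_le_of_ne h0 (Ne.symm hne))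
    linarith
  · rintro ⟨h1, h2⟩ x hx y hy
    have := hD.min_of_dual ht h1 hy
    refine le_trans (le_of_eq ?_) this
    rw [(hD.isDual ht).expand_dual w, sum_dotProduct, sum_dotProduct]
    refine Finset.sum_congr rfl fun u hu => ?_
    rw [smul_dotProduct, smul_dotProduct]
    by_cases hus : u ∈ s
    · rw [hx.2 u hus, toReal_dot, hD.dot ht hu]
    · rw [h2 u hu hus]; simp

lemma isFace_faceOf (hD : IsData T h) {t s : Finset Lat} (ht : t ∈ T) (hs : s ⊆ t) :
    IsFace (poly T h) (faceOf T h s) := by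
  -- The sum of the normals in `s` is minimal exactly where each of the inequalities is tight.
  refine ⟨⟨_, hD.vert_mem_faceOf ht hs⟩, ∑ u ∈ s, toReal u, ?_⟩
  have hsub : ∀ u ∈ s, u ∈ rays T := fun u hu => mem_rays.mpr ⟨t, ht, hs hu⟩
  ext x
  constructor
  · rintro ⟨hx, hxs⟩
    refine ⟨hx, fun y hy => ?_⟩
    rw [sum_dotProduct, sum_dotProduct]
    exact Finset.sum_le_sum fun u hu => by rw [hxs u hu]; exact hy u (hsub u hu)
  · rintro ⟨hx, hmin⟩
    refine ⟨hx, fun u hu => ?_⟩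
    have := hmin _ (hD.vert_mem ht)
    rw [sum_dotProduct, sum_dotProduct] at this
    have hle : ∀ u ∈ s, toReal u ⬝ᵥ toReal (vert h t) ≤ toReal u ⬝ᵥ x := fun u hu => by
      rw [toReal_dot, hD.dot ht (hs hu)]; exact hx u (hsub u hu)
    have := (Finset.sum_eq_sum_iff_of_le hle).mp (le_antisymm (Finset.sum_le_sum hle) this) u hu
    rw [← this, toReal_dot, hD.dot ht (hs hu)]

lemma isFace_iff (hD : IsData T h) {F : Set Spc} :
    IsFace (poly T h) F ↔ ∃ t ∈ T, ∃ s ⊆ t, F = faceOf T h s := by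
  classical
  constructor
  · rintro ⟨-, w, rfl⟩
    obtain ⟨t, ht, hw⟩ := hD.exists_min w
    -- Only the normals with nonzero coefficient in `w` are forced to be tight on the minimal face.
    refine ⟨t, ht, t.filter fun u => w ⬝ᵥ toReal (dualv t u) ≠ 0, Finset.filter_subset _ _, ?_⟩
    have hexp : ∀ y, w ⬝ᵥ y = ∑ u ∈ t, (w ⬝ᵥ toReal (dualv t u)) * (toReal u ⬝ᵥ y) := by
      intro y
      conv_lhs => rw [(hD.isDual ht).expand_dual w, sum_dotProduct]
      exact Finset.sum_congr rfl fun u _ => by rw [smul_dotProduct]; rfl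
    have hray : ∀ u ∈ t, u ∈ rays T := fun u hu => mem_rays.mpr ⟨t, ht, hu⟩
    ext x
    constructor
    · rintro ⟨hx, hmin⟩
      refine ⟨hx, fun u hu => ?_⟩
      obtain ⟨hut, hne⟩ := Finset.mem_filter.mp hu
      have h1 := hmin _ (hD.vert_mem ht)
      rw [hexp, hexp] at h1
      have hle : ∀ u ∈ t, (w ⬝ᵥ toReal (dualv t u)) * (toReal u ⬝ᵥ toReal (vert h t)) ≤
          (w ⬝ᵥ toReal (dualv t u)) * (toReal u ⬝ᵥ x) := fun u hu => by
        rw [toReal_dot, hD.dot ht hu]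
        exact mul_le_mul_of_nonneg_left (hx u (hray u hu)) (hw u hu)
      have := (Finset.sum_eq_sum_iff_of_le hle).mp
        (le_antisymm (Finset.sum_le_sum hle) h1) u hut
      rw [← mul_left_cancel₀ hne this, toReal_dot, hD.dot ht hut]
    · rintro ⟨hx, hxs⟩
      refine ⟨hx, fun y hy => ?_⟩
      rw [hexp, hexp]
      refine Finset.sum_le_sum fun u hu => ?_
      by_cases hne : w ⬝ᵥ toReal (dualv t u) = 0
      · rw [hne]; simp
      · rw [hxs u (Finset.mem_filter.mpr ⟨hu, hne⟩)]
        exact mul_le_mul_of_nonneg_left (hy u (hray u hu)) (hw u hu)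
  · rintro ⟨t, ht, s, hs, rfl⟩
    exact hD.isFace_faceOf ht hs

lemma normalFan_eq (hD : IsData T h) :
    normalFan (poly T h) = cone '' (cplx T : Set (Finset Lat)) := by
  ext σ
  constructor
  · rintro ⟨F, hF, rfl⟩
    obtain ⟨t, ht, s, hs, rfl⟩ := hD.isFace_iff.mp hF
    exact ⟨s, mem_cplx.mpr ⟨t, ht, hs⟩, (hD.normalCone_faceOf ht hs).symm⟩
  · rintro ⟨s, hs, rfl⟩
    obtain ⟨t, ht, hs⟩ := mem_cplx.mp hs
    exact ⟨_, hD.isFace_faceOf ht hs, (hD.normalCone_faceOf ht hs).symm⟩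

lemma primitive (hD : IsData T h) {s : Finset Lat} (hs : s ∈ cplx T) : Primitive s := by
  obtain ⟨t, ht, hs⟩ := mem_cplx.mp hs
  exact ⟨t, hD.uni t ht, hs⟩

lemma convex_poly (T : Finset (Finset Lat)) (h : Lat → ℤ) : Convex ℝ (poly T h) := by
  have : poly T h = ⋂ u ∈ rays T, {y : Spc | (h u : ℝ) ≤ toReal u ⬝ᵥ y} := by
    ext y; simp [poly]
  rw [this]
  refine convex_iInter₂ fun u _ => ?_
  exact convex_halfSpace_ge ⟨fun x y => dotProduct_add _ _ _, fun c x => dotProduct_smul _ _ _⟩ _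

lemma exists_dot (f : StrongDual ℝ Spc) : ∃ w : Spc, ∀ y, f y = w ⬝ᵥ y := by
  refine ⟨fun i => f (Pi.single i 1), fun y => ?_⟩
  conv_lhs => rw [← Finset.univ_sum_single y, map_sum]
  refine Finset.sum_congr rfl fun i _ => ?_
  have : (Pi.single i (y i) : Spc) = y i • Pi.single i 1 := by
    rw [← Pi.single_smul]; simp
  rw [this, map_smul, smul_eq_mul, mul_comm]

/-- A point of the polytope outside the hull of the vertices would be separated from it by some `w`,
but by `exists_min` and `min_of_dual` every `w` attains its minimum over the polytope at a vertex.
-/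
lemma poly_eq_convexHull (hD : IsData T h) :
    poly T h = convexHull ℝ (toReal '' ((T.image (vert h) : Finset Lat) : Set Lat)) := by
  apply Set.Subset.antisymm
  · intro y hy
    by_contra hcon
    have hfin : (toReal '' ((T.image (vert h) : Finset Lat) : Set Lat)).Finite :=
      (Finset.finite_toSet _).image _
    obtain ⟨f, c, h1, h2⟩ := geometric_hahn_banach_point_closed (convex_convexHull ℝ _)
      (hfin.isClosed_convexHull ℝ) hcon
    obtain ⟨w, hw⟩ := exists_dot f
    obtain ⟨t, ht, hmin⟩ := hD.exists_min w
    have h3 := hD.min_of_dual ht hmin hy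
    have h4 := h2 (toReal (vert h t)) (subset_convexHull ℝ _
      ⟨vert h t, by simpa using ⟨t, ht, rfl⟩, rfl⟩)
    rw [hw] at h1 h4
    linarith
  · refine convexHull_min ?_ (convex_poly T h)
    rintro _ ⟨v, hv, rfl⟩
    obtain ⟨t, ht, rfl⟩ := Finset.mem_image.mp (Finset.mem_coe.mp hv)
    exact hD.vert_mem ht

lemma faceOf_self (hD : IsData T h) {t : Finset Lat} (ht : t ∈ T) :
    faceOf T h t = {toReal (vert h t)} := by
  ext y
  constructor
  · rintro ⟨-, hy⟩
    exact (hD.isDual ht).ext_primal fun u hu => by rw [hy u hu, toReal_dot, hD.dot ht hu]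
  · rintro rfl
    exact hD.vert_mem_faceOf ht le_rfl

lemma subset_of_vert_mem (hD : IsData T h) {t s : Finset Lat} (ht : t ∈ T) (hs : s ∈ cplx T)
    (hv : toReal (vert h t) ∈ faceOf T h s) : s ⊆ t := by
  intro u hu
  obtain ⟨t', ht', hst'⟩ := mem_cplx.mp hs
  refine hD.mem_of_eq ht (mem_rays.mpr ⟨t', ht', hst' hu⟩) ?_
  have := hv.2 u hu
  rw [toReal_dot] at this
  exact_mod_cast this

lemma faceOf_injective (hD : IsData T h) {s s' : Finset Lat} (hs : s ∈ cplx T) (hs' : s' ∈ cplx T)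
    (he : faceOf T h s = faceOf T h s') : s = s' := by
  obtain ⟨t, ht, hst⟩ := mem_cplx.mp hs
  obtain ⟨t', ht', hst'⟩ := mem_cplx.mp hs'
  apply cone_injective (hD.primitive hs) (hD.primitive hs')
  rw [← hD.normalCone_faceOf ht hst, he, hD.normalCone_faceOf ht' hst']

lemma isVertex_iff (hD : IsData T h) {v : Spc} :
    IsVertex (poly T h) v ↔ ∃ t ∈ T, v = toReal (vert h t) := by
  constructor
  · intro hv
    obtain ⟨t, ht, s, hs, he⟩ := hD.isFace_iff.mp hv
    refine ⟨t, ht, ?_⟩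
    have := hD.vert_mem_faceOf ht hs
    rw [← he] at this
    exact this.symm
  · rintro ⟨t, ht, rfl⟩
    rw [IsVertex, ← hD.faceOf_self ht]
    exact hD.isFace_faceOf ht le_rfl

lemma faceOf_erase (hD : IsData T h) {t : Finset Lat} (ht : t ∈ T) {u u' : Lat} (hu : u ∈ t)
    (hu' : u' ∉ t) (ht' : insert u' (t.erase u) ∈ T) :
    faceOf T h (t.erase u) = segment ℝ (toReal (vert h t))
      (toReal (vert h t) + ((u' ⬝ᵥ vert h t - h u' : ℤ) : ℝ) • toReal (dualv t u)) := by
  obtain ⟨a1, a2, a3⟩ := hD.wall ht hu hu' ht'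
  set l := u' ⬝ᵥ vert h t - h u' with hl
  have hd := hD.isDual ht
  have hlpos : (0 : ℝ) < l := by exact_mod_cast a2
  apply Set.Subset.antisymm
  · rintro y ⟨hy, hye⟩
    have hc0 : 0 ≤ toReal u ⬝ᵥ y - h u := sub_nonneg.mpr (hy u (mem_rays.mpr ⟨t, ht, hu⟩))
    have hy' : y = toReal (vert h t) + (toReal u ⬝ᵥ y - h u) • toReal (dualv t u) := by
      apply hd.ext_primal
      intro w hw
      rw [dotProduct_add, dotProduct_smul, toReal_dot, toReal_dot, hD.dot ht hw]
      by_cases hwu : w = u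
      · subst hwu; rw [hd.dot_self hw]; simp
      · rw [hd.dot_ne hw hu hwu, hye w (Finset.mem_erase.mpr ⟨hwu, hw⟩)]; simp
    have hcl : toReal u ⬝ᵥ y - h u ≤ l := by
      have := hy u' (mem_rays.mpr ⟨_, ht', Finset.mem_insert_self _ _⟩)
      rw [hy', dotProduct_add, dotProduct_smul, toReal_dot, toReal_dot, a1] at this
      have hl' : (l : ℝ) = ((u' ⬝ᵥ vert h t : ℤ) : ℝ) - h u' := by rw [hl]; push_cast; ring
      rw [hl']
      simp only [smul_eq_mul] at this
      push_cast at this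
      linarith
    rw [segment_eq_image']
    refine ⟨(toReal u ⬝ᵥ y - h u) / l, ⟨div_nonneg hc0 hlpos.le, (div_le_one hlpos).mpr hcl⟩, ?_⟩
    conv_rhs => rw [hy']
    simp only [add_sub_cancel_left, smul_smul]
    rw [div_mul_cancel₀ _ hlpos.ne']
  · have hconv : Convex ℝ (faceOf T h (t.erase u)) := by
      have : faceOf T h (t.erase u) = poly T h ∩
          ⋂ w ∈ t.erase u, {y : Spc | toReal w ⬝ᵥ y = (h w : ℝ)} := by
        ext y; simp [faceOf]
      rw [this]
      refine (convex_poly T h).inter (convex_iInter₂ fun w _ => ?_)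
      exact convex_hyperplane ⟨fun x y => dotProduct_add _ _ _, fun c x => dotProduct_smul _ _ _⟩ _
    apply hconv.segment_subset (hD.vert_mem_faceOf ht (Finset.erase_subset _ _))
    have := hD.vert_mem_faceOf ht' (s := t.erase u) (Finset.subset_insert _ _)
    rw [a3, toReal_add, toReal_zsmul] at this
    exact this

lemma nbr_mem_faceOf (hD : IsData T h) {t s : Finset Lat} (ht : t ∈ T) (hs : s ⊆ t) {u : Lat}
    (hu : u ∈ t) (hus : u ∉ s) :
    ∃ l : ℝ, 0 < l ∧ toReal (vert h t) + l • toReal (dualv t u) ∈ faceOf T h s := by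
  obtain ⟨u', hu', ht'⟩ := hD.exists_nbr ht hu
  obtain ⟨-, a2, a3⟩ := hD.wall ht hu hu' ht'
  refine ⟨((u' ⬝ᵥ vert h t - h u' : ℤ) : ℝ), by exact_mod_cast a2, ?_⟩
  rw [← toReal_zsmul, ← toReal_add, ← a3]
  exact hD.vert_mem_faceOf ht' fun x hx => Finset.mem_insert_of_mem
    (Finset.mem_erase.mpr ⟨fun h => hus (h ▸ hx), hs hx⟩)

lemma dualv_mem_vectorSpan (hD : IsData T h) {t s : Finset Lat} (ht : t ∈ T) (hs : s ⊆ t) {u : Lat}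
    (hu : u ∈ t) (hus : u ∉ s) : toReal (dualv t u) ∈ vectorSpan ℝ (faceOf T h s) := by
  obtain ⟨l, hl, hmem⟩ := hD.nbr_mem_faceOf ht hs hu hus
  have := vsub_mem_vectorSpan ℝ hmem (hD.vert_mem_faceOf ht hs)
  rw [vsub_eq_sub, add_sub_cancel_left] at this
  have h2 := Submodule.smul_mem _ l⁻¹ this
  rwa [smul_smul, inv_mul_cancel₀ hl.ne', one_smul] at h2

lemma linearIndependent_dualv (hD : IsData T h) {t : Finset Lat} (ht : t ∈ T) :
    LinearIndependent ℝ fun u : t => toReal (dualv t u) := by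
  have hd := hD.isDual ht
  rw [Fintype.linearIndependent_iff]
  intro g hg i
  have h := congrArg (fun w => toReal (i : Lat) ⬝ᵥ w) hg
  simp only [dotProduct_sum, dotProduct_smul, toReal_dot, dotProduct_zero, smul_eq_mul] at h
  rw [Finset.sum_eq_single i] at h
  · rw [hd.dot_self i.2] at h; simpa using h
  · intro j _ hj
    rw [hd.dot_ne i.2 j.2 fun h => hj (Subtype.ext h.symm)]; simp
  · simp

lemma finrank_vectorSpan_faceOf (hD : IsData T h) {t s : Finset Lat} (ht : t ∈ T) (hs : s ⊆ t) :
    Module.finrank ℝ (vectorSpan ℝ (faceOf T h s)) = 3 - s.card := by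
  classical
  have hd := hD.isDual ht
  set f : (t \ s : Finset Lat) → Spc := fun u => toReal (dualv t u) with hf
  have hli : LinearIndependent ℝ f :=
    (hD.linearIndependent_dualv ht).comp
      (fun u : (t \ s : Finset Lat) => (⟨u, (Finset.mem_sdiff.mp u.2).1⟩ : t))
      fun a b h => Subtype.ext (by simpa using h)
  have hspan : vectorSpan ℝ (faceOf T h s) = Submodule.span ℝ (Set.range f) := by
    apply le_antisymm
    · rw [vectorSpan_eq_span_vsub_set_right ℝ (hD.vert_mem_faceOf ht hs), Submodule.span_le]
      rintro _ ⟨y, hy, rfl⟩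
      simp only [vsub_eq_sub, SetLike.mem_coe]
      rw [hd.expand_primal (y - _)]
      refine Submodule.sum_mem _ fun u hu => ?_
      by_cases hus : u ∈ s
      · rw [dotProduct_sub, hy.2 u hus, toReal_dot, hD.dot ht hu, sub_self, zero_smul]
        exact Submodule.zero_mem _
      · exact Submodule.smul_mem _ _ (Submodule.subset_span
          ⟨⟨u, Finset.mem_sdiff.mpr ⟨hu, hus⟩⟩, rfl⟩)
    · rw [Submodule.span_le]
      rintro _ ⟨⟨u, hu⟩, rfl⟩
      obtain ⟨hu, hus⟩ := Finset.mem_sdiff.mp hu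
      exact hD.dualv_mem_vectorSpan ht hs hu hus
  rw [hspan, finrank_span_eq_card hli, Fintype.card_coe, Finset.card_sdiff_of_subset hs, hD.card ht]

lemma isEdge_iff (hD : IsData T h) {t : Finset Lat} (ht : t ∈ T) {F : Set Spc} :
    IsEdge (poly T h) F ∧ toReal (vert h t) ∈ F ↔ ∃ u ∈ t, F = faceOf T h (t.erase u) := by
  constructor
  · rintro ⟨⟨hF, hdim⟩, hmem⟩
    obtain ⟨t', ht', s, hs, rfl⟩ := hD.isFace_iff.mp hF
    have hst := hD.subset_of_vert_mem ht (mem_cplx.mpr ⟨t', ht', hs⟩) hmem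
    rw [hD.finrank_vectorSpan_faceOf ht hst] at hdim
    have hc : (t \ s).card = 1 := by
      rw [Finset.card_sdiff_of_subset hst, hD.card ht]; exact hdim
    obtain ⟨u, hu⟩ := Finset.card_eq_one.mp hc
    have hut : u ∈ t \ s := by rw [hu]; simp
    refine ⟨u, (Finset.mem_sdiff.mp hut).1, ?_⟩
    congr 1
    rw [Finset.erase_eq, ← hu, Finset.sdiff_sdiff_eq_self hst]
  · rintro ⟨u, hu, rfl⟩
    refine ⟨⟨hD.isFace_faceOf ht (Finset.erase_subset _ _), ?_⟩,
      hD.vert_mem_faceOf ht (Finset.erase_subset _ _)⟩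
    rw [hD.finrank_vectorSpan_faceOf ht (Finset.erase_subset _ _), Finset.card_erase_of_mem hu,
      hD.card ht]

/-- A basis of the lattice from a unimodular triple. -/
lemma exists_basis (hD : IsData T h) {t : Finset Lat} (ht : t ∈ T) :
    ∃ (b : Module.Basis (Fin 3) ℤ Lat) (f : Fin 3 ≃ t), ∀ i, b i = dualv t (f i) := by
  have hd := hD.isDual ht
  let f : Fin 3 ≃ t := (Finset.equivFinOfCardEq (hD.card ht)).symm
  have hli : LinearIndependent ℤ fun i => dualv t (f i) := by
    rw [Fintype.linearIndependent_iff]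
    intro g hg i
    have h := congrArg (fun w => (f i : Lat) ⬝ᵥ w) hg
    simp only [dotProduct_sum, dotProduct_smul, dotProduct_zero, smul_eq_mul] at h
    rw [Finset.sum_eq_single i] at h
    · rw [hd.dot_self (f i).2] at h; simpa using h
    · intro j _ hj
      rw [hd.dot_ne (f i).2 (f j).2 fun h => hj (f.injective (Subtype.ext h.symm))]; simp
    · simp
  have hsp : ⊤ ≤ Submodule.span ℤ (Set.range fun i => dualv t (f i)) := by
    intro y _
    rw [hd.expand_primal_int y]
    refine Submodule.sum_mem _ fun u hu => Submodule.smul_mem _ _ (Submodule.subset_span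
      ⟨f.symm ⟨u, hu⟩, by simp⟩)
  exact ⟨Module.Basis.mk hli hsp, f, fun i => by simp⟩

theorem isSmooth (hD : IsData T h) : IsSmooth (poly T h) := by
  refine ⟨⟨⟨_, hD.poly_eq_convexHull⟩, ?_⟩, ?_⟩
  · obtain ⟨t, ht⟩ := hD.nonempty
    have hface : faceOf T h ∅ = poly T h := by ext y; simp [faceOf]
    have hr := hD.finrank_vectorSpan_faceOf ht (Finset.empty_subset t)
    rw [hface] at hr
    rw [← AffineSubspace.direction_eq_top_iff_of_nonempty, direction_affineSpan]
    · apply Submodule.eq_top_of_finrank_eq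
      rw [hr]; simp
    · exact ⟨_, subset_affineSpan ℝ _ (hD.vert_mem ht)⟩
  · intro v hv
    obtain ⟨t, ht, rfl⟩ := hD.isVertex_iff.mp hv
    obtain ⟨b, f, hb⟩ := hD.exists_basis ht
    have hex : ∀ i : Fin 3, ∃ l : ℝ, 0 < l ∧ faceOf T h (t.erase (f i)) =
        segment ℝ (toReal (vert h t)) (toReal (vert h t) + l • toReal (dualv t (f i))) := by
      intro i
      obtain ⟨u', hu', ht'⟩ := hD.exists_nbr ht (f i).2
      obtain ⟨-, a2, -⟩ := hD.wall ht (f i).2 hu' ht'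
      exact ⟨_, by exact_mod_cast a2, hD.faceOf_erase ht (f i).2 hu' ht'⟩
    choose l hl hseg using hex
    refine ⟨b, l, hl, ?_⟩
    ext F
    rw [Set.mem_ofPred_eq, hD.isEdge_iff ht]
    constructor
    · rintro ⟨u, hu, rfl⟩
      refine ⟨f.symm ⟨u, hu⟩, ?_⟩
      simp only
      rw [hb, ← hseg]; simp
    · rintro ⟨i, rfl⟩
      simp only
      exact ⟨f i, (f i).2, by rw [hb, hseg]⟩

end IsData

/-! ### From a smooth polytope to its fan and support function -/

lemma le_dot_of_mem_convexHull {d : ℕ} {S : Set (Fin d → ℝ)} {f : Fin d → ℝ} {m : ℝ}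
    (hm : ∀ w ∈ S, m ≤ f ⬝ᵥ w) {x : Fin d → ℝ} (hx : x ∈ convexHull ℝ S) : m ≤ f ⬝ᵥ x := by
  have : convexHull ℝ S ⊆ {y : Fin d → ℝ | m ≤ f ⬝ᵥ y} := convexHull_min hm
    (convex_halfSpace_ge ⟨fun x y => dotProduct_add _ _ _, fun c x => dotProduct_smul _ _ _⟩ _)
  exact this hx

/-- A convex combination that attains the minimum gives weight zero to every point where `f` is
larger. -/
lemma mem_convexHull_face {d : ℕ} {S : Finset (Fin d → ℝ)} {f : Fin d → ℝ} {m : ℝ}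
    (hm : ∀ w ∈ S, m ≤ f ⬝ᵥ w) {x : Fin d → ℝ}
    (hx : x ∈ convexHull ℝ (S : Set (Fin d → ℝ))) (hfx : f ⬝ᵥ x = m) :
    x ∈ convexHull ℝ {w | w ∈ S ∧ f ⬝ᵥ w = m} := by
  classical
  obtain ⟨a, ha0, ha1, hax⟩ := Finset.mem_convexHull'.mp hx
  have hsum : ∑ w ∈ S, a w * (f ⬝ᵥ w - m) = 0 := by
    have : f ⬝ᵥ x = ∑ w ∈ S, a w * (f ⬝ᵥ w) := by
      rw [← hax, dotProduct_sum]
      exact Finset.sum_congr rfl fun w _ => by rw [dotProduct_smul, smul_eq_mul]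
    simp only [mul_sub, Finset.sum_sub_distrib, ← Finset.sum_mul, ha1, ← this, hfx]
    ring
  have hz : ∀ w ∈ S, f ⬝ᵥ w ≠ m → a w = 0 := by
    intro w hw hne
    have := (Finset.sum_eq_zero_iff_of_nonneg fun w hw =>
      mul_nonneg (ha0 w hw) (sub_nonneg.mpr (hm w hw))).mp hsum w hw
    exact (mul_eq_zero.mp this).resolve_right (sub_ne_zero.mpr hne)
  have hs1 : ∑ w ∈ S.filter (fun w => f ⬝ᵥ w = m), a w = 1 := by
    rw [Finset.sum_filter_of_ne, ha1]
    intro w hw h0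
    by_contra hne
    exact h0 (hz w hw hne)
  have hs2 : ∑ w ∈ S.filter (fun w => f ⬝ᵥ w = m), a w • w = x := by
    rw [Finset.sum_filter_of_ne, hax]
    intro w hw h0
    by_contra hne
    exact h0 (by rw [hz w hw hne, zero_smul])
  rw [← hs2]
  refine (convex_convexHull ℝ _).sum_mem (fun w hw => ha0 w (Finset.mem_filter.mp hw).1) hs1
    fun w hw => subset_convexHull ℝ _ (Finset.mem_filter.mp hw)

/-- Every finite set contains an exposed subset with the same convex hull. -/
lemma exists_exposed_subset (S : Finset Spc) :
    ∃ S' ⊆ S, convexHull ℝ (S' : Set Spc) = convexHull ℝ (S : Set Spc) ∧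
      ∀ w ∈ S', ∃ f : Spc, ∀ y ∈ S', y ≠ w → f ⬝ᵥ w < f ⬝ᵥ y := by
  classical
  -- In a subset of least cardinality with the same hull no point lies in the hull of the others, so
  -- it can be separated from them.
  obtain ⟨S', hS', hmin⟩ := Finset.exists_min_image
    (S.powerset.filter fun S' : Finset Spc => convexHull ℝ (S' : Set Spc) = convexHull ℝ (S : Set Spc))
    Finset.card ⟨S, by simp⟩
  obtain ⟨h1, h2⟩ := Finset.mem_filter.mp hS'
  rw [Finset.mem_powerset] at h1
  refine ⟨S', h1, h2, fun w hw => ?_⟩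
  have hnot : w ∉ convexHull ℝ ((S'.erase w : Finset Spc) : Set Spc) := by
    intro hcon
    have hsub : convexHull ℝ (S' : Set Spc) ⊆ convexHull ℝ ((S'.erase w : Finset Spc) : Set Spc) := by
      refine convexHull_min (fun y hy => ?_) (convex_convexHull ℝ _)
      by_cases hyw : y = w
      · rw [hyw]; exact hcon
      · exact subset_convexHull ℝ _ (Finset.mem_coe.mpr (Finset.mem_erase.mpr ⟨hyw, hy⟩))
    have hsub' : convexHull ℝ ((S'.erase w : Finset Spc) : Set Spc) ⊆ convexHull ℝ (S' : Set Spc) :=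
      convexHull_mono (by exact_mod_cast Finset.erase_subset w S')
    have := hmin (S'.erase w) (Finset.mem_filter.mpr
      ⟨Finset.mem_powerset.mpr ((Finset.erase_subset _ _).trans h1),
        (Set.Subset.antisymm hsub' hsub).trans h2⟩)
    have := Finset.card_erase_lt_of_mem hw
    omega
  obtain ⟨f, c, hf1, hf2⟩ := geometric_hahn_banach_point_closed (convex_convexHull ℝ _)
    ((Finset.finite_toSet _).isClosed_convexHull ℝ) hnot
  obtain ⟨g, hg⟩ := IsData.exists_dot f
  refine ⟨g, fun y hy hne => ?_⟩
  rw [← hg, ← hg]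
  exact hf1.trans (hf2 y (subset_convexHull ℝ _ (Finset.mem_coe.mpr
    (Finset.mem_erase.mpr ⟨hne, hy⟩))))

lemma exists_dual_of_basis (b : Module.Basis (Fin 3) ℤ Lat) :
    ∃ u : Fin 3 → Lat, ∀ i j, u i ⬝ᵥ b j = if i = j then 1 else 0 := by
  refine ⟨fun i k => b.coord i (Pi.single k 1), fun i j => ?_⟩
  have : ∀ y : Lat, (fun k => b.coord i (Pi.single k 1)) ⬝ᵥ y = b.coord i y := by
    intro y
    conv_rhs => rw [← Finset.univ_sum_single y, map_sum]
    refine Finset.sum_congr rfl fun k _ => ?_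
    have h2 : (Pi.single k (y k) : Lat) = y k • Pi.single k 1 := by
      rw [← Pi.single_smul]; simp
    rw [h2, map_smul, smul_eq_mul, mul_comm]
  rw [this]
  simp [Finsupp.single_apply, eq_comm]

lemma exists_isDual_of_basis (b : Module.Basis (Fin 3) ℤ Lat) :
    ∃ (t : Finset Lat) (e : Lat → Lat), IsDual t e ∧ ∀ u ∈ t, ∃ i, e u = b i ∧
      ∀ j, u ⬝ᵥ b j = if i = j then 1 else 0 := by
  classical
  obtain ⟨u, hu⟩ := exists_dual_of_basis b
  have hinj : Function.Injective u := by
    intro i j hij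
    by_contra hne
    have h1 := hu i i
    rw [hij, hu j i] at h1
    simp [Ne.symm hne] at h1
  refine ⟨Finset.univ.image u, Function.extend u b 0, ⟨?_, ?_⟩, ?_⟩
  · rw [Finset.card_image_of_injective _ hinj]; simp
  · intro x hx y hy
    obtain ⟨i, -, rfl⟩ := Finset.mem_image.mp hx
    obtain ⟨j, -, rfl⟩ := Finset.mem_image.mp hy
    rw [hinj.extend_apply, hu]
    simp [hinj.eq_iff]
  · intro x hx
    obtain ⟨i, -, rfl⟩ := Finset.mem_image.mp hx
    exact ⟨i, hinj.extend_apply _ _ _, hu i⟩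

/-- The local description of a smooth polytope at its vertices. -/
lemma IsSmooth.exists_local {P : Set Spc} (hP : IsSmooth P) :
    ∃ W : Finset Lat, W.Nonempty ∧ P = convexHull ℝ (toReal '' (W : Set Lat)) ∧
      ∀ v ∈ W, ∃ (t : Finset Lat) (e : Lat → Lat), IsDual t e ∧
        (∀ w ∈ W, ∀ u ∈ t, u ⬝ᵥ v ≤ u ⬝ᵥ w) ∧
        ∀ u ∈ t, ∃ w ∈ W, ∃ m : ℤ, 0 < m ∧ w = v + m • e u := by
  classical
  obtain ⟨⟨⟨V0, hV0⟩, hspan⟩, hvert⟩ := hP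
  obtain ⟨S', hS', hconv, hexp⟩ := exists_exposed_subset (V0.image toReal)
  have hPS : P = convexHull ℝ (S' : Set Spc) := by rw [hconv, hV0, Finset.coe_image]
  set W := V0.filter fun v => toReal v ∈ S' with hW
  have hWS : (toReal '' (W : Set Lat)) = (S' : Set Spc) := by
    ext y
    constructor
    · rintro ⟨v, hv, rfl⟩
      exact (Finset.mem_filter.mp (Finset.mem_coe.mp hv)).2
    · intro hy
      obtain ⟨v, hv, rfl⟩ := Finset.mem_image.mp (hS' hy)
      exact ⟨v, Finset.mem_coe.mpr (Finset.mem_filter.mpr ⟨hv, hy⟩), rfl⟩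
  have hmem : ∀ v ∈ W, toReal v ∈ S' := fun v hv => (Finset.mem_filter.mp hv).2
  have hmemP : ∀ v ∈ W, toReal v ∈ P := fun v hv => by
    rw [hPS]; exact subset_convexHull ℝ _ (hmem v hv)
  have hlift : ∀ y ∈ S', ∃ v ∈ W, toReal v = y := by
    intro y hy
    have : y ∈ toReal '' (W : Set Lat) := by rw [hWS]; exact hy
    obtain ⟨v, hv, h⟩ := this
    exact ⟨v, hv, h⟩
  refine ⟨W, ?_, by rw [hWS, hPS], ?_⟩
  · by_contra hne
    rw [Finset.not_nonempty_iff_eq_empty] at hne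
    rw [hPS, ← hWS, hne] at hspan
    simp at hspan
  intro v hv
  obtain ⟨f, hf⟩ := hexp _ (hmem v hv)
  have hfle : ∀ y ∈ S', f ⬝ᵥ toReal v ≤ f ⬝ᵥ y := by
    intro y hy
    by_cases hyv : y = toReal v
    · rw [hyv]
    · exact (hf y hy hyv).le
  have hvv : IsVertex P (toReal v) := by
    refine ⟨⟨_, rfl⟩, f, ?_⟩
    ext x
    constructor
    · rintro rfl
      refine ⟨hmemP v hv, fun y hy => ?_⟩
      rw [hPS] at hy
      exact le_dot_of_mem_convexHull hfle hy
    · rintro ⟨hx, hxm⟩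
      have h1 := hxm _ (hmemP v hv)
      rw [hPS] at hx
      have h2 := le_dot_of_mem_convexHull hfle hx
      have h3 := mem_convexHull_face hfle hx (le_antisymm h1 h2)
      have h4 : {w | w ∈ S' ∧ f ⬝ᵥ w = f ⬝ᵥ toReal v} = {toReal v} := by
        ext y
        constructor
        · rintro ⟨hy, hye⟩
          by_contra hne
          exact (hf y hy hne).ne' hye
        · rintro rfl; exact ⟨hmem v hv, rfl⟩
      rw [h4, convexHull_singleton] at h3
      exact h3
  obtain ⟨b, l, hl, hedges⟩ := hvert _ hvv
  obtain ⟨t, e, hd, hte⟩ := exists_isDual_of_basis b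
  -- the normalized directions from `v`
  set nd : Spc → Spc := fun y => (f ⬝ᵥ (y - toReal v))⁻¹ • (y - toReal v) with hnd
  have hpos : ∀ y ∈ S'.erase (toReal v), 0 < f ⬝ᵥ (y - toReal v) := by
    intro y hy
    rw [dotProduct_sub, sub_pos]
    exact hf y (Finset.mem_of_mem_erase hy) (Finset.ne_of_mem_erase hy)
  have hnd1 : ∀ y ∈ S'.erase (toReal v), f ⬝ᵥ nd y = 1 := by
    intro y hy
    rw [hnd]; simp only [dotProduct_smul, smul_eq_mul]
    exact inv_mul_cancel₀ (hpos y hy).ne'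
  have hnd2 : ∀ y ∈ S'.erase (toReal v), y - toReal v = (f ⬝ᵥ (y - toReal v)) • nd y := by
    intro y hy
    rw [hnd]; simp only [smul_smul]
    rw [mul_inv_cancel₀ (hpos y hy).ne', one_smul]
  -- This is the vertex figure: the section by `f = 1` of the cone of directions at `v`. Its exposed
  -- points turn out to be edge directions, so that the whole polytope lies in the cone spanned by
  -- the basis `b`.
  obtain ⟨G, hG, hGconv, hGexp⟩ := exists_exposed_subset ((S'.erase (toReal v)).image nd)
  have hGdir : ∀ g ∈ G, ∃ i, ∃ c : ℝ, 0 ≤ c ∧ g = c • toReal (b i) := by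
    intro g hg
    obtain ⟨y0, hy0, hy0g⟩ := Finset.mem_image.mp (hG hg)
    obtain ⟨f2, hf2⟩ := hGexp g hg
    have hfg : f ⬝ᵥ g = 1 := by rw [← hy0g]; exact hnd1 y0 hy0
    -- Correcting `f2` by a multiple of `f` makes it vanish at `g` and stay positive at the other
    -- points of `G`. The face of `P` where `f3` is minimal then lies on the line through `v` in
    -- direction `g`, hence is an edge.
    set f3 := f2 - (f2 ⬝ᵥ g) • f with hf3
    have hf3G : ∀ g' ∈ G, 0 ≤ f3 ⬝ᵥ g' := by
      intro g' hg'
      have h1 : f ⬝ᵥ g' = 1 := by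
        obtain ⟨y', hy', hy'g⟩ := Finset.mem_image.mp (hG hg')
        rw [← hy'g]; exact hnd1 y' hy'
      rw [hf3, sub_dotProduct, smul_dotProduct, h1]
      by_cases hgg : g' = g
      · rw [hgg]; simp
      · have := hf2 g' hg' hgg
        simp only [smul_eq_mul, mul_one]; linarith
    have hf3g : f3 ⬝ᵥ g = 0 := by
      rw [hf3, sub_dotProduct, smul_dotProduct, hfg]; simp
    have hndconv : ∀ y ∈ S'.erase (toReal v), nd y ∈ convexHull ℝ (G : Set Spc) := by
      intro y hy
      rw [hGconv]
      exact subset_convexHull ℝ _ (Finset.mem_coe.mpr (Finset.mem_image_of_mem nd hy))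
    have hGface : {w | w ∈ G ∧ f3 ⬝ᵥ w = 0} = {g} := by
      ext g'
      constructor
      · rintro ⟨hg', h0⟩
        by_contra hne
        have h1 : f ⬝ᵥ g' = 1 := by
          obtain ⟨y', hy', hy'g⟩ := Finset.mem_image.mp (hG hg')
          rw [← hy'g]; exact hnd1 y' hy'
        rw [hf3, sub_dotProduct, smul_dotProduct, h1, smul_eq_mul, mul_one] at h0
        have := hf2 g' hg' hne
        linarith
      · rintro rfl; exact ⟨hg, hf3g⟩
    have hf3S : ∀ y ∈ S', f3 ⬝ᵥ toReal v ≤ f3 ⬝ᵥ y := by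
      intro y hy
      by_cases hyv : y = toReal v
      · rw [hyv]
      · have hy' := Finset.mem_erase.mpr ⟨hyv, hy⟩
        have h1 := le_dot_of_mem_convexHull hf3G (hndconv y hy')
        have h2 : f3 ⬝ᵥ (y - toReal v) = (f ⬝ᵥ (y - toReal v)) * (f3 ⬝ᵥ nd y) := by
          conv_lhs => rw [hnd2 y hy']
          rw [dotProduct_smul, smul_eq_mul]
        have h3 := mul_nonneg (hpos y hy').le h1
        rw [← h2, dotProduct_sub] at h3
        linarith
    set F := {x ∈ P | ∀ y ∈ P, f3 ⬝ᵥ x ≤ f3 ⬝ᵥ y} with hF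
    have hvF : toReal v ∈ F := ⟨hmemP v hv, fun y hy => by
      rw [hPS] at hy; exact le_dot_of_mem_convexHull hf3S hy⟩
    have hF_line : ∀ x ∈ F, ∃ c : ℝ, x = toReal v + c • g := by
      rintro x ⟨hx, hxm⟩
      have h1 := hxm _ (hmemP v hv)
      rw [hPS] at hx
      have h2 := le_dot_of_mem_convexHull hf3S hx
      have h3 := mem_convexHull_face hf3S hx (le_antisymm h1 h2)
      have hcv : Convex ℝ {x : Spc | ∃ c : ℝ, x = toReal v + c • g} := by
        rintro _ ⟨c, rfl⟩ _ ⟨d, rfl⟩ α β hα hβ hαβ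
        refine ⟨α * c + β * d, ?_⟩
        have : toReal v = (α + β) • toReal v := by rw [hαβ, one_smul]
        conv_rhs => rw [this]
        simp only [smul_add, add_smul, smul_smul]
        abel
      refine convexHull_min ?_ hcv h3
      rintro y ⟨hy, hye⟩
      by_cases hyv : y = toReal v
      · exact ⟨0, by rw [hyv]; simp⟩
      · have hy' := Finset.mem_erase.mpr ⟨hyv, hy⟩
        have h2 : f3 ⬝ᵥ (y - toReal v) = (f ⬝ᵥ (y - toReal v)) * (f3 ⬝ᵥ nd y) := by
          conv_lhs => rw [hnd2 y hy']
          rw [dotProduct_smul, smul_eq_mul]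
        rw [dotProduct_sub, hye, sub_self] at h2
        have h4 := (mul_eq_zero.mp h2.symm).resolve_left (hpos y hy').ne'
        have h5 := mem_convexHull_face hf3G (hndconv y hy') h4
        rw [hGface, convexHull_singleton] at h5
        refine ⟨f ⬝ᵥ (y - toReal v), ?_⟩
        have h6 := hnd2 y hy'
        rw [Set.mem_singleton_iff.mp h5] at h6
        rw [← h6]; abel
    have hy0v := hnd2 y0 hy0
    rw [hy0g] at hy0v
    have hy0F : y0 ∈ F := by
      refine ⟨by rw [hPS]; exact subset_convexHull ℝ _ (Finset.mem_of_mem_erase hy0), ?_⟩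
      intro y hy
      refine le_trans (le_of_eq ?_) (hvF.2 y hy)
      have : f3 ⬝ᵥ (y0 - toReal v) = 0 := by rw [hy0v, dotProduct_smul, hf3g, smul_zero]
      rw [dotProduct_sub] at this
      linarith
    have hg0 : g ≠ 0 := by
      intro h; rw [h] at hfg; simp at hfg
    have hedge : IsEdge P F := by
      refine ⟨⟨⟨_, hvF⟩, f3, rfl⟩, ?_⟩
      have : vectorSpan ℝ F = Submodule.span ℝ {g} := by
        apply le_antisymm
        · rw [vectorSpan_eq_span_vsub_set_right ℝ hvF, Submodule.span_le]
          rintro _ ⟨x, hx, rfl⟩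
          obtain ⟨c, rfl⟩ := hF_line x hx
          simp only [vsub_eq_sub, add_sub_cancel_left]
          exact Submodule.smul_mem _ _ (Submodule.mem_span_singleton_self g)
        · rw [Submodule.span_singleton_le_iff_mem]
          have := vsub_mem_vectorSpan ℝ hy0F hvF
          rw [vsub_eq_sub, hy0v] at this
          have h2 := Submodule.smul_mem _ (f ⬝ᵥ (y0 - toReal v))⁻¹ this
          rwa [smul_smul, inv_mul_cancel₀ (hpos y0 hy0).ne', one_smul] at h2
      rw [this, finrank_span_singleton hg0]
    have hFmem : F ∈ {F | IsEdge P F ∧ toReal v ∈ F} := ⟨hedge, hvF⟩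
    rw [hedges] at hFmem
    obtain ⟨i, hi⟩ := hFmem
    have : y0 ∈ segment ℝ (toReal v) (toReal v + l i • toReal (b i)) := by
      have h := hy0F
      rw [← hi] at h; exact h
    rw [segment_eq_image'] at this
    obtain ⟨θ, ⟨hθ, -⟩, hθy⟩ := this
    simp only [add_sub_cancel_left, smul_smul] at hθy
    refine ⟨i, (f ⬝ᵥ (y0 - toReal v))⁻¹ * (θ * l i), mul_nonneg (inv_nonneg.mpr (hpos y0 hy0).le)
      (mul_nonneg hθ (hl i).le), ?_⟩
    have h7 : y0 - toReal v = (θ * l i) • toReal (b i) := by rw [← hθy]; abel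
    rw [mul_smul, ← h7, ← hy0g]
  refine ⟨t, e, hd, ?_, ?_⟩
  · intro w hw u hu
    obtain ⟨i, -, hi⟩ := hte u hu
    have hGu : ∀ g ∈ (G : Set Spc), 0 ≤ toReal u ⬝ᵥ g := by
      intro g hg
      obtain ⟨j, c, hc, rfl⟩ := hGdir g hg
      rw [dotProduct_smul, toReal_dot, hi j, smul_eq_mul]
      split_ifs <;> simp [hc]
    by_cases hwv : toReal w = toReal v
    · rw [toReal_injective hwv]
    · have hy' := Finset.mem_erase.mpr ⟨hwv, hmem w hw⟩
      have h1 : nd (toReal w) ∈ convexHull ℝ (G : Set Spc) := by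
        rw [hGconv]
        exact subset_convexHull ℝ _ (Finset.mem_coe.mpr (Finset.mem_image_of_mem nd hy'))
      have h2 := mul_nonneg (hpos _ hy').le (le_dot_of_mem_convexHull hGu h1)
      rw [← smul_eq_mul, ← dotProduct_smul, ← hnd2 _ hy', dotProduct_sub, toReal_dot, toReal_dot,
        sub_nonneg] at h2
      exact_mod_cast h2
  · intro u hu
    obtain ⟨i, hei, hi⟩ := hte u hu
    have hFmem : segment ℝ (toReal v) (toReal v + l i • toReal (b i)) ∈
        {F | IsEdge P F ∧ toReal v ∈ F} := by rw [hedges]; exact ⟨i, rfl⟩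
    obtain ⟨⟨⟨-, f4, hf4⟩, -⟩, -⟩ := hFmem
    set F := segment ℝ (toReal v) (toReal v + l i • toReal (b i)) with hF
    have hvF : toReal v ∈ F := left_mem_segment ℝ _ _
    have hendF : toReal v + l i • toReal (b i) ∈ F := right_mem_segment ℝ _ _
    have hvF' := hvF
    have hendF' := hendF
    rw [hf4] at hvF' hendF'
    have hf4S : ∀ y ∈ S', f4 ⬝ᵥ toReal v ≤ f4 ⬝ᵥ y := fun y hy =>
      hvF'.2 y (by rw [hPS]; exact subset_convexHull ℝ _ hy)
    have hend : toReal v + l i • toReal (b i) ∈ convexHull ℝ {w | w ∈ S' ∧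
        f4 ⬝ᵥ w = f4 ⬝ᵥ toReal v} := by
      refine mem_convexHull_face hf4S ?_ (le_antisymm (hendF'.2 _ hvF'.1) (hvF'.2 _ hendF'.1))
      rw [← hPS]; exact hendF'.1
    -- Otherwise the edge would shrink to `v`. The far end found here is a lattice point, which
    -- makes the length `m` an integer.
    have hex : ∃ y ∈ S', f4 ⬝ᵥ y = f4 ⬝ᵥ toReal v ∧ y ≠ toReal v := by
      by_contra! hcon
      have hsub : {w | w ∈ S' ∧ f4 ⬝ᵥ w = f4 ⬝ᵥ toReal v} ⊆ {toReal v} :=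
        fun y hy => hcon y hy.1 hy.2
      have := convexHull_mono (𝕜 := ℝ) hsub hend
      rw [convexHull_singleton, Set.mem_singleton_iff] at this
      have h8 : l i • toReal (b i) = 0 := by
        have := congrArg (fun x => x - toReal v) this
        simpa using this
      have h9 : toReal u ⬝ᵥ (l i • toReal (b i)) = 0 := by rw [h8]; simp
      rw [dotProduct_smul, toReal_dot, hi i] at h9
      simp at h9
      exact (hl i).ne' h9
    obtain ⟨y, hy, hye, hyne⟩ := hex
    obtain ⟨w, hw, rfl⟩ := hlift y hy
    have hwF : toReal w ∈ F := by
      rw [hf4]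
      exact ⟨hmemP w hw, fun z hz => by rw [hye]; exact hvF'.2 z hz⟩
    rw [hF, segment_eq_image'] at hwF
    obtain ⟨θ, ⟨hθ, -⟩, hθy⟩ := hwF
    simp only [add_sub_cancel_left, smul_smul] at hθy
    have hm : ((u ⬝ᵥ (w - v) : ℤ) : ℝ) = θ * l i := by
      rw [← toReal_dot, toReal_sub, ← hθy, add_sub_cancel_left, dotProduct_smul, toReal_dot, hi i]
      simp
    refine ⟨w, hw, u ⬝ᵥ (w - v), ?_, ?_⟩
    · have h10 : (0 : ℝ) ≤ ((u ⬝ᵥ (w - v) : ℤ) : ℝ) := by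
        rw [hm]; exact mul_nonneg hθ (hl i).le
      have h11 : (0 : ℤ) ≤ u ⬝ᵥ (w - v) := by exact_mod_cast h10
      rcases h11.lt_or_eq with h | h
      · exact h
      · exfalso
        apply hyne
        rw [← h] at hm
        rw [← hθy, ← hm]; simp
    · apply toReal_injective
      rw [toReal_add, toReal_zsmul, hm, hei, hθy]

/-- Smooth polytopes are described by combinatorial data. -/
theorem IsSmooth.exists_isData {P : Set Spc} (hP : IsSmooth P) :
    ∃ T h, IsData T h ∧ P = poly T h := by
  classical
  obtain ⟨W, hWne, hPW, hloc⟩ := hP.exists_local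
  choose! t e hd hmin hedge using hloc
  set h : Lat → ℤ := fun u => W.inf' hWne fun w => u ⬝ᵥ w with hh
  have hle : ∀ u, ∀ w ∈ W, h u ≤ u ⬝ᵥ w := fun u w hw => Finset.inf'_le _ hw
  have htv : ∀ v ∈ W, ∀ u ∈ t v, h u = u ⬝ᵥ v := fun v hv u hu =>
    le_antisymm (hle u v hv) (Finset.le_inf' _ _ fun w hw => hmin v hv w hw u hu)
  have huni : ∀ v ∈ W, Unimodular (t v) := fun v hv => ⟨e v, hd v hv⟩
  have hvert : ∀ v ∈ W, vert h (t v) = v := fun v hv =>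
    (eq_vert (huni v hv) fun u hu => (htv v hv u hu).symm).symm
  -- A facet normal `u` found at `w` and tight at `v` is a nonnegative combination of `t v`. Any `x`
  -- occurring in it is constant on the facet of `u`, in particular along the edges of that facet at
  -- `w`, so `x` is an integral multiple of `u`; primitivity and the sign give `x = u`.
  have hstrict : ∀ v ∈ W, ∀ w ∈ W, ∀ u ∈ t w, u ⬝ᵥ v = h u → u ∈ t v := by
    intro v hv w hw u hu huv
    have hc : ∀ x ∈ t v, 0 ≤ u ⬝ᵥ e v x := by
      intro x hx
      obtain ⟨w', hw', m, hm, rfl⟩ := hedge v hv x hx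
      have := hle u _ hw'
      rw [dotProduct_add, dotProduct_smul, huv, smul_eq_mul] at this
      exact (mul_nonneg_iff_of_pos_left hm).mp (by linarith)
    have hex : ∃ x ∈ t v, 0 < u ⬝ᵥ e v x := by
      by_contra! hcon
      have : u = 0 := (hd v hv).ext_dual_int fun x hx => by
        rw [zero_dotProduct]; exact le_antisymm (hcon x hx) (hc x hx)
      have h1 := (hd w hw).dot_self hu
      rw [this] at h1; simp at h1
    obtain ⟨x, hx, hxpos⟩ := hex
    have hface : ∀ y ∈ W, u ⬝ᵥ y = h u → x ⬝ᵥ y = x ⬝ᵥ v := by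
      intro y hy hyu
      have h1 : ∑ z ∈ t v, (u ⬝ᵥ e v z) * (z ⬝ᵥ (y - v)) = 0 := by
        have h2 : u ⬝ᵥ (y - v) = ∑ z ∈ t v, (u ⬝ᵥ e v z) * (z ⬝ᵥ (y - v)) := by
          conv_lhs => rw [(hd v hv).expand_dual_int u, sum_dotProduct]
          exact Finset.sum_congr rfl fun z _ => by rw [smul_dotProduct, smul_eq_mul]
        rw [← h2, dotProduct_sub, hyu, huv, sub_self]
      have h3 := (Finset.sum_eq_zero_iff_of_nonneg fun z hz => mul_nonneg (hc z hz)
        (by rw [dotProduct_sub, sub_nonneg]; exact hmin v hv y hy z hz)).mp h1 x hx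
      have h4 := (mul_eq_zero.mp h3).resolve_left hxpos.ne'
      rw [dotProduct_sub] at h4; linarith
    have hwu : u ⬝ᵥ w = h u := (htv w hw u hu).symm
    have hxu : x = (x ⬝ᵥ e w u) • u := by
      apply (hd w hw).ext_dual_int
      intro z hz
      rw [smul_dotProduct]
      by_cases hzu : u = z
      · subst hzu; rw [(hd w hw).dot_self hz]; simp
      · rw [(hd w hw).dot_ne hu hz hzu, smul_zero]
        obtain ⟨w', hw', m, hm, rfl⟩ := hedge w hw z hz
        have h1 := hface _ hw' (by
          rw [dotProduct_add, dotProduct_smul, (hd w hw).dot_ne hu hz hzu, hwu]; simp)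
        have h2 := hface w hw hwu
        rw [dotProduct_add, dotProduct_smul, h2, smul_eq_mul] at h1
        have h3 : m * (x ⬝ᵥ e w z) = 0 := by linarith
        exact (mul_eq_zero.mp h3).resolve_left hm.ne'
    have h5 : (x ⬝ᵥ e w u) * (u ⬝ᵥ e v x) = 1 := by
      have h8 := congrArg (fun z => z ⬝ᵥ e v x) hxu
      simp only [smul_dotProduct, smul_eq_mul] at h8
      rw [← h8, (hd v hv).dot_self hx]
    have h6 : x ⬝ᵥ e w u = 1 := by
      rcases Int.eq_one_or_neg_one_of_mul_eq_one h5 with h | h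
      · exact h
      · rw [h] at h5; linarith
    rw [h6, one_smul] at hxu
    rw [← hxu]; exact hx
  have hD : IsData (W.image t) h := by
    refine ⟨hWne.image t, ?_, ?_, ?_⟩
    · intro s hs
      obtain ⟨v, hv, rfl⟩ := Finset.mem_image.mp hs
      exact huni v hv
    · intro s hs u hu hus
      obtain ⟨v, hv, rfl⟩ := Finset.mem_image.mp hs
      obtain ⟨s', hs', hus'⟩ := mem_rays.mp hu
      obtain ⟨w, hw, rfl⟩ := Finset.mem_image.mp hs'
      rw [hvert v hv]
      exact lt_of_le_of_ne (hle u v hv) fun heq => hus (hstrict v hv w hw u hus' heq.symm)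
    · intro s hs u hu
      obtain ⟨v, hv, rfl⟩ := Finset.mem_image.mp hs
      obtain ⟨w, hw, m, hm, hwe⟩ := hedge v hv u hu
      refine ⟨t w, Finset.mem_image_of_mem t hw, ?_, ?_⟩
      · intro heq
        have h1 : w = v := by rw [← hvert w hw, heq, hvert v hv]
        have h2 : u ⬝ᵥ w = u ⬝ᵥ v + m := by
          rw [hwe, dotProduct_add, dotProduct_smul, (hd v hv).dot_self hu]; simp
        rw [h1] at h2; omega
      · intro x hx
        obtain ⟨hxu, hx⟩ := Finset.mem_erase.mp hx
        refine hstrict w hw v hv x hx ?_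
        rw [hwe, dotProduct_add, dotProduct_smul, (hd v hv).dot_ne hx hu hxu, htv v hv x hx]
        simp
  refine ⟨W.image t, h, hD, ?_⟩
  rw [hPW, hD.poly_eq_convexHull, Finset.image_image]
  congr 2
  ext w
  simp only [Finset.coe_image, Set.mem_image, Finset.mem_coe, Function.comp]
  constructor
  · intro hw; exact ⟨w, hw, hvert w hw⟩
  · rintro ⟨v, hv, rfl⟩; rw [hvert v hv]; exact hv

/-! ### Stellar subdivisions and blow-ups -/

/-- The maximal cones of the stellar subdivision at the cone `σ` with new ray `p`. -/
def stel {α : Type*} [DecidableEq α] (T : Finset (Finset α)) (σ : Finset α) (p : α) :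
    Finset (Finset α) :=
  T.filter (fun t => ¬ σ ⊆ t) ∪
    (T.filter fun t => σ ⊆ t).biUnion fun t => σ.image fun u => insert p (t.erase u)

lemma mem_stel {α : Type*} [DecidableEq α] {T : Finset (Finset α)} {σ t : Finset α} {p : α} :
    t ∈ stel T σ p ↔ (t ∈ T ∧ ¬ σ ⊆ t) ∨ ∃ t₀ ∈ T, σ ⊆ t₀ ∧ ∃ u ∈ σ, t = insert p (t₀.erase u) := by
  simp only [stel, Finset.mem_union, Finset.mem_filter, Finset.mem_biUnion, Finset.mem_image,
    and_assoc]
  refine or_congr_right ⟨?_, ?_⟩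
  · rintro ⟨t₀, h1, h2, u, h3, rfl⟩; exact ⟨t₀, h1, h2, u, h3, rfl⟩
  · rintro ⟨t₀, h1, h2, u, h3, rfl⟩; exact ⟨t₀, h1, h2, u, h3, rfl⟩

/-- `stel` speaks of maximal cones only, whereas `stellarSubdivision` speaks of all cones by means
of star and closed star; the description of all faces given here connects the two. -/
lemma mem_cplx_stel {T : Finset (Finset Lat)} {σ s : Finset Lat} {p : Lat} :
    s ∈ cplx (stel T σ p) ↔ (s ∈ cplx T ∧ ¬ σ ⊆ s) ∨
      ∃ s₀, s = insert p s₀ ∧ ¬ σ ⊆ s₀ ∧ s₀ ∪ σ ∈ cplx T := by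
  constructor
  · intro hs
    obtain ⟨t, ht, hst⟩ := mem_cplx.mp hs
    rcases mem_stel.mp ht with ⟨ht, hσ⟩ | ⟨t₀, ht₀, hσ, u, hu, rfl⟩
    · exact Or.inl ⟨mem_cplx.mpr ⟨t, ht, hst⟩, fun h => hσ (h.trans hst)⟩
    · by_cases hp : p ∈ s
      · right
        have hsub : s.erase p ⊆ t₀.erase u := by
          intro x hx
          obtain ⟨hxp, hx⟩ := Finset.mem_erase.mp hx
          exact (Finset.mem_insert.mp (hst hx)).resolve_left hxp
        refine ⟨s.erase p, (Finset.insert_erase hp).symm, fun h => ?_, mem_cplx.mpr ⟨t₀, ht₀, ?_⟩⟩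
        · exact (Finset.mem_erase.mp (hsub (h hu))).1 rfl
        · exact Finset.union_subset (hsub.trans (Finset.erase_subset _ _)) hσ
      · left
        have hsub : s ⊆ t₀.erase u := fun x hx =>
          (Finset.mem_insert.mp (hst hx)).resolve_left fun h => hp (h ▸ hx)
        exact ⟨mem_cplx.mpr ⟨t₀, ht₀, hsub.trans (Finset.erase_subset _ _)⟩,
          fun h => (Finset.mem_erase.mp (hsub (h hu))).1 rfl⟩
  · rintro (⟨hs, hσ⟩ | ⟨s₀, rfl, hσ, hs⟩)
    · obtain ⟨t, ht, hst⟩ := mem_cplx.mp hs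
      by_cases hσt : σ ⊆ t
      · obtain ⟨u, hu, hus⟩ := Finset.not_subset.mp hσ
        refine mem_cplx.mpr ⟨_, mem_stel.mpr (Or.inr ⟨t, ht, hσt, u, hu, rfl⟩), fun x hx => ?_⟩
        exact Finset.mem_insert_of_mem (Finset.mem_erase.mpr ⟨fun h => hus (h ▸ hx), hst hx⟩)
      · exact mem_cplx.mpr ⟨t, mem_stel.mpr (Or.inl ⟨ht, hσt⟩), hst⟩
    · obtain ⟨t, ht, hst⟩ := mem_cplx.mp hs
      obtain ⟨u, hu, hus⟩ := Finset.not_subset.mp hσ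
      refine mem_cplx.mpr ⟨_, mem_stel.mpr (Or.inr ⟨t, ht,
        Finset.subset_union_right.trans hst, u, hu, rfl⟩), Finset.insert_subset_insert _ fun x hx =>
          Finset.mem_erase.mpr ⟨fun h => hus (h ▸ hx), hst (Finset.mem_union_left _ hx)⟩⟩

lemma IsDual.stel {t σ : Finset Lat} {e : Lat → Lat} (hd : IsDual t e) (hσ : σ ⊆ t) {u : Lat}
    (hu : u ∈ σ) : Unimodular (insert (∑ w ∈ σ, w) (t.erase u)) := by
  set p := ∑ w ∈ σ, w with hp
  have hpdot : ∀ x ∈ t, p ⬝ᵥ e x = if x ∈ σ then 1 else 0 := by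
    intro x hx
    rw [hp, sum_dotProduct, Finset.sum_congr rfl fun w hw => hd.dot w (hσ hw) x hx,
      Finset.sum_ite_eq' σ x]
  have hpn : p ∉ t.erase u := by
    intro h
    obtain ⟨h1, h2⟩ := Finset.mem_erase.mp h
    have h3 := hpdot u (hσ hu)
    rw [if_pos hu, hd.dot_ne h2 (hσ hu) h1] at h3
    omega
  -- When `p` replaces `u`, the vector `e u` becomes dual to `p`; it is subtracted from the dual
  -- vectors of the remaining elements of `σ`, since these pair to 1 with `p`.
  refine ⟨fun x => if x = p then e u else e x - (if x ∈ σ then 1 else 0 : ℤ) • e u, ?_, ?_⟩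
  · rw [Finset.card_insert_of_notMem hpn, Finset.card_erase_of_mem (hσ hu), hd.card]
  · intro x hx y hy
    have hxt : x ≠ p → x ∈ t ∧ x ≠ u := fun h =>
      ⟨Finset.mem_of_mem_erase ((Finset.mem_insert.mp hx).resolve_left h),
        Finset.ne_of_mem_erase ((Finset.mem_insert.mp hx).resolve_left h)⟩
    have hyt : y ≠ p → y ∈ t ∧ y ≠ u := fun h =>
      ⟨Finset.mem_of_mem_erase ((Finset.mem_insert.mp hy).resolve_left h),
        Finset.ne_of_mem_erase ((Finset.mem_insert.mp hy).resolve_left h)⟩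
    by_cases hyp : y = p
    · rw [if_pos hyp, hyp]
      by_cases hxp : x = p
      · rw [hxp, hpdot u (hσ hu), if_pos hu]; simp
      · rw [if_neg hxp, hd.dot_ne (hxt hxp).1 (hσ hu) (hxt hxp).2]
    · rw [if_neg hyp, dotProduct_sub, dotProduct_smul]
      by_cases hxp : x = p
      · rw [hxp, if_neg (Ne.symm hyp), hpdot y (hyt hyp).1, hpdot u (hσ hu), if_pos hu]
        simp
      · rw [hd.dot_ne (hxt hxp).1 (hσ hu) (hxt hxp).2, hd.dot x (hxt hxp).1 y (hyt hyp).1]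
        simp

namespace IsData
variable {T : Finset (Finset Lat)} {h : Lat → ℤ}

lemma congr {h' : Lat → ℤ} (hD : IsData T h) (he : ∀ u ∈ rays T, h u = h' u) : IsData T h' := by
  refine ⟨hD.nonempty, hD.uni, fun t ht u hu hut => ?_, hD.closed⟩
  have : vert h' t = vert h t :=
    (eq_vert (hD.uni t ht) fun w hw => by
      rw [dot_vert (hD.uni t ht) hw, he w (mem_rays.mpr ⟨t, ht, hw⟩)]).symm
  rw [this, ← he u hu]
  exact hD.lt t ht u hu hut

lemma unimodular_stel (hD : IsData T h) {σ t : Finset Lat} (ht : t ∈ stel T σ (∑ u ∈ σ, u)) :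
    Unimodular t := by
  rcases mem_stel.mp ht with ⟨ht, -⟩ | ⟨t₀, ht₀, hσ, u, hu, rfl⟩
  · exact hD.uni t ht
  · exact (hD.isDual ht₀).stel hσ hu

lemma rays_stel (T : Finset (Finset Lat)) {σ : Finset Lat} {p : Lat} (hσ : σ ∈ cplx T)
    (h2 : 2 ≤ σ.card) : rays (stel T σ p) = insert p (rays T) := by
  ext x
  rw [Finset.mem_insert]
  constructor
  · intro hx
    obtain ⟨t, ht, hxt⟩ := mem_rays.mp hx
    rcases mem_stel.mp ht with ⟨ht, -⟩ | ⟨t₀, ht₀, -, u, -, rfl⟩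
    · exact Or.inr (mem_rays.mpr ⟨t, ht, hxt⟩)
    · rcases Finset.mem_insert.mp hxt with h | h
      · exact Or.inl h
      · exact Or.inr (mem_rays.mpr ⟨t₀, ht₀, Finset.mem_of_mem_erase h⟩)
  · rintro (rfl | hx)
    · obtain ⟨t, ht, hσt⟩ := mem_cplx.mp hσ
      obtain ⟨u, hu⟩ := Finset.card_pos.mp (by omega : 0 < σ.card)
      exact mem_rays.mpr ⟨_, mem_stel.mpr (Or.inr ⟨t, ht, hσt, u, hu, rfl⟩),
        Finset.mem_insert_self _ _⟩
    · obtain ⟨t, ht, hxt⟩ := mem_rays.mp hx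
      by_cases hσt : σ ⊆ t
      · obtain ⟨u, hu, hux⟩ := Finset.exists_mem_ne (by omega : 1 < σ.card) x
        exact mem_rays.mpr ⟨_, mem_stel.mpr (Or.inr ⟨t, ht, hσt, u, hu, rfl⟩),
          Finset.mem_insert_of_mem (Finset.mem_erase.mpr ⟨hux.symm, hxt⟩)⟩
      · exact mem_rays.mpr ⟨t, mem_stel.mpr (Or.inl ⟨ht, hσt⟩), hxt⟩

/-- At a vertex of the face of `σ` the sum `p` takes the value `∑ h u`, so strict convexity would
give `h p < ∑ h u` for a ray `p`. At a vertex on the facet of `p` the summands give the opposite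
inequality. -/
lemma sum_notMem_rays (hD : IsData T h) {σ : Finset Lat} (hσ : σ ∈ cplx T) (h2 : 2 ≤ σ.card) :
    ∑ u ∈ σ, u ∉ rays T := by
  intro hp
  obtain ⟨t, ht, hσt⟩ := mem_cplx.mp hσ
  obtain ⟨t', ht', hpt'⟩ := mem_rays.mp hp
  have hd := hD.isDual ht
  have hpdot : ∀ x ∈ σ, (∑ u ∈ σ, u) ⬝ᵥ dualv t x = 1 := by
    intro x hx
    rw [sum_dotProduct, Finset.sum_congr rfl fun w hw => hd.dot w (hσt hw) x (hσt hx),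
      Finset.sum_ite_eq' σ x, if_pos hx]
  have hpt : ∑ u ∈ σ, u ∉ t := by
    intro h
    obtain ⟨x, hx, hxne⟩ := Finset.exists_mem_ne (by omega : 1 < σ.card) (∑ u ∈ σ, u)
    have := hpdot x hx
    rw [hd.dot_ne h (hσt hx) hxne.symm] at this
    omega
  have h3 := hD.lt t ht _ hp hpt
  have h4 : (∑ u ∈ σ, u) ⬝ᵥ vert h t = ∑ u ∈ σ, h u := by
    rw [sum_dotProduct]
    exact Finset.sum_congr rfl fun w hw => hD.dot ht (hσt hw)
  have h5 : ∑ u ∈ σ, h u ≤ (∑ u ∈ σ, u) ⬝ᵥ vert h t' := by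
    rw [sum_dotProduct]
    exact Finset.sum_le_sum fun w hw => hD.le ht' (mem_rays.mpr ⟨t, ht, hσt hw⟩)
  rw [hD.dot ht' hpt'] at h5
  omega

lemma cone_insert (p : Lat) (s : Finset Lat) :
    cone (insert p s) = PointedCone.hull ℝ {toReal p} ⊔ cone s := by
  simp [cone, Set.image_insert_eq, Submodule.span_insert, PointedCone.hull]

lemma stellarSubdivision_eq (hD : IsData T h) {σ : Finset Lat} (hσ : σ ∈ cplx T) :
    stellarSubdivision (normalFan (poly T h)) (cone σ) (toReal (∑ u ∈ σ, u)) =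
      cone '' (cplx (stel T σ (∑ u ∈ σ, u)) : Set (Finset Lat)) := by
  have hstar : ∀ s ∈ cplx T, (cone s ∈ star (normalFan (poly T h)) (cone σ) ↔ σ ⊆ s) := by
    intro s hs
    rw [← cone_isFaceOf_iff (hD.primitive hσ) (hD.primitive hs)]
    refine ⟨fun h => h.2, fun h => ⟨?_, h⟩⟩
    rw [hD.normalFan_eq]; exact ⟨s, hs, rfl⟩
  have hclosed : ∀ s ∈ cplx T, (cone s ∈ closedStar (normalFan (poly T h)) (cone σ) ↔
      s ∪ σ ∈ cplx T) := by
    intro s hs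
    constructor
    · rintro ⟨-, τ', hτ', hf⟩
      obtain ⟨s', hs', rfl⟩ := hD.normalFan_eq ▸ hτ'.1
      have h1 := (hstar s' hs').mp hτ'
      rw [cone_isFaceOf_iff (hD.primitive hs) (hD.primitive hs')] at hf
      obtain ⟨t, ht, hst⟩ := mem_cplx.mp hs'
      exact mem_cplx.mpr ⟨t, ht, (Finset.union_subset hf h1).trans hst⟩
    · intro hu
      refine ⟨by rw [hD.normalFan_eq]; exact ⟨s, hs, rfl⟩, cone (s ∪ σ),
        (hstar _ hu).mpr Finset.subset_union_right, ?_⟩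
      rw [cone_isFaceOf_iff (hD.primitive hs) (hD.primitive hu)]
      exact Finset.subset_union_left
  have hmono : ∀ {s s'}, s ⊆ s' → s' ∈ cplx T → s ∈ cplx T := by
    intro s s' hss hs'
    obtain ⟨t, ht, hst⟩ := mem_cplx.mp hs'
    exact mem_cplx.mpr ⟨t, ht, hss.trans hst⟩
  ext τ
  constructor
  · rintro (⟨hτ, hn⟩ | ⟨τ', ⟨hτ', hn⟩, rfl⟩)
    · obtain ⟨s, hs, rfl⟩ := hD.normalFan_eq ▸ hτ
      exact ⟨s, mem_cplx_stel.mpr (Or.inl ⟨hs, fun h => hn ((hstar s hs).mpr h)⟩), rfl⟩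
    · obtain ⟨s, hs, rfl⟩ := hD.normalFan_eq ▸ hτ'.1
      refine ⟨insert (∑ u ∈ σ, u) s, mem_cplx_stel.mpr (Or.inr ⟨s, rfl,
        fun h => hn ((hstar s hs).mpr h), (hclosed s hs).mp hτ'⟩), cone_insert _ _⟩
  · rintro ⟨s, hs, rfl⟩
    rcases mem_cplx_stel.mp hs with ⟨hs, hn⟩ | ⟨s₀, rfl, hn, hs⟩
    · left
      refine ⟨by rw [hD.normalFan_eq]; exact ⟨s, hs, rfl⟩, fun h => hn ((hstar s hs).mp h)⟩
    · right
      have hs₀ := hmono Finset.subset_union_left hs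
      exact ⟨cone s₀, ⟨(hclosed s₀ hs₀).mpr hs, fun h => hn ((hstar s₀ hs₀).mp h)⟩,
        (cone_insert _ _).symm⟩

lemma eq_filter_cplx (hc : ∀ t ∈ T, t.card = 3) : T = (cplx T).filter fun s => s.card = 3 := by
  ext t
  rw [Finset.mem_filter]
  constructor
  · intro ht; exact ⟨mem_cplx.mpr ⟨t, ht, le_rfl⟩, hc t ht⟩
  · rintro ⟨hs, h3⟩
    obtain ⟨t', ht', hst⟩ := mem_cplx.mp hs
    rwa [Finset.eq_of_subset_of_card_le hst (by rw [hc t' ht', h3])]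

/-- No facet inequality is redundant. If `h' u < h u`, integrality leaves a gap of at least 1, and a
vertex of the facet `u` can be pushed outwards by `1/N` along `dualv t u` without violating any
inequality for `h'`, where `N` dominates all pairings of rays with that vector. -/
lemma height_eq_of_poly_eq (hD : IsData T h) {h' : Lat → ℤ} (he : poly T h = poly T h') :
    ∀ u ∈ rays T, h u = h' u := by
  have hle : ∀ u ∈ rays T, h' u ≤ h u := by
    intro u hu
    obtain ⟨t, ht, hut⟩ := mem_rays.mp hu
    have := hD.vert_mem ht
    rw [he] at this
    have := this u hu
    rw [toReal_dot, hD.dot ht hut] at this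
    exact_mod_cast this
  intro u hu
  by_contra hne
  have hlt : h' u + 1 ≤ h u := by have := hle u hu; omega
  obtain ⟨t, ht, hut⟩ := mem_rays.mp hu
  have hd := hD.isDual ht
  set N : ℤ := 1 + ∑ w ∈ rays T, |w ⬝ᵥ dualv t u| with hN
  have hNw : ∀ w ∈ rays T, |w ⬝ᵥ dualv t u| ≤ N := fun w hw => by
    have := Finset.single_le_sum (f := fun w => |w ⬝ᵥ dualv t u|) (fun w _ => abs_nonneg _) hw
    have h0 : |w ⬝ᵥ dualv t u| ≤ ∑ w ∈ rays T, |w ⬝ᵥ dualv t u| := this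
    linarith
  have hN1 : 1 ≤ N := by
    have : 0 ≤ ∑ w ∈ rays T, |w ⬝ᵥ dualv t u| := Finset.sum_nonneg fun w _ => abs_nonneg _
    omega
  have hNpos : (0 : ℝ) < N := by exact_mod_cast hN1
  have hy : toReal (vert h t) - (N : ℝ)⁻¹ • toReal (dualv t u) ∈ poly T h' := by
    intro w hw
    rw [dotProduct_sub, dotProduct_smul, toReal_dot, toReal_dot, smul_eq_mul]
    have h1 : (N : ℝ)⁻¹ * ((w ⬝ᵥ dualv t u : ℤ) : ℝ) ≤ 1 := by
      rw [inv_mul_le_iff₀ hNpos, mul_one]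
      exact_mod_cast (le_abs_self _).trans (hNw w hw)
    by_cases hwt : w ∈ t
    · by_cases hwu : w = u
      · subst hwu
        rw [hD.dot ht hwt, hd.dot_self hwt]
        have : (N : ℝ)⁻¹ ≤ 1 := inv_le_one_of_one_le₀ (by exact_mod_cast hN1)
        have h2 : ((h' w : ℤ) : ℝ) + 1 ≤ h w := by exact_mod_cast hlt
        push_cast; linarith
      · rw [hD.dot ht hwt, hd.dot_ne hwt hut hwu]
        have : ((h' w : ℤ) : ℝ) ≤ h w := by exact_mod_cast hle w hw
        push_cast; linarith
    · have h3 : h' w + 1 ≤ w ⬝ᵥ vert h t := by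
        have := hD.lt t ht w hw hwt
        have := hle w hw
        omega
      have h4 : ((h' w : ℤ) : ℝ) + 1 ≤ ((w ⬝ᵥ vert h t : ℤ) : ℝ) := by exact_mod_cast h3
      linarith
  rw [← he] at hy
  have := hy u hu
  rw [dotProduct_sub, dotProduct_smul, toReal_dot, toReal_dot, hD.dot ht hut, hd.dot_self hut] at this
  have h5 : (0 : ℝ) < (N : ℝ)⁻¹ := inv_pos.mpr hNpos
  simp only [smul_eq_mul] at this
  push_cast at this
  linarith

/-- The support function after the blow-up along the face of `σ` at level `k`. -/
def _root_.SmoothPolytope.blowHeight (h : Lat → ℤ) (σ : Finset Lat) (k : ℕ) : Lat → ℤ :=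
  Function.update h (∑ u ∈ σ, u) (∑ u ∈ σ, h u + k)

lemma poly_stel_eq (hD : IsData T h) {σ : Finset Lat} (hσ : σ ∈ cplx T) (h2 : 2 ≤ σ.card) (k : ℕ) :
    poly (stel T σ (∑ u ∈ σ, u)) (blowHeight h σ k) = {y ∈ poly T h | ∀ z ∈ faceOf T h σ,
      toReal (∑ u ∈ σ, u) ⬝ᵥ z + k ≤ toReal (∑ u ∈ σ, u) ⬝ᵥ y} := by
  have hp := hD.sum_notMem_rays hσ h2
  have hF : ∀ z ∈ faceOf T h σ, toReal (∑ u ∈ σ, u) ⬝ᵥ z = ((∑ u ∈ σ, h u : ℤ) : ℝ) := by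
    intro z hz
    rw [toReal_sum, sum_dotProduct, Finset.sum_congr rfl fun u hu => hz.2 u hu]
    push_cast; rfl
  obtain ⟨t, ht, hσt⟩ := mem_cplx.mp hσ
  have hne := hD.vert_mem_faceOf ht hσt
  ext y
  constructor
  · intro hy
    refine ⟨fun u hu => ?_, fun z hz => ?_⟩
    · have := hy u (by rw [rays_stel T hσ h2]; exact Finset.mem_insert_of_mem hu)
      rwa [blowHeight, Function.update_of_ne (fun hup : u = ∑ w ∈ σ, w => hp (hup ▸ hu))] at this
    · have := hy _ (by rw [rays_stel T hσ h2]; exact Finset.mem_insert_self _ _)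
      rw [blowHeight, Function.update_self] at this
      rw [hF z hz]
      push_cast at this ⊢
      exact this
  · rintro ⟨hy, hy2⟩ u hu
    rw [rays_stel T hσ h2] at hu
    rcases Finset.mem_insert.mp hu with rfl | hu
    · rw [blowHeight, Function.update_self]
      have := hy2 _ hne
      rw [hF _ hne] at this
      push_cast at this ⊢
      exact this
    · rw [blowHeight, Function.update_of_ne (fun hup : u = ∑ w ∈ σ, w => hp (hup ▸ hu))]
      exact hy u hu

/-- `cone` is injective on primitive sets, so equal fans have equal complexes, and the maximal cones
are their three-element members. -/
lemma eq_stel_of_normalFan_eq (hD : IsData T h) {σ : Finset Lat} {T' : Finset (Finset Lat)}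
    {h' : Lat → ℤ} (hD' : IsData T' h')
    (he : normalFan (poly T' h') = cone '' (cplx (stel T σ (∑ u ∈ σ, u)) : Set (Finset Lat))) :
    T' = stel T σ (∑ u ∈ σ, u) := by
  have hprim : ∀ s ∈ cplx (stel T σ (∑ u ∈ σ, u)), Primitive s := by
    intro s hs
    obtain ⟨t, ht, hst⟩ := mem_cplx.mp hs
    exact ⟨t, hD.unimodular_stel ht, hst⟩
  rw [hD'.normalFan_eq] at he
  have hc : cplx T' = cplx (stel T σ (∑ u ∈ σ, u)) := by
    ext s
    constructor
    · intro hs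
      have : cone s ∈ cone '' (cplx (stel T σ (∑ u ∈ σ, u)) : Set (Finset Lat)) := by
        rw [← he]; exact ⟨s, hs, rfl⟩
      obtain ⟨s', hs', hss⟩ := this
      rwa [cone_injective (hD'.primitive hs) (hprim s' hs') hss.symm]
    · intro hs
      have : cone s ∈ cone '' (cplx T' : Set (Finset Lat)) := by
        rw [he]; exact ⟨s, hs, rfl⟩
      obtain ⟨s', hs', hss⟩ := this
      rwa [cone_injective (hprim s hs) (hD'.primitive hs') hss.symm]
  rw [eq_filter_cplx (T := T') fun t ht => hD'.card ht,
    eq_filter_cplx (T := stel T σ (∑ u ∈ σ, u)) fun t ht => (hD.unimodular_stel ht).isDual.card, hc]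

/-- The combinatorial description of a blow-up. -/
theorem exists_of_isBlowUp (hD : IsData T h) {F B : Set Spc} {k : ℕ}
    (hB : IsBlowUp (poly T h) F k B) :
    ∃ σ ∈ cplx T, 2 ≤ σ.card ∧ 1 ≤ k ∧ F = faceOf T h σ ∧
      IsData (stel T σ (∑ u ∈ σ, u)) (blowHeight h σ k) ∧
      B = poly (stel T σ (∑ u ∈ σ, u)) (blowHeight h σ k) := by
  obtain ⟨-, hF, hk, hBs, r, x, hr, hx, hBeq, hfan⟩ := hB
  obtain ⟨t, ht, σ, hσt, rfl⟩ := hD.isFace_iff.mp hF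
  have hσ : σ ∈ cplx T := mem_cplx.mpr ⟨t, ht, hσt⟩
  rw [hD.normalCone_faceOf ht hσt] at hx hfan
  obtain ⟨hsum, hcard⟩ := hx.sum_eq (hD.primitive hσ)
  rw [hsum] at hBeq hfan
  rw [hcard] at hr
  rw [← hD.poly_stel_eq hσ hr k] at hBeq
  -- Smoothness of the blow-up supplies some data for it; equality of fans identifies `T'` with the
  -- subdivision, and equality of polytopes identifies `h'` with `blowHeight` on the rays.
  obtain ⟨T', h', hD', rfl⟩ := hBs.exists_isData
  rw [hD.stellarSubdivision_eq hσ] at hfan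
  have hT := hD.eq_stel_of_normalFan_eq hD' hfan
  subst hT
  exact ⟨σ, hσ, hr, hk, rfl, hD'.congr (hD'.height_eq_of_poly_eq hBeq), hBeq⟩

theorem isBlowUp (hD : IsData T h) {σ : Finset Lat} (hσ : σ ∈ cplx T) (h2 : 2 ≤ σ.card) {k : ℕ}
    (hk : 1 ≤ k) (hD' : IsData (stel T σ (∑ u ∈ σ, u)) (blowHeight h σ k)) :
    IsBlowUp (poly T h) (faceOf T h σ) k (poly (stel T σ (∑ u ∈ σ, u)) (blowHeight h σ k)) := by
  obtain ⟨t, ht, hσt⟩ := mem_cplx.mp hσ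
  obtain ⟨x, hx, hsum⟩ := exists_isUnimodularGenerators (hD.primitive hσ)
  refine ⟨hD.isSmooth, hD.isFace_faceOf ht hσt, hk, hD'.isSmooth, σ.card, x, h2, ?_, ?_, ?_⟩
  · rw [hD.normalCone_faceOf ht hσt]; exact hx
  · rw [hsum, hD.poly_stel_eq hσ h2]
  · rw [hsum, hD.normalCone_faceOf ht hσt, hD.stellarSubdivision_eq hσ, hD'.normalFan_eq]

lemma eq_of_faceOf_eq_singleton (hD : IsData T h) {σ : Finset Lat} (hσ : σ ∈ cplx T) {v : Spc}
    (he : {v} = faceOf T h σ) : σ ∈ T ∧ v = toReal (vert h σ) := by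
  obtain ⟨t, ht, hσt⟩ := mem_cplx.mp hσ
  have h1 := hD.vert_mem_faceOf ht hσt
  rw [← he] at h1
  have h2 : σ = t := by
    apply hD.faceOf_injective hσ (mem_cplx.mpr ⟨t, ht, le_rfl⟩)
    rw [hD.faceOf_self ht, ← he, h1]
  subst h2
  exact ⟨ht, h1.symm⟩

end IsData

/-! ### Degrees, labels and relabelling -/

section Combinatorial
variable {α β : Type*} [DecidableEq α] [DecidableEq β]

/-- The number of triangles of `T` at the vertex `u`. -/
def deg (T : Finset (Finset α)) (u : α) : ℕ := (T.filter fun t => u ∈ t).card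

/-- The number of edges at the vertex `u`. -/
def edgeDeg (T : Finset (Finset α)) (u : α) : ℕ :=
  ((cplx T).filter fun s => s.card = 2 ∧ u ∈ s).card

/-- The number of vertices with `m` edges. -/
def lab (T : Finset (Finset α)) (m : ℕ) : ℕ := ((rays T).filter fun u => edgeDeg T u = m).card

/-- The image of a simplicial complex under a map of the vertices. -/
def relabel (f : α → β) (T : Finset (Finset α)) : Finset (Finset β) := T.image fun t => t.image f

lemma mem_relabel {f : α → β} {T : Finset (Finset α)} {s : Finset β} :
    s ∈ relabel f T ↔ ∃ t ∈ T, t.image f = s := by simp [relabel]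

lemma rays_relabel (f : α → β) (T : Finset (Finset α)) :
    rays (relabel f T) = (rays T).image f := by
  ext x
  simp only [mem_rays, mem_relabel, Finset.mem_image]
  constructor
  · rintro ⟨_, ⟨t, ht, rfl⟩, hx⟩
    obtain ⟨y, hy, rfl⟩ := Finset.mem_image.mp hx
    exact ⟨y, ⟨t, ht, hy⟩, rfl⟩
  · rintro ⟨y, ⟨t, ht, hy⟩, rfl⟩
    exact ⟨_, ⟨t, ht, rfl⟩, Finset.mem_image_of_mem _ hy⟩

lemma cplx_relabel (f : α → β) (T : Finset (Finset α)) :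
    cplx (relabel f T) = (cplx T).image fun t => t.image f := by
  ext s
  simp only [mem_cplx, mem_relabel, Finset.mem_image]
  constructor
  · rintro ⟨_, ⟨t, ht, rfl⟩, hs⟩
    obtain ⟨s', hs', rfl⟩ := Finset.subset_image_iff.mp hs
    exact ⟨s', ⟨t, ht, by exact_mod_cast hs'⟩, rfl⟩
  · rintro ⟨s', ⟨t, ht, hs⟩, rfl⟩
    exact ⟨_, ⟨t, ht, rfl⟩, Finset.image_subset_image hs⟩

lemma relabel_relabel {γ : Type*} [DecidableEq γ] (g : β → γ) (f : α → β) (T : Finset (Finset α)) :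
    relabel g (relabel f T) = relabel (g ∘ f) T := by
  simp only [relabel, Finset.image_image, Function.comp_def]

variable {f : α → β}

lemma card_relabel (hf : Function.Injective f) (T : Finset (Finset α)) : (relabel f T).card = T.card :=
  Finset.card_image_of_injective _ (Finset.image_injective hf)

lemma deg_relabel (hf : Function.Injective f) (T : Finset (Finset α)) (u : α) :
    deg (relabel f T) (f u) = deg T u := by
  rw [deg, relabel, Finset.filter_image, Finset.card_image_of_injective _ (Finset.image_injective hf),
    deg]
  congr 1
  ext t
  simp [hf.eq_iff]

lemma edgeDeg_relabel (hf : Function.Injective f) (T : Finset (Finset α)) (u : α) :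
    edgeDeg (relabel f T) (f u) = edgeDeg T u := by
  rw [edgeDeg, cplx_relabel, Finset.filter_image,
    Finset.card_image_of_injective _ (Finset.image_injective hf), edgeDeg]
  congr 1
  ext t
  simp [hf.eq_iff, Finset.card_image_of_injective _ hf]

lemma lab_relabel (hf : Function.Injective f) (T : Finset (Finset α)) (m : ℕ) : lab (relabel f T) m = lab T m := by
  rw [lab, rays_relabel, Finset.filter_image, Finset.card_image_of_injective _ hf, lab]
  simp only [edgeDeg_relabel hf]

lemma stel_relabel (hf : Function.Injective f) (T : Finset (Finset α)) (σ : Finset α) (p : α) :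
    stel (relabel f T) (σ.image f) (f p) = relabel f (stel T σ p) := by
  have hsub : ∀ t : Finset α, σ.image f ⊆ t.image f ↔ σ ⊆ t := fun t =>
    Finset.image_subset_image_iff hf
  have hi : ∀ (t : Finset α) u, insert (f p) ((t.image f).erase (f u)) =
      (insert p (t.erase u)).image f := fun t u => by
    rw [Finset.image_insert, Finset.image_erase hf]
  ext s
  rw [mem_stel, mem_relabel (T := stel T σ p)]
  simp only [mem_stel]
  constructor
  · rintro (⟨hs, hσ⟩ | ⟨t₀, ht₀, hσ, u, hu, rfl⟩)
    · obtain ⟨t, ht, rfl⟩ := mem_relabel.mp hs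
      exact ⟨t, Or.inl ⟨ht, fun h => hσ ((hsub t).mpr h)⟩, rfl⟩
    · obtain ⟨t, ht, rfl⟩ := mem_relabel.mp ht₀
      obtain ⟨w, hw, rfl⟩ := Finset.mem_image.mp hu
      exact ⟨_, Or.inr ⟨t, ht, (hsub t).mp hσ, w, hw, rfl⟩, (hi t w).symm⟩
  · rintro ⟨t, (⟨ht, hσ⟩ | ⟨t₀, ht₀, hσ, u, hu, rfl⟩), rfl⟩
    · exact Or.inl ⟨mem_relabel.mpr ⟨t, ht, rfl⟩, fun h => hσ ((hsub t).mp h)⟩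
    · exact Or.inr ⟨_, mem_relabel.mpr ⟨t₀, ht₀, rfl⟩, (hsub t₀).mpr hσ, f u,
        Finset.mem_image_of_mem _ hu, (hi t₀ u).symm⟩

end Combinatorial

namespace IsData
variable {T : Finset (Finset Lat)} {h : Lat → ℤ}

/-- Since `cone` is injective on the complex and preserves dimension and faces, the rays and
two-dimensional cones in `label` correspond to one- and two-element members of `cplx T`. -/
lemma label_eq (hD : IsData T h) (m : ℕ) : label (poly T h) m = lab T m := by
  have hinj : Set.InjOn cone (cplx T : Set (Finset Lat)) := fun s hs s' hs' he =>
    cone_injective (hD.primitive hs) (hD.primitive hs') he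
  have h2 : ∀ u ∈ rays T, {τ ∈ normalFan (poly T h) | coneDim τ = 2 ∧
      (cone {u}).IsFaceOf τ}.ncard = edgeDeg T u := by
    intro u hu
    obtain ⟨t, ht, hut⟩ := mem_rays.mp hu
    have hsu : {u} ∈ cplx T := mem_cplx.mpr ⟨t, ht, Finset.singleton_subset_iff.mpr hut⟩
    rw [edgeDeg, ← Set.ncard_coe_finset, ← Set.InjOn.ncard_image (f := cone)]
    · congr 1
      ext τ
      rw [hD.normalFan_eq]
      simp only [Set.mem_ofPred_eq, Set.mem_image, Finset.mem_coe, Finset.coe_filter]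
      constructor
      · rintro ⟨⟨s, hs, rfl⟩, hd, hf⟩
        rw [coneDim_cone (hD.primitive hs)] at hd
        rw [cone_isFaceOf_iff (hD.primitive hsu) (hD.primitive hs)] at hf
        exact ⟨s, ⟨hs, hd, Finset.singleton_subset_iff.mp hf⟩, rfl⟩
      · rintro ⟨s, ⟨hs, hd, hf⟩, rfl⟩
        refine ⟨⟨s, hs, rfl⟩, ?_, ?_⟩
        · rwa [coneDim_cone (hD.primitive hs)]
        · rw [cone_isFaceOf_iff (hD.primitive hsu) (hD.primitive hs)]
          exact Finset.singleton_subset_iff.mpr hf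
    · exact hinj.mono fun s hs => (Finset.mem_filter.mp hs).1
  have hcp : ∀ u ∈ rays T, {u} ∈ cplx T := fun u hu => by
    obtain ⟨t, ht, hut⟩ := mem_rays.mp hu
    exact mem_cplx.mpr ⟨t, ht, Finset.singleton_subset_iff.mpr hut⟩
  rw [label, lab, ← Set.ncard_coe_finset, ← Set.InjOn.ncard_image (f := fun u => cone {u})]
  · congr 1
    ext ρ
    simp only [Set.mem_ofPred_eq, Set.mem_image, Finset.coe_filter]
    constructor
    · rintro ⟨hρ, hd, hm⟩
      have hρ' := hρ
      rw [hD.normalFan_eq] at hρ'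
      obtain ⟨s, hs, rfl⟩ := hρ'
      rw [coneDim_cone (hD.primitive hs), Finset.card_eq_one] at hd
      obtain ⟨u, rfl⟩ := hd
      have hu : u ∈ rays T := by
        obtain ⟨t, ht, hut⟩ := mem_cplx.mp hs
        exact mem_rays.mpr ⟨t, ht, Finset.singleton_subset_iff.mp hut⟩
      exact ⟨u, ⟨hu, by rw [← h2 u hu, hm]⟩, rfl⟩
    · rintro ⟨u, ⟨hu, hm⟩, rfl⟩
      refine ⟨by rw [hD.normalFan_eq]; exact ⟨_, hcp u hu, rfl⟩, ?_, by rw [h2 u hu, hm]⟩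
      rw [coneDim_cone (hD.primitive (hcp u hu)), Finset.card_singleton]
  · intro u hu u' hu' he
    have := hinj (hcp u (Finset.mem_filter.mp hu).1) (hcp u' (Finset.mem_filter.mp hu').1) he
    exact Finset.singleton_injective this

end IsData

/-! ### Transport along lattice isomorphisms -/

/-- The adjoint of an additive endomorphism of the lattice. -/
def adjoint (B : Lat →+ Lat) : Lat →+ Lat where
  toFun u := fun i => u ⬝ᵥ B (Pi.single i 1)
  map_zero' := by ext i; simp
  map_add' u v := by ext i; simp [add_dotProduct]

lemma adjoint_dot (B : Lat →+ Lat) (u z : Lat) : adjoint B u ⬝ᵥ z = u ⬝ᵥ B z := by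
  have hz : z = ∑ i, z i • (Pi.single i 1 : Lat) := by
    ext j; simp [Finset.sum_apply, Pi.single_apply]
  conv_rhs => rw [hz, map_sum, dotProduct_sum]
  simp only [dotProduct, adjoint, AddMonoidHom.coe_mk, ZeroHom.coe_mk, map_zsmul]
  refine Finset.sum_congr rfl fun i _ => ?_
  rw [Finset.sum_mul]
  refine Finset.sum_congr rfl fun j _ => ?_
  simp only [Pi.smul_apply, smul_eq_mul]
  ring

lemma eq_of_dot_eq {u v : Lat} (h : ∀ z : Lat, u ⬝ᵥ z = v ⬝ᵥ z) : u = v := by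
  ext i
  simpa using h (Pi.single i 1)

/-- The lattice translation by `c` after the linear automorphism `B`, together with the
contragredient `A` of `B`. -/
structure LatIso where
  A : Lat ≃+ Lat
  B : Lat ≃+ Lat
  c : Lat
  dot : ∀ u y, A u ⬝ᵥ B y = u ⬝ᵥ y

/-- The linear part of `φ` restricts to an automorphism `B` of the lattice; normals move by its
inverse transpose `A`, which is integral because `B` is invertible over the integers. The
translation `c` is the image of the origin. -/
lemma exists_latIso {φ : Spc ≃ᵃ[ℝ] Spc} (hφ : φ '' latticePoints 3 = latticePoints 3) :
    ∃ g : LatIso, (∀ z, φ (toReal z) = toReal (g.B z + g.c)) ∧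
      ∀ u y, toReal (g.A u) ⬝ᵥ φ y = toReal u ⬝ᵥ y + toReal (g.A u) ⬝ᵥ toReal g.c := by
  have hmem : ∀ z : Lat, ∃ w : Lat, toReal w = φ (toReal z) := fun z => by
    have : φ (toReal z) ∈ latticePoints 3 := hφ ▸ ⟨_, ⟨z, rfl⟩, rfl⟩
    exact this
  choose f hf using hmem
  have hlin : ∀ y, φ y = φ.linear y + toReal (f 0) := fun y => by
    have := φ.map_vadd 0 y
    rw [hf 0, toReal_zero]
    simpa using this
  have hB : ∀ z, toReal (f z - f 0) = φ.linear (toReal z) := fun z => by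
    rw [toReal_sub, hf z, hlin]; simp
  let B₀ : Lat →+ Lat := AddMonoidHom.mk' (fun z => f z - f 0) fun y z => toReal_injective <| by
    rw [toReal_add, hB, hB, hB, toReal_add, map_add]
  have hbij : Function.Bijective B₀ := by
    constructor
    · intro y z h
      have : φ.linear (toReal y) = φ.linear (toReal z) := by
        rw [← hB, ← hB]; exact congrArg toReal h
      exact toReal_injective (φ.linear.injective this)
    · intro z
      have : toReal (z + f 0) ∈ φ '' latticePoints 3 := by rw [hφ]; exact ⟨_, rfl⟩
      obtain ⟨_, ⟨y, rfl⟩, hy⟩ := this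
      refine ⟨y, toReal_injective ?_⟩
      have h1 : toReal (f y) = toReal (z + f 0) := by rw [hf, hy]
      change toReal (f y - f 0) = _
      rw [toReal_injective h1, add_sub_cancel_right]
  let B : Lat ≃+ Lat := AddEquiv.ofBijective B₀ hbij
  let A : Lat ≃+ Lat :=
    { toFun := adjoint B.symm
      invFun := adjoint B
      left_inv := fun u => eq_of_dot_eq fun z => by
        rw [adjoint_dot, adjoint_dot]; simp
      right_inv := fun u => eq_of_dot_eq fun z => by
        rw [adjoint_dot, adjoint_dot]; simp
      map_add' := map_add _ }
  have hAB : ∀ u y, A u ⬝ᵥ B y = u ⬝ᵥ y := fun u y => by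
    change adjoint B.symm u ⬝ᵥ B y = _
    rw [adjoint_dot]; simp
  refine ⟨⟨A, B, f 0, hAB⟩, fun z => ?_, fun u y => ?_⟩
  · change _ = toReal (f z - f 0 + f 0)
    rw [sub_add_cancel, hf]
  · change toReal (A u) ⬝ᵥ φ y = _ + toReal (A u) ⬝ᵥ toReal (f 0)
    rw [hlin, dotProduct_add]
    congr 1
    have hy : y = ∑ i, y i • toReal (Pi.single i 1 : Lat) := by
      ext j; simp [Finset.sum_apply, toReal, Pi.single_apply]
    have hBe : ∀ i, φ.linear (toReal (Pi.single i 1 : Lat)) = toReal (B (Pi.single i 1)) :=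
      fun i => (hB _).symm
    conv_lhs => rw [hy, map_sum, dotProduct_sum]
    conv_rhs => rw [hy, dotProduct_sum]
    refine Finset.sum_congr rfl fun i _ => ?_
    rw [map_smul, dotProduct_smul, dotProduct_smul, hBe, toReal_dot, toReal_dot, hAB]

namespace LatIso
variable (g : LatIso)

/-- The support function of the image polytope. -/
def height (h : Lat → ℤ) : Lat → ℤ := fun w => h (g.A.symm w) + w ⬝ᵥ g.c

lemma height_apply (h : Lat → ℤ) (u : Lat) : g.height h (g.A u) = h u + g.A u ⬝ᵥ g.c := by
  simp [height]

lemma unimodular {t : Finset Lat} (ht : Unimodular t) : Unimodular (t.image g.A) := by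
  obtain ⟨e, he⟩ := ht
  refine ⟨fun w => g.B (e (g.A.symm w)), ?_, ?_⟩
  · rw [Finset.card_image_of_injective _ g.A.injective, he.card]
  · intro u hu w hw
    obtain ⟨u, hu', rfl⟩ := Finset.mem_image.mp hu
    obtain ⟨w, hw', rfl⟩ := Finset.mem_image.mp hw
    simp only [AddEquiv.symm_apply_apply, g.dot, EmbeddingLike.apply_eq_iff_eq]
    exact he.dot u hu' w hw'

lemma vert_image {h : Lat → ℤ} {t : Finset Lat} (ht : Unimodular t) :
    vert (g.height h) (t.image g.A) = g.B (vert h t) + g.c := by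
  refine (eq_vert (g.unimodular ht) fun u hu => ?_).symm
  obtain ⟨u, hu', rfl⟩ := Finset.mem_image.mp hu
  rw [dotProduct_add, g.dot, dot_vert ht hu', height_apply]

lemma isData {T : Finset (Finset Lat)} {h : Lat → ℤ} (hD : IsData T h) :
    IsData (relabel g.A T) (g.height h) where
  nonempty := hD.nonempty.image _
  uni := by
    intro t ht
    obtain ⟨t, ht', rfl⟩ := mem_relabel.mp ht
    exact g.unimodular (hD.uni t ht')
  lt := by
    intro t ht u hu hut
    obtain ⟨t, ht', rfl⟩ := mem_relabel.mp ht
    rw [rays_relabel] at hu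
    obtain ⟨u, hu', rfl⟩ := Finset.mem_image.mp hu
    rw [g.vert_image (hD.uni t ht'), height_apply, dotProduct_add, g.dot]
    have := hD.lt t ht' u hu' fun h => hut (Finset.mem_image_of_mem _ h)
    linarith
  closed := by
    intro t ht u hu
    obtain ⟨t, ht', rfl⟩ := mem_relabel.mp ht
    obtain ⟨u, hu', rfl⟩ := Finset.mem_image.mp hu
    obtain ⟨t₁, ht₁, hne, hsub⟩ := hD.closed t ht' u hu'
    refine ⟨_, mem_relabel.mpr ⟨t₁, ht₁, rfl⟩, fun h => hne ?_, ?_⟩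
    · exact Finset.image_injective g.A.injective h
    · rw [← Finset.image_erase g.A.injective]
      exact Finset.image_subset_image hsub

lemma height_blowHeight (h : Lat → ℤ) (σ : Finset Lat) (k : ℕ) :
    g.height (blowHeight h σ k) = blowHeight (g.height h) (σ.image g.A) k := by
  have hsum : ∑ w ∈ σ.image g.A, w = g.A (∑ w ∈ σ, w) := by
    rw [Finset.sum_image fun x _ y _ h => g.A.injective h, map_sum]
  ext w
  obtain ⟨u, rfl⟩ := g.A.surjective w
  rw [height_apply]
  by_cases hu : u = ∑ w ∈ σ, w
  · rw [blowHeight, blowHeight, hsum, hu, Function.update_self, Function.update_self,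
      Finset.sum_image fun x _ y _ h => g.A.injective h]
    simp only [height_apply, Finset.sum_add_distrib]
    rw [map_sum, sum_dotProduct]
    ring
  · rw [blowHeight, blowHeight, hsum, Function.update_of_ne hu,
      Function.update_of_ne fun h => hu (g.A.injective h), height_apply]

end LatIso

lemma image_poly {φ : Spc ≃ᵃ[ℝ] Spc} {g : LatIso}
    (hg : ∀ u y, toReal (g.A u) ⬝ᵥ φ y = toReal u ⬝ᵥ y + toReal (g.A u) ⬝ᵥ toReal g.c)
    (T : Finset (Finset Lat)) (h : Lat → ℤ) :
    φ '' poly T h = poly (relabel g.A T) (g.height h) := by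
  have key : ∀ y, φ y ∈ poly (relabel g.A T) (g.height h) ↔ y ∈ poly T h := by
    intro y
    simp only [poly, rays_relabel, Finset.mem_image, Set.mem_ofPred_eq, forall_exists_index, and_imp,
      forall_apply_eq_imp_iff₂]
    refine forall₂_congr fun u _ => ?_
    rw [hg, g.height_apply, toReal_dot]
    push_cast
    exact add_le_add_iff_right _
  ext z
  constructor
  · rintro ⟨y, hy, rfl⟩
    exact (key y).mpr hy
  · intro hz
    refine ⟨φ.symm z, (key _).mp ?_, by simp⟩
    simpa using hz

lemma Iso.refl {d : ℕ} (P : Set (Fin d → ℝ)) : Iso P P :=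
  ⟨AffineEquiv.refl ℝ _, by simp, by simp⟩

lemma Iso.symm {d : ℕ} {P Q : Set (Fin d → ℝ)} (h : Iso P Q) : Iso Q P := by
  obtain ⟨φ, hφ, rfl⟩ := h
  refine ⟨φ.symm, ?_, ?_⟩
  · conv_lhs => rw [← hφ]
    rw [← Set.image_comp]; simp
  · rw [← Set.image_comp]; simp

lemma Iso.trans {d : ℕ} {P Q R : Set (Fin d → ℝ)} (h : Iso P Q) (h' : Iso Q R) : Iso P R := by
  obtain ⟨φ, hφ, rfl⟩ := h
  obtain ⟨ψ, hψ, rfl⟩ := h'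
  refine ⟨φ.trans ψ, ?_, ?_⟩
  · rw [AffineEquiv.coe_trans, Set.image_comp, hφ, hψ]
  · rw [AffineEquiv.coe_trans, Set.image_comp]

lemma Iso.exists_data {P Q : Set Spc} (hi : Iso P Q) : ∃ g : LatIso, ∃ φ : Spc ≃ᵃ[ℝ] Spc,
    φ '' P = Q ∧ φ '' latticePoints 3 = latticePoints 3 ∧
    ∀ T h, φ '' poly T h = poly (relabel g.A T) (g.height h) := by
  obtain ⟨φ, hφ, rfl⟩ := hi
  obtain ⟨g, -, hg⟩ := exists_latIso hφ
  exact ⟨g, φ, rfl, hφ, image_poly hg⟩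

lemma isBlowUp_image {φ : Spc ≃ᵃ[ℝ] Spc} {g : LatIso}
    (hφ : ∀ T h, φ '' poly T h = poly (relabel g.A T) (g.height h)) {P F Q : Set Spc} {k : ℕ}
    (hb : IsBlowUp P F k Q) : ∃ F', IsBlowUp (φ '' P) F' k (φ '' Q) := by
  obtain ⟨T, h, hD, rfl⟩ := hb.1.exists_isData
  obtain ⟨σ, hσ, h2, hk, -, hD', rfl⟩ := hD.exists_of_isBlowUp hb
  have hDg := g.isData hD
  have hDg' := g.isData hD'
  have hsum : ∑ w ∈ σ.image g.A, w = g.A (∑ w ∈ σ, w) := by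
    rw [Finset.sum_image fun x _ y _ h => g.A.injective h, map_sum]
  rw [← stel_relabel g.A.injective, ← hsum, g.height_blowHeight] at hDg'
  rw [hφ, hφ, ← stel_relabel g.A.injective, ← hsum, g.height_blowHeight]
  refine ⟨_, hDg.isBlowUp ?_ ?_ hk hDg'⟩
  · rw [cplx_relabel]; exact Finset.mem_image_of_mem _ hσ
  · rwa [Finset.card_image_of_injective _ g.A.injective]

lemma label_image {φ : Spc ≃ᵃ[ℝ] Spc} {g : LatIso}
    (hφ : ∀ T h, φ '' poly T h = poly (relabel g.A T) (g.height h)) {P : Set Spc}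
    (hP : IsSmooth P) : IsSmooth (φ '' P) ∧ label (φ '' P) = label P := by
  obtain ⟨T, h, hD, rfl⟩ := hP.exists_isData
  rw [hφ]
  refine ⟨(g.isData hD).isSmooth, ?_⟩
  ext m
  rw [(g.isData hD).label_eq, hD.label_eq, lab_relabel g.A.injective]

lemma Iso.label_eq {P Q : Set Spc} (hi : Iso P Q) (hP : IsSmooth P) : label P = label Q := by
  obtain ⟨g, φ, rfl, -, hφ⟩ := hi.exists_data
  exact (label_image hφ hP).2.symm

theorem IsFurther.of_iso {P Q : Set Spc} (hi : Iso P Q) (hP : IsFurther P) : IsFurther Q := by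
  obtain ⟨hs, hc, ⟨R, hR, hl, hch⟩, h1, h2, h3, h4⟩ := hP
  have hi' := hi.symm
  refine ⟨?_, ?_, ?_, fun ⟨k, hk, h⟩ => h1 ⟨k, hk, hi.trans h⟩,
    fun ⟨s, i, j, k, hs, ha, hb, hc, h⟩ => h2 ⟨s, i, j, k, hs, ha, hb, hc, hi.trans h⟩,
    fun ⟨s, P₀, P₁, hs, ha, hb, hc, h⟩ => h3 ⟨s, P₀, P₁, hs, ha, hb, hc, hi.trans h⟩, ?_⟩
  · obtain ⟨g, φ, rfl, -, hφ⟩ := hi.exists_data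
    exact (label_image hφ hs).1
  · obtain ⟨g, φ, rfl, hl, hφ⟩ := hi.exists_data
    rwa [← hl, ← Set.image_inter φ.injective, φ.injective.encard_image]
  · obtain ⟨g, φ, rfl, -, hφ⟩ := hi.exists_data
    refine ⟨φ '' R, (label_image hφ hR).1, ?_, ?_⟩
    · rwa [(label_image hφ hR).2]
    · refine Relation.TransGen.lift (fun S : Set Spc => φ '' S) ?_ _ _ hch
      rintro A B ⟨F, k, hb⟩
      obtain ⟨F', h'⟩ := isBlowUp_image hφ hb
      exact ⟨F', k, h'⟩
  · rwa [← hi.label_eq hs]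

/-! ### Counting lattice points face by face -/

/-- The lattice point `z` lies in `poly T h`. -/
def InPoly (T : Finset (Finset Lat)) (h : Lat → ℤ) (z : Lat) : Prop := ∀ u ∈ rays T, h u ≤ u ⬝ᵥ z

lemma toReal_mem_poly {T : Finset (Finset Lat)} {h : Lat → ℤ} {z : Lat} :
    toReal z ∈ poly T h ↔ InPoly T h z := by
  refine forall₂_congr fun u _ => ?_
  rw [toReal_dot]
  exact_mod_cast Iff.rfl

/-- The facets containing the lattice point `z`. -/
def tight (T : Finset (Finset Lat)) (h : Lat → ℤ) (z : Lat) : Finset Lat :=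
  (rays T).filter fun u => u ⬝ᵥ z = h u

/-- `poly T h` has at most `N` lattice points. -/
def Small (T : Finset (Finset Lat)) (h : Lat → ℤ) (N : ℕ) : Prop :=
  ∀ X : Finset Lat, (∀ z ∈ X, InPoly T h z) → X.card ≤ N

lemma small_of_encard_le {T : Finset (Finset Lat)} {h : Lat → ℤ} {N : ℕ}
    (hN : (poly T h ∩ latticePoints 3).encard ≤ N) : Small T h N := by
  intro X hX
  have hsub : toReal '' (X : Set Lat) ⊆ poly T h ∩ latticePoints 3 := by
    rintro _ ⟨z, hz, rfl⟩
    exact ⟨toReal_mem_poly.mpr (hX z hz), z, rfl⟩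
  have := (Set.encard_le_encard hsub).trans hN
  rw [toReal_injective.encard_image, Set.encard_coe_eq_coe_finsetCard] at this
  exact_mod_cast this

namespace IsData
variable {T : Finset (Finset Lat)} {h : Lat → ℤ}

lemma inPoly_vert (hD : IsData T h) {t : Finset Lat} (ht : t ∈ T) : InPoly T h (vert h t) :=
  fun _ hu => hD.le ht hu

lemma mem_rays (_hD : IsData T h) {t : Finset Lat} (ht : t ∈ T) {u : Lat} (hu : u ∈ t) :
    u ∈ rays T := SmoothPolytope.mem_rays.mpr ⟨t, ht, hu⟩

lemma tight_vert (hD : IsData T h) {t : Finset Lat} (ht : t ∈ T) : tight T h (vert h t) = t := by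
  ext u
  rw [tight, Finset.mem_filter]
  exact ⟨fun ⟨hu, he⟩ => hD.mem_of_eq ht hu he, fun hu => ⟨hD.mem_rays ht hu, hD.dot ht hu⟩⟩

/-- Lattice points that are not vertices are counted separately for each face. -/
lemma card_add_sum_le (hD : IsData T h) {N : ℕ} (hs : Small T h N) (K : Finset (Finset Lat))
    (X : Finset Lat → Finset Lat) (hK : ∀ s ∈ K, s.card ≠ 3)
    (hX : ∀ s ∈ K, ∀ z ∈ X s, InPoly T h z ∧ tight T h z = s) :
    T.card + ∑ s ∈ K, (X s).card ≤ N := by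
  have h1 : (T.image (vert h)).card = T.card :=
    Finset.card_image_of_injOn fun t ht t' ht' he => hD.vert_injOn ht ht' he
  -- The tight set of a point names the face whose relative interior contains it, so the families
  -- for different faces are disjoint.
  have h2 : (K.biUnion X).card = ∑ s ∈ K, (X s).card := by
    refine Finset.card_biUnion fun s hs s' hs' hne => Finset.disjoint_left.mpr fun z hz hz' => ?_
    exact hne ((hX s hs z hz).2.symm.trans (hX s' hs' z hz').2)
  have h3 : Disjoint (T.image (vert h)) (K.biUnion X) := by
    refine Finset.disjoint_left.mpr fun z hz hz' => ?_
    obtain ⟨t, ht, rfl⟩ := Finset.mem_image.mp hz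
    obtain ⟨s, hs, hz'⟩ := Finset.mem_biUnion.mp hz'
    have := (hX s hs _ hz').2
    rw [hD.tight_vert ht] at this
    exact hK s hs (this ▸ hD.card ht)
  have := hs (T.image (vert h) ∪ K.biUnion X) fun z hz => ?_
  · rwa [Finset.card_union_of_disjoint h3, h1, h2] at this
  · rcases Finset.mem_union.mp hz with hz | hz
    · obtain ⟨t, ht, rfl⟩ := Finset.mem_image.mp hz
      exact hD.inPoly_vert ht
    · obtain ⟨s, hs, hz⟩ := Finset.mem_biUnion.mp hz
      exact (hX s hs z hz).1

/-- The version of `card_add_sum_le` with one point for each face. -/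
lemma card_add_card_le (hD : IsData T h) {N : ℕ} (hs : Small T h N) (K : Finset (Finset Lat))
    (hK : ∀ s ∈ K, s.card ≠ 3) (hX : ∀ s ∈ K, ∃ z, InPoly T h z ∧ tight T h z = s) :
    T.card + K.card ≤ N := by
  choose! f hf using hX
  have := hD.card_add_sum_le hs K (fun s => {f s}) hK fun s hs z hz => by
    rw [Finset.mem_singleton.mp hz]; exact hf s hs
  simpa using this

/-- Slack functions in the coordinates at a vertex. -/
lemma slack_eq (hD : IsData T h) {t : Finset Lat} (ht : t ∈ T) (w z : Lat) :
    w ⬝ᵥ z - h w = (w ⬝ᵥ vert h t - h w) + ∑ u ∈ t, (u ⬝ᵥ z - h u) * (w ⬝ᵥ dualv t u) := by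
  have h1 := (hD.isDual ht).expand_primal_int (z - vert h t)
  have h2 := congrArg (w ⬝ᵥ ·) h1
  simp only [dotProduct_sub, dotProduct_sum, dotProduct_smul, smul_eq_mul] at h2
  rw [Finset.sum_congr rfl fun u hu => by rw [hD.dot ht hu]] at h2
  linarith

lemma slack_nonneg (hD : IsData T h) {t : Finset Lat} (ht : t ∈ T) {u : Lat} (hu : u ∈ rays T) :
    0 ≤ u ⬝ᵥ vert h t - h u := sub_nonneg.mpr (hD.le ht hu)

lemma slack_pos (hD : IsData T h) {t : Finset Lat} (ht : t ∈ T) {u : Lat} (hu : u ∈ rays T)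
    (hut : u ∉ t) : 1 ≤ u ⬝ᵥ vert h t - h u := by
  have := hD.lt t ht u hu hut
  omega

lemma eq_of_slack_eq (hD : IsData T h) {t : Finset Lat} (ht : t ∈ T) {y z : Lat}
    (he : ∀ u ∈ t, u ⬝ᵥ y = u ⬝ᵥ z) : y = z := (hD.isDual ht).ext_primal_int he

/-- A vertex does not lie strictly between two other vertices. -/
lemma eq_of_between (hD : IsData T h) {t₁ t₂ t₃ : Finset Lat} (h1 : t₁ ∈ T) (h2 : t₂ ∈ T)
    (h3 : t₃ ∈ T) {m n : ℤ} (hm : 0 < m) (hn : 0 < n)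
    (he : (m + n) • vert h t₂ = m • vert h t₁ + n • vert h t₃) : t₁ = t₂ := by
  have hsub : t₂ ⊆ t₁ := by
    intro w hw
    have hwr := hD.mem_rays h2 hw
    have := congrArg (w ⬝ᵥ ·) he
    simp only [dotProduct_add, dotProduct_smul, smul_eq_mul, hD.dot h2 hw] at this
    refine hD.mem_of_eq h1 hwr ?_
    have a1 := hD.le h1 hwr
    have a3 := hD.le h3 hwr
    nlinarith
  exact (Finset.eq_of_subset_of_card_le hsub (by rw [hD.card h1, hD.card h2])).symm

/-- On a line in a facet there are at most two vertices. -/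
lemma card_line_le (hD : IsData T h) {u a b : Lat}
    (hsep : ∀ y z : Lat, u ⬝ᵥ y = u ⬝ᵥ z → a ⬝ᵥ y = a ⬝ᵥ z → b ⬝ᵥ y = b ⬝ᵥ z → y = z) (k : ℤ) :
    (T.filter fun t => u ∈ t ∧ a ⬝ᵥ vert h t - h a = k).card ≤ 2 := by
  set S := T.filter fun t => u ∈ t ∧ a ⬝ᵥ vert h t - h a = k with hS
  have hmem : ∀ t ∈ S, t ∈ T ∧ u ⬝ᵥ vert h t = h u ∧ a ⬝ᵥ vert h t = k + h a := fun t ht => by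
    obtain ⟨h1, h2, h3⟩ := Finset.mem_filter.mp ht
    exact ⟨h1, hD.dot h1 h2, by linarith⟩
  have key : ∀ t₁ ∈ S, ∀ t₂ ∈ S, ∀ t₃ ∈ S, b ⬝ᵥ vert h t₁ < b ⬝ᵥ vert h t₂ →
      b ⬝ᵥ vert h t₂ < b ⬝ᵥ vert h t₃ → False := by
    intro t₁ h1 t₂ h2 t₃ h3 h12 h23
    obtain ⟨h1, hu1, ha1⟩ := hmem t₁ h1
    obtain ⟨h2, hu2, ha2⟩ := hmem t₂ h2
    obtain ⟨h3, hu3, ha3⟩ := hmem t₃ h3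
    have := hD.eq_of_between h1 h2 h3 (m := b ⬝ᵥ vert h t₃ - b ⬝ᵥ vert h t₂)
      (n := b ⬝ᵥ vert h t₂ - b ⬝ᵥ vert h t₁) (by omega) (by omega) ?_
    · rw [this] at h12; exact lt_irrefl _ h12
    · apply hsep <;> simp only [dotProduct_add, dotProduct_smul, smul_eq_mul]
      · rw [hu1, hu2, hu3]; ring
      · rw [ha1, ha2, ha3]; ring
      · ring
  have inj : ∀ t₁ ∈ S, ∀ t₂ ∈ S, t₁ ≠ t₂ → b ⬝ᵥ vert h t₁ ≠ b ⬝ᵥ vert h t₂ := by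
    intro t₁ h1 t₂ h2 hne he
    obtain ⟨h1, hu1, ha1⟩ := hmem t₁ h1
    obtain ⟨h2, hu2, ha2⟩ := hmem t₂ h2
    exact hne (hD.vert_injOn h1 h2 (hsep _ _ (by rw [hu1, hu2]) (by rw [ha1, ha2]) he))
  by_contra hc
  obtain ⟨t₁, t₂, t₃, h1, h2, h3, h12, h13, h23⟩ := Finset.two_lt_card_iff.mp (not_le.mp hc)
  rcases lt_or_gt_of_ne (inj t₁ h1 t₂ h2 h12) with c1 | c1 <;>
  rcases lt_or_gt_of_ne (inj t₁ h1 t₃ h3 h13) with c2 | c2 <;>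
  rcases lt_or_gt_of_ne (inj t₂ h2 t₃ h3 h23) with c3 | c3
  · exact key t₁ h1 t₂ h2 t₃ h3 c1 c3
  · exact key t₁ h1 t₃ h3 t₂ h2 c2 c3
  · exact key t₁ h1 t₂ h2 t₃ h3 c1 c3
  · exact key t₃ h3 t₁ h1 t₂ h2 c2 c1
  · exact key t₂ h2 t₁ h1 t₃ h3 c1 c2
  · exact key t₂ h2 t₁ h1 t₃ h3 c1 (by omega)
  · exact key t₂ h2 t₃ h3 t₁ h1 c3 c2
  · exact key t₃ h3 t₂ h2 t₁ h1 c3 c1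

lemma card_collinear_le (hD : IsData T h) {t₀ : Finset Lat} (ht₀ : t₀ ∈ T) {u a b : Lat}
    (h0 : t₀ = {u, a, b}) (k : ℤ) :
    (T.filter fun t => u ∈ t ∧ a ⬝ᵥ vert h t - h a = k).card ≤ 2 := by
  refine hD.card_line_le (b := b) (fun y z h1 h2 h3 => hD.eq_of_slack_eq ht₀ fun w hw => ?_) k
  rw [h0] at hw
  simp only [Finset.mem_insert, Finset.mem_singleton] at hw
  rcases hw with rfl | rfl | rfl
  exacts [h1, h2, h3]

/-- Every slack is positive at the sum of the two facet edge directions at a corner of a facet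
with at least five corners. -/
lemma corner_slack_pos (hD : IsData T h) {t : Finset Lat} (ht : t ∈ T) {u a b : Lat}
    (h0 : t = {u, a, b}) (hdeg : 5 ≤ deg T u) {w : Lat} (hw : w ∈ rays T) (hwt : w ∉ t) :
    1 ≤ (w ⬝ᵥ vert h t - h w) + w ⬝ᵥ dualv t a + w ⬝ᵥ dualv t b := by
  have hne : u ≠ a ∧ u ≠ b ∧ a ≠ b := by
    have hc := hD.card ht
    rw [h0] at hc
    refine ⟨?_, ?_, ?_⟩ <;> rintro rfl
    · have := Finset.card_le_two (a := u) (b := b); simp at hc; omega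
    · have := Finset.card_le_two (a := u) (b := a)
      rw [Finset.pair_comm a u, Finset.insert_eq_of_mem (by simp)] at hc; omega
    · have := Finset.card_le_two (a := u) (b := a); simp at hc; omega
  obtain ⟨hua, hub, hab⟩ := hne
  have hut : u ∈ t := by simp [h0]
  have hat : a ∈ t := by simp [h0]
  have hbt : b ∈ t := by simp [h0]
  have hh0 : t = {u, b, a} := by rw [h0]; ext; simp; tauto
  set r := w ⬝ᵥ vert h t - h w with hr
  set p := w ⬝ᵥ dualv t a with hp
  set q := w ⬝ᵥ dualv t b with hq
  have hr1 : 1 ≤ r := hD.slack_pos ht hw hwt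
  -- In the coordinates `X`, `Y` at the corner, the facet of `w` cuts the plane of `u` in the half
  -- plane `r + X p + Y q ≥ 0`, and the assumption says that `(1, 1)` is not strictly inside it.
  -- This confines the corners of the facet `u` to so few places that there are at most four of
  -- them.
  by_contra! hlt
  let X : Finset Lat → ℤ := fun t' => a ⬝ᵥ vert h t' - h a
  let Y : Finset Lat → ℤ := fun t' => b ⬝ᵥ vert h t' - h b
  have hXY : ∀ t' ∈ T, u ∈ t' → 0 ≤ X t' ∧ 0 ≤ Y t' ∧ 0 ≤ r + X t' * p + Y t' * q := by
    intro t' ht' hut'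
    refine ⟨hD.slack_nonneg ht' (hD.mem_rays ht hat), hD.slack_nonneg ht' (hD.mem_rays ht hbt), ?_⟩
    have h1 := hD.slack_nonneg ht' hw
    rw [hD.slack_eq ht, h0, Finset.sum_insert (by simp [hua, hub]), Finset.sum_insert (by simp [hab]),
      Finset.sum_singleton, hD.dot ht' hut', ← h0] at h1
    simpa [add_assoc] using h1
  have hXk : ∀ k : ℤ, (T.filter fun t' => u ∈ t' ∧ X t' = k).card ≤ 2 := hD.card_collinear_le ht h0
  have hYk : ∀ k : ℤ, (T.filter fun t' => u ∈ t' ∧ Y t' = k).card ≤ 2 := hD.card_collinear_le ht hh0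
  have nbr : ∀ c ∈ t, c ≠ u → ∃ t' ∈ T, u ∈ t' ∧ (∀ d ∈ t, d ≠ c → d ∈ t') ∧ c ∉ t' := by
    intro c hc hcu
    obtain ⟨c', hc', hT⟩ := hD.exists_nbr ht hc
    refine ⟨_, hT, ?_, fun d hd hdc => ?_, ?_⟩
    · exact Finset.mem_insert_of_mem (Finset.mem_erase.mpr ⟨hcu.symm, hut⟩)
    · exact Finset.mem_insert_of_mem (Finset.mem_erase.mpr ⟨hdc, hd⟩)
    · simp only [Finset.mem_insert, Finset.mem_erase, ne_eq, not_true_eq_false, false_and, or_false]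
      rintro rfl; exact hc' hc
  obtain ⟨ta, hta, huta, hta', hata⟩ := nbr a hat hua.symm
  obtain ⟨tb, htb, hutb, htb', hbtb⟩ := nbr b hbt hub.symm
  have hYa : Y ta = 0 := sub_eq_zero.mpr (hD.dot hta (hta' b hbt hab.symm))
  have hXa : 1 ≤ X ta := hD.slack_pos hta (hD.mem_rays ht hat) hata
  have hXb : X tb = 0 := sub_eq_zero.mpr (hD.dot htb (htb' a hat hab))
  have hYb : 1 ≤ Y tb := hD.slack_pos htb (hD.mem_rays ht hbt) hbtb
  have ha := (hXY ta hta huta).2.2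
  have hb := (hXY tb htb hutb).2.2
  rw [hYa] at ha
  rw [hXb] at hb
  -- Two lines carry at most four corners, while the facet has five. This settles the cases where
  -- `p` and `q` are not both negative: the adjacent corner on an axis then forces one coefficient
  -- to be 0 and the other to be `-r`.
  have hsplit : ∀ Z : Finset Lat → ℤ, (∀ k, (T.filter fun t' => u ∈ t' ∧ Z t' = k).card ≤ 2) →
      ¬ ∀ t' ∈ T, u ∈ t' → Z t' = 0 ∨ Z t' = 1 := by
    intro Z hZ hall
    have : (T.filter fun t' => u ∈ t') ⊆ (T.filter fun t' => u ∈ t' ∧ Z t' = 0) ∪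
        (T.filter fun t' => u ∈ t' ∧ Z t' = 1) := by
      intro t' ht'
      obtain ⟨h1, h2⟩ := Finset.mem_filter.mp ht'
      rcases hall t' h1 h2 with h3 | h3 <;> simp [h1, h2, h3]
    have h1 := (Finset.card_le_card this).trans (Finset.card_union_le _ _)
    have h2 := hZ 0
    have h3 := hZ 1
    rw [deg] at hdeg
    omega
  rcases le_or_gt 0 p with hp0 | hp0
  · have hq0 : q < 0 := by linarith
    have hpq : p = 0 := by nlinarith
    have hrq : r + q = 0 := by nlinarith
    refine hsplit Y hYk fun t' ht' hut' => ?_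
    obtain ⟨-, h2, h3⟩ := hXY t' ht' hut'
    have : Y t' ≤ 1 := by rw [hpq] at h3; nlinarith
    omega
  · rcases le_or_gt 0 q with hq0 | hq0
    · have hpq : q = 0 := by nlinarith
      have hrq : r + p = 0 := by nlinarith
      refine hsplit X hXk fun t' ht' hut' => ?_
      obtain ⟨h2, -, h3⟩ := hXY t' ht' hut'
      have : X t' ≤ 1 := by rw [hpq] at h3; nlinarith
      omega
    -- With both coefficients negative, a corner with positive coordinates can only be `(1, 1)`. The
    -- two axes carry at most three corners in all, as they share `t`, so there are at most four
    -- corners.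
    · have hcase : ∀ t' ∈ T, u ∈ t' → X t' = 0 ∨ Y t' = 0 ∨ (X t' = 1 ∧ Y t' = 1) := by
        intro t' ht' hut'
        obtain ⟨h1, h2, h3⟩ := hXY t' ht' hut'
        by_contra! hcon
        obtain ⟨c1, c2, c3⟩ := hcon
        have d1 : 1 ≤ X t' := by omega
        have d2 : 1 ≤ Y t' := by omega
        rcases eq_or_lt_of_le d1 with e1 | e1
        · have : 2 ≤ Y t' := by
            have := c3 e1.symm
            omega
          nlinarith
        · nlinarith
      have hsub : (T.filter fun t' => u ∈ t') ⊆ (T.filter fun t' => u ∈ t' ∧ X t' = 0) ∪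
          ((T.filter fun t' => u ∈ t' ∧ Y t' = 0).erase t ∪
            (T.filter fun t' => u ∈ t' ∧ X t' = 1 ∧ Y t' = 1)) := by
        intro t' ht'
        obtain ⟨h1, h2⟩ := Finset.mem_filter.mp ht'
        by_cases hX0 : X t' = 0
        · simp [h1, h2, hX0]
        · rcases hcase t' h1 h2 with h3 | h3 | h3
          · exact absurd h3 hX0
          · have : t' ≠ t := by
              rintro rfl
              exact hX0 (sub_eq_zero.mpr (hD.dot h1 hat))
            simp [h1, h2, h3, this]
          · simp [h1, h2, h3]
      have c1 := (Finset.card_le_card hsub).trans (Finset.card_union_le _ _)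
      have c2 := Finset.card_union_le ((T.filter fun t' => u ∈ t' ∧ Y t' = 0).erase t)
            (T.filter fun t' => u ∈ t' ∧ X t' = 1 ∧ Y t' = 1)
      have htm : t ∈ T.filter fun t' => u ∈ t' ∧ Y t' = 0 := by
        simp only [Finset.mem_filter]
        exact ⟨ht, hut, sub_eq_zero.mpr (hD.dot ht hbt)⟩
      rw [Finset.card_erase_of_mem htm] at c2
      have c3 : (T.filter fun t' => u ∈ t' ∧ X t' = 1 ∧ Y t' = 1).card ≤ 1 := by
        rw [Finset.card_le_one]
        intro t₁ h1 t₂ h2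
        obtain ⟨g1, hu1, hx1, hy1⟩ := Finset.mem_filter.mp h1
        obtain ⟨g2, hu2, hx2, hy2⟩ := Finset.mem_filter.mp h2
        refine hD.vert_injOn g1 g2 (hD.eq_of_slack_eq ht fun d hd => ?_)
        rw [h0] at hd
        simp only [Finset.mem_insert, Finset.mem_singleton] at hd
        simp only [X, Y] at hx1 hx2 hy1 hy2
        rcases hd with rfl | rfl | rfl
        · rw [hD.dot g1 hu1, hD.dot g2 hu2]
        · linarith
        · linarith
      have c4 := hXk 0
      have c5 := hYk 0
      rw [deg] at hdeg
      omega

/-- The lattice point of the facet `u` next to its corner `t`. -/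
noncomputable def _root_.SmoothPolytope.inner (h : Lat → ℤ) (t : Finset Lat) (u : Lat) : Lat :=
  vert h t + ∑ w ∈ t.erase u, dualv t w

/-- The point `inner h t u` has slack 0 over `u`, slack 1 over the two facets that meet `u` at the
corner, and positive slack over all others by `corner_slack_pos`. -/
theorem tight_inner (hD : IsData T h) {t : Finset Lat} (ht : t ∈ T) {u : Lat} (hu : u ∈ t)
    (hdeg : 5 ≤ deg T u) : InPoly T h (inner h t u) ∧ tight T h (inner h t u) = {u} := by
  obtain ⟨a, b, hab, he⟩ : ∃ a b, a ≠ b ∧ t.erase u = {a, b} := by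
    have : (t.erase u).card = 2 := by rw [Finset.card_erase_of_mem hu, hD.card ht]
    exact Finset.card_eq_two.mp this
  have h0 : t = {u, a, b} := by rw [← Finset.insert_erase hu, he]
  have ha : a ∈ t.erase u := by simp [he]
  have hb : b ∈ t.erase u := by simp [he]
  have hdual := hD.isDual ht
  have hval : ∀ w, w ⬝ᵥ inner h t u - h w =
      (w ⬝ᵥ vert h t - h w) + w ⬝ᵥ dualv t a + w ⬝ᵥ dualv t b := fun w => by
    rw [inner, he, Finset.sum_pair hab, dotProduct_add, dotProduct_add]; ring
  have hpos : ∀ w ∈ rays T, w ≠ u → 1 ≤ w ⬝ᵥ inner h t u - h w := by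
    intro w hw hwu
    rw [hval]
    by_cases hwt : w ∈ t
    · have hwe : w ∈ t.erase u := Finset.mem_erase.mpr ⟨hwu, hwt⟩
      rw [he] at hwe
      simp only [Finset.mem_insert, Finset.mem_singleton] at hwe
      rw [hD.dot ht hwt]
      rcases hwe with rfl | rfl
      · rw [hdual.dot_self hwt, hdual.dot_ne hwt (Finset.mem_of_mem_erase hb) hab]; simp
      · rw [hdual.dot_self hwt, hdual.dot_ne hwt (Finset.mem_of_mem_erase ha) hab.symm]; simp
    · exact hD.corner_slack_pos ht h0 hdeg hw hwt
  have hzero : u ⬝ᵥ inner h t u - h u = 0 := by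
    rw [hval, hD.dot ht hu, hdual.dot_ne hu (Finset.mem_of_mem_erase ha)
      (Finset.ne_of_mem_erase ha).symm, hdual.dot_ne hu (Finset.mem_of_mem_erase hb)
      (Finset.ne_of_mem_erase hb).symm]
    simp
  constructor
  · intro w hw
    by_cases hwu : w = u
    · subst hwu; linarith
    · linarith [hpos w hw hwu]
  · ext w
    rw [tight, Finset.mem_filter, Finset.mem_singleton]
    constructor
    · rintro ⟨hw, he⟩
      by_contra hwu
      linarith [hpos w hw hwu]
    · rintro rfl
      exact ⟨hD.mem_rays ht hu, by linarith⟩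

end IsData

/-! ### Long edges and pentagonal facets -/

/-- Some lattice point lies in the relative interior of the face given by `s`. -/
def HasPt (T : Finset (Finset Lat)) (h : Lat → ℤ) (s : Finset Lat) : Prop :=
  ∃ z, InPoly T h z ∧ tight T h z = s

namespace IsData
variable {T : Finset (Finset Lat)} {h : Lat → ℤ}

lemma triple_ne (hD : IsData T h) {u a b : Lat} (ht : {u, a, b} ∈ T) : u ≠ a ∧ u ≠ b ∧ a ≠ b := by
  have hc := hD.card ht
  refine ⟨?_, ?_, ?_⟩ <;> rintro rfl
  · have := Finset.card_le_two (a := u) (b := b); simp at hc; omega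
  · have := Finset.card_le_two (a := u) (b := a)
    rw [Finset.pair_comm a u, Finset.insert_eq_of_mem (by simp)] at hc; omega
  · have := Finset.card_le_two (a := u) (b := a); simp at hc; omega

/-- The wall relation at the edge between two adjacent vertices. -/
lemma wall_triple (hD : IsData T h) {a b c d : Lat} (h1 : {a, b, c} ∈ T) (h2 : {a, b, d} ∈ T)
    (hcd : c ≠ d) :
    d ⬝ᵥ dualv {a, b, c} c = -1 ∧ 1 ≤ d ⬝ᵥ vert h {a, b, c} - h d ∧
      vert h {a, b, d} = vert h {a, b, c} +
        (d ⬝ᵥ vert h {a, b, c} - h d) • dualv {a, b, c} c := by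
  obtain ⟨hab, hac, hbc⟩ := hD.triple_ne h1
  obtain ⟨-, had, hbd⟩ := hD.triple_ne h2
  have he : insert d (({a, b, c} : Finset Lat).erase c) = {a, b, d} := by
    ext x
    simp only [Finset.mem_insert, Finset.mem_erase, Finset.mem_singleton]
    constructor
    · rintro (rfl | ⟨h3, h4⟩)
      · simp
      · tauto
    · rintro (rfl | rfl | rfl)
      · exact Or.inr ⟨hac, by simp⟩
      · exact Or.inr ⟨hbc, by simp⟩
      · simp
  have := hD.wall h1 (u := c) (u' := d) (by simp) (by simp [had.symm, hbd.symm, hcd.symm])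
    (by rwa [he])
  rw [he] at this
  exact ⟨this.1, this.2.1, this.2.2⟩

/-- Interior points of a long edge. -/
lemma edge_point (hD : IsData T h) {a b c d : Lat} (h1 : {a, b, c} ∈ T) (h2 : {a, b, d} ∈ T)
    (hcd : c ≠ d) {j : ℤ} (hj0 : 0 < j) (hj : j < d ⬝ᵥ vert h {a, b, c} - h d) :
    InPoly T h (vert h {a, b, c} + j • dualv {a, b, c} c) ∧
      tight T h (vert h {a, b, c} + j • dualv {a, b, c} c) = {a, b} := by
  obtain ⟨-, hl, hv⟩ := hD.wall_triple h1 h2 hcd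
  set l := d ⬝ᵥ vert h {a, b, c} - h d
  set e := dualv {a, b, c} c
  have hval : ∀ w, l * (w ⬝ᵥ (vert h {a, b, c} + j • e) - h w) =
      (l - j) * (w ⬝ᵥ vert h {a, b, c} - h w) + j * (w ⬝ᵥ vert h {a, b, d} - h w) := by
    intro w
    rw [hv]
    simp only [dotProduct_add, dotProduct_smul, smul_eq_mul]
    ring
  have hin : InPoly T h (vert h {a, b, c} + j • e) := by
    intro w hw
    have a1 := hD.slack_nonneg h1 hw
    have a2 := hD.slack_nonneg h2 hw
    have := hval w
    nlinarith
  refine ⟨hin, ?_⟩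
  ext w
  rw [tight, Finset.mem_filter, Finset.mem_insert, Finset.mem_singleton]
  constructor
  · rintro ⟨hw, he⟩
    have a1 := hD.slack_nonneg h1 hw
    have a2 := hD.slack_nonneg h2 hw
    have h3 := hval w
    rw [he] at h3
    have b1 : w ⬝ᵥ vert h {a, b, c} = h w := by nlinarith
    have b2 : w ⬝ᵥ vert h {a, b, d} = h w := by nlinarith
    have c1 := hD.mem_of_eq h1 hw b1
    have c2 := hD.mem_of_eq h2 hw b2
    simp only [Finset.mem_insert, Finset.mem_singleton] at c1 c2
    rcases c1 with c1 | c1 | c1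
    · exact Or.inl c1
    · exact Or.inr c1
    · rcases c2 with c2 | c2 | c2
      · exact Or.inl c2
      · exact Or.inr c2
      · exact absurd (c1.symm.trans c2) hcd
  · intro hw
    have hw1 : w ∈ ({a, b, c} : Finset Lat) := by simp; tauto
    have hw2 : w ∈ ({a, b, d} : Finset Lat) := by simp; tauto
    refine ⟨hD.mem_rays h1 hw1, ?_⟩
    have h3 := hval w
    rw [hD.dot h1 hw1, hD.dot h2 hw2] at h3
    nlinarith

lemma length_eq_one (hD : IsData T h) {a b c d : Lat} (h1 : {a, b, c} ∈ T) (h2 : {a, b, d} ∈ T)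
    (hcd : c ≠ d) (hp : ¬ HasPt T h {a, b}) : d ⬝ᵥ vert h {a, b, c} - h d = 1 := by
  have h3 := (hD.wall_triple h1 h2 hcd).2.1
  by_contra hne
  exact hp ⟨_, hD.edge_point h1 h2 hcd one_pos (by omega)⟩

lemma hasPt_singleton (hD : IsData T h) {u : Lat} (hdeg : 5 ≤ deg T u) : HasPt T h {u} := by
  have : (T.filter fun t => u ∈ t).Nonempty := Finset.card_pos.mp (by rw [deg] at hdeg; omega)
  obtain ⟨t, ht⟩ := this
  obtain ⟨ht, hu⟩ := Finset.mem_filter.mp ht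
  exact ⟨_, hD.tight_inner ht hu hdeg⟩

lemma dualv_eq (hD : IsData T h) {t : Finset Lat} (ht : t ∈ T) {u : Lat} (hu : u ∈ t) {e : Lat}
    (h1 : u ⬝ᵥ e = 1) (h0 : ∀ w ∈ t, w ≠ u → w ⬝ᵥ e = 0) : dualv t u = e := by
  have hd := hD.isDual ht
  refine hd.ext_primal_int fun w hw => ?_
  by_cases hwu : w = u
  · rw [hwu, hd.dot_self hu, h1]
  · rw [hd.dot_ne hw hu hwu, h0 w hw hwu]

/-- If two adjacent edges of a pentagonal facet have length one, then the opposite edge and one of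
its neighbours are longer. -/
lemma pentagon_core (hD : IsData T h) {u c0 c1 c2 c3 c4 : Lat} (h01 : {u, c0, c1} ∈ T)
    (h12 : {u, c1, c2} ∈ T) (h23 : {u, c2, c3} ∈ T) (h34 : {u, c3, c4} ∈ T)
    (h40 : {u, c4, c0} ∈ T) (n02 : c0 ≠ c2) (n13 : c1 ≠ c3) (n24 : c2 ≠ c4) (n30 : c3 ≠ c0)
    (n41 : c4 ≠ c1) (hdeg : 5 ≤ deg T u) (l0 : c4 ⬝ᵥ vert h {u, c0, c1} - h c4 = 1)
    (l1 : c2 ⬝ᵥ vert h {u, c0, c1} - h c2 = 1) :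
    2 ≤ c4 ⬝ᵥ vert h {u, c2, c3} - h c4 ∧
      (2 ≤ c3 ⬝ᵥ vert h {u, c1, c2} - h c3 ∨ 2 ≤ c3 ⬝ᵥ vert h {u, c4, c0} - h c3) := by
  have p3 : ∀ x y z : Lat, ({x, y, z} : Finset Lat) = {x, z, y} := fun x y z => by
    rw [Finset.pair_comm y z]
  obtain ⟨nu0, nu1, n01⟩ := hD.triple_ne h01
  obtain ⟨-, nu2, n12⟩ := hD.triple_ne h12
  obtain ⟨-, nu3, n23⟩ := hD.triple_ne h23
  obtain ⟨-, nu4, n34⟩ := hD.triple_ne h34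
  obtain ⟨-, -, n40⟩ := hD.triple_ne h40
  have hd := hD.isDual h01
  set e0 := dualv {u, c0, c1} c0 with he0
  set e1 := dualv {u, c0, c1} c1 with he1
  have m0 : c0 ∈ ({u, c0, c1} : Finset Lat) := by simp
  have m1 : c1 ∈ ({u, c0, c1} : Finset Lat) := by simp
  have mu : u ∈ ({u, c0, c1} : Finset Lat) := by simp
  have u0 : u ⬝ᵥ e0 = 0 := hd.dot_ne mu m0 nu0
  have u1 : u ⬝ᵥ e1 = 0 := hd.dot_ne mu m1 nu1
  have d00 : c0 ⬝ᵥ e0 = 1 := hd.dot_self m0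
  have d01 : c0 ⬝ᵥ e1 = 0 := hd.dot_ne m0 m1 n01
  have d10 : c1 ⬝ᵥ e0 = 0 := hd.dot_ne m1 m0 n01.symm
  have d11 : c1 ⬝ᵥ e1 = 1 := hd.dot_self m1
  have h01' := h01
  rw [p3] at h01'
  obtain ⟨w20, -, v12⟩ := hD.wall_triple h01' h12 n02
  obtain ⟨w41, -, v40⟩ := hD.wall_triple h01 (d := c4) (by rw [p3]; exact h40) n41.symm
  rw [p3 u c1 c0, l1, one_smul] at v12
  rw [l0, one_smul, p3 u c0 c4] at v40
  rw [p3 u c1 c0] at w20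
  rw [← he0] at v12 w20
  rw [← he1] at v40 w41
  set α := c2 ⬝ᵥ e1 with hα
  set β := c4 ⬝ᵥ e0 with hβ
  -- The edge directions at the corners next to `c0 c1` are expressed in the basis `e0`, `e1`; the
  -- integers `α` and `β` record how the neighbouring edges bend.
  have D1 : dualv {u, c1, c2} c1 = α • e0 + e1 := by
    refine hD.dualv_eq h12 (by simp) ?_ fun w hw hne => ?_
    · rw [dotProduct_add, dotProduct_smul, d10, d11]; simp
    · simp only [Finset.mem_insert, Finset.mem_singleton] at hw
      rcases hw with rfl | rfl | rfl
      · rw [dotProduct_add, dotProduct_smul, u0, u1]; simp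
      · exact absurd rfl hne
      · rw [dotProduct_add, dotProduct_smul, w20, ← hα]; simp
  have D2 : dualv {u, c1, c2} c2 = - e0 := by
    refine hD.dualv_eq h12 (by simp) ?_ fun w hw hne => ?_
    · rw [dotProduct_neg, w20]; rfl
    · simp only [Finset.mem_insert, Finset.mem_singleton] at hw
      rcases hw with rfl | rfl | rfl
      · rw [dotProduct_neg, u0, neg_zero]
      · rw [dotProduct_neg, d10, neg_zero]
      · exact absurd rfl hne
  have D4 : dualv {u, c4, c0} c0 = e0 + β • e1 := by
    refine hD.dualv_eq h40 (by simp) ?_ fun w hw hne => ?_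
    · rw [dotProduct_add, dotProduct_smul, d00, d01]; simp
    · simp only [Finset.mem_insert, Finset.mem_singleton] at hw
      rcases hw with rfl | rfl | rfl
      · rw [dotProduct_add, dotProduct_smul, u0, u1]; simp
      · rw [dotProduct_add, dotProduct_smul, w41, ← hβ]; simp
      · exact absurd rfl hne
  have D5 : dualv {u, c4, c0} c4 = - e1 := by
    refine hD.dualv_eq h40 (by simp) ?_ fun w hw hne => ?_
    · rw [dotProduct_neg, w41]; rfl
    · simp only [Finset.mem_insert, Finset.mem_singleton] at hw
      rcases hw with rfl | rfl | rfl
      · rw [dotProduct_neg, u1, neg_zero]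
      · exact absurd rfl hne
      · rw [dotProduct_neg, d01, neg_zero]
  -- Because the edge along `c1` has length one, the inner point at the corner `c1 c2` has slack
  -- exactly `α` over `c0`, which `corner_slack_pos` makes positive. The bound on `β` is symmetric.
  have hα1 : 1 ≤ α := by
    have := hD.corner_slack_pos h12 rfl hdeg (w := c0) (hD.mem_rays h01 m0)
      (by simp [nu0.symm, n01, n02])
    rw [D1, D2, v12] at this
    simp only [dotProduct_add, dotProduct_neg, dotProduct_smul, d00, d01, hD.dot h01 m0,
      smul_eq_mul] at this
    linarith
  have hβ1 : 1 ≤ β := by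
    have := hD.corner_slack_pos h40 rfl hdeg (w := c1) (hD.mem_rays h01 m1)
      (by simp [nu1.symm, n01.symm, n41.symm])
    rw [D4, D5, v40] at this
    simp only [dotProduct_add, dotProduct_neg, dotProduct_smul, d10, d11, hD.dot h01 m1,
      smul_eq_mul] at this
    linarith
  have h12' := h12
  rw [p3] at h12'
  obtain ⟨r1, l2, v23⟩ := hD.wall_triple h12' h23 n13
  obtain ⟨r2, l4, v34⟩ := hD.wall_triple h40 (d := c3) (by rw [p3]; exact h34) n30.symm
  rw [p3 u c2 c1, D1] at r1 v23
  rw [p3 u c2 c1] at l2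
  rw [D4] at r2
  set l2' := c3 ⬝ᵥ vert h {u, c1, c2} - h c3 with hl2
  set l4' := c3 ⬝ᵥ vert h {u, c4, c0} - h c3 with hl4
  rw [v12, dotProduct_add] at hl2
  rw [v40, dotProduct_add] at hl4
  rw [v23, v12]
  simp only [dotProduct_add, dotProduct_smul, smul_eq_mul] at r1 r2 ⊢
  rw [← hβ, w41]
  set κ := c3 ⬝ᵥ e0
  set μ := c3 ⬝ᵥ e1
  -- The length of the opposite edge is `1 + β + l2' (α β - 1)`, which is at least 2.
  have hab : 0 < α * β := by positivity
  have hab1 : 0 ≤ (α * β - 1) * (l2' - 1) := mul_nonneg (by omega) (by omega)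
  refine ⟨by nlinarith, ?_⟩
  -- If both neighbours of the opposite edge had length one, then `c3` would take the same value `μ`
  -- on `e0` and `e1`, so that `μ (α + 1) = -1` with `α + 1 ≥ 2`.
  by_contra! hcon
  have e2 : l2' = 1 := by omega
  have e4 : l4' = 1 := by omega
  have hκ : κ = μ := by omega
  rw [hκ] at r1 r2
  have h5 : μ * (α + 1) = -1 := by linarith
  have h6 : α + 1 ∣ 1 := ⟨-μ, by linarith⟩
  have := Int.le_of_dvd one_pos h6
  omega

/-- A pentagonal facet has two adjacent edges with lattice points in the relative interior. -/
theorem pentagon (hD : IsData T h) {u : Lat} {c : Fin 5 → Lat}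
    (hc : ∀ i, {u, c i, c (i + 1)} ∈ T) (hinj : Function.Injective c) (hdeg : 5 ≤ deg T u) :
    ∃ i, HasPt T h {u, c i} ∧ HasPt T h {u, c (i + 1)} := by
  have p3 : ∀ x y z : Lat, ({x, y, z} : Finset Lat) = {x, z, y} := fun x y z => by
    rw [Finset.pair_comm y z]
  have hn : ∀ i j : Fin 5, i ≠ j → c i ≠ c j := fun i j hij h => hij (hinj h)
  have core : ∀ i : Fin 5, ¬ HasPt T h {u, c i} → ¬ HasPt T h {u, c (i + 1)} →
      HasPt T h {u, c (i + 3)} ∧ (HasPt T h {u, c (i + 2)} ∨ HasPt T h {u, c (i + 4)}) := by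
    intro i hi hi1
    have t0 := hc i
    have t1 := hc (i + 1)
    have t2 := hc (i + 2)
    have t3 := hc (i + 3)
    have t4 := hc (i + 4)
    rw [add_assoc] at t1 t2 t3 t4
    change {u, c (i + 1), c (i + 2)} ∈ T at t1
    change {u, c (i + 2), c (i + 3)} ∈ T at t2
    change {u, c (i + 3), c (i + 4)} ∈ T at t3
    change {u, c (i + 4), c (i + 0)} ∈ T at t4
    rw [add_zero] at t4
    have n02 : c i ≠ c (i + 2) := hn _ _ ((by decide : ∀ i : Fin 5, i ≠ i + 2) i)
    have n13 : c (i + 1) ≠ c (i + 3) := hn _ _ ((by decide : ∀ i : Fin 5, i + 1 ≠ i + 3) i)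
    have n24 : c (i + 2) ≠ c (i + 4) := hn _ _ ((by decide : ∀ i : Fin 5, i + 2 ≠ i + 4) i)
    have n30 : c (i + 3) ≠ c i := hn _ _ ((by decide : ∀ i : Fin 5, i + 3 ≠ i) i)
    have n41 : c (i + 4) ≠ c (i + 1) := hn _ _ ((by decide : ∀ i : Fin 5, i + 4 ≠ i + 1) i)
    have l0 := hD.length_eq_one t0 (d := c (i + 4)) (by rw [p3]; exact t4) n41.symm hi
    have l1 := hD.length_eq_one (by rw [p3]; exact t0) t1 n02 hi1
    rw [p3] at l1
    obtain ⟨a1, a2⟩ := hD.pentagon_core t0 t1 t2 t3 t4 n02 n13 n24 n30 n41 hdeg l0 l1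
    refine ⟨?_, ?_⟩
    · have t2' := t2
      rw [p3] at t2' a1
      exact ⟨_, hD.edge_point t2' t3 n24 one_pos (by omega)⟩
    · rcases a2 with a2 | a2
      · have t1' := t1
        rw [p3] at t1' a2
        exact Or.inl ⟨_, hD.edge_point t1' t2 n13 one_pos (by omega)⟩
      · exact Or.inr ⟨_, hD.edge_point t4 (by rw [p3]; exact t3) n30.symm one_pos (by omega)⟩
  classical
  -- On a 5-cycle without two adjacent short edges there are two adjacent long ones; two adjacent
  -- short edges produce two adjacent long ones by `core`.
  have comb : ∀ p : Fin 5 → Bool, (∀ i, p i = false → p (i + 1) = false →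
      p (i + 3) = true ∧ (p (i + 2) = true ∨ p (i + 4) = true)) →
      ∃ i, p i = true ∧ p (i + 1) = true := by decide
  obtain ⟨i, hi⟩ := comb (fun i => decide (HasPt T h {u, c i})) fun i h1 h2 => by
    simpa using core i (by simpa using h1) (by simpa using h2)
  exact ⟨i, by simpa using hi⟩

end IsData

/-! ### Facets with at least seven corners -/

namespace IsData
variable {T : Finset (Finset Lat)} {h : Lat → ℤ}

/-- The lattice points of the facet `u` that are not vertices. -/
def _root_.SmoothPolytope.facetPts (T : Finset (Finset Lat)) (h : Lat → ℤ) (u : Lat) : Set Lat :=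
  {z | InPoly T h z ∧ u ⬝ᵥ z = h u ∧ tight T h z ∉ T}

lemma _root_.SmoothPolytope.Small.finite_facetPts {N : ℕ} (hs : Small T h N) (u : Lat) :
    (facetPts T h u).Finite := by
  by_contra hinf
  obtain ⟨X, hX, hc⟩ := Set.Infinite.exists_subset_card_eq hinf (N + 1)
  have := hs X fun z hz => (hX hz).1
  omega

/-- A facet with at least seven vertices contains at least four further lattice points. -/
theorem four_le_card_facetPts (hD : IsData T h) {u : Lat} (hdeg : 7 ≤ deg T u) {X : Finset Lat}
    (hX : (X : Set Lat) = facetPts T h u) : 4 ≤ X.card := by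
  classical
  have hXm : ∀ z, z ∈ X ↔ InPoly T h z ∧ u ⬝ᵥ z = h u ∧ tight T h z ∉ T := fun z => by
    rw [← Finset.mem_coe, hX]; rfl
  obtain ⟨t, ht, hut⟩ : ∃ t ∈ T, u ∈ t := by
    have : (T.filter fun t => u ∈ t).Nonempty := Finset.card_pos.mp (by rw [deg] at hdeg; omega)
    obtain ⟨t, ht⟩ := this
    exact ⟨t, Finset.mem_filter.mp ht⟩
  obtain ⟨a, b, hab, he⟩ : ∃ a b, a ≠ b ∧ t.erase u = {a, b} := by
    have : (t.erase u).card = 2 := by rw [Finset.card_erase_of_mem hut, hD.card ht]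
    exact Finset.card_eq_two.mp this
  have h0 : t = {u, a, b} := by rw [← Finset.insert_erase hut, he]
  have hd := hD.isDual ht
  set V := (T.filter fun t => u ∈ t).image (vert h) with hV
  have hVc : V.card = deg T u := Finset.card_image_of_injOn fun t₁ h1 t₂ h2 he =>
    hD.vert_injOn (Finset.mem_filter.mp h1).1 (Finset.mem_filter.mp h2).1 he
  have hVm : ∀ z ∈ V, ∃ t ∈ T, u ∈ t ∧ z = vert h t := fun z hz => by
    obtain ⟨t, h1, rfl⟩ := Finset.mem_image.mp hz
    exact ⟨t, (Finset.mem_filter.mp h1).1, (Finset.mem_filter.mp h1).2, rfl⟩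
  have hdisj : Disjoint X V := Finset.disjoint_left.mpr fun z h1 h2 => by
    obtain ⟨t, ht, -, rfl⟩ := hVm z h2
    exact ((hXm _).mp h1).2.2 (by rwa [hD.tight_vert ht])
  set S := X ∪ V with hS
  have hSc : S.card = X.card + deg T u := by rw [Finset.card_union_of_disjoint hdisj, hVc]
  have hSm : ∀ z ∈ S, InPoly T h z ∧ u ⬝ᵥ z = h u := fun z hz => by
    rcases Finset.mem_union.mp hz with h1 | h1
    · exact ⟨((hXm z).mp h1).1, ((hXm z).mp h1).2.1⟩
    · obtain ⟨t, ht, hu, rfl⟩ := hVm z h1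
      exact ⟨hD.inPoly_vert ht, hD.dot ht hu⟩
  -- Parity of the two coordinates in the facet plane: distinct points of the same class have a
  -- lattice midpoint, and this midpoint is no vertex, so it belongs to `X`.
  let κ : Lat → Bool × Bool := fun z => (decide (2 ∣ a ⬝ᵥ z), decide (2 ∣ b ⬝ᵥ z))
  have mid : ∀ y ∈ S, ∀ z ∈ S, y ≠ z → κ y = κ z → ∃ m ∈ X, m + m = y + z := by
    intro y hy z hz hne hk
    simp only [κ, Prod.mk.injEq, decide_eq_decide] at hk
    obtain ⟨m1, hm1⟩ : ∃ m, a ⬝ᵥ y + a ⬝ᵥ z = m + m := by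
      obtain ⟨k, hk⟩ : (2 : ℤ) ∣ a ⬝ᵥ y + a ⬝ᵥ z := by omega
      exact ⟨k, by omega⟩
    obtain ⟨m2, hm2⟩ : ∃ m, b ⬝ᵥ y + b ⬝ᵥ z = m + m := by
      obtain ⟨k, hk⟩ : (2 : ℤ) ∣ b ⬝ᵥ y + b ⬝ᵥ z := by omega
      exact ⟨k, by omega⟩
    obtain ⟨hua, hub, -⟩ := hD.triple_ne (h0 ▸ ht)
    have hat : a ∈ t := by simp [h0]
    have hbt : b ∈ t := by simp [h0]
    set m := h u • dualv t u + m1 • dualv t a + m2 • dualv t b with hm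
    have hmm : m + m = y + z := by
      refine hd.ext_primal_int fun w hw => ?_
      rw [hm]
      simp only [dotProduct_add, dotProduct_smul, smul_eq_mul]
      rw [h0] at hw
      simp only [Finset.mem_insert, Finset.mem_singleton] at hw
      rcases hw with rfl | rfl | rfl
      · rw [hd.dot_self hut, hd.dot_ne hut hat hua, hd.dot_ne hut hbt hub, (hSm y hy).2,
          (hSm z hz).2]
        ring
      · rw [hd.dot_self hat, hd.dot_ne hat hut hua.symm, hd.dot_ne hat hbt hab]
        linarith
      · rw [hd.dot_self hbt, hd.dot_ne hbt hut hub.symm, hd.dot_ne hbt hat hab.symm]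
        linarith
    have hdot : ∀ w, w ⬝ᵥ m + w ⬝ᵥ m = w ⬝ᵥ y + w ⬝ᵥ z := fun w => by
      rw [← dotProduct_add, hmm, dotProduct_add]
    refine ⟨m, (hXm m).mpr ⟨fun w hw => ?_, ?_, fun hT => ?_⟩, hmm⟩
    · have := hdot w
      have := (hSm y hy).1 w hw
      have := (hSm z hz).1 w hw
      omega
    · have := hdot u
      have := (hSm y hy).2
      have := (hSm z hz).2
      omega
    · have key : ∀ w ∈ tight T h m, w ⬝ᵥ y = w ⬝ᵥ z := fun w hw => by
        obtain ⟨hw, he⟩ := Finset.mem_filter.mp hw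
        have := hdot w
        have := (hSm y hy).1 w hw
        have := (hSm z hz).1 w hw
        omega
      exact hne (hD.eq_of_slack_eq hT key)
  have cancel : ∀ x y : Lat, x + x = y + y → x = y := fun x y hxy => by
    ext i
    have := congrFun hxy i
    simp only [Pi.add_apply] at this
    omega
  by_contra! hlt
  let C : Bool × Bool → Finset Lat := fun k => S.filter fun z => κ z = k
  have hC : ∀ k, ∀ z ∈ C k, z ∈ S ∧ κ z = k := fun k z hz => Finset.mem_filter.mp hz
  have hsum : S.card = (C (true, true)).card + (C (true, false)).card + (C (false, true)).card +
      (C (false, false)).card := by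
    rw [Finset.card_eq_sum_card_fiberwise (f := κ) (t := Finset.univ) fun _ _ => Finset.mem_univ _]
    rw [← Finset.univ_product_univ, Finset.sum_product]
    simp [C]
    ring
  have two : ∀ k, (C k).card ≤ 1 ∨ 1 ≤ X.card := by
    intro k
    rw [or_iff_not_imp_left, not_le]
    intro hk
    obtain ⟨y, hy, z, hz, hne⟩ := Finset.one_lt_card.mp hk
    obtain ⟨m, hm, -⟩ := mid y (hC k y hy).1 z (hC k z hz).1 hne
      ((hC k y hy).2.trans (hC k z hz).2.symm)
    exact Finset.card_pos.mpr ⟨m, hm⟩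
  -- Three points of one class have three distinct midpoints, which exhaust `X` under the assumption
  -- that it has at most three elements. Each of the points is then the sum of `X` minus twice the
  -- midpoint of the other two. So such a class is determined by `X`, and only one class can be that
  -- large.
  have three : ∀ k, 3 ≤ (C k).card → X.card = 3 ∧
      C k ⊆ X.image fun x => ∑ x ∈ X, x - (x + x) := by
    intro k hk
    have main : ∀ y₁ ∈ C k, ∀ y₂ ∈ C k, ∀ y₃ ∈ C k, y₁ ≠ y₂ → y₁ ≠ y₃ → y₂ ≠ y₃ →
        X.card = 3 ∧ y₁ ∈ X.image fun x => ∑ x ∈ X, x - (x + x) := by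
      intro y₁ h1 y₂ h2 y₃ h3 n12 n13 n23
      obtain ⟨s1, k1⟩ := hC k _ h1
      obtain ⟨s2, k2⟩ := hC k _ h2
      obtain ⟨s3, k3⟩ := hC k _ h3
      obtain ⟨p, hp, ep⟩ := mid _ s2 _ s3 n23 (k2.trans k3.symm)
      obtain ⟨q, hq, eq⟩ := mid _ s1 _ s3 n13 (k1.trans k3.symm)
      obtain ⟨r, hr, er⟩ := mid _ s1 _ s2 n12 (k1.trans k2.symm)
      have npq : p ≠ q := by
        rintro rfl; rw [ep] at eq; exact n12 (add_right_cancel eq).symm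
      have npr : p ≠ r := by
        rintro rfl; rw [ep, add_comm y₁] at er; exact n13 (add_left_cancel er).symm
      have nqr : q ≠ r := by
        rintro rfl; rw [eq] at er; exact n23 (add_left_cancel er).symm
      have hsub : ({p, q, r} : Finset Lat) ⊆ X := by
        intro x hx
        simp only [Finset.mem_insert, Finset.mem_singleton] at hx
        rcases hx with rfl | rfl | rfl <;> assumption
      have hc3 : ({p, q, r} : Finset Lat).card = 3 := Finset.card_eq_three.mpr
        ⟨p, q, r, npq, npr, nqr, rfl⟩
      have hXeq : ({p, q, r} : Finset Lat) = X :=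
        Finset.eq_of_subset_of_card_le hsub (by omega)
      refine ⟨hXeq ▸ hc3, Finset.mem_image.mpr ⟨p, hp, ?_⟩⟩
      rw [← hXeq, Finset.sum_insert (by simp [npq, npr]), Finset.sum_pair nqr]
      refine cancel _ _ ?_
      have : p + (q + r) - (p + p) + (p + (q + r) - (p + p)) = (q + q) + (r + r) - (p + p) := by abel
      rw [this, ep, eq, er]; abel
    have other : ∀ y ∈ C k, ∃ y₂ ∈ C k, ∃ y₃ ∈ C k, y ≠ y₂ ∧ y ≠ y₃ ∧ y₂ ≠ y₃ := by
      intro y hy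
      have : 1 < ((C k).erase y).card := by rw [Finset.card_erase_of_mem hy]; omega
      obtain ⟨y₂, h2, y₃, h3, hne⟩ := Finset.one_lt_card.mp this
      obtain ⟨n2, h2⟩ := Finset.mem_erase.mp h2
      obtain ⟨n3, h3⟩ := Finset.mem_erase.mp h3
      exact ⟨y₂, h2, y₃, h3, n2.symm, n3.symm, hne⟩
    constructor
    · obtain ⟨y, hy⟩ := Finset.card_pos.mp (show 0 < (C k).card by omega)
      obtain ⟨y₂, h2, y₃, h3, n1, n2, n3⟩ := other y hy
      exact (main y hy y₂ h2 y₃ h3 n1 n2 n3).1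
    · intro y hy
      obtain ⟨y₂, h2, y₃, h3, n1, n2, n3⟩ := other y hy
      exact (main y hy y₂ h2 y₃ h3 n1 n2 n3).2
  have img : (X.image fun x => ∑ x ∈ X, x - (x + x)).card ≤ X.card := Finset.card_image_le
  have one_class : ∀ k k', k ≠ k' → (C k).card ≤ 2 ∨ (C k').card ≤ 2 := by
    intro k k' hne
    by_contra! hcon
    have h1 : 3 ≤ (C k).card := hcon.1
    have h2 : 3 ≤ (C k').card := hcon.2
    have hdis : Disjoint (C k) (C k') := Finset.disjoint_left.mpr fun z hz hz' =>
      hne ((hC k z hz).2.symm.trans (hC k' z hz').2)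
    have := Finset.card_le_card (Finset.union_subset (three k h1).2 (three k' h2).2)
    rw [Finset.card_union_of_disjoint hdis] at this
    omega
  have le3 : ∀ k, (C k).card ≤ 3 := by
    intro k
    by_contra! hk
    have := Finset.card_le_card (three k (by omega)).2
    have := (three k (by omega)).1
    omega
  -- If `x` is the only point of `X`, its own class has no second member, since the midpoint would
  -- again be `x`.
  have hx1 : X.card = 1 → ∃ k, (C k).card ≤ 1 := by
    intro h1
    obtain ⟨x, rfl⟩ := Finset.card_eq_one.mp h1
    have hxS : x ∈ S := Finset.mem_union_left _ (by simp)
    refine ⟨κ x, ?_⟩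
    by_contra! hc
    obtain ⟨s, hs, hne⟩ := Finset.exists_mem_ne hc x
    obtain ⟨m, hm, hmm⟩ := mid x hxS s (hC _ s hs).1 hne.symm (hC _ s hs).2.symm
    rw [Finset.mem_singleton.mp hm] at hmm
    exact hne (add_left_cancel hmm).symm
  have three' : ∀ k, (C k).card ≤ 2 ∨ X.card = 3 := fun k => by
    rw [or_iff_not_imp_left, not_le]
    exact fun hk => (three k hk).1
  have a1 := three' (true, true)
  have a2 := three' (true, false)
  have a3 := three' (false, true)
  have a4 := three' (false, false)
  have b1 := two (true, true)
  have b2 := two (true, false)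
  have b3 := two (false, true)
  have b4 := two (false, false)
  have c1 := one_class (true, true) (true, false) (by decide)
  have c2 := one_class (true, true) (false, true) (by decide)
  have c3 := one_class (true, true) (false, false) (by decide)
  have c4 := one_class (true, false) (false, true) (by decide)
  have c5 := one_class (true, false) (false, false) (by decide)
  have c6 := one_class (false, true) (false, false) (by decide)
  have d1 := le3 (true, true)
  have d2 := le3 (true, false)
  have d3 := le3 (false, true)
  have d4 := le3 (false, false)
  have hx2 : X.card ≠ 1 ∨ (C (true, true)).card ≤ 1 ∨ (C (true, false)).card ≤ 1 ∨
      (C (false, true)).card ≤ 1 ∨ (C (false, false)).card ≤ 1 := by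
    rw [or_iff_not_imp_left, not_not]
    intro h1
    obtain ⟨⟨k1, k2⟩, hk⟩ := hx1 h1
    cases k1 <;> cases k2 <;> simp [hk]
  -- For 0, 1, 2 or 3 points in `X` the four classes hold at most 4, 7, 8 or 9 points, always fewer
  -- than the required `X.card + 7`.
  generalize (C (true, true)).card = n1 at *
  generalize (C (true, false)).card = n2 at *
  generalize (C (false, true)).card = n3 at *
  generalize (C (false, false)).card = n4 at *
  omega

end IsData

/-! ### Isomorphisms from coordinates of the vertices -/

lemma exists_affineEquiv {b u : Fin 3 → Lat} (hb : ∀ i j, u i ⬝ᵥ b j = if i = j then 1 else 0)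
    (A : Lat) : ∃ φ : Spc ≃ᵃ[ℝ] Spc, φ '' latticePoints 3 = latticePoints 3 ∧
      ∀ c : Lat, φ (toReal c) = toReal (A + ∑ i, c i • b i) := by
  let B : Matrix (Fin 3) (Fin 3) ℤ := Matrix.of fun i j => b j i
  let U : Matrix (Fin 3) (Fin 3) ℤ := Matrix.of u
  have hUB : U * B = 1 := by
    ext i j
    rw [Matrix.mul_apply, Matrix.one_apply, ← hb i j]
    rfl
  have hBU : B * U = 1 := mul_eq_one_comm.mp hUB
  let Br := B.map (Int.castRingHom ℝ)
  let Ur := U.map (Int.castRingHom ℝ)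
  have hUBr : Ur * Br = 1 := by
    rw [← Matrix.map_mul, hUB]; simp
  have hBUr : Br * Ur = 1 := by
    rw [← Matrix.map_mul, hBU]; simp
  let L : Spc ≃ₗ[ℝ] Spc := LinearEquiv.ofLinearMap (Matrix.mulVecLin Br) (Matrix.mulVecLin Ur)
    (by rw [← Matrix.mulVecLin_mul, hBUr, Matrix.mulVecLin_one])
    (by rw [← Matrix.mulVecLin_mul, hUBr, Matrix.mulVecLin_one])
  have hL : ∀ c : Lat, L (toReal c) = toReal (∑ i, c i • b i) := by
    intro c
    ext j
    change (Br.mulVec (toReal c)) j = _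
    simp only [Matrix.mulVec, dotProduct, toReal, Br, B, Matrix.map_apply, Matrix.of_apply,
      Finset.sum_apply, Pi.smul_apply, smul_eq_mul]
    push_cast
    exact Finset.sum_congr rfl fun i _ => mul_comm _ _
  have hsurj : ∀ z : Lat, ∃ c : Lat, ∑ i, c i • b i = z := by
    intro z
    refine ⟨U.mulVec z, ?_⟩
    have : B.mulVec (U.mulVec z) = z := by rw [Matrix.mulVec_mulVec, hBU, Matrix.one_mulVec]
    conv_rhs => rw [← this]
    ext j
    simp only [Finset.sum_apply, Pi.smul_apply, smul_eq_mul]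
    conv_rhs => rw [Matrix.mulVec, dotProduct]
    exact Finset.sum_congr rfl fun i _ => mul_comm _ _
  let φ : Spc ≃ᵃ[ℝ] Spc := L.toAffineEquiv.trans (AffineEquiv.constVAdd ℝ Spc (toReal A))
  have hφ : ∀ c : Lat, φ (toReal c) = toReal (A + ∑ i, c i • b i) := fun c => by
    change toReal A +ᵥ L (toReal c) = _
    rw [hL, toReal_add, vadd_eq_add]
  refine ⟨φ, ?_, hφ⟩
  ext z
  constructor
  · rintro ⟨_, ⟨c, rfl⟩, rfl⟩
    exact ⟨_, (hφ c).symm⟩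
  · rintro ⟨z, rfl⟩
    obtain ⟨c, hc⟩ := hsurj (z - A)
    exact ⟨_, ⟨c, rfl⟩, by rw [hφ, hc, add_sub_cancel]⟩

lemma iso_convexHull {b u : Fin 3 → Lat} (hb : ∀ i j, u i ⬝ᵥ b j = if i = j then 1 else 0)
    (A : Lat) {V W : Finset Lat} (hW : V = W.image fun c => A + ∑ i, c i • b i) :
    Iso (convexHull ℝ (toReal '' (V : Set Lat))) (convexHull ℝ (toReal '' (W : Set Lat))) := by
  obtain ⟨φ, h1, hφ⟩ := exists_affineEquiv hb A
  refine Iso.symm ⟨φ, h1, ?_⟩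
  have := φ.toAffineMap.image_convexHull (toReal '' (W : Set Lat))
  change φ '' _ = _ at this
  rw [this, hW]
  congr 1
  rw [Finset.coe_image, Set.image_image, Set.image_image]
  exact Set.image_congr fun c _ => hφ c

/-- A polytope is determined up to isomorphism by the coordinates of its vertices in a lattice
basis. -/
lemma IsData.iso_of_vert {T : Finset (Finset Lat)} {h : Lat → ℤ} (hD : IsData T h)
    {b u : Fin 3 → Lat} (hb : ∀ i j, u i ⬝ᵥ b j = if i = j then 1 else 0) (A : Lat) (W : Finset Lat)
    (hW : T.image (vert h) = W.image fun c => A + ∑ i, c i • b i) :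
    Iso (poly T h) (convexHull ℝ (toReal '' (W : Set Lat))) := by
  rw [hD.poly_eq_convexHull]
  exact iso_convexHull hb A hW

lemma IsData.expand_slack {T : Finset (Finset Lat)} {h : Lat → ℤ} (hD : IsData T h) {a b c : Lat}
    (ht : {a, b, c} ∈ T) (z : Lat) : z = vert h {a, b, c} + ((a ⬝ᵥ z - h a) • dualv {a, b, c} a +
      ((b ⬝ᵥ z - h b) • dualv {a, b, c} b + (c ⬝ᵥ z - h c) • dualv {a, b, c} c)) := by
  obtain ⟨hab, hac, hbc⟩ := hD.triple_ne ht
  have h1 := (hD.isDual ht).expand_primal_int (z - vert h {a, b, c})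
  rw [Finset.sum_insert (by simp [hab, hac]), Finset.sum_pair hbc] at h1
  simp only [dotProduct_sub] at h1
  rw [hD.dot ht (by simp : a ∈ _), hD.dot ht (by simp : b ∈ _), hD.dot ht (by simp : c ∈ _)] at h1
  rw [← h1]; abel

lemma IsData.iso_coords {T : Finset (Finset Lat)} {h : Lat → ℤ} (hD : IsData T h) {a b c : Lat}
    (ht : {a, b, c} ∈ T) : Iso (poly T h) (convexHull ℝ (toReal ''
      ((T.image fun t => (![a ⬝ᵥ vert h t - h a, b ⬝ᵥ vert h t - h b, c ⬝ᵥ vert h t - h c] : Lat) :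
        Finset Lat) : Set Lat))) := by
  obtain ⟨hab, hac, hbc⟩ := hD.triple_ne ht
  have hd := hD.isDual ht
  refine hD.iso_of_vert (b := ![dualv {a, b, c} a, dualv {a, b, c} b, dualv {a, b, c} c])
    (u := ![a, b, c]) ?_ (vert h {a, b, c}) _ ?_
  · have ha : a ∈ ({a, b, c} : Finset Lat) := by simp
    have hb : b ∈ ({a, b, c} : Finset Lat) := by simp
    have hc : c ∈ ({a, b, c} : Finset Lat) := by simp
    intro i j
    fin_cases i <;> fin_cases j
    · simpa using hd.dot_self ha
    · simpa using hd.dot_ne ha hb hab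
    · simpa using hd.dot_ne ha hc hac
    · simpa using hd.dot_ne hb ha hab.symm
    · simpa using hd.dot_self hb
    · simpa using hd.dot_ne hb hc hbc
    · simpa using hd.dot_ne hc ha hac.symm
    · simpa using hd.dot_ne hc hb hbc.symm
    · simpa using hd.dot_self hc
  · rw [Finset.image_image]
    refine Finset.image_congr fun t _ => ?_
    simp only [Function.comp, Fin.sum_univ_three, Matrix.cons_val_zero, Matrix.cons_val_one,
      Matrix.cons_val, add_assoc]
    exact hD.expand_slack ht _

/-! ### Opposite facets and Cayley polytopes -/

/-- The normal cone of a minimal face is read off from the indices at which a functional is minimal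
over the generating points. Two families with the same pattern of minimal indices for every
functional therefore have the same normal cones. -/
lemma normalFan_convexHull_subset {ι : Type*} [Finite ι] [Nonempty ι] {v v' : ι → Fin 2 → ℝ}
    (hv : ∀ w i, (∀ j, w ⬝ᵥ v i ≤ w ⬝ᵥ v j) ↔ ∀ j, w ⬝ᵥ v' i ≤ w ⬝ᵥ v' j) :
    normalFan (convexHull ℝ (Set.range v)) ⊆ normalFan (convexHull ℝ (Set.range v')) := by
  classical
  cases nonempty_fintype ι
  have face : ∀ (x : ι → Fin 2 → ℝ) (w : Fin 2 → ℝ), IsFace (convexHull ℝ (Set.range x))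
        {y ∈ convexHull ℝ (Set.range x) | ∀ z ∈ convexHull ℝ (Set.range x), w ⬝ᵥ y ≤ w ⬝ᵥ z} ∧
      ∀ w', w' ∈ normalCone (convexHull ℝ (Set.range x))
        {y ∈ convexHull ℝ (Set.range x) | ∀ z ∈ convexHull ℝ (Set.range x), w ⬝ᵥ y ≤ w ⬝ᵥ z} ↔
        ∀ i, (∀ j, w ⬝ᵥ x i ≤ w ⬝ᵥ x j) → ∀ j, w' ⬝ᵥ x i ≤ w' ⬝ᵥ x j := by
    intro x w
    have hmin : ∀ (f : Fin 2 → ℝ) i, (∀ j, f ⬝ᵥ x i ≤ f ⬝ᵥ x j) →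
        ∀ z ∈ convexHull ℝ (Set.range x), f ⬝ᵥ x i ≤ f ⬝ᵥ z := by
      intro f i hi z hz
      refine le_dot_of_mem_convexHull ?_ hz
      rintro _ ⟨j, rfl⟩
      exact hi j
    have hx : ∀ i, x i ∈ convexHull ℝ (Set.range x) := fun i => subset_convexHull ℝ _ ⟨i, rfl⟩
    obtain ⟨i₀, hi₀⟩ := Finite.exists_min fun i => w ⬝ᵥ x i
    refine ⟨⟨⟨x i₀, hx i₀, hmin w i₀ hi₀⟩, w, rfl⟩, fun w' => ⟨fun hw i hi j => ?_, ?_⟩⟩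
    · exact hw (x i) ⟨hx i, hmin w i hi⟩ (x j) (hx j)
    · rintro hall y ⟨hy, hyw⟩ z hz
      have hyw' : w ⬝ᵥ y = w ⬝ᵥ x i₀ := le_antisymm (hyw _ (hx i₀)) (hmin w i₀ hi₀ y hy)
      have hy' : y ∈ convexHull ℝ ((Finset.univ.image x : Finset (Fin 2 → ℝ)) : Set (Fin 2 → ℝ)) := by
        simpa using hy
      have hy2 := mem_convexHull_face (m := w ⬝ᵥ x i₀) (fun u hu => by
        obtain ⟨j, -, rfl⟩ := Finset.mem_image.mp hu
        exact hi₀ j) hy' hyw'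
      have h1 := hall i₀ hi₀
      have h2 : - (w' ⬝ᵥ x i₀) ≤ (-w') ⬝ᵥ y := by
        refine le_dot_of_mem_convexHull ?_ hy2
        rintro u ⟨hu, hwu⟩
        obtain ⟨j, -, rfl⟩ := Finset.mem_image.mp hu
        rw [neg_dotProduct, neg_le_neg_iff]
        exact hall j (fun k => hwu ▸ hi₀ k) i₀
      rw [neg_dotProduct, neg_le_neg_iff] at h2
      exact h2.trans (hmin w' i₀ h1 z hz)
  rintro σ ⟨F, ⟨hF, w, rfl⟩, rfl⟩
  refine ⟨_, (face v' w).1, ?_⟩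
  ext w'
  rw [(face v w).2, (face v' w).2]
  exact forall_congr' fun i => by rw [hv w i, hv w' i]

lemma convex_append {n k : ℕ} {C : Set (Fin (n + k) → ℝ)} (hC : Convex ℝ C) (c : Fin k → ℝ) :
    Convex ℝ {p : Fin n → ℝ | Fin.append p c ∈ C} := by
  intro x hx y hy a b ha hb hab
  have : Fin.append (a • x + b • y) c = a • Fin.append x c + b • Fin.append y c := by
    ext i
    refine Fin.addCases (fun i => ?_) (fun i => ?_) i
    · simp
    · simp [← add_mul, hab]
  rw [Set.mem_ofPred_eq, this]
  exact hC hx hy ha hb hab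

lemma cayley_convexHull {n k : ℕ} (s : ℕ) (V : Fin (k + 1) → Set (Fin n → ℝ)) :
    cayley s (fun i => convexHull ℝ (V i)) = convexHull ℝ (⋃ i, (fun p : Fin n → ℝ => Fin.append p
      ((s : ℝ) • (Fin.cons 0 (fun j => Pi.single j 1) : Fin (k + 1) → Fin k → ℝ) i)) '' V i) := by
  refine Set.Subset.antisymm (convexHull_min ?_ (convex_convexHull ℝ _)) (convexHull_mono ?_)
  · refine Set.iUnion_subset fun i => ?_
    rintro _ ⟨p, hp, rfl⟩
    refine convexHull_min (t := {p | Fin.append p _ ∈ _}) ?_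
      (convex_append (convex_convexHull ℝ _) _) hp
    intro q hq
    exact subset_convexHull ℝ _ (Set.mem_iUnion.mpr ⟨i, q, hq, rfl⟩)
  · exact Set.iUnion_mono fun i => Set.image_mono (subset_convexHull ℝ _)

lemma isLatticePolytope_of_corner {S : Set (Fin 2 → ℤ)} (hS : S.Finite) {p : Fin 2 → ℤ}
    (hp : p ∈ S) {l m : ℤ} (hl : l ≠ 0) (hm : m ≠ 0) (h1 : p + ![l, 0] ∈ S) (h2 : p + ![0, m] ∈ S) :
    IsLatticePolytope (convexHull ℝ (toReal '' S)) := by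
  refine ⟨⟨hS.toFinset, by simp⟩, ?_⟩
  rw [affineSpan_convexHull, AffineSubspace.affineSpan_eq_top_iff_vectorSpan_eq_top_of_nonempty
    ℝ _ _ (Set.Nonempty.image _ ⟨p, hp⟩), eq_top_iff]
  have e1 : toReal (![l, 0] : Fin 2 → ℤ) ∈ vectorSpan ℝ (toReal '' S) := by
    have := vsub_mem_vectorSpan ℝ (Set.mem_image_of_mem toReal h1) (Set.mem_image_of_mem toReal hp)
    rwa [vsub_eq_sub, ← toReal_sub, add_sub_cancel_left] at this
  have e2 : toReal (![0, m] : Fin 2 → ℤ) ∈ vectorSpan ℝ (toReal '' S) := by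
    have := vsub_mem_vectorSpan ℝ (Set.mem_image_of_mem toReal h2) (Set.mem_image_of_mem toReal hp)
    rwa [vsub_eq_sub, ← toReal_sub, add_sub_cancel_left] at this
  intro y _
  have : y = (y 0 / l) • toReal (![l, 0] : Fin 2 → ℤ) + (y 1 / m) • toReal (![0, m] : Fin 2 → ℤ) := by
    have hl' : (l : ℝ) ≠ 0 := by exact_mod_cast hl
    have hm' : (m : ℝ) ≠ 0 := by exact_mod_cast hm
    ext i
    fin_cases i <;> simp [toReal, hl', hm']
  rw [this]
  exact Submodule.add_mem _ (Submodule.smul_mem _ _ e1) (Submodule.smul_mem _ _ e2)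

namespace IsData
variable {T : Finset (Finset Lat)} {h : Lat → ℤ}

/-- Within the facet `u` the coordinate along `dualv t u` is constant, so only the two edges of the
facet at the corner matter. -/
lemma min_facet_iff (hD : IsData T h) {t : Finset Lat} (ht : t ∈ T) {u : Lat} (hu : u ∈ t)
    (W : Spc) : (∀ t' ∈ T, u ∈ t' → W ⬝ᵥ toReal (vert h t) ≤ W ⬝ᵥ toReal (vert h t')) ↔
      ∀ a ∈ t, a ≠ u → 0 ≤ W ⬝ᵥ toReal (dualv t a) := by
  constructor
  · intro hmin a ha hau
    obtain ⟨a', ha', hT⟩ := hD.exists_nbr ht ha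
    obtain ⟨-, hl, hv⟩ := hD.wall ht ha ha' hT
    have := hmin _ hT (Finset.mem_insert_of_mem (Finset.mem_erase.mpr ⟨hau.symm, hu⟩))
    rw [hv, toReal_add, toReal_zsmul, dotProduct_add, dotProduct_smul, smul_eq_mul] at this
    have hl' : (0 : ℝ) < ((a' ⬝ᵥ vert h t - h a' : ℤ) : ℝ) := by exact_mod_cast hl
    exact nonneg_of_mul_nonneg_right (by linarith) hl'
  · intro hdual t' ht' hut'
    have h1 := (hD.isDual ht).expand_primal (toReal (vert h t') - toReal (vert h t))
    have h2 := congrArg (W ⬝ᵥ ·) h1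
    simp only [dotProduct_sub, dotProduct_sum, dotProduct_smul, smul_eq_mul] at h2
    have : 0 ≤ ∑ a ∈ t, (toReal a ⬝ᵥ toReal (vert h t') - toReal a ⬝ᵥ toReal (vert h t)) *
        W ⬝ᵥ toReal (dualv t a) := by
      refine Finset.sum_nonneg fun a ha => ?_
      rw [toReal_dot, toReal_dot, hD.dot ht ha]
      by_cases hau : a = u
      · rw [hau, hD.dot ht' hut', sub_self, zero_mul]
      · refine mul_nonneg (sub_nonneg.mpr ?_) (hdual a ha hau)
        exact_mod_cast hD.le ht' (hD.mem_rays ht ha)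
    linarith

lemma neg_notMem (hD : IsData T h) {t : Finset Lat} (ht : t ∈ T) {b : Lat} (hb : b ∈ t) :
    -b ∉ t := by
  intro hn
  have hd := hD.isDual ht
  have h1 := hd.dot_self hb
  by_cases he : -b = b
  · have : b ⬝ᵥ dualv t b = -(b ⬝ᵥ dualv t b) := by rw [← neg_dotProduct, he]
    omega
  · have := hd.dot_ne hn hb he
    rw [neg_dotProduct] at this
    omega

/-- The vertex opposite to `t` in a prism with base normals `b` and `-b`. -/
def _root_.SmoothPolytope.flip (b : Lat) (t : Finset Lat) : Finset Lat := insert (-b) (t.erase b)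

lemma flip_mem (hD : IsData T h) {b : Lat} (hall : ∀ t ∈ T, b ∈ t ∨ -b ∈ t) {t : Finset Lat}
    (ht : t ∈ T) (hb : b ∈ t) : flip b t ∈ T := by
  obtain ⟨b', hb', hT⟩ := hD.exists_nbr ht hb
  have h1 : b ∉ insert b' (t.erase b) := by
    simp only [Finset.mem_insert, Finset.mem_erase, ne_eq, not_true_eq_false, false_and, or_false]
    rintro rfl
    exact hb' hb
  have h2 := (hall _ hT).resolve_left h1
  rcases Finset.mem_insert.mp h2 with h3 | h3
  · rwa [flip, h3]
  · exact absurd (Finset.mem_of_mem_erase h3) (hD.neg_notMem ht hb)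

lemma flip_flip (hD : IsData T h) {b : Lat} {t : Finset Lat} (ht : t ∈ T) (hb : b ∈ t) :
    flip (-b) (flip b t) = t := by
  have := hD.neg_notMem ht hb
  rw [flip, flip, neg_neg, Finset.erase_insert, Finset.insert_erase hb]
  exact fun hn => this (Finset.mem_of_mem_erase hn)

lemma dualv_flip (hD : IsData T h) {b : Lat} {t : Finset Lat} (ht : t ∈ T) (hb : b ∈ t)
    (hf : flip b t ∈ T) {a : Lat} (ha : a ∈ t) (hab : a ≠ b) :
    dualv (flip b t) a = dualv t a := by
  have hd := hD.isDual ht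
  refine hD.dualv_eq hf (Finset.mem_insert_of_mem (Finset.mem_erase.mpr ⟨hab, ha⟩))
    (hd.dot_self ha) fun w hw hwa => ?_
  rcases Finset.mem_insert.mp hw with rfl | hw
  · rw [neg_dotProduct, hd.dot_ne hb ha hab.symm, neg_zero]
  · exact hd.dot_ne (Finset.mem_of_mem_erase hw) ha hwa

/-- If every vertex lies on the facet `b` or `-b`, the edge leaving the facet `b` at `t` must end on
the other facet, at `flip b t`. The edge directions inside the two facets are the same
(`dualv_flip`), hence so are their normal fans. In the coordinates at a corner the polytope is the
hull of the two facets at heights 0 and `H`. -/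
theorem isCayleyOfPolygons (hD : IsData T h) {b : Lat} (hb : b ∈ rays T)
    (hall : ∀ t ∈ T, b ∈ t ∨ -b ∈ t) : IsCayleyOfPolygons (poly T h) := by
  classical
  obtain ⟨t₀, ht₀, hbt₀⟩ := SmoothPolytope.mem_rays.mp hb
  obtain ⟨c, d, hcd, he⟩ : ∃ c d, c ≠ d ∧ t₀.erase b = {c, d} := by
    have : (t₀.erase b).card = 2 := by rw [Finset.card_erase_of_mem hbt₀, hD.card ht₀]
    exact Finset.card_eq_two.mp this
  have h0 : t₀ = {c, d, b} := by
    rw [← Finset.insert_erase hbt₀, he]; ext; simp; tauto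
  subst h0
  obtain ⟨-, hcb, hdb⟩ := hD.triple_ne ht₀
  have hall' : ∀ t ∈ T, -b ∈ t ∨ -(-b) ∈ t := fun t ht => by
    rw [neg_neg]; exact (hall t ht).symm
  let ι := {t // t ∈ T ∧ b ∈ t}
  have : Nonempty ι := ⟨⟨_, ht₀, hbt₀⟩⟩
  have hfin : Finite ι := Finite.of_injective (β := T) (fun i => ⟨i.1, i.2.1⟩) fun i j hij =>
    Subtype.ext (congrArg (fun x : T => x.1) hij)
  let X : Finset Lat → Fin 2 → ℤ := fun t => ![c ⬝ᵥ vert h t - h c, d ⬝ᵥ vert h t - h d]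
  have hX : ∀ (w : Fin 2 → ℝ) t, w ⬝ᵥ toReal (X t) =
      (w 0 • toReal c + w 1 • toReal d) ⬝ᵥ toReal (vert h t) - (w 0 * h c + w 1 * h d) := by
    intro w t
    rw [add_dotProduct, smul_dotProduct, smul_dotProduct, toReal_dot, toReal_dot]
    simp only [dotProduct, Fin.sum_univ_two, toReal, X]
    simp
    ring
  have hflip : ∀ i : ι, flip b i.1 ∈ T := fun i => hD.flip_mem hall i.2.1 i.2.2
  -- Minimality in either facet is tested on the same edge directions, which is the condition for
  -- equal normal fans.
  have hv : ∀ (w : Fin 2 → ℝ) (i : ι), (∀ j : ι, w ⬝ᵥ toReal (X i.1) ≤ w ⬝ᵥ toReal (X j.1)) ↔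
      ∀ j : ι, w ⬝ᵥ toReal (X (flip b i.1)) ≤ w ⬝ᵥ toReal (X (flip b j.1)) := by
    intro w i
    simp only [hX, sub_le_sub_iff_right]
    set W := w 0 • toReal c + w 1 • toReal d
    have e1 := hD.min_facet_iff i.2.1 i.2.2 W
    have e2 := hD.min_facet_iff (hflip i) (u := -b) (Finset.mem_insert_self _ _) W
    have e3 : (∀ a ∈ i.1, a ≠ b → 0 ≤ W ⬝ᵥ toReal (dualv i.1 a)) ↔
        ∀ a ∈ flip b i.1, a ≠ -b → 0 ≤ W ⬝ᵥ toReal (dualv (flip b i.1) a) := by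
      constructor
      · intro hh a ha hab
        have ha' := Finset.mem_erase.mp ((Finset.mem_insert.mp ha).resolve_left hab)
        rw [hD.dualv_flip i.2.1 i.2.2 (hflip i) ha'.2 ha'.1]
        exact hh a ha'.2 ha'.1
      · intro hh a ha hab
        rw [← hD.dualv_flip i.2.1 i.2.2 (hflip i) ha hab]
        refine hh a (Finset.mem_insert_of_mem (Finset.mem_erase.mpr ⟨hab, ha⟩)) ?_
        rintro rfl
        exact hD.neg_notMem i.2.1 i.2.2 ha
    constructor
    · intro hh j
      exact e2.mpr (e3.mp (e1.mp fun t ht hbt => hh ⟨t, ht, hbt⟩)) _ (hflip j)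
        (Finset.mem_insert_self _ _)
    · intro hh j
      refine e1.mpr (e3.mpr (e2.mp fun t ht hbt => ?_)) _ j.2.1 j.2.2
      have hT := hD.flip_mem hall' ht hbt
      have := hh ⟨flip (-b) t, hT, by rw [flip, neg_neg]; exact Finset.mem_insert_self _ _⟩
      have h2 := hD.flip_flip ht hbt
      rw [neg_neg] at h2
      rwa [h2] at this
  set H : ℤ := -h b - h (-b) with hH
  have hHs : ∀ t ∈ T, -b ∈ t → b ⬝ᵥ vert h t - h b = H := fun t ht hbt => by
    have := hD.dot ht hbt
    rw [neg_dotProduct] at this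
    omega
  have hHpos : 1 ≤ H := by
    rw [← hHs _ (hflip ⟨_, ht₀, hbt₀⟩) (Finset.mem_insert_self _ _)]
    refine hD.slack_pos (hflip _) hb ?_
    intro hbf
    have := hD.neg_notMem (hflip ⟨_, ht₀, hbt₀⟩) hbf
    exact this (Finset.mem_insert_self _ _)
  obtain ⟨s, hs⟩ := Int.eq_ofNat_of_zero_le (show 0 ≤ H by omega)
  -- One argument serves both facets, with `Y` the identity or `flip b`: the images of the two
  -- neighbours of the base corner lie on the two coordinate axes through its image, so the polygon
  -- is two-dimensional.
  have hlat : ∀ Y : Finset Lat → Finset Lat, (∀ t ∈ T, b ∈ t → Y t ∈ T ∧ (∀ a ∈ t, a ≠ b → a ∈ Y t) ∧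
      (∀ t' ∈ T, b ∈ t' → ∀ a ∈ t, a ≠ b → a ∉ t' → a ∉ Y t')) →
      IsLatticePolytope (convexHull ℝ (Set.range fun i : ι => toReal (X (Y i.1)))) := by
    intro Y hY
    have hr : (Set.range fun i : ι => toReal (X (Y i.1))) =
        toReal '' (Set.range fun i : ι => X (Y i.1)) := by
      rw [← Set.range_comp]; rfl
    rw [hr]
    obtain ⟨c', hc', hTc⟩ := hD.exists_nbr ht₀ (u := c) (by simp)
    obtain ⟨d', hd', hTd⟩ := hD.exists_nbr ht₀ (u := d) (by simp)
    have mc : c ∈ ({c, d, b} : Finset Lat) := by simp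
    have md : d ∈ ({c, d, b} : Finset Lat) := by simp
    have bc : b ∈ insert c' (({c, d, b} : Finset Lat).erase c) :=
      Finset.mem_insert_of_mem (Finset.mem_erase.mpr ⟨hcb.symm, hbt₀⟩)
    have bd : b ∈ insert d' (({c, d, b} : Finset Lat).erase d) :=
      Finset.mem_insert_of_mem (Finset.mem_erase.mpr ⟨hdb.symm, hbt₀⟩)
    have dc : d ∈ insert c' (({c, d, b} : Finset Lat).erase c) :=
      Finset.mem_insert_of_mem (Finset.mem_erase.mpr ⟨hcd.symm, md⟩)
    have cd : c ∈ insert d' (({c, d, b} : Finset Lat).erase d) :=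
      Finset.mem_insert_of_mem (Finset.mem_erase.mpr ⟨hcd, mc⟩)
    have nc : c ∉ insert c' (({c, d, b} : Finset Lat).erase c) := by
      intro hcc
      rcases Finset.mem_insert.mp hcc with rfl | hcc
      · exact hc' mc
      · exact (Finset.mem_erase.mp hcc).1 rfl
    have nd : d ∉ insert d' (({c, d, b} : Finset Lat).erase d) := by
      intro hdd
      rcases Finset.mem_insert.mp hdd with rfl | hdd
      · exact hd' md
      · exact (Finset.mem_erase.mp hdd).1 rfl
    obtain ⟨y0, y1, -⟩ := hY _ ht₀ hbt₀
    obtain ⟨yc, yc1, -⟩ := hY _ hTc bc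
    obtain ⟨yd, yd1, -⟩ := hY _ hTd bd
    have yc2 := (hY _ ht₀ hbt₀).2.2 _ hTc bc c mc hcb nc
    have yd2 := (hY _ ht₀ hbt₀).2.2 _ hTd bd d md hdb nd
    have zero : ∀ t ∈ T, ∀ a ∈ t, a ⬝ᵥ vert h t - h a = 0 := fun t ht a ha =>
      sub_eq_zero.mpr (hD.dot ht ha)
    refine isLatticePolytope_of_corner (Set.finite_range _) (p := X (Y {c, d, b}))
      ⟨⟨_, ht₀, hbt₀⟩, rfl⟩ (l := c ⬝ᵥ vert h (Y (insert c' (({c, d, b} : Finset Lat).erase c))) - h c)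
      (m := d ⬝ᵥ vert h (Y (insert d' (({c, d, b} : Finset Lat).erase d))) - h d) ?_ ?_ ?_ ?_
    · have := hD.slack_pos yc (hD.mem_rays ht₀ mc) yc2
      omega
    · have := hD.slack_pos yd (hD.mem_rays ht₀ md) yd2
      omega
    · refine ⟨⟨_, hTc, bc⟩, ?_⟩
      simp only [X, zero _ y0 c (y1 c mc hcb), zero _ y0 d (y1 d md hdb), zero _ yc d (yc1 d dc hdb)]
      simp
    · refine ⟨⟨_, hTd, bd⟩, ?_⟩
      simp only [X, zero _ y0 c (y1 c mc hcb), zero _ y0 d (y1 d md hdb), zero _ yd c (yd1 c cd hcb)]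
      simp
  refine ⟨s, _, _, by omega, hlat id fun t ht hbt => ⟨ht, fun a ha _ => ha,
    fun t' _ _ a _ _ hat' => hat'⟩, hlat (flip b) fun t ht hbt => ⟨hD.flip_mem hall ht hbt,
      fun a ha hab => Finset.mem_insert_of_mem (Finset.mem_erase.mpr ⟨hab, ha⟩),
      fun t' ht' hbt' a ha hab hat' hf => ?_⟩, ?_, ?_⟩
  · rcases Finset.mem_insert.mp hf with rfl | hf
    · exact hD.neg_notMem ht hbt ha
    · exact hat' (Finset.mem_of_mem_erase hf)
  · exact Set.Subset.antisymm (normalFan_convexHull_subset hv)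
      (normalFan_convexHull_subset fun w i => (hv w i).symm)
  · refine (hD.iso_coords ht₀).trans ?_
    have hvec : (![convexHull ℝ (Set.range fun i : ι => toReal (X (id i.1))),
        convexHull ℝ (Set.range fun i : ι => toReal (X (flip b i.1)))] :
          Fin 2 → Set (Fin 2 → ℝ)) = fun i : Fin 2 => convexHull ℝ
          ((![Set.range fun i : ι => toReal (X (id i.1)),
            Set.range fun i : ι => toReal (X (flip b i.1))] : Fin 2 → Set (Fin 2 → ℝ)) i) := by
      ext i : 1
      fin_cases i <;> rfl
    rw [hvec, cayley_convexHull]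
    have hset : toReal '' (((T.image fun t => (![c ⬝ᵥ vert h t - h c, d ⬝ᵥ vert h t - h d,
        b ⬝ᵥ vert h t - h b] : Lat)) : Finset Lat) : Set Lat) =
        ⋃ i : Fin 2, (fun p : Fin 2 → ℝ => (Fin.append p ((s : ℝ) • (Fin.cons 0
        (fun j => Pi.single j 1) : Fin 2 → Fin 1 → ℝ) i) : Fin 3 → ℝ)) ''
        (![Set.range fun i : ι => toReal (X (id i.1)),
            Set.range fun i : ι => toReal (X (flip b i.1))] : Fin 2 → Set (Fin 2 → ℝ)) i := by
      have a0 : ∀ t, b ⬝ᵥ vert h t - h b = 0 → (Fin.append (toReal (X t)) ((s : ℝ) • (Fin.cons 0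
        (fun j => Pi.single j 1) : Fin 2 → Fin 1 → ℝ) 0) : Fin 3 → ℝ) =
          toReal (![c ⬝ᵥ vert h t - h c, d ⬝ᵥ vert h t - h d, b ⬝ᵥ vert h t - h b] : Lat) := by
        intro t ht
        rw [ht]
        ext i
        fin_cases i <;> simp [Fin.append, Fin.addCases, toReal, X]
      have a1 : ∀ t, b ⬝ᵥ vert h t - h b = s → (Fin.append (toReal (X t)) ((s : ℝ) • (Fin.cons 0
        (fun j => Pi.single j 1) : Fin 2 → Fin 1 → ℝ) 1) : Fin 3 → ℝ) =
          toReal (![c ⬝ᵥ vert h t - h c, d ⬝ᵥ vert h t - h d, b ⬝ᵥ vert h t - h b] : Lat) := by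
        intro t ht
        rw [ht]
        ext i
        fin_cases i <;> simp [Fin.append, Fin.addCases, toReal, X]
      ext y
      simp only [Set.mem_image, Finset.mem_coe, Finset.mem_image, Set.mem_iUnion]
      constructor
      · rintro ⟨_, ⟨t, ht, rfl⟩, rfl⟩
        rcases hall t ht with hbt | hbt
        · exact ⟨0, _, ⟨⟨t, ht, hbt⟩, rfl⟩, a0 t (sub_eq_zero.mpr (hD.dot ht hbt))⟩
        · refine ⟨1, _, ⟨⟨flip (-b) t, hD.flip_mem hall' ht hbt, ?_⟩, rfl⟩, ?_⟩
          · rw [flip, neg_neg]; exact Finset.mem_insert_self _ _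
          · have h2 := hD.flip_flip ht hbt
            rw [neg_neg] at h2
            simp only [h2]
            exact a1 t (by rw [hHs t ht hbt, hs])
      · rintro ⟨i, p, hp, rfl⟩
        fin_cases i
        · obtain ⟨j, rfl⟩ := hp
          exact ⟨_, ⟨j.1, j.2.1, rfl⟩, (a0 _ (sub_eq_zero.mpr (hD.dot j.2.1 j.2.2))).symm⟩
        · obtain ⟨j, rfl⟩ := hp
          refine ⟨_, ⟨_, hflip j, rfl⟩, (a1 _ ?_).symm⟩
          rw [hHs _ (hflip j) (Finset.mem_insert_self _ _), hs]
    rw [hset]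
    exact Iso.refl _

end IsData

/-! ### Combinatorial types and their computation with lists -/

/-- The fan with maximal cones `T` has the combinatorial type `L`. -/
def HasType {n : ℕ} (L : Finset (Finset (Fin n))) (T : Finset (Finset Lat)) : Prop :=
  ∃ ρ : Fin n → Lat, Function.Injective ρ ∧ T = relabel ρ L

lemma HasType.of_relabel {n : ℕ} {L : Finset (Finset (Fin n))} {T : Finset (Finset Lat)}
    {f : Fin n → Fin n} (hf : Function.Injective f) (hT : HasType (relabel f L) T) :
    HasType L T := by
  obtain ⟨ρ, hρ, rfl⟩ := hT
  exact ⟨ρ ∘ f, hρ.comp hf, relabel_relabel _ _ _⟩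

/-- The stellar subdivision of a labelled complex; the new vertex gets the last label. -/
def ext {n : ℕ} (L : Finset (Finset (Fin n))) (s : Finset (Fin n)) : Finset (Finset (Fin (n + 1))) :=
  stel (relabel Fin.castSucc L) (s.image Fin.castSucc) (Fin.last n)

lemma relabel_snoc {n : ℕ} (L : Finset (Finset (Fin n))) (s : Finset (Fin n)) {ρ : Fin n → Lat}
    (hρ : Function.Injective ρ) {p : Lat} (hp : ∀ i, ρ i ≠ p) :
    Function.Injective (Fin.snoc ρ p : Fin (n + 1) → Lat) ∧
    stel (relabel ρ L) (s.image ρ) p = relabel (Fin.snoc ρ p : Fin (n + 1) → Lat) (ext L s) := by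
  have hinj : Function.Injective (Fin.snoc ρ p : Fin (n + 1) → Lat) :=
    Fin.snoc_injective_of_injective hρ fun ⟨i, hi⟩ => hp i hi
  have hc : (Fin.snoc ρ p : Fin (n + 1) → Lat) ∘ Fin.castSucc = ρ := by
    ext i : 1
    simp
  refine ⟨hinj, ?_⟩
  rw [ext, ← stel_relabel hinj, relabel_relabel, hc, Finset.image_image, hc, Fin.snoc_last]

lemma rays_relabel_univ {n : ℕ} {L : Finset (Finset (Fin n))} (hL : rays L = Finset.univ)
    (ρ : Fin n → Lat) (i : Fin n) : ρ i ∈ rays (relabel ρ L) := by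
  rw [rays_relabel, hL]
  exact Finset.mem_image_of_mem _ (Finset.mem_univ i)

lemma HasType.stel {n : ℕ} {L : Finset (Finset (Fin n))} {T : Finset (Finset Lat)} {h : Lat → ℤ}
    (hD : IsData T h) (hL : rays L = Finset.univ) (hT : HasType L T) {σ : Finset Lat}
    (hσ : σ ∈ cplx T) (h2 : 2 ≤ σ.card) :
    ∃ s ∈ cplx L, 2 ≤ s.card ∧ HasType (ext L s) (stel T σ (∑ u ∈ σ, u)) := by
  obtain ⟨ρ, hρ, rfl⟩ := hT
  have hp := hD.sum_notMem_rays hσ h2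
  rw [cplx_relabel] at hσ
  obtain ⟨s, hs, rfl⟩ := Finset.mem_image.mp hσ
  rw [Finset.card_image_of_injective _ hρ] at h2
  obtain ⟨h3, h4⟩ := relabel_snoc L s hρ (p := ∑ u ∈ s.image ρ, u)
    fun i hi => hp (hi ▸ rays_relabel_univ hL ρ i)
  exact ⟨s, hs, h2, _, h3, h4⟩

/-- The complex whose triangles are given by lists. -/
def fin {α : Type*} [DecidableEq α] (L : List (List α)) : Finset (Finset α) :=
  (L.map List.toFinset).toFinset

section Lists
variable {α β : Type*} [DecidableEq α] [DecidableEq β]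

lemma mem_fin {L : List (List α)} {t : Finset α} : t ∈ fin L ↔ ∃ l ∈ L, l.toFinset = t := by
  simp [fin]

/-- The two lists have the same elements. -/
def eqv (t t' : List α) : Bool := t.all (fun x => t'.contains x) && t'.all fun x => t.contains x

lemma eqv_iff {t t' : List α} : eqv t t' = true ↔ t.toFinset = t'.toFinset := by
  simp only [eqv, Bool.and_eq_true, List.all_eq_true, List.contains_iff_mem]
  rw [Finset.Subset.antisymm_iff]
  simp [Finset.subset_iff]

/-- The two lists of lists describe the same complex. -/
def same (L L' : List (List α)) : Bool :=
  (L.all fun t => L'.any fun t' => eqv t t') && L'.all fun t' => L.any fun t => eqv t t'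

lemma fin_eq_of_same {L L' : List (List α)} (h : same L L' = true) : fin L = fin L' := by
  simp only [same, Bool.and_eq_true, List.all_eq_true, List.any_eq_true, eqv_iff] at h
  ext t
  simp only [mem_fin]
  constructor
  · rintro ⟨l, hl, rfl⟩
    obtain ⟨l', hl', he⟩ := h.1 l hl
    exact ⟨l', hl', he.symm⟩
  · rintro ⟨l, hl, rfl⟩
    obtain ⟨l', hl', he⟩ := h.2 l hl
    exact ⟨l', hl', he⟩

lemma relabel_fin (f : α → β) (L : List (List α)) :
    relabel f (fin L) = fin (L.map fun t => t.map f) := by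
  ext t
  simp only [mem_relabel, mem_fin, List.mem_map]
  constructor
  · rintro ⟨_, ⟨l, hl, rfl⟩, rfl⟩
    exact ⟨_, ⟨l, hl, rfl⟩, by ext; simp⟩
  · rintro ⟨_, ⟨l, hl, rfl⟩, rfl⟩
    exact ⟨_, ⟨l, hl, rfl⟩, by ext; simp⟩

/-- The list version of `ext`. -/
def lext {n : ℕ} (L : List (List (Fin n))) (s : List (Fin n)) : List (List (Fin (n + 1))) :=
  L.flatMap fun t => if s.all fun x => t.contains x then
    s.map fun u => t.map fun x => if x = u then Fin.last n else x.castSucc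
    else [t.map Fin.castSucc]

lemma ext_fin {n : ℕ} (L : List (List (Fin n))) (s : List (Fin n)) :
    ext (fin L) s.toFinset = fin (lext L s) := by
  have hsub : ∀ t : List (Fin n), (s.toFinset.image Fin.castSucc ⊆
      t.toFinset.image Fin.castSucc) ↔ (s.all fun x => t.contains x) = true := by
    intro t
    rw [Finset.image_subset_image_iff (Fin.castSucc_injective n)]
    simp [Finset.subset_iff]
  have hrep : ∀ (t : List (Fin n)) (u : Fin n), u ∈ t →
      (t.map fun x => if x = u then Fin.last n else x.castSucc).toFinset =
        insert (Fin.last n) ((t.toFinset.image Fin.castSucc).erase u.castSucc) := by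
    intro t u hu
    ext x
    simp only [List.mem_toFinset, List.mem_map, Finset.mem_insert, Finset.mem_erase,
      Finset.mem_image]
    constructor
    · rintro ⟨y, hy, rfl⟩
      by_cases h : y = u
      · simp [h]
      · right
        rw [if_neg h]
        exact ⟨fun hh => h (Fin.castSucc_injective n hh), y, hy, rfl⟩
    · rintro (rfl | ⟨hx, y, hy, rfl⟩)
      · exact ⟨u, hu, by simp⟩
      · exact ⟨y, hy, if_neg fun hh => hx (by rw [hh])⟩
  have hmap : ∀ t : List (Fin n), (t.map Fin.castSucc).toFinset = t.toFinset.image Fin.castSucc :=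
    fun t => by ext; simp
  ext t
  rw [ext, mem_stel, mem_fin]
  simp only [mem_relabel, mem_fin, lext, List.mem_flatMap]
  constructor
  · rintro (⟨⟨_, ⟨l, hl, rfl⟩, rfl⟩, hs⟩ | ⟨_, ⟨_, ⟨l, hl, rfl⟩, rfl⟩, hs, u, hu, rfl⟩)
    · rw [hsub] at hs
      exact ⟨_, ⟨l, hl, by rw [if_neg hs]; exact List.mem_singleton.mpr rfl⟩, hmap l⟩
    · rw [hsub] at hs
      obtain ⟨w, hw, rfl⟩ := Finset.mem_image.mp hu
      have hwl : w ∈ l := by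
        have := List.all_eq_true.mp hs w (List.mem_toFinset.mp hw)
        simpa using this
      exact ⟨_, ⟨l, hl, by rw [if_pos hs]; exact List.mem_map.mpr ⟨w, List.mem_toFinset.mp hw, rfl⟩⟩,
        hrep l w hwl⟩
  · rintro ⟨l', ⟨l, hl, hl'⟩, rfl⟩
    split_ifs at hl' with hs
    · obtain ⟨w, hw, rfl⟩ := List.mem_map.mp hl'
      have hwl : w ∈ l := by
        have := List.all_eq_true.mp hs w hw
        simpa using this
      exact Or.inr ⟨_, ⟨_, ⟨l, hl, rfl⟩, rfl⟩, (hsub l).mpr hs, _,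
        Finset.mem_image_of_mem _ (List.mem_toFinset.mpr hw), hrep l w hwl⟩
    · rw [List.mem_singleton.mp hl']
      exact Or.inl ⟨⟨_, ⟨l, hl, rfl⟩, (hmap l).symm⟩, by rw [hmap, hsub]; exact hs⟩

lemma exists_sublist_of_mem_cplx {L : List (List α)} {s : Finset α} (hs : s ∈ cplx (fin L)) :
    ∃ t ∈ L, ∃ l ∈ t.sublists', s = l.toFinset := by
  obtain ⟨_, ht, hst⟩ := mem_cplx.mp hs
  obtain ⟨t, ht', rfl⟩ := mem_fin.mp ht
  refine ⟨t, ht', t.filter (fun x => decide (x ∈ s)), List.mem_sublists'.mpr List.filter_sublist, ?_⟩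
  ext x
  simp only [List.mem_toFinset, List.mem_filter, decide_eq_true_eq]
  exact ⟨fun h => ⟨List.mem_toFinset.mp (hst h), h⟩, fun h => h.2⟩

/-- The list version of `deg`. -/
def ldeg (L : List (List α)) (u : α) : ℕ := (L.filter fun t => t.contains u).length

/-- The triangles in the list are distinct. -/
def ldistinct : List (List α) → Bool
  | [] => true
  | t :: L => (L.all fun t' => !eqv t t') && ldistinct L

lemma nodup_of_ldistinct : ∀ {L : List (List α)}, ldistinct L = true →
    (L.map List.toFinset).Nodup
  | [], _ => by simp
  | t :: L, h => by
    simp only [ldistinct, Bool.and_eq_true, List.all_eq_true] at h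
    simp only [List.map_cons, List.nodup_cons]
    refine ⟨fun hm => ?_, nodup_of_ldistinct h.2⟩
    obtain ⟨t', ht', he⟩ := List.mem_map.mp hm
    have := h.1 t' ht'
    rw [Bool.not_eq_true', Bool.eq_false_iff, Ne, eqv_iff] at this
    exact this he.symm

lemma deg_fin {L : List (List α)} (h : ldistinct L = true) (u : α) : deg (fin L) u = ldeg L u := by
  have hn := nodup_of_ldistinct h
  have he : (fin L).filter (fun t => u ∈ t) =
      ((L.map List.toFinset).filter fun t => decide (u ∈ t)).toFinset := by
    ext t; simp [fin]
  rw [deg, he, List.toFinset_card_of_nodup (hn.filter _), ldeg, List.filter_map, List.length_map]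
  congr 1
  refine List.filter_congr fun t _ => ?_
  simp

lemma card_fin {L : List (List α)} (h : ldistinct L = true) : (fin L).card = L.length := by
  rw [fin, List.toFinset_card_of_nodup (nodup_of_ldistinct h), List.length_map]

end Lists

/-! ### Polytopes with five facets are triangular prisms -/

def triples5 : List (List (Fin 5)) :=
  [[0, 1, 2], [0, 1, 3], [0, 1, 4], [0, 2, 3], [0, 2, 4], [0, 3, 4], [1, 2, 3], [1, 2, 4],
    [1, 3, 4], [2, 3, 4]]

/-- A set of triangles on five points meeting every edge evenly is a 2-cycle modulo 2, hence a sum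
of boundaries of tetrahedra. Up to complement this sum is zero, one boundary, which misses a point,
or the sum of two; in the last case the triangles are those containing exactly one of two apexes. -/
lemma parity_solution : ∀ b012 b013 b014 b023 b024 b034 b123 b124 b134 b234 : Bool,
    (b012 ^^ b013 ^^ b014) = false → (b012 ^^ b023 ^^ b024) = false →
    (b013 ^^ b023 ^^ b034) = false → (b014 ^^ b024 ^^ b034) = false →
    (b012 ^^ b123 ^^ b124) = false → (b013 ^^ b123 ^^ b134) = false →
    (b014 ^^ b124 ^^ b134) = false → (b023 ^^ b123 ^^ b234) = false →
    (b024 ^^ b124 ^^ b234) = false → (b034 ^^ b134 ^^ b234) = false →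
    (b012 || b013 || b014 || b023 || b024 || b034) = true →
    (b012 || b013 || b014 || b123 || b124 || b134) = true →
    (b012 || b023 || b024 || b123 || b124 || b234) = true →
    (b013 || b023 || b034 || b123 || b134 || b234) = true →
    (b014 || b024 || b034 || b124 || b134 || b234) = true →
    ∃ i j : Fin 5, i ≠ j ∧ [b012, b013, b014, b023, b024, b034, b123, b124, b134, b234] =
      triples5.map fun t => t.contains i ^^ t.contains j := by
  decide +kernel

/-- The labelling of `Fin 5` with apexes `i` and `j`. -/
def apexMap (i j : Fin 5) : Fin 5 → Fin 5 := fun x =>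
  (((List.finRange 5).filter fun y => y != i && y != j) ++ [i, j]).getD x 0

/-- The fan is a bipyramid: 0, 1, 2 are the side facets of the prism, and 3, 4 its triangular bases.
-/
def lprism : List (List (Fin 5)) :=
  [[0, 1, 3], [0, 2, 3], [1, 2, 3], [0, 1, 4], [0, 2, 4], [1, 2, 4]]

lemma apexMap_spec : ∀ i j : Fin 5, i ≠ j → Function.Injective (apexMap i j) ∧
    same (lprism.map fun t => t.map (apexMap i j))
      (triples5.filter fun t => t.contains i ^^ t.contains j) = true := by
  decide +kernel

lemma mem_triples5 : ∀ s : Finset (Fin 5), s.card = 3 → ∃ l ∈ triples5, l.toFinset = s := by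
  decide +kernel

namespace IsData
variable {T : Finset (Finset Lat)} {h : Lat → ℤ}

lemma edge_two (hD : IsData T h) {i j k l m : Lat} (hn : [i, j, k, l, m].Nodup)
    (hr : ∀ x ∈ rays T, x ∈ [i, j, k, l, m]) (ht : {i, j, k} ∈ T) :
    ({i, j, l} ∈ T ∧ {i, j, m} ∉ T) ∨ ({i, j, l} ∉ T ∧ {i, j, m} ∈ T) := by
  simp only [List.nodup_cons, List.mem_cons, List.not_mem_nil, or_false, not_or] at hn
  obtain ⟨⟨ij, ik, il, im⟩, ⟨jk, jl, jm⟩, ⟨kl, km⟩, lm, -⟩ := hn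
  have he : ∀ x, insert x (({i, j, k} : Finset Lat).erase k) = {i, j, x} := by
    intro x
    ext y
    simp only [Finset.mem_insert, Finset.mem_erase, Finset.mem_singleton]
    constructor
    · rintro (rfl | ⟨h1, h2⟩) <;> tauto
    · rintro (rfl | rfl | rfl)
      · exact Or.inr ⟨ik, by simp⟩
      · exact Or.inr ⟨jk, by simp⟩
      · simp
  obtain ⟨x, hx, hT⟩ := hD.exists_nbr ht (u := k) (by simp)
  have hxr := hr x (hD.mem_rays hT (Finset.mem_insert_self _ _))
  have uniq : ∀ y, y ∉ ({i, j, k} : Finset Lat) → {i, j, y} ∈ T → x = y := fun y hy hy' =>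
    hD.nbr_unique ht (u := k) (by simp) hx hT hy (by rwa [he])
  rw [he] at hT
  simp only [Finset.mem_insert, Finset.mem_singleton, not_or] at hx
  simp only [List.mem_cons, List.not_mem_nil, or_false] at hxr
  rcases hxr with rfl | rfl | rfl | rfl | rfl
  · exact absurd rfl hx.1
  · exact absurd rfl hx.2.1
  · exact absurd rfl hx.2.2
  · exact Or.inl ⟨hT, fun h => lm (uniq _ (by simp [Ne.symm im, Ne.symm jm, Ne.symm km]) h)⟩
  · exact Or.inr ⟨fun h => lm (uniq _ (by simp [Ne.symm il, Ne.symm jl, Ne.symm kl]) h).symm, hT⟩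

theorem hasType_prism (hD : IsData T h) (h5 : (rays T).card = 5) : HasType (fin lprism) T := by
  classical
  let e := ((rays T).equivFinOfCardEq h5).symm
  let ρ : Fin 5 → Lat := fun i => (e i : Lat)
  have hρ : Function.Injective ρ := Subtype.val_injective.comp e.injective
  have hsurj : ∀ x ∈ rays T, ∃ i, ρ i = x := fun x hx => ⟨e.symm ⟨x, hx⟩, by simp [ρ]⟩
  let b : List (Fin 5) → Bool := fun t => decide (t.toFinset.image ρ ∈ T)
  have b3 : ∀ i j k, b [i, j, k] = true ↔ {ρ i, ρ j, ρ k} ∈ T := fun i j k => by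
    simp [b, Finset.image_insert]
  have hedge : ∀ i j k l m : Fin 5, [i, j, k, l, m].Nodup → b [i, j, k] = true →
      (b [i, j, l] ^^ b [i, j, m]) = true := by
    intro i j k l m hn hb
    have hn' : [ρ i, ρ j, ρ k, ρ l, ρ m].Nodup := hn.map hρ
    have hall : ∀ x : Fin 5, x ∈ [i, j, k, l, m] := by
      have hc : [i, j, k, l, m].toFinset = Finset.univ := by
        rw [← Finset.card_eq_iff_eq_univ, List.toFinset_card_of_nodup hn]; rfl
      intro x
      rw [← List.mem_toFinset, hc]
      exact Finset.mem_univ x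
    have := hD.edge_two hn' (fun x hx => by
      obtain ⟨y, rfl⟩ := hsurj x hx
      exact List.mem_map_of_mem (f := ρ) (hall y)) ((b3 i j k).mp hb)
    rw [← b3, ← b3] at this
    rcases this with ⟨h1, h2⟩ | ⟨h1, h2⟩
    · simp [h1, Bool.eq_false_iff.mpr h2]
    · simp [h2, Bool.eq_false_iff.mpr h1]
  have perm1 : ∀ i j k, b [i, j, k] = b [i, k, j] := fun i j k => by
    rw [Bool.eq_iff_iff, b3, b3, Finset.pair_comm]
  have perm2 : ∀ i j k, b [i, j, k] = b [j, i, k] := fun i j k => by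
    rw [Bool.eq_iff_iff, b3, b3, Finset.insert_comm]
  -- A triangle on an edge has exactly one partner, so each edge lies in none or two of the
  -- triangles.
  have hpar : ∀ i j k l m : Fin 5, [i, j, k, l, m].Nodup →
      (b [i, j, k] ^^ b [i, j, l] ^^ b [i, j, m]) = false := by
    intro i j k l m hn
    have h1 := hedge i j k l m hn
    have h2 := hedge i j l k m (by
      revert hn; simp only [List.nodup_cons, List.mem_cons, List.not_mem_nil]; tauto)
    have h3 := hedge i j m k l (by
      revert hn; simp only [List.nodup_cons, List.mem_cons, List.not_mem_nil]; tauto)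
    revert h1 h2 h3
    generalize b [i, j, k] = x
    generalize b [i, j, l] = y
    generalize b [i, j, m] = z
    revert x y z
    decide
  have hT : T = relabel ρ (fin (triples5.filter b)) := by
    ext t
    simp only [mem_relabel, mem_fin, List.mem_filter]
    constructor
    · intro ht
      let s := Finset.univ.filter fun i => ρ i ∈ t
      have hs : s.image ρ = t := by
        ext x
        simp only [s, Finset.mem_image, Finset.mem_filter, Finset.mem_univ, true_and]
        constructor
        · rintro ⟨i, hi, rfl⟩; exact hi
        · intro hx
          obtain ⟨i, rfl⟩ := hsurj x (hD.mem_rays ht hx)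
          exact ⟨i, hx, rfl⟩
      have hc : s.card = 3 := by
        rw [← hD.card ht, ← hs, Finset.card_image_of_injective _ hρ]
      obtain ⟨l, hl, hls⟩ := mem_triples5 s hc
      exact ⟨s, ⟨l, ⟨hl, by simp only [b, hls, hs]; simpa using ht⟩, hls⟩, hs⟩
    · rintro ⟨_, ⟨l, ⟨-, hb⟩, rfl⟩, rfl⟩
      simpa [b] using hb
  have hused : ∀ i : Fin 5, ∃ l ∈ triples5, b l = true ∧ i ∈ l := by
    intro i
    obtain ⟨t, ht, hit⟩ := SmoothPolytope.mem_rays.mp (e i).2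
    rw [hT] at ht
    simp only [mem_relabel, mem_fin, List.mem_filter] at ht
    obtain ⟨_, ⟨l, ⟨hl, hb⟩, rfl⟩, rfl⟩ := ht
    obtain ⟨j, hj, hji⟩ := Finset.mem_image.mp hit
    have : j = i := hρ hji
    exact ⟨l, hl, hb, this ▸ List.mem_toFinset.mp hj⟩
  have hany : ∀ i : Fin 5, (triples5.filter fun l => l.contains i).any b = true := fun i => by
    obtain ⟨l, hl, hb, hi⟩ := hused i
    exact List.any_eq_true.mpr ⟨l, List.mem_filter.mpr ⟨hl, by simpa using hi⟩, hb⟩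
  have f0 : (triples5.filter fun l => l.contains 0) =
    [[0, 1, 2], [0, 1, 3], [0, 1, 4], [0, 2, 3], [0, 2, 4], [0, 3, 4]] := by decide
  have f1 : (triples5.filter fun l => l.contains 1) =
    [[0, 1, 2], [0, 1, 3], [0, 1, 4], [1, 2, 3], [1, 2, 4], [1, 3, 4]] := by decide
  have f2 : (triples5.filter fun l => l.contains 2) =
    [[0, 1, 2], [0, 2, 3], [0, 2, 4], [1, 2, 3], [1, 2, 4], [2, 3, 4]] := by decide
  have f3 : (triples5.filter fun l => l.contains 3) =
    [[0, 1, 3], [0, 2, 3], [0, 3, 4], [1, 2, 3], [1, 3, 4], [2, 3, 4]] := by decide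
  have f4 : (triples5.filter fun l => l.contains 4) =
    [[0, 1, 4], [0, 2, 4], [0, 3, 4], [1, 2, 4], [1, 3, 4], [2, 3, 4]] := by decide
  obtain ⟨i, j, hij, hsol⟩ := parity_solution (b [0, 1, 2]) (b [0, 1, 3]) (b [0, 1, 4]) (b [0, 2, 3])
    (b [0, 2, 4]) (b [0, 3, 4]) (b [1, 2, 3]) (b [1, 2, 4]) (b [1, 3, 4]) (b [2, 3, 4])
    (hpar 0 1 2 3 4 (by decide))
    (by rw [perm1 0 1 2]; exact hpar 0 2 1 3 4 (by decide))
    (by rw [perm1 0 1 3, perm1 0 2 3]; exact hpar 0 3 1 2 4 (by decide))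
    (by rw [perm1 0 1 4, perm1 0 2 4, perm1 0 3 4]; exact hpar 0 4 1 2 3 (by decide))
    (by rw [perm2 0 1 2, perm1 1 0 2]; exact hpar 1 2 0 3 4 (by decide))
    (by rw [perm2 0 1 3, perm1 1 0 3, perm1 1 2 3]; exact hpar 1 3 0 2 4 (by decide))
    (by rw [perm2 0 1 4, perm1 1 0 4, perm1 1 2 4, perm1 1 3 4]; exact hpar 1 4 0 2 3 (by decide))
    (by rw [perm2 0 2 3, perm1 2 0 3, perm2 1 2 3, perm1 2 1 3]; exact hpar 2 3 0 1 4 (by decide))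
    (by rw [perm2 0 2 4, perm1 2 0 4, perm2 1 2 4, perm1 2 1 4, perm1 2 3 4]
        exact hpar 2 4 0 1 3 (by decide))
    (by rw [perm2 0 3 4, perm1 3 0 4, perm2 1 3 4, perm1 3 1 4, perm2 2 3 4, perm1 3 2 4]
        exact hpar 3 4 0 1 2 (by decide))
    (by rw [← hany 0, f0]; simp only [List.any, Bool.or_assoc, Bool.or_false])
    (by rw [← hany 1, f1]; simp only [List.any, Bool.or_assoc, Bool.or_false])
    (by rw [← hany 2, f2]; simp only [List.any, Bool.or_assoc, Bool.or_false])
    (by rw [← hany 3, f3]; simp only [List.any, Bool.or_assoc, Bool.or_false])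
    (by rw [← hany 4, f4]; simp only [List.any, Bool.or_assoc, Bool.or_false])
  have hfil : triples5.filter b = triples5.filter fun t => t.contains i ^^ t.contains j := by
    refine List.filter_congr ?_
    exact List.map_inj_left.mp (by rw [← hsol]; rfl)
  obtain ⟨hinj, hsame⟩ := apexMap_spec i j hij
  refine HasType.of_relabel hinj ⟨ρ, hρ, ?_⟩
  rw [hT, hfil, ← fin_eq_of_same hsame, ← relabel_fin]

end IsData

/-! ### Enumeration of the iterated blow-ups -/

/-- The map given by a list of values. -/
def listMap {n : ℕ} (p : List (Fin (n + 1))) : Fin (n + 1) → Fin (n + 1) := fun i => p.getD i 0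

/-- The relabelling `p` maps `X` to `L`. -/
def isIso {n : ℕ} (X L : List (List (Fin (n + 1)))) (p : List (Fin (n + 1))) : Bool :=
  same (X.map fun t => t.map (listMap p)) L && decide (Function.Injective (listMap p))

lemma HasType.of_isIso {n : ℕ} {X L : List (List (Fin (n + 1)))} {p : List (Fin (n + 1))}
    (hp : isIso X L p = true) {T : Finset (Finset Lat)} (hT : HasType (fin L) T) :
    HasType (fin X) T := by
  simp only [isIso, Bool.and_eq_true, decide_eq_true_eq] at hp
  refine HasType.of_relabel hp.2 ?_
  rwa [relabel_fin, fin_eq_of_same hp.1]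

/-- The faces of dimension at least one, with repetitions. -/
def faces {α : Type*} (L : List (List α)) : List (List α) :=
  (L.flatMap fun t => t.sublists').filter fun s => decide (2 ≤ s.length)

lemma HasType.lext {n : ℕ} {L : List (List (Fin n))} (hL : rays (fin L) = Finset.univ)
    {T : Finset (Finset Lat)} {h : Lat → ℤ} (hD : IsData T h) (hT : HasType (fin L) T)
    {σ : Finset Lat} (hσ : σ ∈ cplx T) (h2 : 2 ≤ σ.card) :
    ∃ s ∈ faces L, HasType (fin (SmoothPolytope.lext L s)) (SmoothPolytope.stel T σ (∑ u ∈ σ, u)) := by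
  obtain ⟨s, hs, hc, hT'⟩ := hT.stel hD hL hσ h2
  obtain ⟨t, ht, l, hl, rfl⟩ := exists_sublist_of_mem_cplx hs
  refine ⟨l, ?_, by rwa [← ext_fin]⟩
  simp only [faces, List.mem_filter, List.mem_flatMap, decide_eq_true_eq]
  exact ⟨⟨t, ht, hl⟩, hc.trans (List.toFinset_card_le l)⟩

/-- Cutting an edge between two side facets of a prism gives a combinatorial cube. Cutting a corner
(`ltt`) and cutting an edge of a base (`ltt'`) give the same second type, by `isIso_tt'`. -/
def lcube : List (List (Fin 6)) := lext lprism [0, 1]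

def ltt : List (List (Fin 6)) := lext lprism [0, 1, 4]

def ltt' : List (List (Fin 6)) := lext lprism [0, 4]

def l7A : List (List (Fin 7)) := lext ltt [0, 2, 4]

def l7B : List (List (Fin 7)) := lext ltt [2, 3]

def l7C : List (List (Fin 7)) :=
  [[0, 2, 4], [0, 2, 5], [0, 3, 4], [0, 3, 5], [1, 2, 3], [1, 2, 4], [1, 3, 6], [1, 4, 6],
    [2, 3, 5], [3, 4, 6]]

def l7D : List (List (Fin 7)) := lext lcube [0, 2, 3]

def l7E : List (List (Fin 7)) := lext lcube [0, 2]

def perms7 : List (List (Fin 7)) :=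
  [[0, 1, 2, 3, 4, 5, 6], [1, 0, 4, 5, 2, 3, 6], [3, 4, 5, 0, 1, 2, 6], [0, 1, 4, 2, 5, 3, 6],
    [0, 1, 5, 4, 3, 2, 6], [0, 1, 6, 3, 4, 5, 2], [1, 0, 3, 2, 5, 4, 6], [1, 0, 5, 3, 4, 2, 6],
    [2, 5, 4, 1, 0, 3, 6], [0, 1, 2, 5, 3, 6, 4], [0, 1, 3, 2, 5, 4, 6], [0, 1, 4, 3, 5, 6, 2],
    [0, 2, 1, 4, 3, 6, 5], [0, 4, 1, 2, 5, 6, 3], [0, 6, 1, 2, 5, 4, 3], [0, 6, 1, 4, 3, 2, 5],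
    [2, 3, 5, 0, 1, 6, 4], [2, 5, 0, 1, 4, 3, 6], [2, 5, 1, 0, 4, 3, 6], [2, 5, 6, 0, 1, 3, 4],
    [2, 6, 0, 1, 4, 3, 5], [2, 6, 1, 0, 4, 3, 5], [3, 4, 2, 0, 1, 6, 5], [3, 4, 2, 1, 0, 6, 5],
    [4, 6, 0, 1, 2, 5, 3], [4, 6, 1, 0, 2, 5, 3]]

lemma step_cube : ((faces lcube).all fun s => perms7.any fun p =>
    [l7A, l7B, l7C, l7D, l7E].any fun X => isIso X (lext lcube s) p) = true := by
  decide +kernel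

lemma step_tt : ((faces ltt).all fun s => perms7.any fun p =>
    [l7A, l7B, l7C, l7D, l7E].any fun X => isIso X (lext ltt s) p) = true := by
  decide +kernel

/-- The third vertex of the triangle at the edge `u b` on the other side of `a`. -/
def third {α : Type*} [DecidableEq α] (L : List (List α)) (u a b : α) : α :=
  (((L.find? fun t => t.contains u && t.contains b && !t.contains a).getD []).find?
    fun x => x != u && x != b).getD u

/-- The first five vertices of the link of `u`. -/
def link5 {α : Type*} [DecidableEq α] (L : List (List α)) (u : α) : Fin 5 → α :=
  let t := ((L.find? fun t => t.contains u).getD []).filter fun x => x != u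
  let a := t.getD 0 u
  let b := t.getD 1 u
  let c := third L u a b
  let d := third L u b c
  ![a, b, c, d, third L u c d]

/-- There is a pentagon, and there are three vertices of degree at least five. -/
def pentagonal {n : ℕ} (L : List (List (Fin n))) : Prop :=
  (∃ u, ldeg L u = 5 ∧ Function.Injective (link5 L u) ∧
    ∀ i, (L.any fun t => eqv [u, link5 L u i, link5 L u (i + 1)] t) = true) ∧
  3 ≤ ((List.finRange n).filter fun u => decide (5 ≤ ldeg L u)).length

instance {n : ℕ} (L : List (List (Fin n))) : Decidable (pentagonal L) := by
  unfold pentagonal; infer_instance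

/-- There are two vertices of degree at least seven. -/
def heptagonal {n : ℕ} (L : List (List (Fin n))) : Prop :=
  2 ≤ ((List.finRange n).filter fun u => decide (7 ≤ ldeg L u)).length

instance {n : ℕ} (L : List (List (Fin n))) : Decidable (heptagonal L) := by
  unfold heptagonal; infer_instance

/-- The normal fan of the truncated tetrahedron. -/
def ltrunc : List (List (Fin 8)) :=
  [[0, 5, 6], [0, 5, 7], [0, 6, 7], [1, 4, 6], [1, 4, 7], [1, 6, 7], [2, 4, 5], [2, 4, 7],
    [2, 5, 7], [3, 4, 5], [3, 4, 6], [3, 5, 6]]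

/-- The normal fan of the hexagonal prism. -/
def lhex : List (List (Fin 8)) :=
  [[0, 1, 6], [1, 2, 6], [2, 3, 6], [3, 4, 6], [4, 5, 6], [5, 0, 6], [0, 1, 7], [1, 2, 7],
    [2, 3, 7], [3, 4, 7], [4, 5, 7], [5, 0, 7]]

def perms8 : List (List (Fin 8)) :=
  [[0, 5, 1, 2, 6, 7, 3, 4], [0, 5, 1, 2, 7, 6, 3, 4], [0, 5, 1, 7, 2, 6, 3, 4],
    [0, 5, 7, 1, 2, 6, 3, 4], [0, 6, 2, 1, 5, 7, 3, 4], [2, 4, 5, 7, 3, 6, 0, 1],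
    [3, 5, 6, 7, 4, 2, 1, 0]]

/-- The cases `pentagonal` and `heptagonal` are those that the lattice point count refutes; only the
truncated tetrahedron and the hexagonal prism need geometry. The permutations serve as certificates
for isomorphisms. -/
lemma step7 : ([l7A, l7B, l7C, l7D, l7E].all fun X => (faces X).all fun s =>
    let L := lext X s
    ldistinct L && decide (L.length = 12) && (decide (pentagonal L) || decide (heptagonal L) ||
      perms8.any fun p => isIso ltrunc L p || isIso lhex L p)) = true := by
  decide +kernel

lemma isIso_tt' : isIso ltt ltt' [1, 2, 0, 3, 5, 4] = true := by
  decide +kernel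

def autos5 : List (List (Fin 5)) :=
  [[0, 1, 2, 3, 4], [0, 2, 1, 3, 4], [1, 0, 2, 3, 4], [1, 2, 0, 3, 4], [2, 0, 1, 3, 4],
    [2, 1, 0, 3, 4], [0, 1, 2, 4, 3], [0, 2, 1, 4, 3], [1, 0, 2, 4, 3], [1, 2, 0, 4, 3],
    [2, 0, 1, 4, 3], [2, 1, 0, 4, 3]]

/-- The faces of the prism along which it is blown up, up to symmetry. -/
def cuts : List (List (Fin 5)) := [[0, 1], [0, 4], [0, 1, 4]]

lemma step_prism : ((faces lprism).all fun s => autos5.any fun p => isIso lprism lprism p &&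
    cuts.any fun s₀ => eqv (s₀.map (listMap p)) s) = true := by
  decide +kernel

lemma HasType.card_rays {n : ℕ} {L : Finset (Finset (Fin n))} (hL : rays L = Finset.univ)
    {T : Finset (Finset Lat)} (hT : HasType L T) : (rays T).card = n := by
  obtain ⟨ρ, hρ, rfl⟩ := hT
  rw [rays_relabel, Finset.card_image_of_injective _ hρ, hL, Finset.card_univ, Fintype.card_fin]

/-- Data obtained from a triangular prism by one blow-up, with a standard labelling. -/
def Six (T : Finset (Finset Lat)) (h : Lat → ℤ) : Prop :=
  ∃ s ∈ cuts, ∃ (ρ : Fin 5 → Lat) (h₀ : Lat → ℤ) (k : ℕ),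
    Function.Injective ρ ∧ IsData (relabel ρ (fin lprism)) h₀ ∧ 1 ≤ k ∧
    s.toFinset.image ρ ∈ cplx (relabel ρ (fin lprism)) ∧ (s.toFinset.image ρ).card = s.length ∧
    T = stel (relabel ρ (fin lprism)) (s.toFinset.image ρ) (∑ u ∈ s.toFinset.image ρ, u) ∧
    h = blowHeight h₀ (s.toFinset.image ρ) k

def Type7 (T : Finset (Finset Lat)) : Prop :=
  ∃ X ∈ [l7A, l7B, l7C, l7D, l7E], HasType (fin X) T

/-- The third alternative collects the types that `not_pentagonal` and `not_heptagonal` exclude,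
without listing them. -/
def Type8 (T : Finset (Finset Lat)) : Prop :=
  HasType (fin ltrunc) T ∨ HasType (fin lhex) T ∨ ∃ L : List (List (Fin 8)),
    ldistinct L = true ∧ L.length = 12 ∧ (pentagonal L ∨ heptagonal L) ∧ HasType (fin L) T

/-- The combinatorial possibilities for iterated blow-ups of the basic polytopes. -/
def Reach (T : Finset (Finset Lat)) (h : Lat → ℤ) : Prop :=
  (rays T).card = 5 ∨ Six T h ∨ Type7 T ∨ (Type8 T ∧ T.card = 12 ∧ (rays T).card = 8) ∨
    (9 ≤ (rays T).card ∧ 2 * (rays T).card ≤ T.card + 4)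

lemma rays_prism : rays (fin lprism) = Finset.univ := by decide +kernel
lemma rays_cube : rays (fin lcube) = Finset.univ := by decide +kernel
lemma rays_tt : rays (fin ltt) = Finset.univ := by decide +kernel
lemma rays_7 : ∀ X ∈ [l7A, l7B, l7C, l7D, l7E], rays (fin X) = Finset.univ := by decide +kernel

lemma card_cuts : ∀ s ∈ cuts,
    s.toFinset.card = s.length ∧ 2 ≤ s.length := by
  decide

namespace IsData
variable {T : Finset (Finset Lat)} {h : Lat → ℤ}

lemma card_rays_stel (hD : IsData T h) {σ : Finset Lat} (hσ : σ ∈ cplx T) (h2 : 2 ≤ σ.card) :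
    (rays (stel T σ (∑ u ∈ σ, u))).card = (rays T).card + 1 := by
  rw [rays_stel T hσ h2, Finset.card_insert_of_notMem (hD.sum_notMem_rays hσ h2)]

/-- Each maximal cone containing `σ` is replaced by `σ.card` new ones, and all of these are
different. For a triple the gain is at least two; for a pair there are at least two cones containing
it, each with a gain of one. -/
lemma le_card_stel (hD : IsData T h) {σ : Finset Lat} (hσ : σ ∈ cplx T) (h2 : 2 ≤ σ.card) :
    T.card + 2 ≤ (stel T σ (∑ u ∈ σ, u)).card := by
  have hp := hD.sum_notMem_rays hσ h2
  set p := ∑ u ∈ σ, u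
  obtain ⟨t, ht, hst⟩ := mem_cplx.mp hσ
  set A := T.filter fun t => σ ⊆ t with hA
  have hpA : ∀ t ∈ A, p ∉ t := fun t ht hpt =>
    hp (hD.mem_rays (Finset.mem_filter.mp ht).1 hpt)
  have hrec : ∀ t ∈ A, ∀ u ∈ σ, σ ∪ (insert p (t.erase u)).erase p = t ∧
      ∀ w ∈ σ, (w ∉ insert p (t.erase u) ↔ w = u) := by
    intro t ht u hu
    have hpt := hpA t ht
    have hs := (Finset.mem_filter.mp ht).2
    rw [Finset.erase_insert fun hh => hpt (Finset.mem_of_mem_erase hh)]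
    refine ⟨?_, fun w hw => ?_⟩
    · ext x
      simp only [Finset.mem_union, Finset.mem_erase]
      constructor
      · rintro (hx | hx)
        · exact hs hx
        · exact hx.2
      · intro hx
        by_cases hxu : x = u
        · exact Or.inl (hxu ▸ hu)
        · exact Or.inr ⟨hxu, hx⟩
    · simp only [Finset.mem_insert, Finset.mem_erase, not_or, not_and]
      constructor
      · rintro ⟨-, h2⟩
        by_contra hne
        exact h2 hne (hs hw)
      · rintro rfl
        exact ⟨fun hh => hpt (hh ▸ hs hw), fun hh => absurd rfl hh⟩
  have hB : ((A ×ˢ σ).image fun x => insert p (x.1.erase x.2)).card = A.card * σ.card := by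
    rw [Finset.card_image_of_injOn, Finset.card_product]
    rintro ⟨t₁, u₁⟩ h1 ⟨t₂, u₂⟩ h2 he
    simp only [Finset.coe_product, Set.mem_prod, Finset.mem_coe] at h1 h2
    obtain ⟨a1, b1⟩ := hrec t₁ h1.1 u₁ h1.2
    obtain ⟨a2, b2⟩ := hrec t₂ h2.1 u₂ h2.2
    simp only at he
    rw [he] at a1 b1
    have e1 : t₁ = t₂ := a1.symm.trans a2
    have e2 : u₁ = u₂ := (b2 u₁ h1.2).mp ((b1 u₁ h1.2).mpr rfl)
    rw [e1, e2]
  have hsub : (T.filter fun t => ¬ σ ⊆ t) ∪ (A ×ˢ σ).image (fun x => insert p (x.1.erase x.2)) ⊆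
      stel T σ p := by
    intro x hx
    rw [mem_stel]
    rcases Finset.mem_union.mp hx with hx | hx
    · exact Or.inl (Finset.mem_filter.mp hx)
    · obtain ⟨⟨t, u⟩, hy, rfl⟩ := Finset.mem_image.mp hx
      obtain ⟨h1, h2⟩ := Finset.mem_product.mp hy
      exact Or.inr ⟨t, (Finset.mem_filter.mp h1).1, (Finset.mem_filter.mp h1).2, u, h2, rfl⟩
  have hdisj : Disjoint (T.filter fun t => ¬ σ ⊆ t)
      ((A ×ˢ σ).image (fun x => insert p (x.1.erase x.2))) := by
    refine Finset.disjoint_left.mpr fun x hx hx' => ?_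
    obtain ⟨⟨t, u⟩, hy, rfl⟩ := Finset.mem_image.mp hx'
    exact hp (hD.mem_rays (Finset.mem_filter.mp hx).1 (Finset.mem_insert_self _ _))
  have h3 := Finset.card_le_card hsub
  rw [Finset.card_union_of_disjoint hdisj, hB] at h3
  have h4 := Finset.card_filter_add_card_filter_not (s := T) fun t => σ ⊆ t
  rw [← hA] at h4
  have hA1 : 1 ≤ A.card := Finset.card_pos.mpr ⟨t, Finset.mem_filter.mpr ⟨ht, hst⟩⟩
  have hσ3 : σ.card ≤ 3 := hD.card ht ▸ Finset.card_le_card hst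
  by_cases h33 : σ.card = 3
  · rw [h33] at h3; omega
  · have hσ2 : σ.card = 2 := by omega
    obtain ⟨u, hu, huσ⟩ : ∃ u ∈ t, u ∉ σ := by
      by_contra! hcon
      have := Finset.card_le_card (show t ⊆ σ from hcon)
      rw [hD.card ht] at this
      omega
    obtain ⟨u', hu', hT⟩ := hD.exists_nbr ht hu
    have : 1 < A.card := by
      refine Finset.one_lt_card.mpr ⟨t, Finset.mem_filter.mpr ⟨ht, hst⟩, _,
        Finset.mem_filter.mpr ⟨hT, fun x hx => ?_⟩, fun he => ?_⟩
      · exact Finset.mem_insert_of_mem (Finset.mem_erase.mpr ⟨fun hh => huσ (hh ▸ hx), hst hx⟩)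
      · exact hu' (he ▸ Finset.mem_insert_self _ _)
    rw [hσ2] at h3
    omega

lemma image_toFinset_map {α β γ : Type*} [DecidableEq α] [DecidableEq β] [DecidableEq γ]
    (f : α → β) (g : β → γ) (s : List α) :
    (s.map f).toFinset.image g = s.toFinset.image (g ∘ f) := by
  ext; simp

/-- The symmetries of the type allow the labelling to be chosen so that the centre of the blow-up is
one of the representatives in `S`. -/
lemma exists_relabel_of_faces {n : ℕ} {L : List (List (Fin (n + 1)))}
    {autos S : List (List (Fin (n + 1)))} (hstep : ((faces L).all fun s => autos.any fun p =>
      isIso L L p && S.any fun s₀ => eqv (s₀.map (listMap p)) s) = true)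
    {ρ : Fin (n + 1) → Lat} (hρ : Function.Injective ρ) {σ : Finset Lat}
    (hσ : σ ∈ cplx (relabel ρ (fin L))) (h2 : 2 ≤ σ.card) :
    ∃ s₀ ∈ S, ∃ ρ' : Fin (n + 1) → Lat, Function.Injective ρ' ∧
      relabel ρ (fin L) = relabel ρ' (fin L) ∧ σ = s₀.toFinset.image ρ' := by
  rw [cplx_relabel] at hσ
  obtain ⟨s, hs, rfl⟩ := Finset.mem_image.mp hσ
  rw [Finset.card_image_of_injective _ hρ] at h2
  obtain ⟨t, ht, l, hl, rfl⟩ := exists_sublist_of_mem_cplx hs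
  have hlf : l ∈ faces L := by
    simp only [faces, List.mem_filter, List.mem_flatMap, decide_eq_true_eq]
    exact ⟨⟨t, ht, hl⟩, h2.trans (List.toFinset_card_le l)⟩
  have := List.all_eq_true.mp hstep l hlf
  obtain ⟨p, hp, hpp⟩ := List.any_eq_true.mp this
  simp only [Bool.and_eq_true] at hpp
  obtain ⟨h1, h2⟩ := hpp
  obtain ⟨s₀, hs₀, he⟩ := List.any_eq_true.mp h2
  rw [eqv_iff] at he
  simp only [isIso, Bool.and_eq_true, decide_eq_true_eq] at h1
  refine ⟨s₀, hs₀, ρ ∘ listMap p, hρ.comp h1.2, ?_, ?_⟩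
  · rw [← relabel_relabel, relabel_fin (listMap p), fin_eq_of_same h1.1]
  · rw [← he, image_toFinset_map]

attribute [local irreducible] lprism cuts in
lemma six_of_prism (hD : IsData T h) (h5 : (rays T).card = 5) {σ : Finset Lat} (hσ : σ ∈ cplx T)
    (h2 : 2 ≤ σ.card) {k : ℕ} (hk : 1 ≤ k) :
    Six (stel T σ (∑ u ∈ σ, u)) (blowHeight h σ k) := by
  obtain ⟨ρ, hρ, rfl⟩ := hD.hasType_prism h5
  obtain ⟨s₀, hs₀, ρ', hρ', he, rfl⟩ := exists_relabel_of_faces step_prism hρ hσ h2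
  rw [he] at hD hσ ⊢
  exact ⟨s₀, hs₀, ρ', h, k, hρ', hD, hk, hσ,
    (Finset.card_image_of_injective _ hρ').trans (card_cuts s₀ hs₀).1, rfl, rfl⟩

end IsData

lemma HasType.of_stel {n : ℕ} {L : List (List (Fin n))} (hL : rays (fin L) = Finset.univ)
    {ρ : Fin n → Lat} (hρ : Function.Injective ρ) {h : Lat → ℤ}
    (hD : IsData (relabel ρ (fin L)) h) {s : List (Fin n)}
    (hs : s.toFinset.image ρ ∈ cplx (relabel ρ (fin L))) (h2 : 2 ≤ (s.toFinset.image ρ).card) :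
    HasType (fin (SmoothPolytope.lext L s)) (SmoothPolytope.stel (relabel ρ (fin L))
      (s.toFinset.image ρ) (∑ u ∈ s.toFinset.image ρ, u)) := by
  have hp := hD.sum_notMem_rays hs h2
  obtain ⟨h3, h4⟩ := relabel_snoc (fin L) s.toFinset hρ (p := ∑ u ∈ s.toFinset.image ρ, u)
    fun i hi => hp (hi ▸ rays_relabel_univ hL ρ i)
  rw [← ext_fin]
  exact ⟨_, h3, h4⟩

lemma Six.hasType {T : Finset (Finset Lat)} {h : Lat → ℤ} (hS : Six T h) :
    HasType (fin lcube) T ∨ HasType (fin ltt) T := by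
  obtain ⟨s, hs, ρ, h₀, k, hρ, hD, hk, hc, hl, rfl, rfl⟩ := hS
  have hs2 := (card_cuts s hs).2
  have hT := HasType.of_stel rays_prism hρ hD hc (by omega)
  simp only [cuts, List.mem_cons, List.not_mem_nil, or_false] at hs
  rcases hs with rfl | rfl | rfl
  · exact Or.inl hT
  · exact Or.inr (HasType.of_isIso isIso_tt' hT)
  · exact Or.inr hT

lemma Type7.step {T : Finset (Finset Lat)} {h : Lat → ℤ} (hD : IsData T h) (hT : Type7 T)
    {σ : Finset Lat} (hσ : σ ∈ cplx T) (h2 : 2 ≤ σ.card) :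
    Type8 (stel T σ (∑ u ∈ σ, u)) ∧ (stel T σ (∑ u ∈ σ, u)).card = 12 := by
  obtain ⟨X, hX, hT⟩ := hT
  obtain ⟨s, hs, hT'⟩ := hT.lext (rays_7 X hX) hD hσ h2
  have := List.all_eq_true.mp (List.all_eq_true.mp step7 X hX) s hs
  simp only [Bool.and_eq_true, Bool.or_eq_true, decide_eq_true_eq, List.any_eq_true] at this
  obtain ⟨⟨h1, h12⟩, h3⟩ := this
  constructor
  · rcases h3 with (h3 | h3) | ⟨p, -, h3 | h3⟩
    · exact Or.inr (Or.inr ⟨_, h1, h12, Or.inl h3, hT'⟩)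
    · exact Or.inr (Or.inr ⟨_, h1, h12, Or.inr h3, hT'⟩)
    · exact Or.inl (HasType.of_isIso h3 hT')
    · exact Or.inr (Or.inl (HasType.of_isIso h3 hT'))
  · obtain ⟨ρ, hρ, he⟩ := hT'
    rw [he, card_relabel hρ, card_fin h1, h12]

/-- The types are followed exactly up to eight facets. Beyond that only the inequality between the
numbers of facets and vertices is kept, which every further blow-up preserves. -/
lemma Reach.step {T : Finset (Finset Lat)} {h : Lat → ℤ} (hD : IsData T h)
    (hR : (rays T).card = 4 ∨ Reach T h) {σ : Finset Lat} (hσ : σ ∈ cplx T) (h2 : 2 ≤ σ.card)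
    {k : ℕ} (hk : 1 ≤ k) : Reach (stel T σ (∑ u ∈ σ, u)) (blowHeight h σ k) := by
  have hr := hD.card_rays_stel hσ h2
  rcases hR with h4 | h5 | h6 | h7 | ⟨h8, h12, hr8⟩ | ⟨h9, hc⟩
  · exact Or.inl (by rw [hr, h4])
  · exact Or.inr (Or.inl (hD.six_of_prism h5 hσ h2 hk))
  · refine Or.inr (Or.inr (Or.inl ?_))
    rcases h6.hasType with hT | hT
    · obtain ⟨s, hs, hT'⟩ := hT.lext rays_cube hD hσ h2
      obtain ⟨p, -, hp⟩ := List.any_eq_true.mp (List.all_eq_true.mp step_cube s hs)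
      obtain ⟨X, hX, hp⟩ := List.any_eq_true.mp hp
      exact ⟨X, hX, HasType.of_isIso hp hT'⟩
    · obtain ⟨s, hs, hT'⟩ := hT.lext rays_tt hD hσ h2
      obtain ⟨p, -, hp⟩ := List.any_eq_true.mp (List.all_eq_true.mp step_tt s hs)
      obtain ⟨X, hX, hp⟩ := List.any_eq_true.mp hp
      exact ⟨X, hX, HasType.of_isIso hp hT'⟩
  · refine Or.inr (Or.inr (Or.inr (Or.inl ⟨(h7.step hD hσ h2).1, (h7.step hD hσ h2).2, ?_⟩)))
    obtain ⟨X, hX, hT⟩ := h7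
    rw [hr, hT.card_rays (rays_7 X hX)]
  · have := hD.le_card_stel hσ h2
    exact Or.inr (Or.inr (Or.inr (Or.inr ⟨by omega, by omega⟩)))
  · have := hD.le_card_stel hσ h2
    exact Or.inr (Or.inr (Or.inr (Or.inr ⟨by omega, by omega⟩)))

lemma IsData.card_rays_of_label {T : Finset (Finset Lat)} {h : Lat → ℤ} (hD : IsData T h)
    (hl : label (poly T h) = Pi.single 3 4 ∨
      label (poly T h) = Pi.single 3 2 + Pi.single 4 3) :
    (rays T).card = 4 ∨ (rays T).card = 5 := by
  have hlab : ∀ m, label (poly T h) m = ((rays T).filter fun u => edgeDeg T u = m).card :=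
    fun m => hD.label_eq m
  have hmem : ∀ u ∈ rays T, edgeDeg T u ∈ ({3, 4} : Finset ℕ) := by
    intro u hu
    have h1 : 0 < label (poly T h) (edgeDeg T u) := by
      rw [hlab]
      exact Finset.card_pos.mpr ⟨u, Finset.mem_filter.mpr ⟨hu, rfl⟩⟩
    by_contra hne
    simp only [Finset.mem_insert, Finset.mem_singleton, not_or] at hne
    rcases hl with hl | hl
    · rw [hl] at h1; simp [hne.1] at h1
    · rw [hl] at h1; simp [hne.1, hne.2] at h1
  have h2 := Finset.card_eq_sum_card_fiberwise hmem
  rw [Finset.sum_pair (by norm_num), ← hlab, ← hlab] at h2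
  rcases hl with hl | hl
  · left; rw [h2, hl]; simp
  · right; rw [h2, hl]; simp

theorem exists_reach {P Q : Set Spc} (hP : IsSmooth P)
    (hl : label P = Pi.single 3 4 ∨ label P = Pi.single 3 2 + Pi.single 4 3)
    (hc : IsIteratedBlowUp P Q) : ∃ T h, IsData T h ∧ Q = poly T h ∧ Reach T h := by
  obtain ⟨T, h, hD, rfl⟩ := hP.exists_isData
  induction hc with
  | single hb =>
    obtain ⟨F, k, hb⟩ := hb
    obtain ⟨σ, hσ, h2, hk, -, hD', rfl⟩ := hD.exists_of_isBlowUp hb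
    refine ⟨_, _, hD', rfl, Reach.step hD ?_ hσ h2 hk⟩
    exact (hD.card_rays_of_label hl).imp_right Or.inl
  | tail _ hb ih =>
    obtain ⟨T', h', hD', rfl, hR⟩ := ih
    obtain ⟨F, k, hb⟩ := hb
    obtain ⟨σ, hσ, h2, hk, -, hD'', rfl⟩ := hD'.exists_of_isBlowUp hb
    exact ⟨_, _, hD'', rfl, Reach.step hD' (Or.inr hR) hσ h2 hk⟩

/-! ### Normal form of a prism -/

def det3 (a b c : Lat) : ℤ :=
  a 0 * (b 1 * c 2 - b 2 * c 1) - a 1 * (b 0 * c 2 - b 2 * c 0) + a 2 * (b 0 * c 1 - b 1 * c 0)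

lemma dot3 (a b : Lat) : a ⬝ᵥ b = a 0 * b 0 + a 1 * b 1 + a 2 * b 2 := by
  simp [dotProduct, Fin.sum_univ_three]

/-- The wall relation reads `d = x a + y b - c`, so adjacent cones have opposite orientation. This
turns smoothness into polynomial equations between coordinates of normals. -/
lemma IsData.wall_det {T : Finset (Finset Lat)} {h : Lat → ℤ} (hD : IsData T h) {a b c d : Lat}
    (h1 : {a, b, c} ∈ T) (h2 : {a, b, d} ∈ T) (hcd : c ≠ d) : det3 a b d = -det3 a b c := by
  obtain ⟨hab, hac, hbc⟩ := hD.triple_ne h1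
  have h3 := (hD.wall_triple h1 h2 hcd).1
  have h4 := (hD.isDual h1).expand_dual_int d
  rw [Finset.sum_insert (by simp [hab, hac]), Finset.sum_pair hbc, h3] at h4
  generalize d ⬝ᵥ dualv {a, b, c} a = x at h4
  generalize d ⬝ᵥ dualv {a, b, c} b = y at h4
  have h5 : ∀ i, d i = x * a i + (y * b i - c i) := fun i => by
    have := congrFun h4 i
    simp only [Pi.add_apply, Pi.smul_apply, smul_eq_mul] at this
    linarith
  simp only [det3, h5]
  ring

lemma LatIso.small (g : LatIso) {T : Finset (Finset Lat)} {h : Lat → ℤ} {N : ℕ}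
    (hs : Small T h N) : Small (relabel g.A T) (g.height h) N := by
  intro X hX
  have hinj : Function.Injective fun z => g.B.symm (z - g.c) :=
    g.B.symm.injective.comp (sub_left_injective)
  rw [← Finset.card_image_of_injective X hinj]
  refine hs _ fun z hz => ?_
  obtain ⟨y, hy, rfl⟩ := Finset.mem_image.mp hz
  intro u hu
  have h1 := hX y hy (g.A u) (by rw [rays_relabel]; exact Finset.mem_image_of_mem _ hu)
  rw [g.height_apply] at h1
  have h2 := g.dot u (g.B.symm (y - g.c))
  rw [AddEquiv.apply_symm_apply, dotProduct_sub] at h2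
  linarith

/-- The rays of a given cone can be moved to the standard basis. -/
lemma IsData.exists_normalized {T : Finset (Finset Lat)} {h : Lat → ℤ} (hD : IsData T h)
    {a b c : Lat} (ht : {a, b, c} ∈ T) : ∃ g : LatIso,
      (∀ T' h', Iso (poly T' h') (poly (relabel g.A T') (g.height h'))) ∧
      g.A a = ![1, 0, 0] ∧ g.A b = ![0, 1, 0] ∧ g.A c = ![0, 0, 1] ∧
      g.height h ![1, 0, 0] = 0 ∧ g.height h ![0, 1, 0] = 0 ∧ g.height h ![0, 0, 1] = 0 := by
  obtain ⟨hab, hac, hbc⟩ := hD.triple_ne ht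
  have hd := hD.isDual ht
  have ha : a ∈ ({a, b, c} : Finset Lat) := by simp
  have hb : b ∈ ({a, b, c} : Finset Lat) := by simp
  have hc : c ∈ ({a, b, c} : Finset Lat) := by simp
  have hdual : ∀ i j, (![a, b, c] : Fin 3 → Lat) i ⬝ᵥ (![dualv {a, b, c} a, dualv {a, b, c} b,
      dualv {a, b, c} c] : Fin 3 → Lat) j = if i = j then 1 else 0 := by
    intro i j
    fin_cases i <;> fin_cases j
    · simpa using hd.dot_self ha
    · simpa using hd.dot_ne ha hb hab
    · simpa using hd.dot_ne ha hc hac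
    · simpa using hd.dot_ne hb ha hab.symm
    · simpa using hd.dot_self hb
    · simpa using hd.dot_ne hb hc hbc
    · simpa using hd.dot_ne hc ha hac.symm
    · simpa using hd.dot_ne hc hb hbc.symm
    · simpa using hd.dot_self hc
  obtain ⟨φ, h1, hφ⟩ := exists_affineEquiv hdual (vert h {a, b, c})
  have h1' : φ.symm '' latticePoints 3 = latticePoints 3 := by
    conv_lhs => rw [← h1]
    rw [← Set.image_comp]; simp
  obtain ⟨g, h2, h3⟩ := exists_latIso h1'
  have hz : ∀ c' : Lat, g.B (vert h {a, b, c} + ∑ i, c' i • (![dualv {a, b, c} a,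
      dualv {a, b, c} b, dualv {a, b, c} c] : Fin 3 → Lat) i) + g.c = c' := by
    intro c'
    apply toReal_injective
    rw [← h2, ← hφ, AffineEquiv.symm_apply_apply]
  have h0 : g.B (vert h {a, b, c}) + g.c = 0 := by
    have := hz 0
    simpa using this
  have hA : ∀ i c', g.A ((![a, b, c] : Fin 3 → Lat) i) ⬝ᵥ c' = c' i := by
    intro i c'
    have h4 := hz c'
    rw [map_add, add_right_comm, h0, zero_add] at h4
    conv_lhs => rw [← h4]
    rw [g.dot, dotProduct_sum]
    simp only [dotProduct_smul, hdual]
    simp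
  have hAi : ∀ i, g.A ((![a, b, c] : Fin 3 → Lat) i) = Pi.single i 1 := fun i => by
    ext j
    have := hA i (Pi.single j 1)
    rw [dotProduct_single_one] at this
    rw [this, Pi.single_apply, Pi.single_apply]
    simp [eq_comm]
  have e0 : (Pi.single 0 1 : Lat) = ![1, 0, 0] := by ext i; fin_cases i <;> rfl
  have e1 : (Pi.single 1 1 : Lat) = ![0, 1, 0] := by ext i; fin_cases i <;> rfl
  have e2 : (Pi.single 2 1 : Lat) = ![0, 0, 1] := by ext i; fin_cases i <;> rfl
  have hA0 : g.A a = ![1, 0, 0] := by rw [← e0]; exact hAi 0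
  have hA1 : g.A b = ![0, 1, 0] := by rw [← e1]; exact hAi 1
  have hA2 : g.A c = ![0, 0, 1] := by rw [← e2]; exact hAi 2
  have hh : ∀ u ∈ ({a, b, c} : Finset Lat), g.height h (g.A u) = 0 := by
    intro u hu
    have := hD.dot ht hu
    rw [g.height_apply, ← this, ← g.dot, ← dotProduct_add, h0, dotProduct_zero]
  refine ⟨g, fun T' h' => ⟨φ.symm, h1', image_poly h3 T' h'⟩, hA0, hA1, hA2, ?_, ?_, ?_⟩
  · rw [← hA0]; exact hh a ha
  · rw [← hA1]; exact hh b hb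
  · rw [← hA2]; exact hh c hc

/-- A polytope is the convex hull of the points that solve the equations of its corners. -/
lemma IsData.poly_eq_of_corners {n : ℕ} {L : List (List (Fin n))} {ρ : Fin n → Lat} {h : Lat → ℤ}
    (hD : IsData (relabel ρ (fin L)) h) (v : List (Fin n) → Lat)
    (hv : ∀ t ∈ L, ∀ i ∈ t, ρ i ⬝ᵥ v t = h (ρ i)) :
    poly (relabel ρ (fin L)) h = convexHull ℝ (toReal '' (((L.map v).toFinset : Finset Lat) : Set Lat)) := by
  rw [hD.poly_eq_convexHull]
  congr 2
  have key : ∀ t ∈ L, vert h (t.toFinset.image ρ) = v t := by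
    intro t ht
    have hT : t.toFinset.image ρ ∈ relabel ρ (fin L) :=
      mem_relabel.mpr ⟨_, mem_fin.mpr ⟨t, ht, rfl⟩, rfl⟩
    refine (eq_vert (hD.uni _ hT) fun u hu => ?_).symm
    obtain ⟨i, hi, rfl⟩ := Finset.mem_image.mp hu
    exact hv t ht i (List.mem_toFinset.mp hi)
  ext z
  simp only [Finset.mem_coe, Finset.mem_image, List.mem_toFinset, List.mem_map, mem_relabel, mem_fin]
  constructor
  · rintro ⟨_, ⟨_, ⟨t, ht, rfl⟩, rfl⟩, rfl⟩
    exact ⟨t, ht, (key t ht).symm⟩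
  · rintro ⟨t, ht, rfl⟩
    exact ⟨_, ⟨_, ⟨t, ht, rfl⟩, rfl⟩, key t ht⟩

lemma smul_simplex_one (k : ℕ) : (k : ℝ) • simplex 1 =
    convexHull ℝ (toReal '' (({0, ![(k : ℤ)]} : Finset (Fin 1 → ℤ)) : Set (Fin 1 → ℤ))) := by
  rw [simplex, ← convexHull_smul]
  congr 1
  have hr : (Set.range fun i : Fin 1 => (Pi.single i 1 : Fin 1 → ℝ)) = {![1]} := by
    ext x
    simp only [Set.mem_range, Set.mem_singleton_iff]
    have : (Pi.single 0 1 : Fin 1 → ℝ) = ![1] := by ext i; fin_cases i; simp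
    constructor
    · rintro ⟨i, rfl⟩; fin_cases i; exact this
    · rintro rfl; exact ⟨0, this⟩
  rw [hr]
  have h1 : toReal ![(k : ℤ)] = ![(k : ℝ)] := by ext i; fin_cases i; simp [toReal]
  have h2 : (k : ℝ) • (![1] : Fin 1 → ℝ) = ![(k : ℝ)] := by ext i; fin_cases i; simp
  simp only [Finset.coe_insert, Finset.coe_singleton, Set.image_insert_eq, Set.image_singleton, h1,
    toReal_zero, Set.smul_set_insert, Set.smul_set_singleton, h2, smul_zero]

lemma cayley_segments (s i j k : ℕ) : cayley (n := 1) (k := 2) s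
      ![(i : ℝ) • simplex 1, (j : ℝ) • simplex 1, (k : ℝ) • simplex 1] =
    convexHull ℝ (toReal '' (({![0, 0, 0], ![(i : ℤ), 0, 0], ![0, (s : ℤ), 0], ![(j : ℤ), s, 0],
      ![0, 0, (s : ℤ)], ![(k : ℤ), 0, s]} : Finset Lat) : Set Lat)) := by
  have h : (![(i : ℝ) • simplex 1, (j : ℝ) • simplex 1, (k : ℝ) • simplex 1] :
      Fin 3 → Set (Fin 1 → ℝ)) = fun l => convexHull ℝ ((fun l : Fin 3 => toReal ''
        (({0, ![((![i, j, k] : Fin 3 → ℕ) l : ℤ)]} : Finset (Fin 1 → ℤ)) : Set (Fin 1 → ℤ))) l) := by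
    ext1 l
    fin_cases l <;> exact smul_simplex_one _
  rw [h, cayley_convexHull]
  congr 1
  have h1 : (Fin.cons 0 (fun j => Pi.single j 1) : Fin 3 → Fin 2 → ℝ) 1 = Pi.single 0 1 := rfl
  have h2 : (Fin.cons 0 (fun j => Pi.single j 1) : Fin 3 → Fin 2 → ℝ) 2 = Pi.single 1 1 := rfl
  have ha : ∀ (l : Fin 3) (m : ℤ), Fin.append (toReal (![m] : Fin 1 → ℤ)) ((s : ℝ) • (Fin.cons 0
      (fun j => Pi.single j 1) : Fin 3 → Fin 2 → ℝ) l) =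
      toReal (![m, if l = 1 then s else 0, if l = 2 then s else 0] : Lat) := by
    intro l m
    ext x
    fin_cases l <;> fin_cases x <;> simp [Fin.append, Fin.addCases, toReal, h1, h2]
  have ha0 : ∀ (l : Fin 3), Fin.append (0 : Fin 1 → ℝ) ((s : ℝ) • (Fin.cons 0
      (fun j => Pi.single j 1) : Fin 3 → Fin 2 → ℝ) l) =
      toReal (![0, if l = 1 then s else 0, if l = 2 then s else 0] : Lat) := by
    intro l
    rw [← ha l 0]
    congr 1
    ext x; fin_cases x; simp [toReal]
  ext x
  simp only [Set.mem_iUnion, Fin.exists_fin_succ, Finset.coe_insert, Finset.coe_singleton, Set.image_insert_eq,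
    Set.image_singleton, Set.mem_insert_iff, Set.mem_singleton_iff, toReal_zero, ha, ha0]
  simp [or_assoc]

/-- A polytope with two opposite facet normals such that each corner lies on one of the two facets
is a Cayley polytope of polygons. -/
lemma IsData.isCayley_of_opposite {n : ℕ} {L : List (List (Fin n))} {ρ : Fin n → Lat}
    {h : Lat → ℤ} (hD : IsData (relabel ρ (fin L)) h) {i j : Fin n} (hi : ∃ t ∈ L, i ∈ t)
    (hij : ρ j = -ρ i) (hall : ∀ t ∈ L, i ∈ t ∨ j ∈ t) :
    IsCayleyOfPolygons (poly (relabel ρ (fin L)) h) := by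
  have hmem : ∀ t ∈ L, ∀ i ∈ t, ρ i ∈ t.toFinset.image ρ := fun t _ i hi =>
    Finset.mem_image_of_mem _ (List.mem_toFinset.mpr hi)
  refine hD.isCayleyOfPolygons (b := ρ i) ?_ ?_
  · obtain ⟨t, ht, hit⟩ := hi
    exact SmoothPolytope.mem_rays.mpr ⟨_, mem_relabel.mpr ⟨_, mem_fin.mpr ⟨t, ht, rfl⟩, rfl⟩, hmem t ht i hit⟩
  · intro t ht
    obtain ⟨t, ht', rfl⟩ := mem_relabel.mp ht
    obtain ⟨l, hl, rfl⟩ := mem_fin.mp ht'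
    rcases hall l hl with h | h
    · exact Or.inl (hmem l hl i h)
    · right; rw [← hij]; exact hmem l hl j h

/-- The normal form of a polytope with the combinatorial type of a triangular prism. -/
structure PrismForm (ρ : Fin 5 → Lat) (h : Lat → ℤ) (s c H α β : ℤ) : Prop where
  r0 : ρ 0 = ![1, 0, 0]
  r1 : ρ 1 = ![0, 1, 0]
  r2 : ρ 2 = ![-1, -1, c]
  r3 : ρ 3 = ![0, 0, 1]
  r4 : ρ 4 = ![α, β, -1]
  h0 : h (ρ 0) = 0
  h1 : h (ρ 1) = 0
  h2 : h (ρ 2) = -s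
  h3 : h (ρ 3) = 0
  h4 : h (ρ 4) = -H
  zero : c = 0 ∨ α = 0 ∧ β = 0
  s_pos : 1 ≤ s
  H_pos : 1 ≤ H
  α_pos : 1 ≤ H + α * s
  β_pos : 1 ≤ H + β * s
  top_pos : 1 ≤ s + c * H

lemma exists_vec (v : Lat) : ∃ p q r, v = ![p, q, r] :=
  ⟨v 0, v 1, v 2, by ext i; fin_cases i <;> rfl⟩

lemma mem_relabel_fin {n : ℕ} {L : List (List (Fin n))} (ρ : Fin n → Lat) {i j k : Fin n}
    (ht : L.any (eqv [i, j, k]) = true) : {ρ i, ρ j, ρ k} ∈ relabel ρ (fin L) := by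
  obtain ⟨l, hl, he⟩ := List.any_eq_true.mp ht
  rw [eqv_iff] at he
  exact mem_relabel.mpr ⟨_, mem_fin.mpr ⟨_, hl, he.symm⟩, by simp [Finset.image_insert]⟩

lemma IsData.wall_det_fin {n : ℕ} {L : List (List (Fin n))} {ρ : Fin n → Lat} {h : Lat → ℤ}
    (hD : IsData (relabel ρ (fin L)) h) (hρ : Function.Injective ρ) (i j k l : Fin n)
    (h1 : L.any (eqv [i, j, k]) = true) (h2 : L.any (eqv [i, j, l]) = true) (hkl : k ≠ l) :
    det3 (ρ i) (ρ j) (ρ l) = -det3 (ρ i) (ρ j) (ρ k) :=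
  hD.wall_det (mem_relabel_fin ρ h1) (mem_relabel_fin ρ h2) (hρ.ne hkl)

lemma mem_rays_relabel_fin {n : ℕ} {L : List (List (Fin n))} {ρ : Fin n → Lat} {i : Fin n}
    (ht : ∃ t ∈ L, i ∈ t) : ρ i ∈ rays (relabel ρ (fin L)) := by
  obtain ⟨t, ht, hi⟩ := ht
  exact SmoothPolytope.mem_rays.mpr ⟨_, mem_relabel.mpr ⟨_, mem_fin.mpr ⟨_, ht, rfl⟩, rfl⟩,
    Finset.mem_image_of_mem _ (List.mem_toFinset.mpr hi)⟩

/-- The corner in the facets `i`, `j`, `k` lies strictly inside the facet `l`. -/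
lemma IsData.corner_lt {n : ℕ} {L : List (List (Fin n))} {ρ : Fin n → Lat} {h : Lat → ℤ}
    (hD : IsData (relabel ρ (fin L)) h) (hρ : Function.Injective ρ) (i j k l : Fin n)
    (ht : L.any (eqv [i, j, k]) = true) (hl : ∃ t ∈ L, l ∈ t) (hn : l ≠ i ∧ l ≠ j ∧ l ≠ k) {v : Lat}
    (hi : ρ i ⬝ᵥ v = h (ρ i)) (hj : ρ j ⬝ᵥ v = h (ρ j)) (hk : ρ k ⬝ᵥ v = h (ρ k)) :
    h (ρ l) < ρ l ⬝ᵥ v := by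
  have hT := mem_relabel_fin ρ ht
  have hv : v = vert h {ρ i, ρ j, ρ k} := by
    refine eq_vert (hD.uni _ hT) fun u hu => ?_
    simp only [Finset.mem_insert, Finset.mem_singleton] at hu
    rcases hu with rfl | rfl | rfl <;> assumption
  rw [hv]
  refine hD.lt _ hT _ (mem_rays_relabel_fin hl) ?_
  simp [hρ.eq_iff, hn]

/-- With one corner moved to the origin, five wall determinants leave the free parameters `c`, `α`,
`β` subject to `c α = c β = 0`. Strict convexity at the corners gives the positivity conditions. -/
lemma IsData.prismForm {ρ : Fin 5 → Lat} {h : Lat → ℤ} (hD : IsData (relabel ρ (fin lprism)) h)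
    (hρ : Function.Injective ρ) (r0 : ρ 0 = ![1, 0, 0]) (r1 : ρ 1 = ![0, 1, 0])
    (r3 : ρ 3 = ![0, 0, 1]) (h0 : h (ρ 0) = 0) (h1 : h (ρ 1) = 0) (h3 : h (ρ 3) = 0) :
    ∃ s c H α β, PrismForm ρ h s c H α β := by
  obtain ⟨p, q, c, r2⟩ := exists_vec (ρ 2)
  obtain ⟨α, β, r, r4⟩ := exists_vec (ρ 4)
  have d1 := hD.wall_det_fin hρ 1 3 0 2 (by decide) (by decide) (by decide)
  have d2 := hD.wall_det_fin hρ 0 3 1 2 (by decide) (by decide) (by decide)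
  have d3 := hD.wall_det_fin hρ 0 1 3 4 (by decide) (by decide) (by decide)
  have d4 := hD.wall_det_fin hρ 1 2 3 4 (by decide) (by decide) (by decide)
  have d5 := hD.wall_det_fin hρ 0 2 3 4 (by decide) (by decide) (by decide)
  simp only [r0, r1, r2, r3, r4, det3, Matrix.cons_val] at d1 d2 d3 d4 d5
  ring_nf at d1 d2 d3 d4 d5
  have hq : q = -1 := by linarith
  subst d1 hq d3
  have e4 : c * α = 0 := by linarith
  have e5 : c * β = 0 := by linarith
  have l2 := hD.corner_lt hρ 0 1 3 2 (by decide) (by decide) (by decide) (v := ![0, 0, 0])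
    (by simp [h0]) (by simp [h1]) (by simp [h3])
  have l4 := hD.corner_lt hρ 0 1 3 4 (by decide) (by decide) (by decide) (v := ![0, 0, 0])
    (by simp [h0]) (by simp [h1]) (by simp [h3])
  have lα := hD.corner_lt hρ 1 2 3 4 (by decide) (by decide) (by decide) (v := ![-h (ρ 2), 0, 0])
    (by rw [h1, r1]; simp) (by simp [r2]) (by rw [h3, r3]; simp)
  have lβ := hD.corner_lt hρ 0 2 3 4 (by decide) (by decide) (by decide) (v := ![0, -h (ρ 2), 0])
    (by rw [h0, r0]; simp) (by simp [r2]) (by rw [h3, r3]; simp)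
  have lt := hD.corner_lt hρ 0 1 4 2 (by decide) (by decide) (by decide) (v := ![0, 0, -h (ρ 4)])
    (by rw [h0, r0]; simp) (by rw [h1, r1]; simp) (by simp [r4])
  simp only [r2, r4, dot3, Matrix.cons_val] at l2 l4 lα lβ lt
  refine ⟨-h (ρ 2), c, -h (ρ 4), α, β, r0, r1, r2, r3, r4, h0, h1, by ring, h3, by ring, ?_, ?_, ?_, ?_,
    ?_, ?_⟩
  · by_cases hc : c = 0
    · exact Or.inl hc
    · exact Or.inr ⟨by simpa [hc] using e4, by simpa [hc] using e5⟩
  · rw [r2]; linarith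
  · rw [r4]; linarith
  · rw [r2, r4]; linarith
  · rw [r2, r4]; linarith
  · rw [r2, r4]; linarith

/-- Every prism has a normal form. -/
lemma IsData.exists_prismForm {ρ : Fin 5 → Lat} {h : Lat → ℤ}
    (hD : IsData (relabel ρ (fin lprism)) h) (hρ : Function.Injective ρ) : ∃ g : LatIso,
      (∀ T' h', Iso (poly T' h') (poly (relabel g.A T') (g.height h'))) ∧
      ∃ s c H α β, PrismForm (g.A ∘ ρ) (g.height h) s c H α β := by
  obtain ⟨g, hg, gA, gB, gC, g1, g2, g3⟩ :=
    hD.exists_normalized (mem_relabel_fin ρ (show lprism.any (eqv [0, 1, 3]) = true by decide))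
  refine ⟨g, hg, ?_⟩
  have := g.isData hD
  rw [relabel_relabel] at this
  refine this.prismForm (g.A.injective.comp hρ) gA gB gC ?_ ?_ ?_
  · rw [Function.comp_apply, gA, g1]
  · rw [Function.comp_apply, gB, g2]
  · rw [Function.comp_apply, gC, g3]

/-- The corners of a prism in normal form. -/
def prismCorner (s c H α β : ℤ) : List (Fin 5) → Lat
  | [0, 1, 3] => ![0, 0, 0]
  | [0, 2, 3] => ![0, s, 0]
  | [1, 2, 3] => ![s, 0, 0]
  | [0, 1, 4] => ![0, 0, H]
  | [0, 2, 4] => ![0, s + c * H, H + β * s]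
  | [1, 2, 4] => ![s + c * H, 0, H + α * s]
  | _ => 0

lemma PrismForm.corner {ρ : Fin 5 → Lat} {h : Lat → ℤ} {s c H α β : ℤ}
    (hP : PrismForm ρ h s c H α β) :
    ∀ t ∈ lprism, ∀ i ∈ t, ρ i ⬝ᵥ prismCorner s c H α β t = h (ρ i) := by
  have hα : c * α = 0 := by rcases hP.zero with h | h <;> simp [h]
  have hβ : c * β = 0 := by rcases hP.zero with h | h <;> simp [h]
  simp only [lprism, List.forall_mem_cons, List.not_mem_nil, IsEmpty.forall_iff, implies_true,
    and_true, prismCorner, hP.h0, hP.h1, hP.h2, hP.h3, hP.h4]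
  simp only [hP.r0, hP.r1, hP.r2, hP.r3, hP.r4, dot3, Matrix.cons_val]
  refine ⟨⟨?_, ?_, ?_⟩, ⟨?_, ?_, ?_⟩, ⟨?_, ?_, ?_⟩, ⟨?_, ?_, ?_⟩, ⟨?_, ?_, ?_⟩, ⟨?_, ?_, ?_⟩⟩ <;>
    first
      | ring1
      | linear_combination s * hβ
      | linear_combination s * hα
      | linear_combination H * hβ
      | linear_combination H * hα

/-- If `c = 0`, the three side edges are parallel, with lengths `H`, `H + α s` and `H + β s`, over
the triangle `s Δ₂`. Otherwise `α = β = 0` and the two bases are parallel. -/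
theorem IsData.cayley_of_prism {T : Finset (Finset Lat)} {h : Lat → ℤ} (hD : IsData T h)
    (h5 : (rays T).card = 5) :
    IsCayleyOfSegments (poly T h) ∨ IsCayleyOfPolygons (poly T h) := by
  obtain ⟨ρ, hρ, rfl⟩ := hD.hasType_prism h5
  obtain ⟨g, hg, s, c, H, α, β, hP⟩ := hD.exists_prismForm hρ
  by_cases hc : c = 0
  · left
    have h1 := hg (relabel ρ (fin lprism)) h
    have hD' := g.isData hD
    rw [relabel_relabel] at h1 hD'
    rw [hD'.poly_eq_of_corners _ hP.corner] at h1
    have h2 := hP.s_pos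
    have h3 := hP.H_pos
    have h4 := hP.α_pos
    have h5 := hP.β_pos
    obtain ⟨s, rfl⟩ := Int.eq_ofNat_of_zero_le (by omega : 0 ≤ s)
    obtain ⟨i, hi⟩ := Int.eq_ofNat_of_zero_le (by omega : 0 ≤ H)
    obtain ⟨j, hj⟩ := Int.eq_ofNat_of_zero_le (by omega : 0 ≤ H + α * s)
    obtain ⟨k, hk⟩ := Int.eq_ofNat_of_zero_le (by omega : 0 ≤ H + β * s)
    refine ⟨s, i, j, k, by omega, by omega, by omega, by omega, h1.trans ?_⟩
    rw [cayley_segments]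
    refine iso_convexHull (b := ![![0, 0, 1], ![1, 0, 0], ![0, 1, 0]])
      (u := ![![0, 0, 1], ![1, 0, 0], ![0, 1, 0]]) (by decide) 0 ?_
    simp only [lprism, List.map_cons, List.map_nil, prismCorner, hc, zero_mul, add_zero, hj, hk]
    have hf : ∀ x y z : ℤ, (0 : Lat) + ∑ l, (![x, y, z] : Lat) l •
        (![![0, 0, 1], ![1, 0, 0], ![0, 1, 0]] : Fin 3 → Lat) l = ![y, z, x] := by
      intro x y z
      ext l
      fin_cases l <;> simp [Fin.sum_univ_three]
    simp only [Finset.image_insert, Finset.image_singleton, hf, hi]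
    ext z
    simp only [List.toFinset_cons, List.toFinset_nil, insert_empty_eq, Finset.mem_insert,
      Finset.mem_singleton]
    clear * -
    grind
  · right
    have hab := hP.zero.resolve_left hc
    refine hD.isCayley_of_opposite (i := 3) (j := 4) (by decide) (g.A.injective ?_) (by decide)
    have h1 := hP.r4
    have h2 := hP.r3
    simp only [Function.comp_apply] at h1 h2
    rw [map_neg, h1, h2, hab.1, hab.2]
    simp

/-! ### Polytopes with six facets -/

/-- The upper bound for the number of lattice points of a region above a finite set of columns. -/
lemma columns_le {K : ℤ → ℤ → ℤ → Prop} {N : ℕ}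
    (hK : ∀ X : Finset Lat, (∀ v ∈ X, K (v 0) (v 1) (v 2)) → X.card ≤ N) (C : Finset (ℤ × ℤ))
    (lo hi : ℤ × ℤ → ℤ) (hC : ∀ x y, (x, y) ∈ C → ∀ z, lo (x, y) ≤ z → z ≤ hi (x, y) → K x y z) :
    ∑ p ∈ C, (hi p + 1 - lo p) ≤ N := by
  have hinj : Function.Injective fun q : (_ : ℤ × ℤ) × ℤ => (![q.1.1, q.1.2, q.2] : Lat) := by
    rintro ⟨⟨x, y⟩, z⟩ ⟨⟨x', y'⟩, z'⟩ h
    have h0 := congrFun h 0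
    have h1 := congrFun h 1
    have h2 := congrFun h 2
    simp only [Matrix.cons_val] at h0 h1 h2
    subst h0 h1 h2
    rfl
  have h1 := hK ((C.sigma fun p => Finset.Icc (lo p) (hi p)).image
    fun q : (_ : ℤ × ℤ) × ℤ => (![q.1.1, q.1.2, q.2] : Lat)) (fun v hv => by
    obtain ⟨⟨⟨x, y⟩, z⟩, hq, rfl⟩ := Finset.mem_image.mp hv
    rw [Finset.mem_sigma, Finset.mem_Icc] at hq
    exact hC x y hq.1 z hq.2.1 hq.2.2)
  rw [Finset.card_image_of_injective _ hinj, Finset.card_sigma] at h1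
  refine le_trans ?_ (Nat.cast_le.mpr h1)
  push_cast
  refine Finset.sum_le_sum fun p _ => ?_
  rw [Int.card_Icc]
  exact Int.self_le_toNat _

/-- An affine function that is at least `k` at the corners of a triangle is at least `k` on it. -/
lemma le_of_corners {s x y H α β k : ℤ} (hx : 0 ≤ x) (hy : 0 ≤ y) (hs : x + y ≤ s) (h0 : k ≤ H)
    (h1 : k ≤ H + α * s) (h2 : k ≤ H + β * s) : k ≤ H + α * x + β * y := by
  rcases (by omega : s = 0 ∨ 0 < s) with rfl | hs0
  · have : x = 0 := by omega
    have : y = 0 := by omega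
    subst x y; linarith
  · refine le_of_mul_le_mul_left (a := s) ?_ hs0
    nlinarith [mul_nonneg (sub_nonneg.mpr hs) (sub_nonneg.mpr h0),
      mul_nonneg hx (sub_nonneg.mpr h1), mul_nonneg hy (sub_nonneg.mpr h2)]

/-- The lattice points of the triangle `x + y ≤ n`. -/
noncomputable def tri (n : ℕ) : Finset (ℤ × ℤ) :=
  (Finset.Icc 0 (n : ℤ) ×ˢ Finset.Icc 0 (n : ℤ)).filter fun p => p.1 + p.2 ≤ n

lemma mem_tri {n : ℕ} {x y : ℤ} : (x, y) ∈ tri n ↔ 0 ≤ x ∧ 0 ≤ y ∧ x + y ≤ n := by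
  simp only [tri, Finset.mem_filter, Finset.mem_product, Finset.mem_Icc]
  omega

lemma tri_two : tri 2 = {(0, 0), (1, 0), (0, 1), (2, 0), (1, 1), (0, 2)} := by decide

/-- The region is a prism with the top corner over the origin cut off at level `k`. For `c = 0` and
`s ≥ 3`, two layers over a triangle already have 20 points; for `s = 2`, `k = 1` the columns contain
`6 H + 4 (α + β) + 5` points, and the bound leaves a single solution. For `c ≠ 0` the bases are
parallel, and explicit columns contain 25 or 18 points. -/
lemma corner_cut_params {s c H α β k : ℤ} (zero : c = 0 ∨ α = 0 ∧ β = 0)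
    (hs1 : 1 ≤ s) (hα : 1 ≤ H + α * s) (hβ : 1 ≤ H + β * s) (hk : 1 ≤ k) (hkH : k < H) (hs : c = 0 → k < s) (hm : k < s + c * H)
    (hN : ∀ X : Finset Lat, (∀ v ∈ X, 0 ≤ v 0 ∧ 0 ≤ v 1 ∧ 0 ≤ v 2 ∧ v 0 + v 1 ≤ s + c * v 2 ∧
      v 2 ≤ H + α * v 0 + β * v 1 ∧ k ≤ v 0 + v 1 + (H + α * v 0 + β * v 1 - v 2)) → X.card ≤ 16) :
    c = 0 ∧ s = 2 ∧ k = 1 ∧ H = 3 ∧ α = -1 ∧ β = -1 := by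
  have hcol := columns_le (K := fun x y z => 0 ≤ x ∧ 0 ≤ y ∧ 0 ≤ z ∧ x + y ≤ s + c * z ∧
    z ≤ H + α * x + β * y ∧ k ≤ x + y + (H + α * x + β * y - z)) hN
  by_cases hc : c = 0
  · subst hc
    have hs' := hs rfl
    by_cases h3 : 3 ≤ s
    · exfalso
      have := hcol (tri 3) 0 1 (fun x y hxy z hz hz' => by
        obtain ⟨hx, hy, hxy⟩ := mem_tri.mp hxy
        simp only [Pi.zero_apply, Pi.one_apply] at hz hz'
        have h1 := le_of_corners (s := s) hx hy (by push_cast at hxy; omega) (by omega) hα hβ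
        have h2 := le_of_corners (s := s) (k := k + 1) (H := H) (α := α + 1) (β := β + 1) hx hy
          (by push_cast at hxy; omega) (by omega) (by nlinarith) (by nlinarith)
        push_cast at hxy
        refine ⟨hx, hy, hz, by omega, by omega, by linarith⟩)
      revert this; decide
    · obtain rfl : s = 2 := by omega
      obtain rfl : k = 1 := by omega
      have := hcol (tri 2) 0 (fun p => if p = (0, 0) then H - 1 else H + α * p.1 + β * p.2)
        (fun x y hxy z hz hz' => by
          obtain ⟨hx, hy, hxy⟩ := mem_tri.mp hxy
          simp only [Pi.zero_apply, Prod.mk.injEq] at hz hz'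
          push_cast at hxy
          split_ifs at hz' with h0
          · obtain ⟨rfl, rfl⟩ := h0; omega
          · have : 1 ≤ x + y := by omega
            exact ⟨hx, hy, hz, by omega, hz', by linarith⟩)
      rw [tri_two] at this
      norm_num at this
      omega
  · obtain ⟨rfl, rfl⟩ := zero.resolve_left hc
    exfalso
    rcases lt_or_gt_of_ne hc with hc | hc
    · have h4 : 4 ≤ s := by nlinarith
      have h5 : 3 ≤ s + c := by nlinarith
      have := hcol (tri 4) 0 (fun p => if p.1 + p.2 ≤ 3 then 1 else 0) (fun x y hxy z hz hz' => by
        obtain ⟨hx, hy, hxy⟩ := mem_tri.mp hxy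
        simp only [Pi.zero_apply] at hz hz'
        push_cast at hxy
        rcases (by split_ifs at hz' <;> omega : z = 0 ∨ z = 1) with rfl | rfl
        · exact ⟨hx, hy, hz, by omega, by omega, by omega⟩
        · have : x + y ≤ 3 := by split_ifs at hz' <;> omega
          exact ⟨hx, hy, hz, by omega, by omega, by omega⟩)
      revert this; decide
    · have := hcol (tri 3) (fun p => max 0 (p.1 + p.2 - 1))
        (fun p => if 1 ≤ p.1 + p.2 then 2 else 1) (fun x y hxy z hz hz' => by
        obtain ⟨hx, hy, hxy⟩ := mem_tri.mp hxy
        push_cast at hxy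
        have hz0 : 0 ≤ z := le_trans (le_max_left _ _) hz
        have hz1 : x + y - 1 ≤ z := le_trans (le_max_right _ _) hz
        have : 1 * z ≤ c * z := mul_le_mul_of_nonneg_right hc hz0
        refine ⟨hx, hy, hz0, by omega, ?_, ?_⟩ <;> (simp only at hz'; split_ifs at hz' <;> omega))
      revert this; decide

/-- Here the edge of the top base over `x = 0` is cut off. The method is the one of
`corner_cut_params`, but two parameter sets survive; they turn out to describe the same polytope up
to isomorphism. -/
lemma edge_cut_params {s c H α β k : ℤ} (zero : c = 0 ∨ α = 0 ∧ β = 0)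
    (hs1 : 1 ≤ s) (hα : 1 ≤ H + α * s) (hβ : k < H + β * s) (hk : 1 ≤ k) (hkH : k < H)
    (hm : k < s + c * H)
    (hN : ∀ X : Finset Lat, (∀ v ∈ X, 0 ≤ v 0 ∧ 0 ≤ v 1 ∧ 0 ≤ v 2 ∧ v 0 + v 1 ≤ s + c * v 2 ∧
      v 2 ≤ H + α * v 0 + β * v 1 ∧ k ≤ v 0 + (H + α * v 0 + β * v 1 - v 2)) → X.card ≤ 16) :
    c = 0 ∧ s = 2 ∧ k = 1 ∧ H = 2 ∧ α = 0 ∧ β = 0 ∨ c = 1 ∧ s = 1 ∧ k = 1 ∧ H = 2 ∧ α = 0 ∧ β = 0 := by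
  have hcol := columns_le (K := fun x y z => 0 ≤ x ∧ 0 ≤ y ∧ 0 ≤ z ∧ x + y ≤ s + c * z ∧
    z ≤ H + α * x + β * y ∧ k ≤ x + (H + α * x + β * y - z)) hN
  by_cases hc : c = 0
  · left
    subst hc
    by_cases h3 : 3 ≤ s
    · exfalso
      have := hcol (tri 3) 0 1 (fun x y hxy z hz hz' => by
        obtain ⟨hx, hy, hxy⟩ := mem_tri.mp hxy
        simp only [Pi.zero_apply, Pi.one_apply] at hz hz'
        push_cast at hxy
        have h1 := le_of_corners (s := s) (k := 1) (β := β) hx hy (by omega) (by omega) hα (by omega)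
        have h2 := le_of_corners (s := s) (k := k + 1) (H := H) (α := α + 1) (β := β) hx hy
          (by omega) (by omega) (by nlinarith) (by omega)
        exact ⟨hx, hy, hz, by omega, by omega, by linarith⟩)
      revert this; decide
    · obtain rfl : s = 2 := by omega
      obtain rfl : k = 1 := by omega
      have := hcol (tri 2) 0 (fun p => if p.1 = 0 then H + β * p.2 - 1 else H + α * p.1 + β * p.2)
        (fun x y hxy z hz hz' => by
          obtain ⟨hx, hy, hxy⟩ := mem_tri.mp hxy
          simp only [Pi.zero_apply] at hz hz'
          push_cast at hxy
          split_ifs at hz' with h0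
          · subst h0; exact ⟨hx, hy, hz, by omega, by omega, by omega⟩
          · have : 1 ≤ x := by omega
            exact ⟨hx, hy, hz, by omega, hz', by linarith⟩)
      rw [tri_two] at this
      norm_num at this
      omega
  · obtain ⟨rfl, rfl⟩ := zero.resolve_left hc
    rcases lt_or_gt_of_ne hc with hc | hc
    · exfalso
      have h4 : 4 ≤ s := by nlinarith
      have h5 : 3 ≤ s + c := by nlinarith
      have := hcol (tri 4) 0 (fun p => if p.1 + p.2 ≤ 3 then 1 else 0) (fun x y hxy z hz hz' => by
        obtain ⟨hx, hy, hxy⟩ := mem_tri.mp hxy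
        simp only [Pi.zero_apply] at hz hz'
        push_cast at hxy
        rcases (by split_ifs at hz' <;> omega : z = 0 ∨ z = 1) with rfl | rfl
        · exact ⟨hx, hy, hz, by omega, by omega, by omega⟩
        · have : x + y ≤ 3 := by split_ifs at hz' <;> omega
          exact ⟨hx, hy, hz, by omega, by omega, by omega⟩)
      revert this; decide
    · have key : ∀ x y z : ℤ, 0 ≤ x → 0 ≤ y → 0 ≤ z → x + y ≤ s + c * z → z ≤ H → k ≤ x + (H - z) →
          0 ≤ x ∧ 0 ≤ y ∧ 0 ≤ z ∧ x + y ≤ s + c * z ∧ z ≤ H + 0 * x + 0 * y ∧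
            k ≤ x + (H + 0 * x + 0 * y - z) := by
        intro x y z hx hy hz h1 h2 h3
        exact ⟨hx, hy, hz, h1, by omega, by omega⟩
      by_cases h2 : 2 ≤ s
      · exfalso
        have := hcol (tri 3) (fun p => if p.1 + p.2 ≤ 2 then 0 else 1)
          (fun p => if 1 ≤ p.1 then 2 else 1) (fun x y hxy z hz hz' => by
          obtain ⟨hx, hy, hxy⟩ := mem_tri.mp hxy
          push_cast at hxy
          simp only at hz hz'
          have hz0 : 0 ≤ z := by split_ifs at hz <;> omega
          have : 1 * z ≤ c * z := mul_le_mul_of_nonneg_right hc hz0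
          refine key _ _ _ hx hy hz0 ?_ ?_ ?_ <;> split_ifs at hz hz' <;> omega)
        revert this; decide
      obtain rfl : s = 1 := by omega
      by_cases h2 : 2 ≤ c
      · exfalso
        have := hcol (tri 3) (fun p => if p.1 + p.2 ≤ 1 then 0 else 1)
          (fun p => if 1 ≤ p.1 then 2 else 1) (fun x y hxy z hz hz' => by
          obtain ⟨hx, hy, hxy⟩ := mem_tri.mp hxy
          push_cast at hxy
          simp only at hz hz'
          have hz0 : 0 ≤ z := by split_ifs at hz <;> omega
          have : 2 * z ≤ c * z := mul_le_mul_of_nonneg_right h2 hz0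
          refine key _ _ _ hx hy hz0 ?_ ?_ ?_ <;> split_ifs at hz hz' <;> omega)
        revert this; decide
      obtain rfl : c = 1 := by omega
      by_cases h2 : H = 2
      · right; omega
      exfalso
      by_cases hk2 : k ≤ H - 2
      · have := hcol (tri 3) (fun p => max 0 (p.1 + p.2 - 1)) (fun p => 2) (fun x y hxy z hz hz' => by
          obtain ⟨hx, hy, hxy⟩ := mem_tri.mp hxy
          push_cast at hxy
          have hz0 : 0 ≤ z := le_trans (le_max_left _ _) hz
          have hz1 : x + y - 1 ≤ z := le_trans (le_max_right _ _) hz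
          exact key _ _ _ hx hy hz0 (by omega) (by omega) (by omega))
        revert this; decide
      · have := hcol ((tri 4).filter fun p => p.1 + p.2 ≤ 2 ∨ 1 ≤ p.1 ∧ p.1 + p.2 ≤ 3 ∨ 2 ≤ p.1)
          (fun p => max 0 (p.1 + p.2 - 1)) (fun p => if 2 ≤ p.1 then 3 else if 1 ≤ p.1 then 2 else 1)
          (fun x y hxy z hz hz' => by
          rw [Finset.mem_filter, mem_tri] at hxy
          obtain ⟨⟨hx, hy, hxy⟩, -⟩ := hxy
          have hz0 : 0 ≤ z := le_trans (le_max_left _ _) hz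
          have hz1 : x + y - 1 ≤ z := le_trans (le_max_right _ _) hz
          simp only at hz'
          refine key _ _ _ hx hy hz0 (by omega) ?_ ?_ <;> split_ifs at hz' <;> omega)
        revert this; decide

lemma nodup_cuts : ∀ s ∈ cuts, s.Nodup := by decide

attribute [local irreducible] lprism cuts in
/-- A blow-up of a prism in normal form. -/
lemma Six.normal {T : Finset (Finset Lat)} {h : Lat → ℤ} {N : ℕ} (hD : IsData T h)
    (hN : Small T h N) (h6 : Six T h) : ∃ s ∈ cuts, ∃ (q : Fin 6 → Lat) (h' : Lat → ℤ) (k : ℕ),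
      Function.Injective q ∧ 1 ≤ k ∧
      (∃ m c H α β, PrismForm (q ∘ Fin.castSucc) h' m c H α β) ∧
      q 5 = (s.map fun i => q i.castSucc).sum ∧
      h' (q 5) = (s.map fun i => h' (q i.castSucc)).sum + k ∧
      IsData (relabel q (fin (lext lprism s))) h' ∧ Small (relabel q (fin (lext lprism s))) h' N ∧
      Iso (poly T h) (poly (relabel q (fin (lext lprism s))) h') := by
  obtain ⟨s, hs, ρ, h₀, k, hρ, hD₀, hk, hc, hl, rfl, rfl⟩ := h6
  obtain ⟨g, hg, m, c, H, α, β, hP⟩ := hD₀.exists_prismForm hρ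
  have hcard := card_cuts s hs
  have hsum : ∀ {M : Type} [AddCommMonoid M] (f : Lat → M),
      ∑ u ∈ s.toFinset.image ρ, f u = (s.map fun i => f (ρ i)).sum := by
    intro M _ f
    rw [Finset.sum_image fun x _ y _ h => hρ h,
      List.sum_toFinset _ (nodup_cuts s hs)]
  have hp := hD₀.sum_notMem_rays hc (by omega)
  have hne : ∀ i, ρ i ≠ ∑ u ∈ s.toFinset.image ρ, u :=
    fun i hi => hp (by rw [← hi]; exact rays_relabel_univ rays_prism ρ i)
  obtain ⟨hinj, hrel⟩ := relabel_snoc (fin lprism) s.toFinset hρ hne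
  set p := ∑ u ∈ s.toFinset.image ρ, u with hpdef
  set q₀ : Fin 6 → Lat := Fin.snoc ρ p with hq₀
  have hq : ∀ i : Fin 5, q₀ i.castSucc = ρ i := fun i => by
    rw [hq₀]; exact Fin.snoc_castSucc (α := fun _ => Lat) _ _ _
  have hq5 : q₀ 5 = p := by rw [hq₀]; exact Fin.snoc_last (α := fun _ => Lat) _ _
  rw [hrel, ext_fin] at hD hN ⊢
  have hD' := g.isData hD
  have hN' := g.small hN
  have hI := hg (relabel q₀ (fin (lext lprism s))) (blowHeight h₀ (s.toFinset.image ρ) k)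
  rw [relabel_relabel] at hD' hN' hI
  have hh : ∀ i, g.height (blowHeight h₀ (s.toFinset.image ρ) k) (g.A (ρ i)) =
      g.height h₀ (g.A (ρ i)) := by
    intro i
    rw [g.height_apply, g.height_apply, blowHeight, Function.update_of_ne (hne i)]
  refine ⟨s, hs, g.A ∘ q₀, _, k, g.A.injective.comp hinj, hk, ⟨m, c, H, α, β, ?_⟩, ?_, ?_, hD', hN',
    hI⟩
  · have : (g.A ∘ q₀) ∘ Fin.castSucc = g.A ∘ ρ := by
      ext i : 1
      simp only [Function.comp_apply, hq]
    rw [this]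
    exact { hP with
      h0 := (hh 0).trans hP.h0
      h1 := (hh 1).trans hP.h1
      h2 := (hh 2).trans hP.h2
      h3 := (hh 3).trans hP.h3
      h4 := (hh 4).trans hP.h4 }
  · simp only [Function.comp_apply, hq, hq5]
    rw [hpdef, map_sum, hsum]
  · simp only [Function.comp_apply, hq, hq5, hh]
    rw [g.height_apply, hpdef, blowHeight, Function.update_self, map_sum, sum_dotProduct, hsum,
      hsum]
    simp only [g.height_apply]
    rw [List.sum_map_add]
    ring

lemma small_coord {n : ℕ} {L : List (List (Fin n))} {q : Fin n → Lat} {h : Lat → ℤ} {N : ℕ}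
    (hN : Small (relabel q (fin L)) h N) (X : Finset Lat) (hX : ∀ v ∈ X, ∀ i, h (q i) ≤ q i ⬝ᵥ v) :
    X.card ≤ N := by
  refine hN X fun v hv u hu => ?_
  rw [rays_relabel] at hu
  obtain ⟨i, -, rfl⟩ := Finset.mem_image.mp hu
  exact hX v hv i

/-- The vertices of the blow-up of `Cay²(3Δ₁, Δ₁, Δ₁)` at a vertex. -/
def W₁ : Finset Lat := {![0, 0, 0], ![2, 0, 0], ![2, 1, 0], ![2, 0, 1], ![0, 2, 0], ![1, 2, 0],
  ![0, 0, 2], ![1, 0, 2]}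

def cornerA : List (Fin 6) → Lat
  | [0, 1, 3] => ![0, 0, 0]
  | [0, 2, 3] => ![0, 2, 0]
  | [1, 2, 3] => ![2, 0, 0]
  | [5, 1, 4] => ![1, 0, 2]
  | [0, 5, 4] => ![0, 1, 2]
  | [0, 1, 5] => ![0, 0, 2]
  | [0, 2, 4] => ![0, 2, 1]
  | [1, 2, 4] => ![2, 0, 1]
  | _ => 0

def cornerB : List (Fin 6) → Lat
  | [0, 1, 3] => ![0, 0, 0]
  | [0, 2, 3] => ![0, 2, 0]
  | [1, 2, 3] => ![2, 0, 0]
  | [5, 1, 4] => ![1, 0, 2]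
  | [0, 1, 5] => ![0, 0, 1]
  | [5, 2, 4] => ![1, 1, 2]
  | [0, 2, 5] => ![0, 2, 1]
  | [1, 2, 4] => ![2, 0, 2]
  | _ => 0

def cornerC : List (Fin 6) → Lat
  | [0, 1, 3] => ![0, 0, 0]
  | [0, 2, 3] => ![0, 1, 0]
  | [1, 2, 3] => ![1, 0, 0]
  | [5, 1, 4] => ![1, 0, 2]
  | [0, 1, 5] => ![0, 0, 1]
  | [5, 2, 4] => ![1, 2, 2]
  | [0, 2, 5] => ![0, 2, 1]
  | [1, 2, 4] => ![3, 0, 2]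
  | _ => 0

lemma IsCayleyOfPolygons.of_iso {P Q : Set Spc} (h : Iso P Q) (hQ : IsCayleyOfPolygons Q) :
    IsCayleyOfPolygons P := by
  obtain ⟨s, P₀, P₁, hs, h0, h1, h2, h3⟩ := hQ
  exact ⟨s, P₀, P₁, hs, h0, h1, h2, h.trans h3⟩

/-- A polytope given by explicit normals and heights. -/
lemma IsData.poly_eq_of_explicit {n : ℕ} {L : List (List (Fin n))} {ρ ρ₀ : Fin n → Lat}
    {h : Lat → ℤ} {h₀ : Fin n → ℤ} (hD : IsData (relabel ρ (fin L)) h) (hρ : ∀ i, ρ i = ρ₀ i)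
    (hh : ∀ i, h (ρ i) = h₀ i) (v : List (Fin n) → Lat)
    (hv : (L.all fun t => t.all fun i => decide (ρ₀ i ⬝ᵥ v t = h₀ i)) = true) :
    poly (relabel ρ (fin L)) h =
      convexHull ℝ (toReal '' (((L.map v).toFinset : Finset Lat) : Set Lat)) := by
  refine hD.poly_eq_of_corners v fun t ht i hi => ?_
  have := List.all_eq_true.mp (List.all_eq_true.mp hv t ht) i hi
  rw [hh, hρ]
  exact of_decide_eq_true this

/-- Cutting a side edge keeps a pair of opposite normals: the new facet against the third side if `c
= 0`, the two bases otherwise. For the other two cuts the parameters are determined by the count of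
lattice points, and each solution is matched with `W₁` by an explicit lattice map. -/
theorem Six.classify {T : Finset (Finset Lat)} {h : Lat → ℤ} (hD : IsData T h)
    (hN : Small T h 16) (h6 : Six T h) : IsCayleyOfPolygons (poly T h) ∨
      Iso (poly T h) (convexHull ℝ (toReal '' (W₁ : Set Lat))) := by
  obtain ⟨s, hs, q, h', k, hq, hk, ⟨m, c, H, α, β, hP⟩, q5, h5, hD', hN', hI⟩ := h6.normal hD hN
  have r0 : q 0 = ![1, 0, 0] := hP.r0
  have r1 : q 1 = ![0, 1, 0] := hP.r1
  have r2 : q 2 = ![-1, -1, c] := hP.r2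
  have r3 : q 3 = ![0, 0, 1] := hP.r3
  have r4 : q 4 = ![α, β, -1] := hP.r4
  have h0 : h' (q 0) = 0 := hP.h0
  have h1 : h' (q 1) = 0 := hP.h1
  have h2 : h' (q 2) = -m := hP.h2
  have h3 : h' (q 3) = 0 := hP.h3
  have h4 : h' (q 4) = -H := hP.h4
  have zero := hP.zero
  have s_pos := hP.s_pos
  have H_pos := hP.H_pos
  have α_pos := hP.α_pos
  have β_pos := hP.β_pos
  have top_pos := hP.top_pos
  clear hP hN hD h6
  simp only [cuts, List.mem_cons, List.not_mem_nil, or_false] at hs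
  rcases hs with rfl | rfl | rfl
  · left
    refine IsCayleyOfPolygons.of_iso hI ?_
    have q5' : q 5 = q 0 + (q 1 + 0) := q5
    by_cases hc : c = 0
    · refine hD'.isCayley_of_opposite (i := 5) (j := 2) (by decide) ?_ (by decide)
      rw [q5', r0, r1, r2, hc]; decide
    · obtain ⟨rfl, rfl⟩ := zero.resolve_left hc
      refine hD'.isCayley_of_opposite (i := 3) (j := 4) (by decide) ?_ (by decide)
      rw [r3, r4]; decide
  · right
    have q5' : q 5 = ![1 + α, β, -1] := by
      have : q 5 = q 0 + (q 4 + 0) := q5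
      rw [this, r0, r4]; ext i; fin_cases i <;> simp
    have h5' : h' (q 5) = k - H := by
      have : h' (q 5) = h' (q 0) + (h' (q 4) + 0) + k := h5
      rw [this, h0, h4]; ring
    have hcα : c * α = 0 := by rcases zero with h | h <;> simp [h]
    have hcβ : c * β = 0 := by rcases zero with h | h <;> simp [h]
    -- The three corners of the prism adjacent to the edge's ends survive the cut and must lie
    -- strictly beyond it; this bounds the level `k` from above.
    have l1 := hD'.corner_lt hq 0 1 3 5 (by decide) (by decide) (by decide) (v := ![0, 0, 0])
      (by simp [h0]) (by simp [h1]) (by simp [h3])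
    have l2 := hD'.corner_lt hq 0 2 3 5 (by decide) (by decide) (by decide) (v := ![0, m, 0])
      (by rw [h0, r0]; simp) (by rw [h2, r2]; simp) (by rw [h3, r3]; simp)
    have l3 := hD'.corner_lt hq 1 2 4 5 (by decide) (by decide) (by decide)
      (v := ![m + c * H, 0, H + α * m]) (by rw [h1, r1]; simp)
      (by rw [h2, r2]; simp; linear_combination m * hcα)
      (by rw [h4, r4]; simp; linear_combination H * hcα)
    rw [h5', q5', dot3] at l1 l2 l3
    simp only [Matrix.cons_val] at l1 l2 l3
    have l3' : k < m + c * H := by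
      have : H * (c * α) = 0 := by rw [hcα, mul_zero]
      linarith
    have hpar := edge_cut_params zero s_pos α_pos (by linarith) (by exact_mod_cast hk)
      (by linarith) l3' (fun X hX => small_coord hN' X fun v hv i => by
        obtain ⟨b1, b2, b3, b4, b5, b6⟩ := hX v hv
        rw [dot3]
        fin_cases i
        · change h' (q 0) ≤ q 0 0 * _ + q 0 1 * _ + q 0 2 * _
          rw [h0, r0]; simpa using b1
        · change h' (q 1) ≤ q 1 0 * _ + q 1 1 * _ + q 1 2 * _
          rw [h1, r1]; simpa using b2
        · change h' (q 2) ≤ q 2 0 * _ + q 2 1 * _ + q 2 2 * _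
          rw [h2, r2]; simp only [Matrix.cons_val]; linarith
        · change h' (q 3) ≤ q 3 0 * _ + q 3 1 * _ + q 3 2 * _
          rw [h3, r3]; simpa using b3
        · change h' (q 4) ≤ q 4 0 * _ + q 4 1 * _ + q 4 2 * _
          rw [h4, r4]; simp only [Matrix.cons_val]; linarith
        · change h' (q 5) ≤ q 5 0 * _ + q 5 1 * _ + q 5 2 * _
          rw [h5', q5']; simp only [Matrix.cons_val]; linarith)
    refine hI.trans ?_
    rcases hpar with ⟨rfl, rfl, hk1, rfl, rfl, rfl⟩ | ⟨rfl, rfl, hk1, rfl, rfl, rfl⟩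
    · rw [hD'.poly_eq_of_explicit (ρ₀ := ![![1, 0, 0], ![0, 1, 0], ![-1, -1, 0], ![0, 0, 1],
        ![0, 0, -1], ![1, 0, -1]]) (h₀ := ![0, 0, -2, 0, -2, -1]) ?_ ?_ cornerB (by decide)]
      · exact iso_convexHull (b := ![![0, 0, 1], ![-1, 0, 0], ![-1, 1, 0]])
          (u := ![![0, 0, 1], ![-1, -1, 0], ![0, 1, 0]]) (by decide) ![2, 0, 0] (by decide +kernel)
      · intro i; fin_cases i <;> assumption
      · intro i; fin_cases i <;> first | assumption | (refine h5'.trans ?_; rw [hk1]; rfl)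
    · rw [hD'.poly_eq_of_explicit (ρ₀ := ![![1, 0, 0], ![0, 1, 0], ![-1, -1, 1], ![0, 0, 1],
        ![0, 0, -1], ![1, 0, -1]]) (h₀ := ![0, 0, -1, 0, -2, -1]) ?_ ?_ cornerC (by decide)]
      · exact iso_convexHull (b := ![![-1, 0, -1], ![-1, 0, 0], ![-1, 1, 0]])
          (u := ![![0, 0, -1], ![-1, -1, 1], ![0, 1, 0]]) (by decide) ![3, 0, 2] (by decide +kernel)
      · intro i; fin_cases i <;> assumption
      · intro i; fin_cases i <;> first | assumption | (refine h5'.trans ?_; rw [hk1]; rfl)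
  · right
    have q5' : q 5 = ![1 + α, 1 + β, -1] := by
      have : q 5 = q 0 + (q 1 + (q 4 + 0)) := q5
      rw [this, r0, r1, r4]; ext i; fin_cases i <;> simp
    have h5' : h' (q 5) = k - H := by
      have : h' (q 5) = h' (q 0) + (h' (q 1) + (h' (q 4) + 0)) + k := h5
      rw [this, h0, h1, h4]; ring
    have hcα : c * α = 0 := by rcases zero with h | h <;> simp [h]
    have l1 := hD'.corner_lt hq 0 1 3 5 (by decide) (by decide) (by decide) (v := ![0, 0, 0])
      (by simp [h0]) (by simp [h1]) (by simp [h3])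
    have l3 := hD'.corner_lt hq 1 2 4 5 (by decide) (by decide) (by decide)
      (v := ![m + c * H, 0, H + α * m]) (by rw [h1, r1]; simp)
      (by rw [h2, r2]; simp; linear_combination m * hcα)
      (by rw [h4, r4]; simp; linear_combination H * hcα)
    rw [h5', q5', dot3] at l1 l3
    simp only [Matrix.cons_val] at l1 l3
    have l3' : k < m + c * H := by
      have : H * (c * α) = 0 := by rw [hcα, mul_zero]
      linarith
    obtain ⟨rfl, rfl, hk1, rfl, rfl, rfl⟩ := corner_cut_params zero s_pos α_pos β_pos
      (by exact_mod_cast hk) (by linarith) (fun hc => by rw [hc] at l3'; linarith) l3'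
      (fun X hX => small_coord hN' X fun v hv i => by
        obtain ⟨b1, b2, b3, b4, b5, b6⟩ := hX v hv
        rw [dot3]
        fin_cases i
        · change h' (q 0) ≤ q 0 0 * _ + q 0 1 * _ + q 0 2 * _
          rw [h0, r0]; simpa using b1
        · change h' (q 1) ≤ q 1 0 * _ + q 1 1 * _ + q 1 2 * _
          rw [h1, r1]; simpa using b2
        · change h' (q 2) ≤ q 2 0 * _ + q 2 1 * _ + q 2 2 * _
          rw [h2, r2]; simp only [Matrix.cons_val]; linarith
        · change h' (q 3) ≤ q 3 0 * _ + q 3 1 * _ + q 3 2 * _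
          rw [h3, r3]; simpa using b3
        · change h' (q 4) ≤ q 4 0 * _ + q 4 1 * _ + q 4 2 * _
          rw [h4, r4]; simp only [Matrix.cons_val]; linarith
        · change h' (q 5) ≤ q 5 0 * _ + q 5 1 * _ + q 5 2 * _
          rw [h5', q5']; simp only [Matrix.cons_val]; linarith)
    refine hI.trans ?_
    rw [hD'.poly_eq_of_explicit (ρ₀ := ![![1, 0, 0], ![0, 1, 0], ![-1, -1, 0], ![0, 0, 1],
      ![-1, -1, -1], ![0, 0, -1]]) (h₀ := ![0, 0, -2, 0, -3, -2]) ?_ ?_ cornerA (by decide)]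
    · exact iso_convexHull (b := ![![0, 0, 1], ![1, 0, 0], ![0, 1, 0]])
        (u := ![![0, 0, 1], ![1, 0, 0], ![0, 1, 0]]) (by decide) 0 (by decide +kernel)
    · intro i; fin_cases i <;> assumption
    · intro i; fin_cases i <;> first | assumption | (refine h5'.trans ?_; rw [hk1]; rfl)

/-! ### Bounds from counting faces with lattice points -/

lemma sum_deg {α : Type*} [DecidableEq α] {T : Finset (Finset α)} {m : ℕ}
    (hT : ∀ t ∈ T, t.card = m) : ∑ u ∈ rays T, deg T u = m * T.card := by
  have h1 : ∀ u, deg T u = ∑ t ∈ T, if u ∈ t then 1 else 0 := fun u => by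
    rw [deg, Finset.card_filter]
  rw [Finset.sum_congr rfl fun u _ => h1 u, Finset.sum_comm, mul_comm, ← smul_eq_mul,
    ← Finset.sum_const]
  refine Finset.sum_congr rfl fun t ht => ?_
  rw [← Finset.sum_filter, Finset.sum_const, smul_eq_mul, mul_one, ← hT t ht]
  congr 1
  ext u
  rw [Finset.mem_filter, mem_rays]
  exact ⟨fun h => h.2, fun h => ⟨⟨t, ht, h⟩, h⟩⟩

namespace IsData
variable {T : Finset (Finset Lat)} {h : Lat → ℤ}

/-- The four extra points lie on the facet `u`, whereas the interior point of another facet `w` is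
tight only at `w`, so nothing is counted twice. -/
lemma card_add_four_le (hD : IsData T h) {N : ℕ} (hs : Small T h N) {u : Lat} (hu : 7 ≤ deg T u) :
    T.card + 4 + ((rays T).filter fun w => w ≠ u ∧ 5 ≤ deg T w).card ≤ N := by
  set B := (rays T).filter fun w => w ≠ u ∧ 5 ≤ deg T w with hB
  have hex : ∀ w ∈ B, ∃ z, InPoly T h z ∧ tight T h z = {w} := fun w hw =>
    hD.hasPt_singleton (Finset.mem_filter.mp hw).2.2
  choose! f hf using hex
  set X := (hs.finite_facetPts u).toFinset with hXdef
  have hX : (X : Set Lat) = facetPts T h u := (hs.finite_facetPts u).coe_toFinset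
  have h4 := hD.four_le_card_facetPts hu hX
  have hXm : ∀ z, z ∈ X ↔ InPoly T h z ∧ u ⬝ᵥ z = h u ∧ tight T h z ∉ T := fun z => by
    rw [← Finset.mem_coe, hX]; rfl
  have hV : (T.image (vert h)).card = T.card :=
    Finset.card_image_of_injOn fun t ht t' ht' he => hD.vert_injOn ht ht' he
  have hF : (B.image f).card = B.card := Finset.card_image_of_injOn fun w hw w' hw' he => by
    have h1 := (hf w hw).2
    rw [show f w = f w' from he, (hf w' hw').2] at h1
    exact (Finset.singleton_injective h1).symm
  have hur : u ∈ rays T := by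
    have : (T.filter fun t => u ∈ t).Nonempty := Finset.card_pos.mp (by rw [deg] at hu; omega)
    obtain ⟨t, ht⟩ := this
    exact hD.mem_rays (Finset.mem_filter.mp ht).1 (Finset.mem_filter.mp ht).2
  have hd1 : Disjoint (T.image (vert h)) X := Finset.disjoint_left.mpr fun z h1 h2 => by
    obtain ⟨t, ht, rfl⟩ := Finset.mem_image.mp h1
    exact ((hXm _).mp h2).2.2 (by rwa [hD.tight_vert ht])
  have hd2 : Disjoint (T.image (vert h) ∪ X) (B.image f) := Finset.disjoint_left.mpr fun z h1 h2 => by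
    obtain ⟨w, hw, rfl⟩ := Finset.mem_image.mp h2
    rcases Finset.mem_union.mp h1 with h3 | h3
    · obtain ⟨t, ht, he⟩ := Finset.mem_image.mp h3
      have h5 := hD.tight_vert ht
      rw [he, (hf w hw).2] at h5
      have := hD.card ht
      rw [← h5, Finset.card_singleton] at this
      omega
    · have h5 : u ∈ tight T h (f w) := Finset.mem_filter.mpr ⟨hur, ((hXm _).mp h3).2.1⟩
      rw [(hf w hw).2, Finset.mem_singleton] at h5
      exact (Finset.mem_filter.mp hw).2.1 h5.symm
  have := hs (T.image (vert h) ∪ X ∪ B.image f) (fun z hz => by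
    rcases Finset.mem_union.mp hz with hz | hz
    · rcases Finset.mem_union.mp hz with hz | hz
      · obtain ⟨t, ht, rfl⟩ := Finset.mem_image.mp hz
        exact hD.inPoly_vert ht
      · exact ((hXm _).mp hz).1
    · obtain ⟨w, hw, rfl⟩ := Finset.mem_image.mp hz
      exact (hf w hw).1)
  rw [Finset.card_union_of_disjoint hd2, Finset.card_union_of_disjoint hd1, hV, hF] at this
  omega

/-- Nine facets would mean at least 14 vertices, so no heptagons and at most two facets with five or
six corners. The degrees then sum to at most `4 n + 4` for `n` facets, but the sum is three times
the number of vertices, at least `6 n - 12`. -/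
theorem card_rays_le (hD : IsData T h) (hs : Small T h 16)
    (hT : 2 * (rays T).card ≤ T.card + 4) : (rays T).card ≤ 8 := by
  by_contra! h9
  have hdeg : ∀ u ∈ rays T, deg T u ≤ 6 := by
    intro u _
    by_contra! hu
    have := hD.card_add_four_le hs hu
    omega
  set B := (rays T).filter fun w => 5 ≤ deg T w with hB
  have h1 := hD.card_add_card_le hs (B.image fun w => {w})
    (fun s hs => by
      obtain ⟨w, -, rfl⟩ := Finset.mem_image.mp hs
      simp)
    (fun s hs => by
      obtain ⟨w, hw, rfl⟩ := Finset.mem_image.mp hs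
      exact hD.hasPt_singleton (Finset.mem_filter.mp hw).2)
  rw [Finset.card_image_of_injective _ Finset.singleton_injective] at h1
  have h2 := sum_deg fun t ht => hD.card ht
  have h3 : ∑ u ∈ rays T, deg T u ≤ ∑ u ∈ rays T, (4 + if 5 ≤ deg T u then 2 else 0) := by
    refine Finset.sum_le_sum fun u hu => ?_
    have := hdeg u hu
    split_ifs <;> omega
  rw [Finset.sum_add_distrib, Finset.sum_const, ← Finset.sum_filter, Finset.sum_const, ← hB,
    smul_eq_mul, smul_eq_mul] at h3
  omega

/-- A facet normal whose slack takes the same value at three vertices of another facet is opposite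
to the normal of that facet. -/
lemma eq_neg_of_three_le (hD : IsData T h) {u a : Lat} (ha : a ∈ rays T) (hau : a ≠ u) {k : ℤ}
    (h3 : 3 ≤ (T.filter fun t => u ∈ t ∧ a ⬝ᵥ vert h t - h a = k).card) : a = -u := by
  -- If `a` were not constant on the facet `u`, its level set there would be a line, which contains
  -- at most two vertices. So `a` vanishes on both edge directions of the facet and is a multiple of
  -- `u`.
  have hsep : ∀ b : Lat, ¬ ∀ y z : Lat, u ⬝ᵥ y = u ⬝ᵥ z → a ⬝ᵥ y = a ⬝ᵥ z → b ⬝ᵥ y = b ⬝ᵥ z → y = z :=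
    fun b hb => by
      have := hD.card_line_le hb k
      omega
  obtain ⟨t, ht⟩ : (T.filter fun t => u ∈ t ∧ a ⬝ᵥ vert h t - h a = k).Nonempty :=
    Finset.card_pos.mp (by omega)
  obtain ⟨ht, hut, -⟩ := Finset.mem_filter.mp ht
  have hd := hD.isDual ht
  have key : ∀ v ∈ t, v ≠ u → a ⬝ᵥ dualv t v = 0 := by
    intro v hv hvu
    by_contra hne
    obtain ⟨w, hw⟩ : ∃ w, (t.erase u).erase v = {w} := Finset.card_eq_one.mp (by
      rw [Finset.card_erase_of_mem (Finset.mem_erase.mpr ⟨hvu, hv⟩), Finset.card_erase_of_mem hut,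
        hD.card ht])
    have ht3 : t = {u, v, w} := by
      rw [← hw, Finset.insert_erase (Finset.mem_erase.mpr ⟨hvu, hv⟩), Finset.insert_erase hut]
    refine hsep w fun y z h1 h2 h3 => hd.ext_primal_int fun x hx => ?_
    have h4 := hd.expand_primal_int (y - z)
    have h5 := congrArg (a ⬝ᵥ ·) h4
    have hx' := hx
    rw [ht3] at hx'
    simp only [Finset.mem_insert, Finset.mem_singleton] at hx'
    rcases hx' with rfl | rfl | rfl
    · exact h1
    · obtain ⟨n1, n2, n3⟩ := hD.triple_ne (ht3 ▸ ht)
      simp only [dotProduct_sum, dotProduct_smul, smul_eq_mul] at h5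
      rw [Finset.sum_eq_single x] at h5
      · rw [dotProduct_sub, dotProduct_sub, h2, sub_self] at h5
        have := (mul_eq_zero.mp h5.symm).resolve_right hne
        linarith
      · intro b hb hbx
        rw [ht3] at hb
        simp only [Finset.mem_insert, Finset.mem_singleton] at hb
        rcases hb with rfl | rfl | rfl
        · rw [dotProduct_sub, h1, sub_self, zero_mul]
        · exact absurd rfl hbx
        · rw [dotProduct_sub, h3, sub_self, zero_mul]
      · exact fun hh => absurd hx hh
    · exact h3
  have ha' := hd.expand_dual_int a
  rw [Finset.sum_eq_single u (fun v hv hvu => by rw [key v hv hvu, zero_smul])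
    (fun hh => absurd hut hh)] at ha'
  -- As a member of a basis `a` is primitive, so the factor is `1` or `-1`.
  obtain ⟨t', ht', hat'⟩ := SmoothPolytope.mem_rays.mp ha
  have h1 := (hD.isDual ht').dot_self hat'
  nth_rewrite 1 [ha'] at h1
  rw [smul_dotProduct, smul_eq_mul] at h1
  rcases Int.isUnit_iff.mp (IsUnit.of_mul_eq_one _ h1) with h2 | h2
  · rw [h2, one_smul] at ha'
    exact absurd ha' hau
  · rw [h2, neg_smul, one_smul] at ha'
    exact ha'

variable {n : ℕ} {L : List (List (Fin n))} {ρ : Fin n → Lat}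

lemma deg_list (hL : ldistinct L = true) (hρ : Function.Injective ρ) (u : Fin n) :
    deg (relabel ρ (fin L)) (ρ u) = ldeg L u := by
  rw [deg_relabel hρ, deg_fin hL]

lemma hasPt_facet (hD : IsData (relabel ρ (fin L)) h) (hL : ldistinct L = true)
    (hρ : Function.Injective ρ) {u : Fin n} (hu : 5 ≤ ldeg L u) :
    HasPt (relabel ρ (fin L)) h (Finset.image ρ {u}) := by
  rw [Finset.image_singleton]
  exact hD.hasPt_singleton (by rwa [deg_list hL hρ])

/-- Lattice points that are not vertices are counted separately for each face. -/
lemma card_faces_le (hD : IsData (relabel ρ (fin L)) h) (hL : ldistinct L = true)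
    (hρ : Function.Injective ρ) {N : ℕ} (hs : Small (relabel ρ (fin L)) h N)
    (K : Finset (Finset (Fin n))) (hK : ∀ s ∈ K, s.card ≠ 3)
    (hP : ∀ s ∈ K, HasPt (relabel ρ (fin L)) h (s.image ρ)) : L.length + K.card ≤ N := by
  have := hD.card_add_card_le hs (relabel ρ K)
    (fun s hsK => by
      obtain ⟨s', hs', rfl⟩ := mem_relabel.mp hsK
      rw [Finset.card_image_of_injective _ hρ]
      exact hK s' hs')
    (fun s hsK => by
      obtain ⟨s', hs', rfl⟩ := mem_relabel.mp hsK
      exact hP s' hs')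
  rwa [card_relabel hρ, card_relabel hρ, card_fin hL] at this

def _root_.SmoothPolytope.isPentagon (L : List (List (Fin n))) (u : Fin n) : Prop :=
  ldeg L u = 5 ∧ Function.Injective (link5 L u) ∧
    ∀ i, (L.any fun t => eqv [u, link5 L u i, link5 L u (i + 1)] t) = true

instance (u : Fin n) : Decidable (isPentagon L u) := by unfold isPentagon; infer_instance

lemma hasPt_pentagon (hD : IsData (relabel ρ (fin L)) h) (hL : ldistinct L = true)
    (hρ : Function.Injective ρ) {u : Fin n} (hu : isPentagon L u) :
    ∃ i, HasPt (relabel ρ (fin L)) h (Finset.image ρ {u, link5 L u i}) ∧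
      HasPt (relabel ρ (fin L)) h (Finset.image ρ {u, link5 L u (i + 1)}) := by
  obtain ⟨h5, hi, hc⟩ := hu
  simp only [Finset.image_insert, Finset.image_singleton]
  exact hD.pentagon (u := ρ u) (c := ρ ∘ link5 L u) (fun i => mem_relabel_fin ρ (hc i))
    (hρ.comp hi) (by rw [deg_list hL hρ, h5])

/-- Twelve vertices, interior points of three facets and of two edges of the pentagon make 17
points. -/
lemma not_pentagonal (hD : IsData (relabel ρ (fin L)) h) (hL : ldistinct L = true)
    (hρ : Function.Injective ρ) (hs : Small (relabel ρ (fin L)) h 16) (h12 : L.length = 12) :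
    ¬ pentagonal L := by
  rintro ⟨⟨u, hu⟩, h3⟩
  obtain ⟨i, hi1, hi2⟩ := hD.hasPt_pentagon hL hρ hu
  have hmem : ∀ i, link5 L u i ≠ u := fun i he => by
    have h1 := (hD.triple_ne (mem_relabel_fin ρ (hu.2.2 i))).1
    rw [he] at h1
    exact h1 rfl
  set B := Finset.univ.filter fun u => 5 ≤ ldeg L u with hB
  have hBc : 3 ≤ B.card := by
    have hn : ((List.finRange n).filter fun u => decide (5 ≤ ldeg L u)).Nodup :=
      (List.nodup_finRange n).filter _
    rw [← List.toFinset_card_of_nodup hn] at h3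
    refine h3.trans_eq (congrArg _ ?_)
    ext x; simp [hB]
  set S : Finset (Finset (Fin n)) := B.image fun w => {w} with hS
  have hSc : S.card = B.card := Finset.card_image_of_injective _ Finset.singleton_injective
  have hn1 : ∀ i, ({u, link5 L u i} : Finset (Fin n)).card = 2 := fun i =>
    Finset.card_pair (hmem i).symm
  have hS1 : ∀ s ∈ S, s.card = 1 := fun s hs => by
    obtain ⟨w, -, rfl⟩ := Finset.mem_image.mp hs
    simp
  have hne : ({u, link5 L u i} : Finset (Fin n)) ≠ {u, link5 L u (i + 1)} := fun he => by
    have h1 : link5 L u i ∈ ({u, link5 L u (i + 1)} : Finset (Fin n)) := he ▸ by simp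
    simp only [Finset.mem_insert, Finset.mem_singleton] at h1
    rcases h1 with h1 | h1
    · exact hmem i h1
    · have := hu.2.1 h1
      revert this; clear * -; revert i; decide
  have h2 : (insert {u, link5 L u i} (insert {u, link5 L u (i + 1)} S)).card = B.card + 2 := by
    rw [Finset.card_insert_of_notMem, Finset.card_insert_of_notMem, hSc]
    · exact fun hh => by have := hS1 _ hh; have := hn1 (i + 1); omega
    · rw [Finset.mem_insert, not_or]
      exact ⟨hne, fun hh => by have := hS1 _ hh; have := hn1 i; omega⟩
  have := hD.card_faces_le hL hρ hs (insert {u, link5 L u i} (insert {u, link5 L u (i + 1)} S))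
    (by
      simp only [Finset.mem_insert, forall_eq_or_imp]
      exact ⟨by rw [hn1]; decide, by rw [hn1]; decide, fun s hs => by rw [hS1 s hs]; decide⟩)
    (by
      simp only [Finset.mem_insert, forall_eq_or_imp]
      refine ⟨hi1, hi2, fun s hs => ?_⟩
      obtain ⟨w, hw, rfl⟩ := Finset.mem_image.mp hs
      exact hD.hasPt_facet hL hρ (Finset.mem_filter.mp hw).2)
  omega

/-- Twelve vertices, four more points on one large facet and an interior point of the other make 17
points. -/
lemma not_heptagonal (hD : IsData (relabel ρ (fin L)) h) (hL : ldistinct L = true)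
    (hρ : Function.Injective ρ) (hs : Small (relabel ρ (fin L)) h 16) (h12 : L.length = 12) :
    ¬ heptagonal L := by
  intro h2
  rw [heptagonal, ← List.toFinset_card_of_nodup ((List.nodup_finRange n).filter _)] at h2
  obtain ⟨u, hu, w, hw, huw⟩ := Finset.one_lt_card.mp h2
  simp only [List.mem_toFinset, List.mem_filter, decide_eq_true_eq] at hu hw
  have h1 := hD.card_add_four_le hs (u := ρ u) (by rw [deg_list hL hρ]; exact hu.2)
  have hdw : deg (relabel ρ (fin L)) (ρ w) = ldeg L w := deg_list hL hρ w
  have h3 : 1 ≤ ((rays (relabel ρ (fin L))).filter fun x => x ≠ ρ u ∧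
      5 ≤ deg (relabel ρ (fin L)) x).card := by
    refine Finset.card_pos.mpr ⟨ρ w, Finset.mem_filter.mpr ⟨?_, hρ.ne huw.symm, by omega⟩⟩
    have : ((relabel ρ (fin L)).filter fun t => ρ w ∈ t).Nonempty :=
      Finset.card_pos.mp (by rw [deg] at hdw; omega)
    obtain ⟨t, ht⟩ := this
    exact hD.mem_rays (Finset.mem_filter.mp ht).1 (Finset.mem_filter.mp ht).2
  rw [card_relabel hρ, card_fin hL] at h1
  omega

end IsData

/-! ### Types with seven and eight facets that yield nothing new -/

namespace IsData
variable {h : Lat → ℤ}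

/-- Ten vertices leave room for six points, but four facets have at least five corners, and two of
them are pentagons whose pairs of long edges comprise at least three different edges. -/
lemma not_l7A {ρ : Fin 7 → Lat} (hD : IsData (relabel ρ (fin l7A)) h) (hρ : Function.Injective ρ)
    (hs : Small (relabel ρ (fin l7A)) h 16) : False := by
  have hL : ldistinct l7A = true := by decide +kernel
  obtain ⟨i, hi, hi'⟩ := hD.hasPt_pentagon hL hρ (u := 1) (by decide +kernel)
  obtain ⟨j, hj, hj'⟩ := hD.hasPt_pentagon hL hρ (u := 2) (by decide +kernel)
  have key : ∀ i j : Fin 5, 7 ≤ ({{0}, {1}, {2}, {4}, {1, link5 l7A 1 i}, {1, link5 l7A 1 (i + 1)},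
      {2, link5 l7A 2 j}, {2, link5 l7A 2 (j + 1)}} : Finset (Finset (Fin 7))).card ∧
      ∀ s ∈ ({{0}, {1}, {2}, {4}, {1, link5 l7A 1 i}, {1, link5 l7A 1 (i + 1)},
      {2, link5 l7A 2 j}, {2, link5 l7A 2 (j + 1)}} : Finset (Finset (Fin 7))), s.card ≠ 3 := by
    decide +kernel
  have h1 := hD.card_faces_le hL hρ hs _ (key i j).2 (by
    simp only [Finset.mem_insert, Finset.mem_singleton, forall_eq_or_imp, forall_eq]
    refine ⟨?_, ?_, ?_, ?_, hi, hi', hj, hj'⟩ <;>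
      exact hD.hasPt_facet hL hρ (by decide +kernel))
  have h2 := (key i j).1
  have h3 : l7A.length = 10 := by decide +kernel
  omega

/-- Three pentagons contribute an interior point each, and wherever their pairs of long edges lie,
at least four different edges occur; this is one point too many. -/
lemma not_l7D {ρ : Fin 7 → Lat} (hD : IsData (relabel ρ (fin l7D)) h) (hρ : Function.Injective ρ)
    (hs : Small (relabel ρ (fin l7D)) h 16) : False := by
  have hL : ldistinct l7D = true := by decide +kernel
  obtain ⟨i, hi, hi'⟩ := hD.hasPt_pentagon hL hρ (u := 0) (by decide +kernel)
  obtain ⟨j, hj, hj'⟩ := hD.hasPt_pentagon hL hρ (u := 2) (by decide +kernel)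
  obtain ⟨k, hk, hk'⟩ := hD.hasPt_pentagon hL hρ (u := 3) (by decide +kernel)
  have key : ∀ i j k : Fin 5, 7 ≤ ({{0}, {2}, {3}, {0, link5 l7D 0 i}, {0, link5 l7D 0 (i + 1)},
      {2, link5 l7D 2 j}, {2, link5 l7D 2 (j + 1)}, {3, link5 l7D 3 k},
      {3, link5 l7D 3 (k + 1)}} : Finset (Finset (Fin 7))).card ∧
      ∀ s ∈ ({{0}, {2}, {3}, {0, link5 l7D 0 i}, {0, link5 l7D 0 (i + 1)},
      {2, link5 l7D 2 j}, {2, link5 l7D 2 (j + 1)}, {3, link5 l7D 3 k},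
      {3, link5 l7D 3 (k + 1)}} : Finset (Finset (Fin 7))), s.card ≠ 3 := by
    decide +kernel
  have h1 := hD.card_faces_le hL hρ hs _ (key i j k).2 (by
    simp only [Finset.mem_insert, Finset.mem_singleton, forall_eq_or_imp, forall_eq]
    refine ⟨?_, ?_, ?_, hi, hi', hj, hj', hk, hk'⟩ <;>
      exact hD.hasPt_facet hL hρ (by decide +kernel))
  have h2 := (key i j k).1
  have h3 : l7D.length = 10 := by decide +kernel
  omega

/-- The normals of two facets are opposite if the facets are joined by three edges of length
one. -/
lemma neg_of_short_edges {n : ℕ} {L : List (List (Fin n))} {ρ : Fin n → Lat}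
    (hD : IsData (relabel ρ (fin L)) h) (hρ : Function.Injective ρ) {i j : Fin n} (hij : i ≠ j)
    (M : Finset (Finset (Fin n))) (hM : 3 ≤ M.card)
    (hE : ∀ s ∈ M, s.card = 2 ∧ i ∉ s ∧ insert i s ∈ fin L ∧ insert j s ∈ fin L)
    (hP : ∀ s ∈ M, ¬ HasPt (relabel ρ (fin L)) h (s.image ρ)) : ρ j = -ρ i := by
  obtain ⟨s₀, hs₀⟩ : M.Nonempty := Finset.card_pos.mp (by omega)
  have hmem : ∀ t ∈ fin L, t.image ρ ∈ relabel ρ (fin L) := fun t ht => mem_relabel.mpr ⟨t, ht, rfl⟩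
  refine hD.eq_neg_of_three_le (k := 1) (hD.mem_rays (hmem _ (hE s₀ hs₀).2.2.2)
    (Finset.mem_image_of_mem _ (Finset.mem_insert_self _ _))) (hρ.ne hij.symm) ?_
  have hinj : Set.InjOn (fun s : Finset (Fin n) => (insert i s).image ρ) M := by
    intro s hs s' hs' he
    have h1 := Finset.image_injective hρ he
    rw [← Finset.erase_insert (hE s hs).2.1, h1, Finset.erase_insert (hE s' hs').2.1]
  rw [← Finset.card_image_of_injOn hinj] at hM
  refine hM.trans (Finset.card_le_card fun t ht => ?_)
  obtain ⟨s, hs, rfl⟩ := Finset.mem_image.mp ht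
  obtain ⟨h2, his, hi, hj⟩ := hE s hs
  refine Finset.mem_filter.mpr ⟨hmem _ hi, Finset.mem_image_of_mem _ (Finset.mem_insert_self _ _), ?_⟩
  obtain ⟨a, b, hab, rfl⟩ := Finset.card_eq_two.mp h2
  have e1 : ∀ i, (insert i ({a, b} : Finset (Fin n))).image ρ = {ρ a, ρ b, ρ i} := fun i => by
    ext x
    simp only [Finset.mem_image, Finset.mem_insert, Finset.mem_singleton, exists_eq_or_imp,
      exists_eq_left]
    grind
  have h3 := hmem _ hi
  have h4 := hmem _ hj
  rw [e1] at h3 h4 ⊢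
  refine hD.length_eq_one h3 h4 (hρ.ne hij) ?_
  have := hP _ hs
  rwa [Finset.image_insert, Finset.image_singleton] at this

/-- In the pentagonal prism each base accounts for an interior point and two points on its own
edges. These six exhaust the bound, so the side edges have length one, and `neg_of_short_edges`
makes the base normals opposite. -/
lemma cayley_of_l7E {ρ : Fin 7 → Lat} (hD : IsData (relabel ρ (fin l7E)) h)
    (hρ : Function.Injective ρ) (hs : Small (relabel ρ (fin l7E)) h 16) :
    IsCayleyOfPolygons (poly (relabel ρ (fin l7E)) h) := by
  have hL : ldistinct l7E = true := by decide +kernel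
  obtain ⟨i, hi, hi'⟩ := hD.hasPt_pentagon hL hρ (u := 3) (by decide +kernel)
  obtain ⟨j, hj, hj'⟩ := hD.hasPt_pentagon hL hρ (u := 4) (by decide +kernel)
  have key : ∀ i j : Fin 5, ∀ e ∈ ({{5, 1}, {1, 2}, {2, 6}} : Finset (Finset (Fin 7))),
      7 ≤ ({{3}, {4}, {3, link5 l7E 3 i}, {3, link5 l7E 3 (i + 1)},
      {4, link5 l7E 4 j}, {4, link5 l7E 4 (j + 1)}, e} : Finset (Finset (Fin 7))).card ∧
      ∀ s ∈ ({{3}, {4}, {3, link5 l7E 3 i}, {3, link5 l7E 3 (i + 1)},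
      {4, link5 l7E 4 j}, {4, link5 l7E 4 (j + 1)}, e} : Finset (Finset (Fin 7))), s.card ≠ 3 := by
    decide +kernel
  refine hD.isCayley_of_opposite (i := 3) (j := 4) (by decide +kernel) ?_ (by decide +kernel)
  refine hD.neg_of_short_edges hρ (by decide) {{5, 1}, {1, 2}, {2, 6}} (by decide)
    (by decide +kernel) fun e he hp => ?_
  have h1 := hD.card_faces_le hL hρ hs _ (key i j e he).2 (by
    simp only [Finset.mem_insert, Finset.mem_singleton, forall_eq_or_imp, forall_eq]
    refine ⟨?_, ?_, hi, hi', hj, hj', hp⟩ <;> exact hD.hasPt_facet hL hρ (by decide +kernel))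
  have h2 := (key i j e he).1
  have h3 : l7E.length = 10 := by decide +kernel
  omega

/-- Twelve vertices and the interior points of the two hexagons leave at most two points for the
side edges. So at least four of the six side edges have length one, and three suffice. -/
lemma cayley_of_lhex {ρ : Fin 8 → Lat} (hD : IsData (relabel ρ (fin lhex)) h)
    (hρ : Function.Injective ρ) (hs : Small (relabel ρ (fin lhex)) h 16) :
    IsCayleyOfPolygons (poly (relabel ρ (fin lhex)) h) := by
  classical
  have hL : ldistinct lhex = true := by decide +kernel
  set E : Finset (Finset (Fin 8)) := {{0, 1}, {1, 2}, {2, 3}, {3, 4}, {4, 5}, {5, 0}} with hEdef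
  have hE : ∀ s ∈ E, s.card = 2 ∧ 6 ∉ s ∧ insert 6 s ∈ fin lhex ∧ insert 7 s ∈ fin lhex := by
    rw [hEdef]; decide +kernel
  have hEc : E.card = 6 := by rw [hEdef]; decide +kernel
  refine hD.isCayley_of_opposite (i := 6) (j := 7) (by decide +kernel) ?_ (by decide +kernel)
  refine hD.neg_of_short_edges hρ (by decide)
    (E.filter fun s => ¬ HasPt (relabel ρ (fin lhex)) h (s.image ρ)) ?_
    (fun s hs => hE s (Finset.mem_filter.mp hs).1) (fun s hs => (Finset.mem_filter.mp hs).2)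
  have h1 := hD.card_faces_le hL hρ hs (insert {6} (insert {7}
    (E.filter fun s => HasPt (relabel ρ (fin lhex)) h (s.image ρ))))
    (by
      simp only [Finset.mem_insert, forall_eq_or_imp]
      exact ⟨by decide, by decide, fun s hs => by rw [(hE s (Finset.mem_filter.mp hs).1).1]; decide⟩)
    (by
      simp only [Finset.mem_insert, forall_eq_or_imp]
      exact ⟨hD.hasPt_facet hL hρ (by decide +kernel), hD.hasPt_facet hL hρ (by decide +kernel),
        fun s hs => (Finset.mem_filter.mp hs).2⟩)
  rw [Finset.card_insert_of_notMem, Finset.card_insert_of_notMem] at h1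
  · have h2 := Finset.card_filter_add_card_filter_not (s := E)
      fun s => HasPt (relabel ρ (fin lhex)) h (s.image ρ)
    have h3 : lhex.length = 12 := by decide +kernel
    omega
  · intro hh
    have := (hE _ (Finset.mem_filter.mp hh).1).1
    simp at this
  · rw [Finset.mem_insert, not_or]
    refine ⟨by decide, fun hh => ?_⟩
    have := (hE _ (Finset.mem_filter.mp hh).1).1
    simp at this

lemma label_of_l7B {ρ : Fin 7 → Lat} (hD : IsData (relabel ρ (fin l7B)) h)
    (hρ : Function.Injective ρ) : label (poly (relabel ρ (fin l7B)) h) =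
      Pi.single 3 2 + Pi.single 4 3 + Pi.single 6 2 := by
  have h1 : ∀ u : Fin 7, edgeDeg (fin l7B) u ∈ ({3, 4, 6} : Finset ℕ) := by decide +kernel
  have h3 : lab (fin l7B) 3 = 2 := by decide +kernel
  have h4 : lab (fin l7B) 4 = 3 := by decide +kernel
  have h6 : lab (fin l7B) 6 = 2 := by decide +kernel
  ext m
  rw [hD.label_eq, lab_relabel hρ]
  by_cases m3 : m = 3
  · subst m3; rw [h3]; rfl
  by_cases m4 : m = 4
  · subst m4; rw [h4]; rfl
  by_cases m6 : m = 6
  · subst m6; rw [h6]; rfl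
  have : lab (fin l7B) m = 0 := by
    rw [lab, Finset.card_eq_zero, Finset.filter_eq_empty_iff]
    intro u _ hu
    have := h1 u
    rw [hu] at this
    simp [m3, m4, m6] at this
  rw [this]
  simp [m3, m4, m6]

end IsData

/-! ### The two rigid types -/

namespace IsData
variable {T : Finset (Finset Lat)} {h : Lat → ℤ} {n : ℕ} {L : List (List (Fin n))} {ρ : Fin n → Lat}

/-- When the vertices and the faces in `K` already use up the bound, no other face has an interior
lattice point. Likewise each face in `K` has only one, by `pt_unique_of_card`. -/
lemma not_hasPt_of_card (hD : IsData (relabel ρ (fin L)) h) (hL : ldistinct L = true)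
    (hρ : Function.Injective ρ) {N : ℕ} (hs : Small (relabel ρ (fin L)) h N)
    {K : Finset (Finset (Fin n))} (hK : ∀ s ∈ K, s.card ≠ 3)
    (hP : ∀ s ∈ K, HasPt (relabel ρ (fin L)) h (s.image ρ)) (hN : N ≤ L.length + K.card)
    {s : Finset (Fin n)} (h3 : s.card ≠ 3) (hsK : s ∉ K) :
    ¬ HasPt (relabel ρ (fin L)) h (s.image ρ) := by
  intro hp
  have := hD.card_faces_le hL hρ hs (insert s K)
    (by
      simp only [Finset.mem_insert, forall_eq_or_imp]
      exact ⟨h3, hK⟩)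
    (by
      simp only [Finset.mem_insert, forall_eq_or_imp]
      exact ⟨hp, hP⟩)
  rw [Finset.card_insert_of_notMem hsK] at this
  omega

lemma pt_unique_of_card (hD : IsData (relabel ρ (fin L)) h) (hL : ldistinct L = true)
    (hρ : Function.Injective ρ) {N : ℕ} (hs : Small (relabel ρ (fin L)) h N)
    {K : Finset (Finset (Fin n))} (hK : ∀ s ∈ K, s.card ≠ 3)
    (hP : ∀ s ∈ K, HasPt (relabel ρ (fin L)) h (s.image ρ)) (hN : N ≤ L.length + K.card)
    {s : Finset (Fin n)} (hsK : s ∈ K) {y z : Lat} (hy : InPoly (relabel ρ (fin L)) h y)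
    (hy' : tight (relabel ρ (fin L)) h y = s.image ρ) (hz : InPoly (relabel ρ (fin L)) h z)
    (hz' : tight (relabel ρ (fin L)) h z = s.image ρ) : y = z := by
  classical
  by_contra hne
  have hP' : ∀ t ∈ relabel ρ K, HasPt (relabel ρ (fin L)) h t := fun t ht => by
    obtain ⟨t, ht', rfl⟩ := mem_relabel.mp ht
    exact hP t ht'
  choose! f hf using hP'
  have hsr : s.image ρ ∈ relabel ρ K := mem_relabel.mpr ⟨s, hsK, rfl⟩
  have := hD.card_add_sum_le hs (relabel ρ K)
    (fun t => if t = s.image ρ then {y, z} else {f t})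
    (fun t ht => by
      obtain ⟨t, ht', rfl⟩ := mem_relabel.mp ht
      rw [Finset.card_image_of_injective _ hρ]
      exact hK t ht')
    (fun t ht x hx => by
      by_cases he : t = s.image ρ
      · rw [if_pos he, Finset.mem_insert, Finset.mem_singleton] at hx
        rcases hx with rfl | rfl
        · exact ⟨hy, hy'.trans he.symm⟩
        · exact ⟨hz, hz'.trans he.symm⟩
      · rw [if_neg he, Finset.mem_singleton] at hx
        rw [hx]; exact hf t ht)
  rw [← Finset.add_sum_erase _ _ hsr, if_pos rfl, Finset.card_pair hne,
    Finset.sum_congr rfl fun t ht => by rw [if_neg (Finset.mem_erase.mp ht).1, Finset.card_singleton],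
    Finset.sum_const, Finset.card_erase_of_mem hsr, card_relabel hρ, card_relabel hρ, card_fin hL,
    smul_eq_mul] at this
  have : 0 < K.card := Finset.card_pos.mpr ⟨s, hsK⟩
  omega

/-- The vertex in the facets with the given labels. -/
noncomputable def _root_.SmoothPolytope.corner (ρ : Fin n → Lat) (h : Lat → ℤ) (s : Finset (Fin n)) :
    Lat := vert h (s.image ρ)

/-- The neighbours of a vertex in a facet. -/
lemma corner_step (hD : IsData (relabel ρ (fin L)) h) (hL : ldistinct L = true)
    (hρ : Function.Injective ρ) (u a b c d : Fin n) (h0 : {u, a, b} ∈ fin L)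
    (h1 : {u, b, c} ∈ fin L) (h2 : {u, c, d} ∈ fin L) (hac : a ≠ c) (hbd : b ≠ d)
    (h5 : 5 ≤ ldeg L u) : ∃ (D₁ D₂ : Lat) (l₁ l₂ : ℤ), 1 ≤ l₁ ∧ 1 ≤ l₂ ∧
      (¬ HasPt (relabel ρ (fin L)) h (Finset.image ρ {u, b}) → l₁ = 1) ∧
      (¬ HasPt (relabel ρ (fin L)) h (Finset.image ρ {u, c}) → l₂ = 1) ∧
      corner ρ h {u, a, b} = corner ρ h {u, b, c} + l₁ • D₁ ∧
      corner ρ h {u, c, d} = corner ρ h {u, b, c} + l₂ • D₂ ∧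
      ρ c ⬝ᵥ D₁ = 1 ∧ ρ b ⬝ᵥ D₂ = 1 ∧
      InPoly (relabel ρ (fin L)) h (corner ρ h {u, b, c} + D₁ + D₂) ∧
      tight (relabel ρ (fin L)) h (corner ρ h {u, b, c} + D₁ + D₂) = {ρ u} := by
  have hm : ∀ {i j k : Fin n}, {i, j, k} ∈ fin L → {ρ i, ρ j, ρ k} ∈ relabel ρ (fin L) :=
    fun {i j k} hh => mem_relabel.mpr ⟨_, hh, by simp [Finset.image_insert]⟩
  have hc : ∀ i j k : Fin n, corner ρ h {i, j, k} = vert h {ρ i, ρ j, ρ k} := fun i j k => by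
    simp [corner, Finset.image_insert]
  have p3 : ∀ x y z : Lat, ({x, y, z} : Finset Lat) = {x, z, y} := fun x y z => by
    rw [Finset.pair_comm y z]
  have m0 := hm h0
  have m1 := hm h1
  have m2 := hm h2
  rw [p3] at m0
  have w2 := hD.wall_triple (c := ρ b) (d := ρ d) (a := ρ u) (b := ρ c) (p3 _ _ _ ▸ m1) m2 (hρ.ne hbd)
  have w1 := hD.wall_triple (c := ρ c) (d := ρ a) (a := ρ u) (b := ρ b) m1 m0 (hρ.ne hac.symm)
  have e1 := hD.length_eq_one (c := ρ c) (d := ρ a) (a := ρ u) (b := ρ b) m1 m0 (hρ.ne hac.symm)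
  have e2 := hD.length_eq_one (c := ρ b) (d := ρ d) (a := ρ u) (b := ρ c) (p3 _ _ _ ▸ m1) m2
    (hρ.ne hbd)
  rw [p3 (ρ u) (ρ c) (ρ b)] at w2 e2
  rw [p3 (ρ u) (ρ b) (ρ a)] at w1
  have hu : ρ u ∈ ({ρ u, ρ b, ρ c} : Finset Lat) := by simp
  have hi := hD.tight_inner m1 hu (by rw [deg_list hL hρ]; exact h5)
  obtain ⟨hub, huc, hbc⟩ := hD.triple_ne m1
  have hin : inner h {ρ u, ρ b, ρ c} (ρ u) = vert h {ρ u, ρ b, ρ c} +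
      dualv {ρ u, ρ b, ρ c} (ρ c) + dualv {ρ u, ρ b, ρ c} (ρ b) := by
    rw [inner, Finset.erase_insert (by simp [hub, huc]), Finset.sum_pair hbc]
    abel
  rw [hin] at hi
  refine ⟨dualv {ρ u, ρ b, ρ c} (ρ c), dualv {ρ u, ρ b, ρ c} (ρ b), _, _, w1.2.1, w2.2.1, ?_, ?_, ?_,
    ?_, (hD.isDual m1).dot_self (by simp), (hD.isDual m1).dot_self (by simp), ?_⟩
  · intro hh
    exact e1 (by simpa [Finset.image_insert] using hh)
  · intro hh
    exact e2 (by simpa [Finset.image_insert] using hh)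
  · rw [hc, hc]; exact w1.2.2
  · rw [hc, hc]; exact w2.2.2
  · rw [hc]; exact hi

/-- Along unit edges the inner point next to a corner completes a parallelogram with its two
neighbours. If that point is the only interior one, consecutive corners obey the recursion `V₂ = V₁
+ p - V₀`, which determines the facet. -/
lemma corner_step_of_short (hD : IsData (relabel ρ (fin L)) h) (hL : ldistinct L = true)
    (hρ : Function.Injective ρ) {u : Fin n} {p : Lat} (h5 : 5 ≤ ldeg L u)
    (hp : ∀ z, InPoly (relabel ρ (fin L)) h z → tight (relabel ρ (fin L)) h z = {ρ u} → z = p)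
    (a b c d : Fin n) (h0 : {u, a, b} ∈ fin L) (h1 : {u, b, c} ∈ fin L) (h2 : {u, c, d} ∈ fin L)
    (hac : a ≠ c) (hbd : b ≠ d) (hb : ¬ HasPt (relabel ρ (fin L)) h (Finset.image ρ {u, b}))
    (hc : ¬ HasPt (relabel ρ (fin L)) h (Finset.image ρ {u, c})) :
    corner ρ h {u, a, b} + corner ρ h {u, c, d} = corner ρ h {u, b, c} + p := by
  obtain ⟨D₁, D₂, l₁, l₂, -, -, e1, e2, h3, h4, -, -, hi, ht⟩ :=
    hD.corner_step hL hρ u a b c d h0 h1 h2 hac hbd h5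
  rw [h3, h4, e1 hb, e2 hc, ← hp _ hi ht, one_smul, one_smul]
  abel

end IsData

/-- The vertices of the blow-up of `3Δ₃` at four vertices. -/
def W₂ : Finset Lat := {![1, 0, 0], ![2, 0, 0], ![0, 1, 0], ![0, 2, 0], ![0, 0, 1], ![0, 0, 2],
  ![2, 1, 0], ![1, 2, 0], ![2, 0, 1], ![1, 0, 2], ![0, 2, 1], ![0, 1, 2]}

/-- The vertices of the blow-up of `Cay²(2Δ₁, 2Δ₁, 2Δ₁)` at two vertices. -/
def W₃ : Finset Lat := {![1, 0, 0], ![0, 1, 0], ![0, 0, 1], ![2, 0, 0], ![0, 2, 0], ![0, 0, 2],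
  ![2, 0, 2], ![1, 2, 0], ![2, 1, 0], ![2, 1, 1]}

namespace IsData
variable {h : Lat → ℤ} {n : ℕ} {L : List (List (Fin n))} {ρ : Fin n → Lat}

lemma poly_eq_of_corner_eq (hD : IsData (relabel ρ (fin L)) h) (v : List (Fin n) → Lat)
    (hv : ∀ t ∈ L, corner ρ h t.toFinset = v t) :
    poly (relabel ρ (fin L)) h =
      convexHull ℝ (toReal '' (((L.map v).toFinset : Finset Lat) : Set Lat)) := by
  refine hD.poly_eq_of_corners v fun t ht i hi => ?_
  rw [← hv t ht]
  exact hD.dot (mem_relabel.mpr ⟨_, mem_fin.mpr ⟨t, ht, rfl⟩, rfl⟩)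
    (Finset.mem_image_of_mem _ (List.mem_toFinset.mpr hi))

/-- The first corner in normalised coordinates. -/
lemma corner_eq_of_dot (hD : IsData (relabel ρ (fin L)) h) {i j k : Fin n}
    (ht : {i, j, k} ∈ fin L) {v : Lat} (hi : ρ i ⬝ᵥ v = h (ρ i)) (hj : ρ j ⬝ᵥ v = h (ρ j))
    (hk : ρ k ⬝ᵥ v = h (ρ k)) : corner ρ h {i, j, k} = v := by
  refine (eq_vert (hD.uni _ (mem_relabel.mpr ⟨_, ht, rfl⟩)) fun u hu => ?_).symm
  simp only [Finset.image_insert, Finset.image_singleton, Finset.mem_insert,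
    Finset.mem_singleton] at hu
  rcases hu with rfl | rfl | rfl <;> assumption

/-- The corner reached from a corner along an edge of length one. -/
lemma corner_eq_add (hD : IsData (relabel ρ (fin L)) h) (hρ : Function.Injective ρ)
    {i j k l : Fin n} (h1 : {i, j, k} ∈ fin L) (h2 : {i, j, l} ∈ fin L) (hkl : k ≠ l)
    (hp : ¬ HasPt (relabel ρ (fin L)) h (Finset.image ρ {i, j})) {e : Lat} (hi : ρ i ⬝ᵥ e = 0)
    (hj : ρ j ⬝ᵥ e = 0) (hk : ρ k ⬝ᵥ e = 1) : corner ρ h {i, j, l} = corner ρ h {i, j, k} + e := by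
  have m1 : {ρ i, ρ j, ρ k} ∈ relabel ρ (fin L) :=
    mem_relabel.mpr ⟨_, h1, by simp [Finset.image_insert]⟩
  have m2 : {ρ i, ρ j, ρ l} ∈ relabel ρ (fin L) :=
    mem_relabel.mpr ⟨_, h2, by simp [Finset.image_insert]⟩
  have h3 := (hD.wall_triple m1 m2 (hρ.ne hkl)).2.2
  rw [hD.length_eq_one m1 m2 (hρ.ne hkl) (by simpa [Finset.image_insert] using hp), one_smul,
    hD.dualv_eq (e := e) m1 (by simp) hk (by
      intro w hw hwk
      simp only [Finset.mem_insert, Finset.mem_singleton] at hw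
      rcases hw with rfl | rfl | rfl
      · exact hi
      · exact hj
      · exact absurd rfl hwk)] at h3
  simpa [corner, Finset.image_insert] using h3

end IsData

lemma corner_perm {n : ℕ} {ρ : Fin n → Lat} {h : Lat → ℤ} {s s' : Finset (Fin n)} {v : Lat}
    (hc : corner ρ h s = v) (hs : s' = s) : corner ρ h s' = v := by rw [hs, hc]

def cornerT : List (Fin 8) → Lat
  | [3, 4, 5] => ![0, 0, 0]
  | [3, 5, 6] => ![1, 0, 0]
  | [3, 4, 6] => ![0, 1, 0]
  | [2, 4, 5] => ![0, 0, 1]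
  | [2, 4, 7] => ![0, 1, 2]
  | [1, 4, 7] => ![0, 2, 2]
  | [1, 4, 6] => ![0, 2, 1]
  | [2, 5, 7] => ![1, 0, 2]
  | [0, 5, 7] => ![2, 0, 2]
  | [0, 5, 6] => ![2, 0, 1]
  | [1, 6, 7] => ![1, 2, 2]
  | [0, 6, 7] => ![2, 1, 2]
  | _ => 0

namespace IsData
variable {h : Lat → ℤ}

/-- Twelve vertices and one point in each of the four hexagons make 16. Hence all edges have length
one and the interior points are unique, so three of the hexagons can be run around by the recursion;
together they contain all vertices. -/
lemma iso_of_ltrunc_normalized {ρ : Fin 8 → Lat} (hD : IsData (relabel ρ (fin ltrunc)) h)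
    (hρ : Function.Injective ρ) (hs : Small (relabel ρ (fin ltrunc)) h 16)
    (r4 : ρ 4 = ![1, 0, 0]) (r5 : ρ 5 = ![0, 1, 0]) (r3 : ρ 3 = ![0, 0, 1]) (h4 : h (ρ 4) = 0)
    (h5 : h (ρ 5) = 0) (h3 : h (ρ 3) = 0) :
    Iso (poly (relabel ρ (fin ltrunc)) h) (convexHull ℝ (toReal '' (W₂ : Set Lat))) := by
  have hL : ldistinct ltrunc = true := by decide +kernel
  have hd : ∀ u ∈ ({4, 5, 6, 7} : Finset (Fin 8)), 5 ≤ ldeg ltrunc u := by decide +kernel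
  have hK : ∀ s ∈ ({{4}, {5}, {6}, {7}} : Finset (Finset (Fin 8))), s.card ≠ 3 := by decide +kernel
  have hP : ∀ s ∈ ({{4}, {5}, {6}, {7}} : Finset (Finset (Fin 8))),
      HasPt (relabel ρ (fin ltrunc)) h (s.image ρ) := by
    simp only [Finset.mem_insert, Finset.mem_singleton, forall_eq_or_imp, forall_eq]
    refine ⟨?_, ?_, ?_, ?_⟩ <;> exact hD.hasPt_facet hL hρ (hd _ (by decide))
  have hN : 16 ≤ ltrunc.length + ({{4}, {5}, {6}, {7}} : Finset (Finset (Fin 8))).card := by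
    decide +kernel
  have hE : ∀ {i j : Fin 8}, i ≠ j → ¬ HasPt (relabel ρ (fin ltrunc)) h (Finset.image ρ {i, j}) := by
    intro i j hij
    refine hD.not_hasPt_of_card hL hρ hs hK hP hN (by rw [Finset.card_pair hij]; decide) ?_
    revert i j; decide +kernel
  have hU : ∀ {u : Fin 8}, u ∈ ({4, 5, 6, 7} : Finset (Fin 8)) → ∃ p, ∀ z,
      InPoly (relabel ρ (fin ltrunc)) h z → tight (relabel ρ (fin ltrunc)) h z = {ρ u} → z = p := by
    intro u hu
    have hu' : {u} ∈ ({{4}, {5}, {6}, {7}} : Finset (Finset (Fin 8))) := by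
      revert u; decide +kernel
    obtain ⟨p, hp1, hp2⟩ := hP _ hu'
    exact ⟨p, fun z hz hz' => hD.pt_unique_of_card hL hρ hs hK hP hN hu' hz
      (by rw [hz', Finset.image_singleton]) hp1 hp2⟩
  have c345 : corner ρ h {3, 4, 5} = ![0, 0, 0] := by
    refine hD.corner_eq_of_dot (by decide +kernel) ?_ ?_ ?_
    · rw [h3, r3]; simp
    · rw [h4, r4]; simp
    · rw [h5, r5]; simp
  have c356 : corner ρ h {3, 5, 6} = ![1, 0, 0] := by
    rw [hD.corner_eq_add hρ (k := 4) (e := ![1, 0, 0]) (by decide +kernel) (by decide +kernel) (by decide)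
      (hE (by decide)) (by rw [r3]; simp) (by rw [r5]; simp) (by rw [r4]; simp),
      show ({3, 5, 4} : Finset (Fin 8)) = {3, 4, 5} by decide, c345]
    simp
  have c346 : corner ρ h {3, 4, 6} = ![0, 1, 0] := by
    rw [hD.corner_eq_add hρ (k := 5) (e := ![0, 1, 0]) (by decide +kernel) (by decide +kernel) (by decide)
      (hE (by decide)) (by rw [r3]; simp) (by rw [r4]; simp) (by rw [r5]; simp), c345]
    simp
  have c452 : corner ρ h {4, 5, 2} = ![0, 0, 1] := by
    rw [hD.corner_eq_add hρ (k := 3) (e := ![0, 0, 1]) (by decide +kernel) (by decide +kernel) (by decide)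
      (hE (by decide)) (by rw [r4]; simp) (by rw [r5]; simp) (by rw [r3]; simp),
      show ({4, 5, 3} : Finset (Fin 8)) = {3, 4, 5} by decide, c345]
    simp
  -- `F` computes the next corner from two known ones and the interior point.
  have F : ∀ (a b : Fin 8) {u c d : Fin 8} {p V₀ V₁ V₂ : Lat}, u ∈ ({4, 5, 6, 7} : Finset (Fin 8)) →
      (∀ z, InPoly (relabel ρ (fin ltrunc)) h z → tight (relabel ρ (fin ltrunc)) h z = {ρ u} → z = p) →
      {u, a, b} ∈ fin ltrunc ∧ {u, b, c} ∈ fin ltrunc ∧ {u, c, d} ∈ fin ltrunc →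
      a ≠ c ∧ b ≠ d ∧ u ≠ b ∧ u ≠ c → corner ρ h {u, a, b} = V₀ → corner ρ h {u, b, c} = V₁ →
      V₁ + p - V₀ = V₂ → corner ρ h {u, c, d} = V₂ := by
    intro a b u c d p V₀ V₁ V₂ hu hp ht hne e0 e1 e2
    have := hD.corner_step_of_short hL hρ (hd u hu) hp a b c d ht.1 ht.2.1 ht.2.2 hne.1 hne.2.1
      (hE hne.2.2.1) (hE hne.2.2.2)
    rw [e0, e1] at this
    rw [← e2, ← this, add_sub_cancel_left]
  -- `G` reads the same relation backwards: three known corners determine the interior point.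
  have G : ∀ (a b c d : Fin 8) {u : Fin 8} {p V₀ V₁ V₂ p' : Lat}, u ∈ ({4, 5, 6, 7} : Finset (Fin 8)) →
      (∀ z, InPoly (relabel ρ (fin ltrunc)) h z → tight (relabel ρ (fin ltrunc)) h z = {ρ u} → z = p) →
      {u, a, b} ∈ fin ltrunc ∧ {u, b, c} ∈ fin ltrunc ∧ {u, c, d} ∈ fin ltrunc →
      a ≠ c ∧ b ≠ d ∧ u ≠ b ∧ u ≠ c → corner ρ h {u, a, b} = V₀ → corner ρ h {u, b, c} = V₁ →
      corner ρ h {u, c, d} = V₂ → V₀ + V₂ - V₁ = p' → p = p' := by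
    intro a b c d u p V₀ V₁ V₂ p' hu hp ht hne e0 e1 e2 e3
    have := hD.corner_step_of_short hL hρ (hd u hu) hp a b c d ht.1 ht.2.1 ht.2.2 hne.1 hne.2.1
      (hE hne.2.2.1) (hE hne.2.2.2)
    rw [e0, e1, e2] at this
    rw [← e3, this, add_sub_cancel_left]
  obtain ⟨p4, hp4⟩ := hU (u := 4) (by decide)
  obtain rfl := G 6 3 5 2 (p' := ![0, 1, 1]) (by decide) hp4 (by decide +kernel) (by decide)
    (corner_perm c346 (by decide)) (corner_perm c345 (by decide)) (corner_perm c452 (by decide)) (by decide)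
  have c427 : corner ρ h {4, 2, 7} = ![0, 1, 2] := F 3 5 (by decide) hp4 (by decide +kernel) (by decide)
    (corner_perm c345 (by decide)) (corner_perm c452 (by decide)) (by decide)
  have c471 : corner ρ h {4, 7, 1} = ![0, 2, 2] := F 5 2 (by decide) hp4 (by decide +kernel) (by decide)
    (corner_perm c452 (by decide)) (corner_perm c427 (by decide)) (by decide)
  have c416 : corner ρ h {4, 1, 6} = ![0, 2, 1] := F 2 7 (by decide) hp4 (by decide +kernel) (by decide)
    (corner_perm c427 (by decide)) (corner_perm c471 (by decide)) (by decide)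
  obtain ⟨p5, hp5⟩ := hU (u := 5) (by decide)
  obtain rfl := G 6 3 4 2 (p' := ![1, 0, 1]) (by decide) hp5 (by decide +kernel) (by decide)
    (corner_perm c356 (by decide)) (corner_perm c345 (by decide)) (corner_perm c452 (by decide)) (by decide)
  have c527 : corner ρ h {5, 2, 7} = ![1, 0, 2] := F 3 4 (by decide) hp5 (by decide +kernel) (by decide)
    (corner_perm c345 (by decide)) (corner_perm c452 (by decide)) (by decide)
  have c570 : corner ρ h {5, 7, 0} = ![2, 0, 2] := F 4 2 (by decide) hp5 (by decide +kernel) (by decide)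
    (corner_perm c452 (by decide)) (corner_perm c527 (by decide)) (by decide)
  have c506 : corner ρ h {5, 0, 6} = ![2, 0, 1] := F 2 7 (by decide) hp5 (by decide +kernel) (by decide)
    (corner_perm c527 (by decide)) (corner_perm c570 (by decide)) (by decide)
  obtain ⟨p6, hp6⟩ := hU (u := 6) (by decide)
  obtain rfl := G 5 3 4 1 (p' := ![1, 1, 1]) (by decide) hp6 (by decide +kernel) (by decide)
    (corner_perm c356 (by decide)) (corner_perm c346 (by decide)) (corner_perm c416 (by decide)) (by decide)
  have c617 : corner ρ h {6, 1, 7} = ![1, 2, 2] := F 3 4 (by decide) hp6 (by decide +kernel) (by decide)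
    (corner_perm c346 (by decide)) (corner_perm c416 (by decide)) (by decide)
  have c670 : corner ρ h {6, 7, 0} = ![2, 1, 2] := F 4 1 (by decide) hp6 (by decide +kernel) (by decide)
    (corner_perm c416 (by decide)) (corner_perm c617 (by decide)) (by decide)
  rw [hD.poly_eq_of_corner_eq cornerT]
  · exact iso_convexHull (b := ![![0, 0, 1], ![1, 0, 1], ![0, 1, 1]])
      (u := ![![-1, -1, 1], ![1, 0, 0], ![0, 1, 0]]) (by decide) ![0, 0, -1] (by decide +kernel)
  · simp only [ltrunc, List.forall_mem_cons, List.not_mem_nil, IsEmpty.forall_iff, implies_true,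
      and_true, cornerT]
    exact ⟨corner_perm c506 (by decide), corner_perm c570 (by decide), corner_perm c670 (by decide), corner_perm c416 (by decide), corner_perm c471 (by decide), corner_perm c617 (by decide), corner_perm c452 (by decide), corner_perm c427 (by decide), corner_perm c527 (by decide), corner_perm c345 (by decide), corner_perm c346 (by decide), corner_perm c356 (by decide)⟩

end IsData

/-- The faces of the third type with seven facets that contain further lattice points. -/
def facesC (x y : Fin 7) : Finset (Finset (Fin 7)) := {{2}, {3}, {4}, {2, 4}, {2, x}, {4, y}}

def cornerP : List (Fin 7) → Lat
  | [0, 2, 4] => ![2, 0, 1]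
  | [0, 2, 5] => ![1, 0, 0]
  | [0, 3, 4] => ![0, 2, 1]
  | [0, 3, 5] => ![0, 1, 0]
  | [1, 2, 3] => ![0, 0, 1]
  | [1, 2, 4] => ![2, 0, 3]
  | [1, 3, 6] => ![0, 1, 2]
  | [1, 4, 6] => ![1, 1, 3]
  | [2, 3, 5] => ![0, 0, 0]
  | [3, 4, 6] => ![0, 2, 2]
  | _ => 0

namespace IsData
variable {h : Lat → ℤ}

/-- When only the first edge is known to be short, the recursion still gives the direction of the
next edge, and its length `l` remains as an unknown. -/
lemma corner_step_length {n : ℕ} {L : List (List (Fin n))} {ρ : Fin n → Lat}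
    (hD : IsData (relabel ρ (fin L)) h) (hL : ldistinct L = true)
    (hρ : Function.Injective ρ) {u : Fin n} {p : Lat} (h5 : 5 ≤ ldeg L u)
    (hp : ∀ z, InPoly (relabel ρ (fin L)) h z → tight (relabel ρ (fin L)) h z = {ρ u} → z = p)
    (a b c d : Fin n) (h0 : {u, a, b} ∈ fin L) (h1 : {u, b, c} ∈ fin L) (h2 : {u, c, d} ∈ fin L)
    (hac : a ≠ c) (hbd : b ≠ d) (hb : ¬ HasPt (relabel ρ (fin L)) h (Finset.image ρ {u, b})) :
    ∃ l : ℤ, 1 ≤ l ∧ (¬ HasPt (relabel ρ (fin L)) h (Finset.image ρ {u, c}) → l = 1) ∧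
      corner ρ h {u, c, d} = corner ρ h {u, b, c} + l • (p - corner ρ h {u, a, b}) ∧
      ρ b ⬝ᵥ (p - corner ρ h {u, a, b}) = 1 := by
  obtain ⟨D₁, D₂, l₁, l₂, -, h2, e1, e2, h3, h4, -, h6, hi, ht⟩ :=
    hD.corner_step hL hρ u a b c d h0 h1 h2 hac hbd h5
  have : D₂ = p - corner ρ h {u, a, b} := by
    rw [h3, e1 hb, ← hp _ hi ht, one_smul]
    abel
  rw [this] at h4 h6
  exact ⟨l₂, h2, e2, h4, h6⟩

/-- Ten vertices and the interior points of the facets 2, 3, 4 leave three points for edges. The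
pentagons 2 and 4 each need two adjacent long edges, so their pairs must share the common edge `{2,
4}`. -/
lemma hasPt_l7C {ρ : Fin 7 → Lat} (hD : IsData (relabel ρ (fin l7C)) h)
    (hρ : Function.Injective ρ) (hs : Small (relabel ρ (fin l7C)) h 16) :
    ∃ x y : Fin 7, (x = 0 ∨ x = 1) ∧ (y = 0 ∨ y = 1) ∧
      ∀ s ∈ facesC x y, HasPt (relabel ρ (fin l7C)) h (s.image ρ) := by
  have hL : ldistinct l7C = true := by decide +kernel
  obtain ⟨i, hi, hi'⟩ := hD.hasPt_pentagon hL hρ (u := 2) (by decide +kernel)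
  obtain ⟨j, hj, hj'⟩ := hD.hasPt_pentagon hL hρ (u := 4) (by decide +kernel)
  have key : ∀ i j : Fin 5, ((7 ≤ ({{2}, {3}, {4}, {2, link5 l7C 2 i}, {2, link5 l7C 2 (i + 1)},
      {4, link5 l7C 4 j}, {4, link5 l7C 4 (j + 1)}} : Finset (Finset (Fin 7))).card) ∨
        ((i = 0 ∨ i = 1) ∧ (j = 0 ∨ j = 1))) ∧
      ∀ s ∈ ({{2}, {3}, {4}, {2, link5 l7C 2 i}, {2, link5 l7C 2 (i + 1)},
      {4, link5 l7C 4 j}, {4, link5 l7C 4 (j + 1)}} : Finset (Finset (Fin 7))), s.card ≠ 3 := by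
    decide +kernel
  have h234 : ∀ u ∈ ({2, 3, 4} : Finset (Fin 7)),
      HasPt (relabel ρ (fin l7C)) h (Finset.image ρ {u}) := by
    have : ∀ u ∈ ({2, 3, 4} : Finset (Fin 7)), 5 ≤ ldeg l7C u := by decide +kernel
    exact fun u hu => hD.hasPt_facet hL hρ (this u hu)
  rcases (key i j).1 with h7 | ⟨hi0, hj0⟩
  · have h1 := hD.card_faces_le hL hρ hs _ (key i j).2 (by
      simp only [Finset.mem_insert, Finset.mem_singleton, forall_eq_or_imp, forall_eq]
      exact ⟨h234 2 (by decide), h234 3 (by decide), h234 4 (by decide), hi, hi', hj, hj'⟩)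
    have h3 : l7C.length = 10 := by decide +kernel
    omega
  · have e2 : link5 l7C 2 0 = 0 ∧ link5 l7C 2 1 = 4 ∧ link5 l7C 2 2 = 1 := by decide +kernel
    have e4 : link5 l7C 4 0 = 0 ∧ link5 l7C 4 1 = 2 ∧ link5 l7C 4 2 = 1 := by decide +kernel
    have hx : HasPt (relabel ρ (fin l7C)) h (Finset.image ρ {2, 4}) ∧ ∃ x : Fin 7, (x = 0 ∨ x = 1) ∧
        HasPt (relabel ρ (fin l7C)) h (Finset.image ρ {2, x}) := by
      rcases hi0 with rfl | rfl
      · rw [e2.1] at hi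
        rw [zero_add, e2.2.1] at hi'
        exact ⟨hi', 0, Or.inl rfl, hi⟩
      · rw [e2.2.1] at hi
        rw [show (1 : Fin 5) + 1 = 2 from rfl, e2.2.2] at hi'
        exact ⟨hi, 1, Or.inr rfl, hi'⟩
    have hy : ∃ y : Fin 7, (y = 0 ∨ y = 1) ∧
        HasPt (relabel ρ (fin l7C)) h (Finset.image ρ {4, y}) := by
      rcases hj0 with rfl | rfl
      · rw [e4.1] at hj
        exact ⟨0, Or.inl rfl, hj⟩
      · rw [show (1 : Fin 5) + 1 = 2 from rfl, e4.2.2] at hj'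
        exact ⟨1, Or.inr rfl, hj'⟩
    obtain ⟨h24, x, hx, hx'⟩ := hx
    obtain ⟨y, hy, hy'⟩ := hy
    refine ⟨x, y, hx, hy, ?_⟩
    simp only [facesC, Finset.mem_insert, Finset.mem_singleton, forall_eq_or_imp, forall_eq]
    exact ⟨h234 2 (by decide), h234 3 (by decide), h234 4 (by decide), h24, hx', hy'⟩

/-- The six faces in `facesC x y` use up all remaining points, so every other edge has length one.
The hexagon 3 is then determined completely; the pentagons 2 and 4 are determined up to the lengths
of their long edges, which are found from the fact that their common corners lie in the plane of
facet 4. -/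
lemma iso_of_l7C_normalized {ρ : Fin 7 → Lat} (hD : IsData (relabel ρ (fin l7C)) h)
    (hρ : Function.Injective ρ) (hs : Small (relabel ρ (fin l7C)) h 16)
    (r3 : ρ 3 = ![1, 0, 0]) (r2 : ρ 2 = ![0, 1, 0]) (r5 : ρ 5 = ![0, 0, 1]) (h3 : h (ρ 3) = 0)
    (h2 : h (ρ 2) = 0) (h5 : h (ρ 5) = 0) :
    Iso (poly (relabel ρ (fin l7C)) h) (convexHull ℝ (toReal '' (W₃ : Set Lat))) := by
  have hL : ldistinct l7C = true := by decide +kernel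
  have hd : ∀ u ∈ ({2, 3, 4} : Finset (Fin 7)), 5 ≤ ldeg l7C u := by decide +kernel
  obtain ⟨x, y, hx, hy, hP⟩ := hD.hasPt_l7C hρ hs
  have hK : ∀ s ∈ facesC x y, s.card ≠ 3 := by
    clear hP; revert x y; decide +kernel
  have hN : 16 ≤ l7C.length + (facesC x y).card := by
    clear hK hP; revert x y; decide +kernel
  have hE : ∀ {i j : Fin 7}, i ≠ j → {i, j} ∉ facesC x y →
      ¬ HasPt (relabel ρ (fin l7C)) h (Finset.image ρ {i, j}) := by
    intro i j hij hij'
    exact hD.not_hasPt_of_card hL hρ hs hK hP hN (by rw [Finset.card_pair hij]; decide) hij'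
  have n3 : ∀ a : Fin 7, a ≠ 3 → {3, a} ∉ facesC x y ∧ {a, 3} ∉ facesC x y := by
    clear hE hN hK hP; revert x y; decide +kernel
  have n2 : {2, 5} ∉ facesC x y ∧ {4, 6} ∉ facesC x y := by
    clear hE hN hK hP n3; revert x y; decide +kernel
  have nx : {2, 0} ∉ facesC x y ∨ {2, 1} ∉ facesC x y := by
    clear hE hN hK hP n3 n2; revert x y; decide +kernel
  have hU : ∀ {u : Fin 7}, u ∈ ({2, 3, 4} : Finset (Fin 7)) → ∃ p, ∀ z,
      InPoly (relabel ρ (fin l7C)) h z → tight (relabel ρ (fin l7C)) h z = {ρ u} → z = p := by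
    intro u hu
    have hu' : {u} ∈ facesC x y := by
      simp only [facesC, Finset.mem_insert]
      simp only [Finset.mem_insert, Finset.mem_singleton] at hu
      rcases hu with rfl | rfl | rfl <;> simp
    obtain ⟨p, hp1, hp2⟩ := hP _ hu'
    exact ⟨p, fun z hz hz' => hD.pt_unique_of_card hL hρ hs hK hP hN hu' hz
      (by rw [hz', Finset.image_singleton]) hp1 hp2⟩
  have c235 : corner ρ h {2, 3, 5} = ![0, 0, 0] := by
    refine hD.corner_eq_of_dot (by decide +kernel) ?_ ?_ ?_
    · rw [h2, r2]; simp
    · rw [h3, r3]; simp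
    · rw [h5, r5]; simp
  have c250 : corner ρ h {2, 5, 0} = ![1, 0, 0] := by
    rw [hD.corner_eq_add hρ (k := 3) (e := ![1, 0, 0]) (by decide +kernel) (by decide +kernel)
      (by decide) (hE (by decide) n2.1) (by rw [r2]; simp) (by rw [r5]; simp) (by rw [r3]; simp),
      corner_perm c235 (by decide)]
    simp
  have c350 : corner ρ h {3, 5, 0} = ![0, 1, 0] := by
    rw [hD.corner_eq_add hρ (k := 2) (e := ![0, 1, 0]) (by decide +kernel) (by decide +kernel)
      (by decide) (hE (by decide) (n3 5 (by decide)).1) (by rw [r3]; simp) (by rw [r5]; simp)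
      (by rw [r2]; simp), corner_perm c235 (by decide)]
    simp
  have c231 : corner ρ h {2, 3, 1} = ![0, 0, 1] := by
    rw [hD.corner_eq_add hρ (k := 5) (e := ![0, 0, 1]) (by decide +kernel) (by decide +kernel)
      (by decide) (hE (by decide) (n3 2 (by decide)).2) (by rw [r2]; simp) (by rw [r3]; simp)
      (by rw [r5]; simp), c235]
    simp
  have F : ∀ (a b c d u : Fin 7) {p V₀ V₁ V₂ : Lat}, u ∈ ({2, 3, 4} : Finset (Fin 7)) →
      (∀ z, InPoly (relabel ρ (fin l7C)) h z → tight (relabel ρ (fin l7C)) h z = {ρ u} → z = p) →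
      {u, a, b} ∈ fin l7C ∧ {u, b, c} ∈ fin l7C ∧ {u, c, d} ∈ fin l7C →
      a ≠ c ∧ b ≠ d ∧ u ≠ b ∧ u ≠ c → {u, b} ∉ facesC x y → corner ρ h {u, a, b} = V₀ →
      corner ρ h {u, b, c} = V₁ → p - V₀ = V₂ → ∃ l : ℤ, 1 ≤ l ∧ ({u, c} ∉ facesC x y → l = 1) ∧
        corner ρ h {u, c, d} = V₁ + l • V₂ ∧ ρ b ⬝ᵥ V₂ = 1 := by
    intro a b c d u p V₀ V₁ V₂ hu hp ht hne hb e0 e1 e2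
    obtain ⟨l, hl, hl1, h6, h7⟩ := hD.corner_step_length hL hρ (hd u hu) hp a b c d ht.1 ht.2.1
      ht.2.2 hne.1 hne.2.1 (hE hne.2.2.1 hb)
    rw [e0, e1, e2] at h6
    rw [e0, e2] at h7
    exact ⟨l, hl, fun hc => hl1 (hE hne.2.2.2 hc), h6, h7⟩
  have F1 : ∀ (a b c d u : Fin 7) {p V₀ V₁ V₂ : Lat}, u ∈ ({2, 3, 4} : Finset (Fin 7)) →
      (∀ z, InPoly (relabel ρ (fin l7C)) h z → tight (relabel ρ (fin l7C)) h z = {ρ u} → z = p) →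
      {u, a, b} ∈ fin l7C ∧ {u, b, c} ∈ fin l7C ∧ {u, c, d} ∈ fin l7C →
      a ≠ c ∧ b ≠ d ∧ u ≠ b ∧ u ≠ c → {u, b} ∉ facesC x y → {u, c} ∉ facesC x y →
      corner ρ h {u, a, b} = V₀ → corner ρ h {u, b, c} = V₁ → V₁ + p - V₀ = V₂ →
      corner ρ h {u, c, d} = V₂ := by
    intro a b c d u p V₀ V₁ V₂ hu hp ht hne hb hc e0 e1 e2
    obtain ⟨l, -, hl1, h6, -⟩ := F a b c d u hu hp ht hne hb e0 e1 rfl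
    rw [h6, hl1 hc, one_smul, ← e2]; abel
  have G : ∀ (a b c d u : Fin 7) {p V₀ V₁ V₂ p' : Lat}, u ∈ ({2, 3, 4} : Finset (Fin 7)) →
      (∀ z, InPoly (relabel ρ (fin l7C)) h z → tight (relabel ρ (fin l7C)) h z = {ρ u} → z = p) →
      {u, a, b} ∈ fin l7C ∧ {u, b, c} ∈ fin l7C ∧ {u, c, d} ∈ fin l7C →
      a ≠ c ∧ b ≠ d ∧ u ≠ b ∧ u ≠ c → {u, b} ∉ facesC x y → {u, c} ∉ facesC x y →
      corner ρ h {u, a, b} = V₀ → corner ρ h {u, b, c} = V₁ → corner ρ h {u, c, d} = V₂ →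
      V₀ + V₂ - V₁ = p' → p = p' := by
    intro a b c d u p V₀ V₁ V₂ p' hu hp ht hne hb hc e0 e1 e2 e3
    obtain ⟨l, -, hl1, h6, -⟩ := F a b c d u hu hp ht hne hb e0 e1 rfl
    rw [hl1 hc, one_smul, e2] at h6
    rw [← e3, h6]; abel
  obtain ⟨p3, hp3⟩ := hU (u := 3) (by decide)
  obtain rfl := G 0 5 2 1 3 (p' := ![0, 1, 1]) (by decide) hp3 (by decide +kernel) (by decide)
    (n3 5 (by decide)).1 (n3 2 (by decide)).1 (corner_perm c350 (by decide))
    (corner_perm c235 (by decide)) (corner_perm c231 (by decide)) (by decide)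
  have c316 : corner ρ h {3, 1, 6} = ![0, 1, 2] := F1 5 2 1 6 3 (by decide) hp3 (by decide +kernel)
    (by decide) (n3 2 (by decide)).1 (n3 1 (by decide)).1 (corner_perm c235 (by decide))
    (corner_perm c231 (by decide)) (by decide)
  have c364 : corner ρ h {3, 6, 4} = ![0, 2, 2] := F1 2 1 6 4 3 (by decide) hp3 (by decide +kernel)
    (by decide) (n3 1 (by decide)).1 (n3 6 (by decide)).1 (corner_perm c231 (by decide)) c316
    (by decide)
  have c340 : corner ρ h {3, 4, 0} = ![0, 2, 1] := F1 1 6 4 0 3 (by decide) hp3 (by decide +kernel)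
    (by decide) (n3 6 (by decide)).1 (n3 4 (by decide)).1 c316 c364 (by decide)
  obtain ⟨p2, hp2⟩ := hU (u := 2) (by decide)
  obtain rfl := G 0 5 3 1 2 (p' := ![1, 0, 1]) (by decide) hp2 (by decide +kernel) (by decide)
    n2.1 (n3 2 (by decide)).2 (corner_perm c250 (by decide))
    (corner_perm c235 (by decide)) c231 (by decide)
  obtain ⟨l, hl, hl1, c214, -⟩ := F 5 3 1 4 2 (V₂ := ![1, 0, 1]) (by decide) hp2 (by decide +kernel)
    (by decide) (n3 2 (by decide)).2 (corner_perm c235 (by decide)) c231 (by decide)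
  obtain ⟨m, hm, hm1, c204, -⟩ := F 3 5 0 4 2 (V₂ := ![1, 0, 1]) (by decide) hp2 (by decide +kernel)
    (by decide) n2.1 c235 c250 (by decide)
  have hdot : ∀ (s : Finset (Fin 7)), s ∈ fin l7C → 4 ∈ s → ρ 4 ⬝ᵥ corner ρ h s = h (ρ 4) :=
    fun s hs h4 => hD.dot (mem_relabel.mpr ⟨s, hs, rfl⟩) (Finset.mem_image_of_mem _ h4)
  have d1 := hdot {3, 6, 4} (by decide +kernel) (by decide)
  have d2 := hdot {3, 4, 0} (by decide +kernel) (by decide)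
  have d3 := hdot {2, 1, 4} (by decide +kernel) (by decide)
  have d4 := hdot {2, 0, 4} (by decide +kernel) (by decide)
  have hne : ρ 4 ≠ 0 := by
    intro h0
    have m4 : ({3, 6, 4} : Finset (Fin 7)).image ρ ∈ relabel ρ (fin l7C) :=
      mem_relabel.mpr ⟨_, by decide +kernel, rfl⟩
    have := (hD.isDual m4).dot_self (u := ρ 4) (Finset.mem_image_of_mem _ (by decide))
    rw [h0, zero_dotProduct] at this
    exact absurd this (by decide)
  obtain ⟨a, b, c, r4⟩ := exists_vec (ρ 4)
  rw [c364] at d1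
  rw [c340] at d2
  rw [c214] at d3
  rw [c204] at d4
  rw [r4, dot3] at d1 d2 d3 d4
  simp only [Matrix.cons_val, Pi.add_apply, Pi.smul_apply, smul_eq_mul] at d1 d2 d3 d4
  have hc : c = 0 := by linarith
  subst hc
  have hml : (l - 1 - m) * a = 0 := by linear_combination d3 - d4
  -- The four known corners on facet 4 satisfy one linear equation. Its normal is not zero, and this
  -- forces the relation between the lengths of the edges `{2, 1}` and `{2, 0}`.
  have hlm : l = m + 1 := by
    rcases mul_eq_zero.mp hml with h6 | h6
    · linarith
    · exfalso
      subst h6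
      have : b = 0 := by linarith
      subst this
      exact hne (by rw [r4]; decide)
  -- At most one of the two edges is long, by `nx`; as `m ≥ 1`, the edge of length `m` must be the
  -- short one.
  obtain ⟨rfl, rfl⟩ : m = 1 ∧ l = 2 := by
    rcases nx with h6 | h6
    · have := hm1 h6; omega
    · have := hl1 h6; omega
  have e214 : corner ρ h {2, 1, 4} = ![2, 0, 3] := by rw [c214]; decide
  have e204 : corner ρ h {2, 0, 4} = ![2, 0, 1] := by rw [c204]; decide
  obtain ⟨p4, hp4⟩ := hU (u := 4) (by decide)
  -- Both ends of the edge `{4, 0}` are known, so its length and the interior point of facet 4 can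
  -- be solved for.
  obtain ⟨k, hk, -, c402, hk1⟩ := F 6 3 0 2 4 (by decide) hp4 (by decide +kernel) (by decide)
    (n3 4 (by decide)).2 (corner_perm c364 (by decide)) (corner_perm c340 (by decide)) rfl
  have e402 : corner ρ h {4, 0, 2} = ![2, 0, 1] := corner_perm e204 (by decide)
  rw [e402] at c402
  obtain ⟨a', b', c', hp4'⟩ := exists_vec p4
  rw [hp4'] at c402 hk1
  rw [r3, dot3] at hk1
  simp only [Matrix.cons_val, Pi.sub_apply] at hk1
  have k0 := congrFun c402 0
  have k1 := congrFun c402 1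
  have k2 := congrFun c402 2
  simp only [Matrix.cons_val, Pi.add_apply, Pi.smul_apply, Pi.sub_apply, smul_eq_mul] at k0 k1 k2
  have ha' : a' = 1 := by linarith
  subst ha'
  have hk2 : k = 2 := by linarith
  subst hk2
  obtain rfl : p4 = ![1, 1, 2] := by
    rw [hp4', show b' = 1 by linarith, show c' = 2 by linarith]
  have c461 : corner ρ h {4, 6, 1} = ![1, 1, 3] := F1 0 3 6 1 4 (by decide) hp4 (by decide +kernel)
    (by decide) (n3 4 (by decide)).2 n2.2 (corner_perm c340 (by decide))
    (corner_perm c364 (by decide)) (by decide)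
  rw [hD.poly_eq_of_corner_eq cornerP]
  · exact iso_convexHull (b := ![![0, 0, 1], ![0, 1, 1], ![1, 0, 1]])
      (u := ![![-1, -1, 1], ![0, 1, 0], ![1, 0, 0]]) (by decide) ![0, 0, -1] (by decide +kernel)
  · simp only [l7C, List.forall_mem_cons, List.not_mem_nil, IsEmpty.forall_iff, implies_true,
      and_true, cornerP]
    exact ⟨corner_perm e204 (by decide), corner_perm c250 (by decide), corner_perm c340 (by decide),
      corner_perm c350 (by decide), corner_perm c231 (by decide), corner_perm e214 (by decide),
      corner_perm c316 (by decide), corner_perm c461 (by decide), corner_perm c235 (by decide),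
      corner_perm c364 (by decide)⟩

/-- Passing to the normal form of a labelled polytope. -/
lemma exists_normalized_relabel {n : ℕ} {L : List (List (Fin n))} {ρ : Fin n → Lat} {N : ℕ}
    (hD : IsData (relabel ρ (fin L)) h) (hρ : Function.Injective ρ)
    (hs : Small (relabel ρ (fin L)) h N) {i j k : Fin n} (ht : {i, j, k} ∈ fin L) :
    ∃ (q : Fin n → Lat) (h' : Lat → ℤ), Function.Injective q ∧ IsData (relabel q (fin L)) h' ∧
      Small (relabel q (fin L)) h' N ∧ Iso (poly (relabel ρ (fin L)) h) (poly (relabel q (fin L)) h') ∧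
      q i = ![1, 0, 0] ∧ q j = ![0, 1, 0] ∧ q k = ![0, 0, 1] ∧ h' (q i) = 0 ∧ h' (q j) = 0 ∧
      h' (q k) = 0 := by
  have m1 : {ρ i, ρ j, ρ k} ∈ relabel ρ (fin L) :=
    mem_relabel.mpr ⟨_, ht, by simp [Finset.image_insert]⟩
  obtain ⟨g, hg, gi, gj, gk, g1, g2, g3⟩ := hD.exists_normalized m1
  have h1 := g.isData hD
  have h2 := g.small hs
  have h3 := hg (relabel ρ (fin L)) h
  rw [relabel_relabel] at h1 h2 h3
  refine ⟨g.A ∘ ρ, _, g.A.injective.comp hρ, h1, h2, h3, gi, gj, gk, ?_, ?_, ?_⟩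
  · rw [Function.comp_apply, gi, g1]
  · rw [Function.comp_apply, gj, g2]
  · rw [Function.comp_apply, gk, g3]

theorem iso_of_l7C {ρ : Fin 7 → Lat} (hD : IsData (relabel ρ (fin l7C)) h)
    (hρ : Function.Injective ρ) (hs : Small (relabel ρ (fin l7C)) h 16) :
    Iso (poly (relabel ρ (fin l7C)) h) (convexHull ℝ (toReal '' (W₃ : Set Lat))) := by
  obtain ⟨q, h', h1, h2, h3, h4, h5, h6, h7, h8, h9, h10⟩ :=
    hD.exists_normalized_relabel hρ hs (i := 3) (j := 2) (k := 5) (by decide +kernel)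
  exact h4.trans (h2.iso_of_l7C_normalized h1 h3 h5 h6 h7 h8 h9 h10)

theorem iso_of_ltrunc {ρ : Fin 8 → Lat} (hD : IsData (relabel ρ (fin ltrunc)) h)
    (hρ : Function.Injective ρ) (hs : Small (relabel ρ (fin ltrunc)) h 16) :
    Iso (poly (relabel ρ (fin ltrunc)) h) (convexHull ℝ (toReal '' (W₂ : Set Lat))) := by
  obtain ⟨q, h', h1, h2, h3, h4, h5, h6, h7, h8, h9, h10⟩ :=
    hD.exists_normalized_relabel hρ hs (i := 4) (j := 5) (k := 3) (by decide +kernel)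
  exact h4.trans (h2.iso_of_ltrunc_normalized h1 h3 h5 h6 h7 h8 h9 h10)

end IsData

/-! ### The classification -/

/-- The further polytopes are among the three blow-ups. -/
theorem IsFurther.classify {Q : Set Spc} (hQ : IsFurther Q) :
    Iso Q (convexHull ℝ (toReal '' (W₁ : Set Lat))) ∨
      Iso Q (convexHull ℝ (toReal '' (W₂ : Set Lat))) ∨
      Iso Q (convexHull ℝ (toReal '' (W₃ : Set Lat))) := by
  obtain ⟨-, hN, ⟨P, hP, hl, hc⟩, -, hseg, hpol, hlab⟩ := hQ
  obtain ⟨T, h, hD, rfl, hR⟩ := exists_reach hP hl hc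
  have hs := small_of_encard_le (N := 16) hN
  rcases hR with h5 | h6 | ⟨X, hX, ρ, hρ, rfl⟩ | ⟨h8, h12, -⟩ | ⟨h9, hT⟩
  · rcases hD.cayley_of_prism h5 with h | h
    · exact absurd h hseg
    · exact absurd h hpol
  · rcases h6.classify hD hs with h | h
    · exact absurd h hpol
    · exact Or.inl h
  · simp only [List.mem_cons, List.not_mem_nil, or_false] at hX
    rcases hX with rfl | rfl | rfl | rfl | rfl
    · exact (hD.not_l7A hρ hs).elim
    · exact absurd (hD.label_of_l7B hρ) hlab
    · exact Or.inr (Or.inr (hD.iso_of_l7C hρ hs))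
    · exact (hD.not_l7D hρ hs).elim
    · exact absurd (hD.cayley_of_l7E hρ hs) hpol
  · rcases h8 with ⟨ρ, hρ, rfl⟩ | ⟨ρ, hρ, rfl⟩ | ⟨L, hL, hl12, hp, ρ, hρ, rfl⟩
    · exact Or.inr (Or.inl (hD.iso_of_ltrunc hρ hs))
    · exact absurd (hD.cayley_of_lhex hρ hs) hpol
    · rcases hp with hp | hp
      · exact (hD.not_pentagonal hL hρ hs hl12 hp).elim
      · exact (hD.not_heptagonal hL hρ hs hl12 hp).elim
  · have := hD.card_rays_le hs hT
    omega

/-! ### Computing blow-ups at vertices explicitly -/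

def cross (a b : Lat) : Lat :=
  ![a 1 * b 2 - a 2 * b 1, a 2 * b 0 - a 0 * b 2, a 0 * b 1 - a 1 * b 0]

/-- The dual basis of a list of three vectors of determinant `±1`. -/
def ldual : List Lat → Lat → Lat
  | [a, b, c], u => det3 a b c • if u = a then cross b c else if u = b then cross c a else cross a b
  | _, _ => 0

/-- The solution of the equations `u ⬝ᵥ v = h u` for `u` in a list. -/
def lvert (h : Lat → ℤ) : List Lat → Lat
  | [a, b, c] => det3 a b c • (h a • cross b c + h b • cross c a + h c • cross a b)
  | _ => 0

/-- A list of cones, and a support function. -/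
abbrev State := List (List Lat) × (Lat → ℤ)

namespace State

/-- The cones form a complete unimodular complex. -/
def Good (S : State) : Prop :=
  S.1 ≠ [] ∧ (∀ t ∈ S.1, t.Nodup ∧ t.length = 3 ∧
    (∀ u ∈ t, ∀ w ∈ t, u ⬝ᵥ ldual t w = if u = w then 1 else 0) ∧
    (∀ u ∈ t, u ⬝ᵥ lvert S.2 t = S.2 u) ∧
    (∀ t' ∈ S.1, (∀ u ∈ t, u ∈ t') → t' = t) ∧
    ∀ u ∈ t, ∃ t' ∈ S.1, u ∉ t' ∧ ∀ w ∈ t, w = u ∨ w ∈ t')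

instance : DecidablePred Good := fun _ => by unfold Good; infer_instance

/-- The support function is strictly convex. -/
def Lower (S : State) : Prop :=
  ∀ t ∈ S.1, ∀ t' ∈ S.1, ∀ u ∈ t', u ∈ t ∨ S.2 u < u ⬝ᵥ lvert S.2 t

instance : DecidablePred Lower := fun _ => by unfold Lower; infer_instance

/-- The polytope of a state. -/
def body (S : State) : Set Spc := poly (fin S.1) S.2

/-- The vertices of the polytope. -/
def corners (S : State) : Finset Lat := (S.1.map (lvert S.2)).toFinset

/-- The blow-up at the vertex with normal cone `t`. -/
def cut (S : State) (t : List Lat) (k : ℕ) : State :=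
  (S.1.filter (fun t' => t' ≠ t) ++ t.map (fun u => t.sum :: t.erase u),
    Function.update S.2 t.sum ((t.map S.2).sum + k))

/-- The blow-ups of `S` at vertices of `S₀`, of levels one and two. -/
def cuts (S₀ S : State) : List State :=
  (S.1.filter fun t => t ∈ S₀.1).flatMap fun t => [S.cut t 1, S.cut t 2]

/-- The blow-ups at `n` vertices. -/
def reach (S₀ : State) : ℕ → List State
  | 0 => [S₀]
  | n + 1 => (reach S₀ n).flatMap fun S => (cuts S₀ S).filter Lower

/-- The blow-ups of `S` at vertices of `S₀` are determined by `cuts S₀ S`. -/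
def Ok (S₀ S : State) : Prop :=
  (∀ S' ∈ cuts S₀ S, S'.Good) ∧ (∀ t ∈ S.1, ∀ t' ∈ S₀.1, lvert S.2 t = lvert S₀.2 t' → t ∈ S₀.1) ∧
  ∀ t ∈ S.1, t ∈ S₀.1 → lvert S.2 t = lvert S₀.2 t ∧
    ∃ t' ∈ S.1, t' ≠ t ∧ t.sum ∉ t' ∧ t.sum ⬝ᵥ lvert S.2 t' ≤ (t.map S.2).sum + 3

instance (S₀ : State) : DecidablePred (Ok S₀) := fun _ => by unfold Ok; infer_instance

variable {S S₀ : State}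

lemma Good.unimodular (hS : S.Good) {t : List Lat} (ht : t ∈ S.1) : Unimodular t.toFinset := by
  obtain ⟨h1, h2, h3, -⟩ := hS.2 t ht
  refine ⟨ldual t, by rw [List.toFinset_card_of_nodup h1, h2], fun u hu w hw => ?_⟩
  exact h3 u (List.mem_toFinset.mp hu) w (List.mem_toFinset.mp hw)

lemma Good.vert (hS : S.Good) {t : List Lat} (ht : t ∈ S.1) :
    vert S.2 t.toFinset = lvert S.2 t :=
  (eq_vert (hS.unimodular ht) fun u hu => (hS.2 t ht).2.2.2.1 u (List.mem_toFinset.mp hu)).symm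

lemma mem_rays_fin {L : List (List Lat)} {u : Lat} : u ∈ rays (fin L) ↔ ∃ t ∈ L, u ∈ t := by
  simp [mem_rays, mem_fin]

lemma Good.isData (hS : S.Good) (hl : S.Lower) : IsData (fin S.1) S.2 := by
  refine ⟨?_, ?_, ?_, ?_⟩
  · obtain ⟨t, ht⟩ := List.exists_mem_of_ne_nil _ hS.1
    exact ⟨_, mem_fin.mpr ⟨t, ht, rfl⟩⟩
  · intro _ hs
    obtain ⟨t, ht, rfl⟩ := mem_fin.mp hs
    exact hS.unimodular ht
  · intro _ hs u hu hut
    obtain ⟨t, ht, rfl⟩ := mem_fin.mp hs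
    obtain ⟨t', ht', hu'⟩ := mem_rays_fin.mp hu
    rw [hS.vert ht]
    exact (hl t ht t' ht' u hu').resolve_left fun h => hut (List.mem_toFinset.mpr h)
  · intro _ hs u hu
    obtain ⟨t, ht, rfl⟩ := mem_fin.mp hs
    obtain ⟨t', ht', h1, h2⟩ := (hS.2 t ht).2.2.2.2.2 u (List.mem_toFinset.mp hu)
    refine ⟨_, mem_fin.mpr ⟨t', ht', rfl⟩, fun he => h1 ?_, fun w hw => ?_⟩
    · rwa [← List.mem_toFinset, he]
    · obtain ⟨h3, h4⟩ := Finset.mem_erase.mp hw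
      exact List.mem_toFinset.mpr ((h2 w (List.mem_toFinset.mp h4)).resolve_left h3)

/-- The converse of `Good.isData`: it ensures that filtering by `Lower` in `reach` loses no actual
blow-up. -/
lemma Good.lower (hS : S.Good) (hD : IsData (fin S.1) S.2) : S.Lower := by
  intro t ht t' ht' u hu
  by_cases hut : u ∈ t
  · exact Or.inl hut
  · rw [← hS.vert ht]
    exact Or.inr (hD.lt _ (mem_fin.mpr ⟨t, ht, rfl⟩) u (mem_rays_fin.mpr ⟨t', ht', hu⟩)
      fun h => hut (List.mem_toFinset.mp h))

lemma Good.body_eq (hS : S.Good) (hl : S.Lower) :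
    S.body = convexHull ℝ (toReal '' (S.corners : Set Lat)) := by
  rw [body, (hS.isData hl).poly_eq_convexHull]
  congr 3
  ext z
  simp only [corners, Finset.mem_image, List.mem_toFinset, List.mem_map, mem_fin]
  constructor
  · rintro ⟨_, ⟨t, ht, rfl⟩, rfl⟩
    exact ⟨t, ht, (hS.vert ht).symm⟩
  · rintro ⟨t, ht, rfl⟩
    exact ⟨_, ⟨t, ht, rfl⟩, hS.vert ht⟩

lemma sum_toFinset' {t : List Lat} (ht : t.Nodup) : ∑ u ∈ t.toFinset, u = t.sum := by
  rw [List.sum_toFinset _ ht]; simp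

lemma Good.body_cut (hS : S.Good) {t : List Lat} (ht : t ∈ S.1) (k : ℕ) :
    fin (S.cut t k).1 = stel (fin S.1) t.toFinset (∑ u ∈ t.toFinset, u) ∧
      (S.cut t k).2 = blowHeight S.2 t.toFinset k := by
  obtain ⟨h1, -, -, -, h4, -⟩ := hS.2 t ht
  rw [blowHeight, sum_toFinset' h1, List.sum_toFinset _ h1]
  refine ⟨?_, rfl⟩
  have he : ∀ u, (t.erase u).toFinset = t.toFinset.erase u := by
    intro u; ext w; simp [h1.mem_erase_iff]
  ext s
  simp only [mem_fin, cut, List.mem_append, List.mem_filter, List.mem_map, mem_stel,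
    decide_eq_true_eq]
  constructor
  · rintro ⟨l, ⟨hl, hlt⟩ | ⟨u, hu, rfl⟩, rfl⟩
    · refine Or.inl ⟨⟨l, hl, rfl⟩, fun h => hlt (h4 l hl fun u hu => ?_)⟩
      exact List.mem_toFinset.mp (h (List.mem_toFinset.mpr hu))
    · exact Or.inr ⟨_, ⟨t, ht, rfl⟩, le_rfl, u, List.mem_toFinset.mpr hu, by
        rw [List.toFinset_cons, he]⟩
  · rintro (⟨⟨l, hl, rfl⟩, hn⟩ | ⟨_, ⟨l, hl, rfl⟩, hs, u, hu, rfl⟩)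
    · exact ⟨l, Or.inl ⟨hl, fun h => hn (h ▸ le_rfl)⟩, rfl⟩
    · obtain rfl := h4 l hl fun u hu => List.mem_toFinset.mp (hs (List.mem_toFinset.mpr hu))
      exact ⟨_, Or.inr ⟨u, List.mem_toFinset.mp hu, rfl⟩, by rw [List.toFinset_cons, he]⟩

lemma mem_reach_succ {n : ℕ} {S' : State} : S' ∈ reach S₀ (n + 1) ↔
    ∃ S ∈ reach S₀ n, S'.Lower ∧ ∃ t ∈ S.1, t ∈ S₀.1 ∧ ∃ k : ℕ, (k = 1 ∨ k = 2) ∧ S' = S.cut t k := by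
  simp only [reach, cuts, List.mem_flatMap, List.mem_filter, List.mem_cons, List.not_mem_nil,
    or_false, decide_eq_true_eq]
  constructor
  · rintro ⟨S, hS, ⟨t, ⟨ht, ht'⟩, h⟩, hl⟩
    exact ⟨S, hS, hl, t, ht, ht', h.elim (fun h => ⟨1, Or.inl rfl, h⟩) fun h => ⟨2, Or.inr rfl, h⟩⟩
  · rintro ⟨S, hS, hl, t, ht, ht', k, rfl | rfl, h⟩
    · exact ⟨S, hS, ⟨t, ⟨ht, ht'⟩, Or.inl h⟩, hl⟩
    · exact ⟨S, hS, ⟨t, ⟨ht, ht'⟩, Or.inr h⟩, hl⟩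

lemma mem_cuts {t : List Lat} (ht : t ∈ S.1) (ht' : t ∈ S₀.1) {k : ℕ} (hk : k = 1 ∨ k = 2) :
    S.cut t k ∈ cuts S₀ S := by
  simp only [cuts, List.mem_flatMap, List.mem_filter, List.mem_cons, List.not_mem_nil,
    or_false, decide_eq_true_eq]
  exact ⟨t, ⟨ht, ht'⟩, by rcases hk with rfl | rfl <;> simp⟩

variable {n : ℕ}

lemma good_of_mem_reach (h0 : S₀.Good ∧ S₀.Lower) (hok : ∀ m < n, ∀ S ∈ reach S₀ m, Ok S₀ S)
    (hS : S ∈ reach S₀ n) : S.Good ∧ S.Lower := by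
  cases n with
  | zero => rwa [List.mem_singleton.mp hS]
  | succ n =>
    obtain ⟨S', hS', hl, t, ht, ht', k, hk, rfl⟩ := mem_reach_succ.mp hS
    exact ⟨(hok n n.lt_succ_self S' hS').1 _ (mem_cuts ht ht' hk), hl⟩

theorem isBlowUpAtVertices_of_mem_reach (h0 : S₀.Good ∧ S₀.Lower)
    (hok : ∀ m < n, ∀ S ∈ reach S₀ m, Ok S₀ S) (hS : S ∈ reach S₀ n) :
    IsBlowUpAtVertices S₀.body n S.body := by
  induction n generalizing S with
  | zero => rw [List.mem_singleton.mp hS]; exact .zero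
  | succ n ih =>
    have hS2 := good_of_mem_reach h0 hok hS
    obtain ⟨S', hS', hl, t, ht, ht', k, hk, rfl⟩ := mem_reach_succ.mp hS
    have hok' := fun m (hm : m < n) => hok m (hm.trans n.lt_succ_self)
    obtain ⟨g, l⟩ := good_of_mem_reach h0 hok' hS'
    have hD := g.isData l
    have hD' := hS2.1.isData hl
    rw [(g.body_cut ht k).1, (g.body_cut ht k).2] at hD'
    have hT : t.toFinset ∈ fin S'.1 := mem_fin.mpr ⟨t, ht, rfl⟩
    have hb := hD.isBlowUp (mem_cplx.mpr ⟨_, hT, le_rfl⟩) (by rw [hD.card hT]; omega)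
      (by omega) hD'
    rw [hD.faceOf_self hT, ← (g.body_cut ht k).1, ← (g.body_cut ht k).2] at hb
    refine .succ (ih hok' hS') ?_ hb
    refine (h0.1.isData h0.2).isVertex_iff.mpr ⟨_, mem_fin.mpr ⟨t, ht', rfl⟩, ?_⟩
    rw [g.vert ht, h0.1.vert ht', ((hok n n.lt_succ_self S' hS').2.2 t ht ht').1]

/-- The blow-up levels are not bounded in `IsBlowUpAtVertices`; the checks collected in `Ok` show
that only levels 1 and 2 occur, so the enumeration is complete. -/
theorem exists_mem_reach (h0 : S₀.Good ∧ S₀.Lower) (hok : ∀ m < n, ∀ S ∈ reach S₀ m, Ok S₀ S)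
    {Q : Set Spc} (hQ : IsBlowUpAtVertices S₀.body n Q) : ∃ S ∈ reach S₀ n, Q = S.body := by
  induction hQ with
  | zero => exact ⟨_, List.mem_singleton.mpr rfl, rfl⟩
  | @succ n A B v k hA hv hB ih =>
    have hok' := fun m (hm : m < n) => hok m (hm.trans n.lt_succ_self)
    obtain ⟨S, hS, rfl⟩ := ih hok'
    obtain ⟨g, l⟩ := good_of_mem_reach h0 hok' hS
    obtain ⟨o1, o2, o3⟩ := hok n n.lt_succ_self S hS
    have hD := g.isData l
    obtain ⟨σ, hσ, h2, hk, he, hD', rfl⟩ := hD.exists_of_isBlowUp hB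
    obtain ⟨hσT, rfl⟩ := hD.eq_of_faceOf_eq_singleton hσ he
    obtain ⟨t, ht, rfl⟩ := mem_fin.mp hσT
    obtain ⟨_, hs, hv⟩ := (h0.1.isData h0.2).isVertex_iff.mp hv
    obtain ⟨t', ht', rfl⟩ := mem_fin.mp hs
    rw [g.vert ht, h0.1.vert ht'] at hv
    have ht0 := o2 t ht t' ht' (toReal_injective hv)
    obtain ⟨-, t₁, ht₁, hne, hp, hle⟩ := o3 t ht ht0
    obtain ⟨h1, -, -, -, h4, -⟩ := g.2 t ht
    -- The vertex of `t₁` survives and must lie strictly beyond the cut, whereas by `Ok` its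
    -- distance from the vertex being cut, measured by the new normal, is at most 3.
    have hk3 : k < 3 := by
      have m1 : t₁.toFinset ∈ stel (fin S.1) t.toFinset (∑ u ∈ t.toFinset, u) :=
        mem_stel.mpr (Or.inl ⟨mem_fin.mpr ⟨t₁, ht₁, rfl⟩, fun h => hne (h4 _ ht₁ fun u hu =>
          List.mem_toFinset.mp (h (List.mem_toFinset.mpr hu)))⟩)
      have := hD'.lt _ m1 (∑ u ∈ t.toFinset, u) (by rw [IsData.rays_stel _ hσ h2]; exact Finset.mem_insert_self _ _)
        (by rwa [sum_toFinset' h1, List.mem_toFinset])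
      have e1 : vert (blowHeight S.2 t.toFinset k) t₁.toFinset = lvert S.2 t₁ := by
        rw [← g.vert ht₁]
        refine (eq_vert (g.unimodular ht₁) fun u hu => ?_).symm
        rw [dot_vert (g.unimodular ht₁) hu, blowHeight, Function.update_of_ne]
        rintro rfl
        rw [sum_toFinset' h1, List.mem_toFinset] at hu
        exact hp hu
      have e2 : ∑ u ∈ t.toFinset, S.2 u = (t.map S.2).sum := List.sum_toFinset _ h1
      rw [e1, blowHeight, Function.update_self, sum_toFinset' h1, e2] at this
      omega
    have hk' : k = 1 ∨ k = 2 := by omega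
    rw [← (g.body_cut ht k).1, ← (g.body_cut ht k).2] at hD' ⊢
    exact ⟨S.cut t k, mem_reach_succ.mpr ⟨S, hS, (o1 _ (mem_cuts ht ht0 hk')).lower hD', t, ht, ht0,
      k, hk', rfl⟩, rfl⟩

end State

/-! ### An obstruction to being a Cayley polytope or a simplex -/

lemma IsVertex.mem_extremePoints {d : ℕ} {P : Set (Fin d → ℝ)} {v : Fin d → ℝ} (hv : IsVertex P v) :
    v ∈ P.extremePoints ℝ := by
  obtain ⟨-, u, hu⟩ := hv
  have h0 : v ∈ {x ∈ P | ∀ y ∈ P, u ⬝ᵥ x ≤ u ⬝ᵥ y} := hu ▸ Set.mem_singleton v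
  refine mem_extremePoints_iff_left.mpr ⟨h0.1, fun x hx y hy ⟨a, b, ha, hb, hab, he⟩ => ?_⟩
  have h1 := h0.2 x hx
  have h2 := h0.2 y hy
  have h3 : u ⬝ᵥ v = a * (u ⬝ᵥ x) + b * (u ⬝ᵥ y) := by
    rw [← he, dotProduct_add, dotProduct_smul, dotProduct_smul, smul_eq_mul, smul_eq_mul]
  have h4 : u ⬝ᵥ x ≤ u ⬝ᵥ v := by
    have : a * (u ⬝ᵥ x - u ⬝ᵥ v) ≤ 0 := by
      have := mul_le_mul_of_nonneg_left h2 hb.le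
      have h5 : u ⬝ᵥ v = a * (u ⬝ᵥ v) + b * (u ⬝ᵥ v) := by rw [← add_mul, hab, one_mul]
      rw [mul_sub]; linarith
    have := nonpos_of_mul_nonpos_right this ha
    linarith
  have : x ∈ ({v} : Set (Fin d → ℝ)) := hu ▸ ⟨hx, fun z hz => h4.trans (h0.2 z hz)⟩
  exact this

/-- Up to an affine map, `P` is spanned by points on two parallel coordinate hyperplanes. -/
def Layered (P : Set Spc) : Prop :=
  ∃ (φ : Spc ≃ᵃ[ℝ] Spc) (i : Fin 3) (s : ℝ) (Z : Set Spc),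
    φ '' P = convexHull ℝ Z ∧ ∀ x ∈ Z, x i = 0 ∨ x i = s

/-- Each of the last `k` coordinates is `s` on one of the summands and 0 on the others. -/
lemma exists_layers {n k : ℕ} (s : ℕ) (P : Fin (k + 1) → Set (Fin n → ℝ)) (j : Fin k) :
    ∃ Z, cayley s P = convexHull ℝ Z ∧
      ∀ x ∈ Z, x (Fin.natAdd n j) = 0 ∨ x (Fin.natAdd n j) = s := by
  refine ⟨_, rfl, fun x hx => ?_⟩
  obtain ⟨i, p, hp, rfl⟩ := Set.mem_iUnion.mp hx
  simp only [Fin.append_right, Pi.smul_apply, smul_eq_mul]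
  cases i using Fin.cases with
  | zero => simp
  | succ i => by_cases h : j = i <;> simp [h]

lemma IsCayleyOfPolygons.layered {P : Set Spc} (h : IsCayleyOfPolygons P) : Layered P := by
  obtain ⟨s, P₀, P₁, -, -, -, -, φ, -, hφ⟩ := h
  obtain ⟨Z, h1, h2⟩ := exists_layers s ![P₀, P₁] 0
  exact ⟨φ, _, s, Z, hφ.trans h1, h2⟩

lemma IsCayleyOfSegments.layered {P : Set Spc} (h : IsCayleyOfSegments P) : Layered P := by
  obtain ⟨s, i, j, k, -, -, -, -, φ, -, hφ⟩ := h
  obtain ⟨Z, h1, h2⟩ := exists_layers (n := 1) (k := 2) s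
    ![(i : ℝ) • simplex 1, (j : ℝ) • simplex 1, (k : ℝ) • simplex 1] 0
  exact ⟨φ, _, s, Z, hφ.trans h1, h2⟩

lemma smul_simplex (d : ℕ) (k : ℝ) : k • simplex d = convexHull ℝ
    (insert 0 (Set.range fun i : Fin d => (Pi.single i k : Fin d → ℝ))) := by
  rw [simplex, ← convexHull_smul, Set.smul_set_insert, smul_zero, Set.smul_set_range]
  congr 3
  ext i : 1
  rw [← Pi.single_smul, smul_eq_mul, mul_one]

lemma IsSimplexType.layered {P : Set Spc} (h : IsSimplexType P) : Layered P := by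
  obtain ⟨k, -, φ, -, hφ⟩ := h
  refine ⟨φ, 0, k, _, hφ.trans (smul_simplex 3 k), ?_⟩
  rintro _ (rfl | ⟨i, rfl⟩)
  · simp
  · by_cases h : 0 = i <;> simp [h]

/-- In each coordinate direction there are segments of lengths one and two between points of `W`. -/
def HasSteps (W : Finset Lat) : Prop :=
  ∀ i : Fin 3, (∃ w ∈ W, w + Pi.single i 1 ∈ W) ∧ ∃ w ∈ W, w + Pi.single i 2 ∈ W

instance : DecidablePred HasSteps := fun _ => by unfold HasSteps; infer_instance

/-- Extreme points come from `Z`, so one coordinate of `φ` takes only the values 0 and `s` on `W`.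
If its linear part has the value `d` on a basis vector, then `d` and `2 d` are both differences of
these two values, which forces `d = 0`. A zero coordinate contradicts the bijectivity of `φ`. -/
lemma not_layered {W : Finset Lat} (hW : HasSteps W)
    (hv : ∀ w ∈ W, toReal w ∈ (convexHull ℝ (toReal '' (W : Set Lat))).extremePoints ℝ) :
    ¬ Layered (convexHull ℝ (toReal '' (W : Set Lat))) := by
  rintro ⟨φ, i, s, Z, hφ, hZ⟩
  have hc : convexHull ℝ (toReal '' (W : Set Lat)) = convexHull ℝ (φ.symm '' Z) := by
    have := φ.symm.toAffineMap.image_convexHull Z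
    rw [← hφ] at this
    refine Eq.trans ?_ this
    ext x
    simp
  have hz : ∀ w ∈ W, φ (toReal w) i = 0 ∨ φ (toReal w) i = s := by
    intro w hw
    have := hv w hw
    rw [hc] at this
    obtain ⟨x, hx, he⟩ := extremePoints_convexHull_subset this
    rw [← he, AffineEquiv.apply_symm_apply]
    exact hZ x hx
  have hadd : ∀ (w : Lat) (j : Fin 3) (m : ℤ), φ (toReal (w + Pi.single j m)) i =
      φ (toReal w) i + m * φ.linear (Pi.single j 1) i := by
    intro w j m
    have : toReal (w + Pi.single j m) = (m : ℝ) • (Pi.single j 1 : Spc) +ᵥ toReal w := by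
      rw [← Pi.single_smul, smul_eq_mul, mul_one, vadd_eq_add]
      ext l
      by_cases h : l = j
      · subst h; simp [toReal, add_comm]
      · simp [toReal, h]
    rw [this, φ.map_vadd, map_smul, vadd_eq_add, Pi.add_apply, Pi.smul_apply, smul_eq_mul, add_comm]
  have hzero : (LinearMap.proj i ∘ₗ (φ.linear : Spc →ₗ[ℝ] Spc)) = 0 := by
    refine (Pi.basisFun ℝ (Fin 3)).ext fun j => ?_
    obtain ⟨⟨w, hw, hw'⟩, x, hx, hx'⟩ := hW j
    have h1 := hz _ hw
    have h2 := hz _ hw'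
    have h3 := hz _ hx
    have h4 := hz _ hx'
    rw [hadd] at h2 h4
    push_cast at h2 h4
    simp only [Pi.basisFun_apply, LinearMap.comp_apply, LinearEquiv.coe_coe, LinearMap.proj_apply,
      LinearMap.zero_apply]
    rcases h1 with h1 | h1 <;> rcases h2 with h2 | h2 <;> rcases h3 with h3 | h3 <;>
      rcases h4 with h4 | h4 <;> linarith
  obtain ⟨y, hy⟩ := φ.linear.surjective (Pi.single i 1)
  have := LinearMap.congr_fun hzero y
  simp only [LinearMap.comp_apply, LinearEquiv.coe_coe, LinearMap.proj_apply, hy,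
    LinearMap.zero_apply, Pi.single_eq_same] at this
  exact one_ne_zero this

/-! ### The three models -/

namespace State

/-- The tetrahedron `3Δ₃`. -/
def tetrahedron : State :=
  ([[![1, 0, 0], ![0, 1, 0], ![0, 0, 1]], [![1, 0, 0], ![0, 1, 0], ![-1, -1, -1]],
    [![1, 0, 0], ![0, 0, 1], ![-1, -1, -1]], [![0, 1, 0], ![0, 0, 1], ![-1, -1, -1]]],
    fun u => if u = ![-1, -1, -1] then -3 else 0)

/-- A prism with lower facet `2Δ₂` whose upper facet has the inner normal `u` and height `c`. -/
def prism (u : Lat) (c : ℤ) : State :=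
  ([[![1, 0, 0], ![0, 1, 0], ![0, 0, 1]], [![1, 0, 0], ![0, 1, 0], ![0, -1, -1]],
    [![1, 0, 0], ![0, 0, 1], ![0, -1, -1]], [u, ![0, 1, 0], ![0, 0, 1]],
    [u, ![0, 1, 0], ![0, -1, -1]], [u, ![0, 0, 1], ![0, -1, -1]]],
    fun v => if v = u then c else if v = ![0, -1, -1] then -2 else 0)

/-- An affine automorphism of the lattice maps `W` to the vertices of `S`. -/
def Similar (W : Finset Lat) (autos : List (Lat × (Fin 3 → Lat))) (S : State) : Prop :=
  ∃ a ∈ autos, (∀ i j, ldual (List.ofFn a.2) (a.2 i) ⬝ᵥ a.2 j = if i = j then 1 else 0) ∧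
    S.corners = W.image fun c => a.1 + ∑ i, c i • a.2 i

instance (W : Finset Lat) (autos : List (Lat × (Fin 3 → Lat))) : DecidablePred (Similar W autos) :=
  fun _ => by unfold Similar; infer_instance

/-- The lattice points with coordinates between `0` and `3`. -/
def box : Finset Lat := Fintype.piFinset fun _ => {0, 1, 2, 3}

/-- The polytope of `S` has the vertices `W`, exactly `m` hexagons, and at most `16` lattice points
in the box. -/
def IsModel (W : Finset Lat) (m : ℕ) (S : State) : Prop :=
  S.corners = W ∧ lab (fin S.1) 6 = m ∧
    (box.filter fun z => ∀ t ∈ S.1, ∀ u ∈ t, S.2 u ≤ u ⬝ᵥ z).card ≤ 16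

instance (W : Finset Lat) (m : ℕ) : DecidablePred (IsModel W m) :=
  fun _ => by unfold IsModel; infer_instance

lemma ok_tetrahedron : (tetrahedron.Good ∧ tetrahedron.Lower) ∧
    ∀ m < 4, ∀ S ∈ reach tetrahedron m, Ok tetrahedron S := by
  decide +kernel

lemma ok_prism₁ : ((prism ![-1, -1, -1] (-3)).Good ∧ (prism ![-1, -1, -1] (-3)).Lower) ∧
    ∀ m < 1, ∀ S ∈ reach (prism ![-1, -1, -1] (-3)) m, Ok (prism ![-1, -1, -1] (-3)) S := by
  decide +kernel

lemma ok_prism₂ : ((prism ![-1, 0, 0] (-2)).Good ∧ (prism ![-1, 0, 0] (-2)).Lower) ∧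
    ∀ m < 2, ∀ S ∈ reach (prism ![-1, 0, 0] (-2)) m, Ok (prism ![-1, 0, 0] (-2)) S := by
  decide +kernel

/-- The identity suffices: whatever the order of the cuts, the result has the vertices `W₂`. -/
lemma similar_tetrahedron : ∀ S ∈ reach tetrahedron 4,
    Similar W₂ [(0, ![![1, 0, 0], ![0, 1, 0], ![0, 0, 1]])] S := by
  decide +kernel

lemma similar_prism₁ : ∀ S ∈ reach (prism ![-1, -1, -1] (-3)) 1,
    Similar W₁ [(0, ![![1, 0, 0], ![0, 1, 0], ![0, 0, 1]]),
      (![3, 0, 0], ![![-1, 0, 0], ![-1, 1, 0], ![-1, 0, 1]])] S := by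
  decide +kernel

/-- The listed affine lattice maps account for the different choices of the two vertices that are
cut. -/
lemma similar_prism₂ : ∀ S ∈ reach (prism ![-1, 0, 0] (-2)) 2,
    Similar W₃ [(0, ![![1, 0, 0], ![0, 1, 0], ![0, 0, 1]]),
      (0, ![![1, 0, 0], ![0, 0, 1], ![0, 1, 0]]),
      (![0, 2, 0], ![![1, 0, 0], ![0, -1, 0], ![0, -1, 1]]),
      (![0, 2, 0], ![![1, 0, 0], ![0, -1, 1], ![0, -1, 0]]),
      (![0, 0, 2], ![![1, 0, 0], ![0, 1, -1], ![0, 0, -1]]),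
      (![0, 0, 2], ![![1, 0, 0], ![0, 0, -1], ![0, 1, -1]])] S := by
  decide +kernel

lemma model_tetrahedron : ∃ S ∈ reach tetrahedron 4, IsModel W₂ 4 S := by
  decide +kernel

lemma model_prism₁ : ∃ S ∈ reach (prism ![-1, -1, -1] (-3)) 1, IsModel W₁ 0 S := by
  decide +kernel

lemma model_prism₂ : ∃ S ∈ reach (prism ![-1, 0, 0] (-2)) 2, IsModel W₃ 1 S := by
  decide +kernel

lemma steps_W : HasSteps W₁ ∧ HasSteps W₂ ∧ HasSteps W₃ := by decide +kernel

lemma box_W : W₁ ⊆ box ∧ W₂ ⊆ box ∧ W₃ ⊆ box := by decide +kernel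

variable {S₀ S : State} {W : Finset Lat} {n m : ℕ}

lemma iso_of_similar (hS : S.Good ∧ S.Lower) {autos} (h : Similar W autos S) :
    Iso S.body (convexHull ℝ (toReal '' (W : Set Lat))) := by
  obtain ⟨a, -, h1, h2⟩ := h
  rw [hS.1.body_eq hS.2]
  exact iso_convexHull h1 a.1 h2

lemma iteratedBlowUp_of_vertices {P Q : Set Spc} (h : IsBlowUpAtVertices P n Q) (hn : n ≠ 0) :
    IsIteratedBlowUp P Q := by
  induction h with
  | zero => exact absurd rfl hn
  | @succ n A B v k hA hv hB ih =>
    rcases eq_or_ne n 0 with rfl | h0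
    · cases hA
      exact .single ⟨_, k, hB⟩
    · exact .tail (ih h0) ⟨_, k, hB⟩

/-- Coordinate bounds on the vertices hold on the hull, so all lattice points of the polytope lie in
the finite box in which `IsModel` counts. -/
lemma encard_le (hS : S.Good ∧ S.Lower) (hm : IsModel W m S) (hW : W ⊆ box) :
    (S.body ∩ latticePoints 3).encard ≤ 16 := by
  have hsub : S.body ∩ latticePoints 3 ⊆
      toReal '' ((box.filter fun z => ∀ t ∈ S.1, ∀ u ∈ t, S.2 u ≤ u ⬝ᵥ z : Finset Lat) : Set Lat) := by
    rintro _ ⟨hz, z, rfl⟩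
    refine ⟨z, Finset.mem_coe.mpr (Finset.mem_filter.mpr ⟨?_, fun t ht u hu => ?_⟩), rfl⟩
    · rw [hS.1.body_eq hS.2, hm.1] at hz
      have key : ∀ (u : Lat) (c : ℤ), (∀ w ∈ W, c ≤ u ⬝ᵥ w) → c ≤ u ⬝ᵥ z := by
        intro u c hc
        have := le_dot_of_mem_convexHull (f := toReal u) (m := c) (by
          rintro _ ⟨w, hw, rfl⟩
          rw [toReal_dot]
          exact_mod_cast hc w hw) hz
        rw [toReal_dot] at this
        exact_mod_cast this
      have hi : ∀ k : ℤ, k ∈ ({0, 1, 2, 3} : Finset ℤ) ↔ 0 ≤ k ∧ k ≤ 3 := by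
        intro k
        simp only [Finset.mem_insert, Finset.mem_singleton]
        omega
      refine Fintype.mem_piFinset.mpr fun i => (hi _).mpr ?_
      have hb : ∀ w ∈ W, _ := fun w hw => (hi _).mp (Fintype.mem_piFinset.mp (hW hw) i)
      have h1 := key (Pi.single i 1) 0 fun w hw => by simpa using (hb w hw).1
      have h2 := key (-Pi.single i 1) (-3) fun w hw => by simpa using (hb w hw).2
      simp only [neg_dotProduct, single_dotProduct, one_mul] at h1 h2
      omega
    · exact toReal_mem_poly.mp hz u (mem_rays_fin.mpr ⟨t, ht, hu⟩)
  refine (Set.encard_le_encard hsub).trans ?_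
  rw [toReal_injective.encard_image, Set.encard_coe_eq_coe_finsetCard]
  exact_mod_cast hm.2.2

/-- The blow-ups of `S₀` at `n` vertices are isomorphic to the polytope with vertices `W`. -/
theorem blowUp_unique (h0 : S₀.Good ∧ S₀.Lower) (hok : ∀ m < n, ∀ S ∈ reach S₀ m, Ok S₀ S) {autos}
    (hs : ∀ S ∈ reach S₀ n, Similar W autos S) (hm : ∃ S ∈ reach S₀ n, IsModel W m S) :
    IsBlowUpAtVertices S₀.body n (convexHull ℝ (toReal '' (W : Set Lat))) ∧
      ∀ Q, IsBlowUpAtVertices S₀.body n Q → Iso Q (convexHull ℝ (toReal '' (W : Set Lat))) := by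
  constructor
  · obtain ⟨S, hS, hm⟩ := hm
    have hg := good_of_mem_reach h0 hok hS
    rw [← hm.1, ← hg.1.body_eq hg.2]
    exact isBlowUpAtVertices_of_mem_reach h0 hok hS
  · intro Q hQ
    obtain ⟨S, hS, rfl⟩ := exists_mem_reach h0 hok hQ
    exact iso_of_similar (good_of_mem_reach h0 hok hS) (hs S hS)

/-- One obstruction, `not_layered`, disposes of simplices and both kinds of Cayley polytopes. The
excluded label has two hexagons, hence the condition `m ≠ 2`. -/
theorem isFurther (h0 : S₀.Good ∧ S₀.Lower) (hok : ∀ m < n, ∀ S ∈ reach S₀ m, Ok S₀ S) (hn : n ≠ 0)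
    (hl : label S₀.body = Pi.single 3 4 ∨ label S₀.body = Pi.single 3 2 + Pi.single 4 3)
    (hm : ∃ S ∈ reach S₀ n, IsModel W m S) (hW : HasSteps W) (hb : W ⊆ box) (h6 : m ≠ 2) :
    IsFurther (convexHull ℝ (toReal '' (W : Set Lat))) ∧
      label (convexHull ℝ (toReal '' (W : Set Lat))) 6 = m := by
  obtain ⟨S, hS, hm⟩ := hm
  have hg := good_of_mem_reach h0 hok hS
  have hD := hg.1.isData hg.2
  have hbody := hg.1.body_eq hg.2
  rw [hm.1] at hbody
  have hlab : label S.body 6 = m := (hD.label_eq 6).trans hm.2.1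
  have hL : ¬ Layered S.body := by
    rw [hbody]
    refine not_layered hW fun w hw => ?_
    rw [← hm.1, corners, List.mem_toFinset, List.mem_map] at hw
    obtain ⟨t, ht, rfl⟩ := hw
    rw [← hbody]
    refine (hD.isVertex_iff.mpr ⟨_, mem_fin.mpr ⟨t, ht, rfl⟩, ?_⟩).mem_extremePoints
    rw [hg.1.vert ht]
  rw [← hbody]
  refine ⟨⟨hD.isSmooth, encard_le hg hm hb, ⟨_, (h0.1.isData h0.2).isSmooth, hl,
    iteratedBlowUp_of_vertices (isBlowUpAtVertices_of_mem_reach h0 hok hS) hn⟩,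
    fun h => hL h.layered, fun h => hL h.layered, fun h => hL h.layered, fun h => h6 ?_⟩, hlab⟩
  rw [← hlab, h]
  rfl

lemma label_tetrahedron : label tetrahedron.body = Pi.single 3 4 := by
  have h1 : ∀ u ∈ rays (fin tetrahedron.1), edgeDeg (fin tetrahedron.1) u = 3 := by decide +kernel
  have h2 : (rays (fin tetrahedron.1)).card = 4 := by decide +kernel
  ext m
  rw [body, (ok_tetrahedron.1.1.isData ok_tetrahedron.1.2).label_eq, lab]
  by_cases h : m = 3
  · subst h; rw [Finset.filter_true_of_mem h1, h2]; rfl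
  · rw [Finset.filter_false_of_mem fun u hu he => h (he.symm.trans (h1 u hu))]; simp [h]

lemma label_of_lab (hS : S.Good ∧ S.Lower) (h3 : lab (fin S.1) 3 = 2) (h4 : lab (fin S.1) 4 = 3)
    (h : ∀ u ∈ rays (fin S.1), edgeDeg (fin S.1) u ∈ ({3, 4} : Finset ℕ)) :
    label S.body = Pi.single 3 2 + Pi.single 4 3 := by
  ext m
  rw [body, (hS.1.isData hS.2).label_eq]
  by_cases m3 : m = 3
  · subst m3; rw [h3]; rfl
  by_cases m4 : m = 4
  · subst m4; rw [h4]; rfl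
  rw [lab, Finset.filter_false_of_mem fun u hu he => ?_]
  · simp [m3, m4]
  · have := h u hu
    rw [he] at this
    simp [m3, m4] at this

lemma label_prism₁ : label (prism ![-1, -1, -1] (-3)).body = Pi.single 3 2 + Pi.single 4 3 :=
  label_of_lab ok_prism₁.1 (by decide +kernel) (by decide +kernel) (by decide +kernel)

lemma label_prism₂ : label (prism ![-1, 0, 0] (-2)).body = Pi.single 3 2 + Pi.single 4 3 :=
  label_of_lab ok_prism₂.1 (by decide +kernel) (by decide +kernel) (by decide +kernel)

lemma tetrahedron_body : tetrahedron.body = (3 : ℝ) • simplex 3 := by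
  have h : tetrahedron.corners = {![0, 0, 0], ![3, 0, 0], ![0, 3, 0], ![0, 0, 3]} := by
    decide +kernel
  rw [ok_tetrahedron.1.1.body_eq ok_tetrahedron.1.2, h, smul_simplex]
  congr 1
  have hr : (Set.range fun i : Fin 3 => (Pi.single i 3 : Spc)) =
      {toReal ![3, 0, 0], toReal ![0, 3, 0], toReal ![0, 0, 3]} := by
    have e1 : (Pi.single 0 3 : Spc) = toReal ![3, 0, 0] := by ext i; fin_cases i <;> simp [toReal]
    have e2 : (Pi.single 1 3 : Spc) = toReal ![0, 3, 0] := by ext i; fin_cases i <;> simp [toReal]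
    have e3 : (Pi.single 2 3 : Spc) = toReal ![0, 0, 3] := by ext i; fin_cases i <;> simp [toReal]
    rw [← e1, ← e2, ← e3]
    ext x
    constructor
    · rintro ⟨i, rfl⟩; fin_cases i <;> simp
    · rintro (rfl | rfl | rfl) <;> exact ⟨_, rfl⟩
  rw [hr]
  have : toReal ![0, 0, 0] = (0 : Spc) := by ext i; fin_cases i <;> simp [toReal]
  simp only [Finset.coe_insert, Finset.coe_singleton, Set.image_insert_eq, Set.image_singleton, this]

lemma prism₁_body : (prism ![-1, -1, -1] (-3)).body = cayley (n := 1) (k := 2) 2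
    ![(3 : ℝ) • simplex 1, simplex 1, simplex 1] := by
  have h := cayley_segments 2 3 1 1
  rw [Nat.cast_one, one_smul] at h
  refine Eq.trans ?_ h.symm
  rw [ok_prism₁.1.1.body_eq ok_prism₁.1.2]
  congr 3
  decide +kernel

lemma prism₂_body : (prism ![-1, 0, 0] (-2)).body = cayley (n := 1) (k := 2) 2
    ![(2 : ℝ) • simplex 1, (2 : ℝ) • simplex 1, (2 : ℝ) • simplex 1] := by
  refine Eq.trans ?_ (cayley_segments 2 2 2 2).symm
  rw [ok_prism₂.1.1.body_eq ok_prism₂.1.2]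
  congr 3
  decide +kernel

end State

end SmoothPolytope

theorem lemma6p3 :
    ∃ Q₁ Q₂ Q₃ : Set (Fin 3 → ℝ),
      -- the blow-up of Cay²(3Δ₁, Δ₁, Δ₁) at a vertex
      (SmoothPolytope.IsBlowUpAtVertices
          (SmoothPolytope.cayley (n := 1) (k := 2) 2
            ![(3 : ℝ) • SmoothPolytope.simplex 1, SmoothPolytope.simplex 1,
              SmoothPolytope.simplex 1]) 1 Q₁ ∧
        ∀ Q, SmoothPolytope.IsBlowUpAtVertices
          (SmoothPolytope.cayley (n := 1) (k := 2) 2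
            ![(3 : ℝ) • SmoothPolytope.simplex 1, SmoothPolytope.simplex 1,
              SmoothPolytope.simplex 1]) 1 Q → SmoothPolytope.Iso Q Q₁) ∧
      -- the blow-up of 3Δ₃ at four vertices
      (SmoothPolytope.IsBlowUpAtVertices ((3 : ℝ) • SmoothPolytope.simplex 3) 4 Q₂ ∧
        ∀ Q, SmoothPolytope.IsBlowUpAtVertices ((3 : ℝ) • SmoothPolytope.simplex 3) 4 Q →
          SmoothPolytope.Iso Q Q₂) ∧
      -- the blow-up of Cay²(2Δ₁, 2Δ₁, 2Δ₁) at two vertices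
      (SmoothPolytope.IsBlowUpAtVertices
          (SmoothPolytope.cayley (n := 1) (k := 2) 2
            ![(2 : ℝ) • SmoothPolytope.simplex 1, (2 : ℝ) • SmoothPolytope.simplex 1,
              (2 : ℝ) • SmoothPolytope.simplex 1]) 2 Q₃ ∧
        ∀ Q, SmoothPolytope.IsBlowUpAtVertices
          (SmoothPolytope.cayley (n := 1) (k := 2) 2
            ![(2 : ℝ) • SmoothPolytope.simplex 1, (2 : ℝ) • SmoothPolytope.simplex 1,
              (2 : ℝ) • SmoothPolytope.simplex 1]) 2 Q → SmoothPolytope.Iso Q Q₃) ∧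
      -- they are pairwise non-isomorphic, and they are exactly the further polytopes
      ¬ SmoothPolytope.Iso Q₁ Q₂ ∧ ¬ SmoothPolytope.Iso Q₁ Q₃ ∧ ¬ SmoothPolytope.Iso Q₂ Q₃ ∧
      ∀ Q : Set (Fin 3 → ℝ), SmoothPolytope.IsFurther Q ↔
        (SmoothPolytope.Iso Q Q₁ ∨ SmoothPolytope.Iso Q Q₂ ∨ SmoothPolytope.Iso Q Q₃) := by
  open SmoothPolytope State in
  obtain ⟨a1, a2⟩ := blowUp_unique ok_prism₁.1 ok_prism₁.2 similar_prism₁ model_prism₁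
  obtain ⟨b1, b2⟩ := blowUp_unique ok_tetrahedron.1 ok_tetrahedron.2 similar_tetrahedron
    model_tetrahedron
  obtain ⟨c1, c2⟩ := blowUp_unique ok_prism₂.1 ok_prism₂.2 similar_prism₂ model_prism₂
  obtain ⟨f1, l1⟩ := isFurther ok_prism₁.1 ok_prism₁.2 (by decide) (Or.inr label_prism₁)
    model_prism₁ steps_W.1 box_W.1 (by decide)
  obtain ⟨f2, l2⟩ := isFurther ok_tetrahedron.1 ok_tetrahedron.2 (by decide)
    (Or.inl label_tetrahedron) model_tetrahedron steps_W.2.1 box_W.2.1 (by decide)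
  obtain ⟨f3, l3⟩ := isFurther ok_prism₂.1 ok_prism₂.2 (by decide) (Or.inr label_prism₂)
    model_prism₂ steps_W.2.2 box_W.2.2 (by decide)
  rw [prism₁_body] at a1 a2
  rw [tetrahedron_body] at b1 b2
  rw [prism₂_body] at c1 c2
  refine ⟨_, _, _, ⟨a1, a2⟩, ⟨b1, b2⟩, ⟨c1, c2⟩, fun h => ?_, fun h => ?_, fun h => ?_,
    fun Q => ⟨IsFurther.classify, ?_⟩⟩
  -- The three polytopes have 0, 4 and 1 hexagons, and the label is invariant under isomorphism.
  · have := congrFun (h.label_eq f1.1) 6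
    rw [l1, l2] at this
    omega
  · have := congrFun (h.label_eq f1.1) 6
    rw [l1, l3] at this
    omega
  · have := congrFun (h.label_eq f2.1) 6
    rw [l2, l3] at this
    omega
  · rintro (h | h | h)
    · exact IsFurther.of_iso h.symm f1
    · exact IsFurther.of_iso h.symm f2
    · exact IsFurther.of_iso h.symm f3
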